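/- Let $k$ be an algebraically closed field with a fixed linear order on its elements, let $\Gamma\subset k^{t\times t}$ be a basic matrix algebra (an algebra of upper triangular matrices that contains with each matrix its diagonal part), and let $\operatorname{rad}\Gamma$ be its radical. All modules are finite-dimensional right modules. Definitions. For $\Delta\subset k^{T\times T}$, $\Delta=\Gamma$ or $\Delta=\Gamma\oplus\Gamma$ (block-diagonal matrices, $T=2t$), put $i\sim j$ if $a_{ii}=a_{jj}$ for all $[a_{ij}]\in\Delta$. A step-sequence is $n=(n_1,\dots,n_T)$, $n_i\ge 0$, with $n_i=n_j$ whenever $i\sim j$. For a $(\Delta,\Delta)$-stable subspace $\mathcal M\subset k^{T\times T}$, $\mathcal M_{n\times n}$ is the space of block matrices $M=[M_{ij}]$, $M_{ij}\in k^{n_i\times n_j}$, whose blocks satisfy the same linear relations, within each set of places $I\times J$ with $I,J\in\{1,\dots,T\}/\!\sim$, as the entries of the matrices in $\mathcal M$. Two matrices in $\mathcal M_{n\times n}$ are equivalent if they are $\Delta_{n\times n}$-similar, i.e. conjugate by a nonsingular matrix from $\Delta_{n\times n}$. A matrix $M\in\mathcal M_{n\times n}$ is indecomposable if $n\ne0$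 and $M$ is not equivalent to $[A_{ij}\oplus B_{ij}]_{i,j}$ with $A\in\mathcal M_{a\times a}$, $B\in\mathcal M_{b\times b}$, $a,b$ nonzero step-sequences, $a+b=n$. A reduced algebra $\Lambda$ is an algebra consisting of all block matrices $S=[S_{ij}]$ for a partition into consecutive strips such that $S_{ij}=0$ for $i>j$, $S_{ii}=S_{jj}$ whenever $i\approx j$, and the blocks satisfy $\sum_{I\ni i<j\in J}c^{(l)}_{ij}S_{ij}=0$ for a finite system of coefficients $c^{(l)}_{ij}\in k$ for each pair $(I,J)$ of classes of $\approx$, where $\approx$ is an equivalence relation on the set of strips (equivalent strips having equal sizes). The canonical form $M^\infty$ of $M$ under $\Lambda$-similarity is obtained by Belitskiĭ's algorithm: order the blocks from the last horizontal strip to the first, and from left to right inside a strip, and take the first block $M_{lr}$ that is not invariant under $\Lambda$-similarity. If $\sum_{j<r}M_{lj}S_{jr}=\sum_{i>l}S_{li}M_{ir}$ fails for some $S\in\Lambda$, make this block zero by conjugation with a nonsingular $S\in\Lambda$ with identity diagonal blocks. Otherwise reduce it, by conjugation with a nonsingular $S\in\Lambda$, to the form $\begin{bmatrix}0&I\\0&0\end{bmatrix}$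 if $l\not\approx r$, and to a Weyr matrix if $l\approx r$. Then replace $M$ by the matrix $M'$ obtained and $\Lambda$ by $\Lambda'=\{S\in\Lambda: (SM')_{lr}=(M'S)_{lr}\}$, which is again a reduced algebra with respect to a refined partition, and repeat until $M$ is invariant under $\Lambda$-similarity. A Weyr matrix is a direct sum $W_{\lambda_1}\oplus\dots\oplus W_{\lambda_r}$, $\lambda_1<\dots<\lambda_r$, where $W_{\lambda_i}$ has the diagonal blocks $\lambda_iI_{m_{i1}},\lambda_iI_{m_{i2}},\dots$ with $m_{i1}\ge m_{i2}\ge\cdots$, the blocks $\begin{bmatrix}I\\0\end{bmatrix}$ immediately above the diagonal, and zeros elsewhere. The canonical matrices of $(\Delta,\mathcal M)$ are the matrices $M^\infty\in\mathcal M_{n\times n}$ obtained with the initial algebra $\Lambda=\Delta_{n\times n}$, for all step-sequences $n$. Let $0\diagdown\operatorname{rad}\Gamma$ be the space of $2t\times2t$ matrices $\begin{bmatrix}0&R\\0&0\end{bmatrix}$ with $R\in\operatorname{rad}\Gamma$. A matrix of the problem $(\Gamma\oplus\Gamma,\,0\diagdown\operatorname{rad}\Gamma)$ of size $(m_1,\dots,m_t,n_1,\dots,n_t)$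 has the form $X=\begin{bmatrix}0&N\\0&0\end{bmatrix}$. Let $\mathcal I_1,\dots,\mathcal I_r$ be the classes of $\sim$ for $\Gamma$, let $E_\alpha=\sum_{i\in\mathcal I_\alpha}e_{ii}$, and let $q_\alpha$, $p_\alpha$ be the common values of $m_i$ and of $n_i$ for $i\in\mathcal I_\alpha$. Then $X$ determines a homomorphism of projective right modules $$\varphi_X:\bigoplus_{\beta}(E_\beta\Gamma)^{p_\beta}\to\bigoplus_\alpha(E_\alpha\Gamma)^{q_\alpha},$$ whose matrix has the entries $\Phi_{(\alpha,x),(\beta,y)}\in E_\alpha\Gamma E_\beta=\operatorname{Hom}_\Gamma(E_\beta\Gamma,E_\alpha\Gamma)$ formed by the $(x,y)$ entries of the blocks $N_{ij}$, $(i,j)\in\mathcal I_\alpha\times\mathcal I_\beta$. Theorem. The map $X\mapsto\operatorname{Coker}\varphi_X$ induces a bijection from the set of indecomposable canonical matrices of the problem $(\Gamma\oplus\Gamma,\ 0\diagdown\operatorname{rad}\Gamma)$, without the zero $n\times n$ matrices with $n=(0,\dots,0,n_{t+1},\dots,n_{2t})$, onto the set of isomorphism classes of indecomposable finite-dimensional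 right $\Gamma$-modules. -/

import Mathlib

universe u

/-! ### Block matrices

A sequence `n = (n₁, …, n_T)` of natural numbers (zeros allowed) is a function `Fin T → ℕ`.  The rows
and columns of an `n × n` block matrix are indexed by the pairs `(i, p)` with `p < n i`, in
lexicographic order. -/

/-- The linearly ordered index set of the rows (columns) of a block matrix with strips of
sizes `n 0, …, n (T - 1)`. -/
abbrev Idx {T : ℕ} (n : Fin T → ℕ) : Type := Σₗ i : Fin T, Fin (n i)

/-- The `(i, j)` block of an `m × n` block matrix. -/
def blk {k : Type u} {T : ℕ} {m n : Fin T → ℕ} (M : Matrix (Idx m) (Idx n) k) (i j : Fin T) :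
    Matrix (Fin (m i)) (Fin (n j)) k :=
  fun p q => M (toLex ⟨i, p⟩) (toLex ⟨j, q⟩)

/-- The `(p, q)` entry of the `(i, j)` block of an `m × n` block matrix, and `0` if `p` or `q` is out
of range. It serves to compare and add blocks of equal sizes in different places. -/
def blkEntry {k : Type u} [Zero k] {T : ℕ} {m n : Fin T → ℕ} (M : Matrix (Idx m) (Idx n) k)
    (i : Fin T) (p : ℕ) (j : Fin T) (q : ℕ) : k :=
  if h : p < m i ∧ q < n j then blk M i j ⟨p, h.1⟩ ⟨q, h.2⟩ else 0

/-- The block-direct sum `M ⊎ N = [M_ij ⊕ N_ij]`. -/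
def blockDirectSum {k : Type u} [Zero k] {T : ℕ} {m n : Fin T → ℕ}
    (M : Matrix (Idx m) (Idx m) k) (N : Matrix (Idx n) (Idx n) k) :
    Matrix (Idx (m + n)) (Idx (m + n)) k :=
  fun a b => Matrix.fromBlocks (blk M (ofLex a).1 (ofLex b).1) 0 0 (blk N (ofLex a).1 (ofLex b).1)
    (finSumFinEquiv.symm (ofLex a).2) (finSumFinEquiv.symm (ofLex b).2)

/-! ### Weyr matrices -/

/-- `W` is a Weyr matrix with respect to the given linear order on `k`:
`W = W_{λ₁} ⊕ ⋯ ⊕ W_{λᵣ}` with `λ₁ < ⋯ < λᵣ`, where `W_{λᵢ}` is divided into `c i` strips of sizes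
`m i 0 ≥ m i 1 ≥ ⋯ > 0`, has the diagonal blocks `λᵢ I`, the blocks `[I; 0]` immediately above
the diagonal, and zeros elsewhere. -/
def IsWeyr {k : Type u} [Field k] [LinearOrder k] {N : ℕ} (W : Matrix (Fin N) (Fin N) k) : Prop :=
  ∃ (r : ℕ) (lam : Fin r → k) (c : Fin r → ℕ) (m : (i : Fin r) → Fin (c i) → ℕ)
    (e : (Σₗ i : Fin r, Idx (m i)) ≃o Fin N),
    StrictMono lam ∧ (∀ i, 0 < c i) ∧ (∀ i, Antitone (m i)) ∧ (∀ i j, 0 < m i j) ∧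
    (∀ i i' (a : Idx (m i)) (b : Idx (m i')), i ≠ i' → W (e (toLex ⟨i, a⟩)) (e (toLex ⟨i', b⟩)) = 0) ∧
    (∀ i j j' (p : Fin (m i j)) (q : Fin (m i j')),
      W (e (toLex ⟨i, toLex ⟨j, p⟩⟩)) (e (toLex ⟨i, toLex ⟨j', q⟩⟩)) =
        if (p : ℕ) = q then
          (if (j' : ℕ) = j then lam i else if (j' : ℕ) = j + 1 then 1 else 0)
        else 0)

/-- The rectangular matrix `[0 I; 0 0]` for some size of the identity block, which is
located in the upper right corner. -/
def IsUpperRightIdentity {k : Type u} [Zero k] [One k] {a b : ℕ} (W : Matrix (Fin a) (Fin b) k) :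
    Prop :=
  ∃ s : ℕ, s ≤ a ∧ s ≤ b ∧
    ∀ p q, W p q = if (p : ℕ) < s ∧ (q : ℕ) = p + (b - s) then 1 else 0

/-! ### Reduced matrix algebras -/

/-- A partition of the rows and columns of `ι × ι` matrices (`ι` linearly ordered) into consecutive
strips of sizes `size 0, …, size (count - 1)`. -/
structure StripPartition (ι : Type) [LinearOrder ι] where
  count : ℕ
  size : Fin count → ℕ
  equiv : Idx size ≃o ι

/-- The matrix `M`, partitioned into blocks. -/
def StripPartition.part {k : Type u} {ι : Type} [LinearOrder ι] (P : StripPartition ι)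
    (M : Matrix ι ι k) : Matrix (Idx P.size) (Idx P.size) k :=
  M.submatrix P.equiv P.equiv

/-- The `(i, j)` block of `M` with respect to the partition `P`. -/
abbrev StripPartition.block {k : Type u} {ι : Type} [LinearOrder ι] (P : StripPartition ι)
    (M : Matrix ι ι k) (i j : Fin P.count) : Matrix (Fin (P.size i)) (Fin (P.size j)) k :=
  blk (P.part M) i j

open scoped Classical in
/-- `Lam` is a reduced algebra with respect to the partition `P` and the equivalence relation `r`
on the set of strips. It is an algebra of matrices that is determined by: vanishing of the blocks below
the diagonal; equality `S_ii = S_jj` of the diagonal blocks for equivalent `i`, `j`; and for every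
pair of equivalence classes `I, J` a finite system (of `q I J` equations) of the form
`∑ c_ij S_ij = 0`, the sum being over `i < j` with `i ∈ I` and `j ∈ J`. -/
def IsReducedAlgebra {k : Type u} [Field k] {ι : Type} [Fintype ι] [LinearOrder ι]
    (P : StripPartition ι) (r : Setoid (Fin P.count)) (Lam : Set (Matrix ι ι k)) : Prop :=
  (∀ A ∈ Lam, ∀ B ∈ Lam, A * B ∈ Lam) ∧
  (∀ i j, r i j → P.size i = P.size j) ∧
  ∃ (q : Quotient r → Quotient r → ℕ)
    (c : (I J : Quotient r) → Fin (q I J) → Matrix (Fin P.count) (Fin P.count) k),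
    ∀ S : Matrix ι ι k, S ∈ Lam ↔
      (∀ i j, j < i → P.block S i j = 0) ∧
      (∀ i j, r i j → ∀ x y : ℕ, blkEntry (P.part S) i x i y = blkEntry (P.part S) j x j y) ∧
      (∀ I J (l : Fin (q I J)) (x y : ℕ),
        ∑ ij : Fin P.count × Fin P.count with
            Quotient.mk r ij.1 = I ∧ ij.1 < ij.2 ∧ Quotient.mk r ij.2 = J,
          c I J l ij.1 ij.2 * blkEntry (P.part S) ij.1 x ij.2 y = 0)

/-- `Lam`-similarity: `N = S⁻¹ M S` for some nonsingular `S ∈ Lam`. -/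
def LamSimilar {k : Type u} [Field k] {ι : Type} [Fintype ι] [LinearOrder ι]
    (Lam : Set (Matrix ι ι k)) (M N : Matrix ι ι k) : Prop :=
  ∃ S ∈ Lam, IsUnit S ∧ S⁻¹ * M * S = N

/-! ### Belitskii's algorithm -/

/-- The `(i, j)` block of `M` is stable: it is not changed by `Lam`-similarity transformations. -/
def IsStableBlock {k : Type u} [Field k] {ι : Type} [Fintype ι] [LinearOrder ι]
    (P : StripPartition ι) (Lam : Set (Matrix ι ι k)) (M : Matrix ι ι k) (i j : Fin P.count) : Prop :=
  ∀ N, LamSimilar Lam M N → P.block N i j = P.block M i j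

/-- `(l, r)` is the position of the first nonstable block, the blocks being ordered from
the last horizontal strip to the first one, and from left to right within a horizontal strip. -/
def IsFirstNonstable {k : Type u} [Field k] {ι : Type} [Fintype ι] [LinearOrder ι]
    (P : StripPartition ι) (Lam : Set (Matrix ι ι k)) (M : Matrix ι ι k) (l r : Fin P.count) : Prop :=
  ¬ IsStableBlock P Lam M l r ∧
    ∀ i j, (l < i ∨ (i = l ∧ j < r)) → IsStableBlock P Lam M i j

/-- No element of `Lam` gives an addition to the `(l, r)` block of `M` from the preceding blocks:
`M_l1 S_1r + ⋯ + M_l,r-1 S_r-1,r = S_l,l+1 M_l+1,r + ⋯ + S_lt M_tr` for all `S ∈ Lam`. -/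
def NoAddition {k : Type u} [Field k] {ι : Type} [Fintype ι] [LinearOrder ι]
    (P : StripPartition ι) (Lam : Set (Matrix ι ι k)) (M : Matrix ι ι k) (l r : Fin P.count) : Prop :=
  ∀ S ∈ Lam, ∑ j ∈ Finset.Iio r, P.block M l j * P.block S j r =
    ∑ i ∈ Finset.Ioi l, P.block S l i * P.block M i r

/-- One step `(M, Lam) ↦ (M', Lam')` of the algorithm: the first nonstable block `M_lr` of `M` is
reduced by an admissible transformation
* to `0` by a transformation with identity diagonal blocks, if there is a nonzero addition to it;
* to the form `[0 I; 0 0]`, if there is no addition and the strips `l`, `r` are not equivalent;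
* to a Weyr matrix, if there is no addition and the strips `l`, `r` are equivalent;
and `Lam'` consists of those `S ∈ Lam` for which `S M'` and `M' S` have the same `(l, r)` block. -/
def BelitskiiStep {k : Type u} [Field k] [LinearOrder k] {ι : Type} [Fintype ι] [LinearOrder ι]
    (X Y : Matrix ι ι k × Set (Matrix ι ι k)) : Prop :=
  ∃ (P : StripPartition ι) (eqv : Setoid (Fin P.count)) (l r : Fin P.count),
    IsReducedAlgebra P eqv X.2 ∧ IsFirstNonstable P X.2 X.1 l r ∧
    (∃ S ∈ X.2, IsUnit S ∧ Y.1 = S⁻¹ * X.1 * S ∧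
      ((¬ NoAddition P X.2 X.1 l r ∧ (∀ i, P.block S i i = 1) ∧ P.block Y.1 l r = 0) ∨
       (NoAddition P X.2 X.1 l r ∧ ¬ eqv l r ∧ IsUpperRightIdentity (P.block Y.1 l r)) ∨
       (NoAddition P X.2 X.1 l r ∧ eqv l r ∧
          ∃ h : P.size l = P.size r, IsWeyr ((P.block Y.1 l r).submatrix id (Fin.cast h))))) ∧
    Y.2 = {S | S ∈ X.2 ∧ P.block (S * Y.1) l r = P.block (Y.1 * S) l r}

/-- `N` is the `Lam`-canonical form `M^∞` of `M`: the algorithm, applied to `(M, Lam)`, ends with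
the matrix `N`, which is not changed by the remaining admissible transformations. -/
def IsLamCanonicalForm {k : Type u} [Field k] [LinearOrder k] {ι : Type} [Fintype ι] [LinearOrder ι]
    (Lam : Set (Matrix ι ι k)) (M N : Matrix ι ι k) : Prop :=
  ∃ Lam' : Set (Matrix ι ι k), Relation.ReflTransGen BelitskiiStep (M, Lam) (N, Lam') ∧
    ∀ N', LamSimilar Lam' N N' → N' = N

/-- `Lam`-canonical matrices: the `Lam`-canonical forms of matrices. -/
def IsLamCanonical {k : Type u} [Field k] [LinearOrder k] {ι : Type} [Fintype ι] [LinearOrder ι]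
    (Lam : Set (Matrix ι ι k)) (N : Matrix ι ι k) : Prop :=
  ∃ M, IsLamCanonicalForm Lam M N

/-! ### Basic matrix algebras and linear matrix problems -/

/-- A basic matrix algebra: an algebra of upper triangular matrices which contains with every
matrix its diagonal part. -/
def IsBasicMatrixAlgebra {k : Type u} [Field k] {t : ℕ}
    (Γ : Subalgebra k (Matrix (Fin t) (Fin t) k)) : Prop :=
  ∀ A ∈ Γ, (∀ i j, j < i → A i j = 0) ∧ Matrix.diagonal A.diag ∈ Γ

/-- The equivalence relation on `{1, …, T}` of a basic matrix algebra: `i ∼ j` if `a_ii = a_jj`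
for all its elements. -/
def stripSetoid {k : Type u} {T : ℕ} (Γ : Set (Matrix (Fin T) (Fin T) k)) : Setoid (Fin T) where
  r i j := ∀ A ∈ Γ, A i i = A j j
  iseqv := ⟨fun _ _ _ => rfl, fun h A hA => (h A hA).symm,
    fun h h' A hA => (h A hA).trans (h' A hA)⟩

/-- The step-sequences of a basic matrix algebra. -/
def IsStepSequence {k : Type u} {T : ℕ} (Γ : Set (Matrix (Fin T) (Fin T) k)) (n : Fin T → ℕ) : Prop :=
  ∀ i j, stripSetoid Γ i j → n i = n j

open scoped Classical in
/-- For classes `I`, `J` and `x, y ∈ ℕ`: the `T × T` matrix formed by the `(x, y)` entries of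
the blocks `M_ij` with `(i, j) ∈ I × J`, and by zeros in the other places. -/
noncomputable def cell {k : Type u} [Zero k] {T : ℕ} (Γ : Set (Matrix (Fin T) (Fin T) k))
    {m n : Fin T → ℕ} (M : Matrix (Idx m) (Idx n) k) (I : Quotient (stripSetoid Γ)) (x : ℕ)
    (J : Quotient (stripSetoid Γ)) (y : ℕ) : Matrix (Fin T) (Fin T) k :=
  fun i j => if Quotient.mk (stripSetoid Γ) i = I ∧ Quotient.mk (stripSetoid Γ) j = J
    then blkEntry M i x j y else 0

/-- The set `𝓜_{m × n}` of the `m × n` matrices whose blocks satisfy the same linear relations, within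
each set `I × J` of places (`I`, `J` equivalence classes), as the entries of the matrices
from `𝓜`.  Since a relation `∑ d_ij M_ij = 0` between equally sized blocks is a relation between their
`(x, y)` entries for all `x, y`, this means that the matrices formed by these entries are in `𝓜`.
For `𝓜 = Γ` and `m = n` it is the algebra `Γ_{n × n}`. -/
def blowUp {k : Type u} [Zero k] {T : ℕ} (Γ 𝓜 : Set (Matrix (Fin T) (Fin T) k)) (m n : Fin T → ℕ) :
    Set (Matrix (Idx m) (Idx n) k) :=
  {M | ∀ I x J y, cell Γ M I x J y ∈ 𝓜}

/-- A square block matrix together with the sizes of its strips. -/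
structure BlockMatrix (k : Type u) (T : ℕ) where
  size : Fin T → ℕ
  mat : Matrix (Idx size) (Idx size) k

/-- `X` is a matrix of the linear matrix problem `(Γ, 𝓜)`. -/
def IsProblemMatrix {k : Type u} [Field k] {T : ℕ} (Γ 𝓜 : Set (Matrix (Fin T) (Fin T) k))
    (X : BlockMatrix k T) : Prop :=
  IsStepSequence Γ X.size ∧ X.mat ∈ blowUp Γ 𝓜 X.size X.size

/-- Canonical matrices of the linear matrix problem `(Γ, 𝓜)`. -/
def IsCanonicalMatrix {k : Type u} [Field k] [LinearOrder k] {T : ℕ}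
    (Γ 𝓜 : Set (Matrix (Fin T) (Fin T) k)) (X : BlockMatrix k T) : Prop :=
  IsProblemMatrix Γ 𝓜 X ∧ IsLamCanonical (blowUp Γ Γ X.size X.size) X.mat

/-- A matrix of the problem `(Γ, 𝓜)` is indecomposable if its size is nonzero and it is not
equivalent to a block-direct sum of two matrices of nonzero size. -/
def IsIndecomposableMatrix {k : Type u} [Field k] {T : ℕ} (Γ 𝓜 : Set (Matrix (Fin T) (Fin T) k))
    (X : BlockMatrix k T) : Prop :=
  X.size ≠ 0 ∧
  ∀ (N : Matrix (Idx X.size) (Idx X.size) k) (X₁ X₂ : BlockMatrix k T),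
    IsProblemMatrix Γ 𝓜 X₁ → IsProblemMatrix Γ 𝓜 X₂ →
    LamSimilar (blowUp Γ Γ X.size X.size) X.mat N →
    BlockMatrix.mk X.size N =
      BlockMatrix.mk (X₁.size + X₂.size) (blockDirectSum X₁.mat X₂.mat) →
    X₁.size = 0 ∨ X₂.size = 0

/-! ### The separated problem `(Γ ⊕ Γ, 0 ∖ rad Γ)` -/

/-- The algebra `Γ ⊕ Γ` of block-diagonal matrices `A ⊕ B` with `A, B ∈ Γ`. -/
def doubleAlgebra {k : Type u} [Field k] {t : ℕ} (Γ : Subalgebra k (Matrix (Fin t) (Fin t) k)) :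
    Set (Matrix (Fin (t + t)) (Fin (t + t)) k) :=
  {C | ∃ A ∈ Γ, ∃ B ∈ Γ,
    C = (Matrix.fromBlocks A 0 0 B).submatrix finSumFinEquiv.symm finSumFinEquiv.symm}

/-- The space `0 ∖ rad Γ` of the matrices `[0 R; 0 0]` with `R` in the radical of `Γ`. -/
def zeroRad {k : Type u} [Field k] {t : ℕ} (Γ : Subalgebra k (Matrix (Fin t) (Fin t) k)) :
    Set (Matrix (Fin (t + t)) (Fin (t + t)) k) :=
  {C | ∃ R ∈ Ring.jacobson Γ,
    C = (Matrix.fromBlocks 0 (R : Matrix (Fin t) (Fin t) k) 0 0).submatrix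
      finSumFinEquiv.symm finSumFinEquiv.symm}

/-- The indecomposable canonical matrices of the problem `(Γ ⊕ Γ, 0 ∖ rad Γ)`, except for the zero
matrices of size `n × n` with `n = (0, …, 0, n_{t+1}, …, n_{2t})`. -/
def indecomposableCanonicalMatrices {k : Type u} [Field k] [LinearOrder k] {t : ℕ}
    (Γ : Subalgebra k (Matrix (Fin t) (Fin t) k)) : Set (BlockMatrix k (t + t)) :=
  {X | IsCanonicalMatrix (doubleAlgebra Γ) (zeroRad Γ) X ∧
    IsIndecomposableMatrix (doubleAlgebra Γ) (zeroRad Γ) X ∧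
    ¬ (X.mat = 0 ∧ ∀ i : Fin t, X.size (Fin.castAdd t i) = 0)}

/-! ### The module presented by a matrix -/

open scoped Classical in
/-- The idempotent `E_I = ∑_{i ∈ I} e_ii`. -/
noncomputable def classIdempotent {k : Type u} [Field k] {t : ℕ}
    (Γ : Subalgebra k (Matrix (Fin t) (Fin t) k))
    (I : Quotient (stripSetoid (Γ : Set (Matrix (Fin t) (Fin t) k)))) : Matrix (Fin t) (Fin t) k :=
  Matrix.diagonal fun i =>
    if Quotient.mk (stripSetoid (Γ : Set (Matrix (Fin t) (Fin t) k))) i = I then 1 else 0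

/-- The projective right `Γ`-module `E_I Γ`. -/
def projModule {k : Type u} [Field k] {t : ℕ} (Γ : Subalgebra k (Matrix (Fin t) (Fin t) k))
    (I : Quotient (stripSetoid (Γ : Set (Matrix (Fin t) (Fin t) k)))) : Submodule Γᵐᵒᵖ Γ where
  carrier := {x | classIdempotent Γ I * (x : Matrix (Fin t) (Fin t) k) = x}
  add_mem' := fun {a b} ha hb => by
    simp only [Set.mem_ofPred_eq] at *
    rw [Subalgebra.coe_add, mul_add, ha, hb]
  zero_mem' := by simp
  smul_mem' := fun c x hx => by
    simp only [Set.mem_ofPred_eq] at *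
    rw [MulOpposite.smul_eq_mul_unop, Subalgebra.coe_mul, ← mul_assoc, hx]

/-- The projective right `Γ`-module `⨁_I (E_I Γ)^(n_I)` given by a step-sequence `n`, where `n_I` is the
common value of the `n i` with `i ∈ I`. -/
def ProjSum {k : Type u} [Field k] {t : ℕ} (Γ : Subalgebra k (Matrix (Fin t) (Fin t) k))
    (n : Fin t → ℕ) : Type u :=
  (I : Quotient (stripSetoid (Γ : Set (Matrix (Fin t) (Fin t) k)))) → Fin (n I.out) → projModule Γ I

noncomputable instance instAddCommGroupProjSum {k : Type u} [Field k] {t : ℕ}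
    (Γ : Subalgebra k (Matrix (Fin t) (Fin t) k)) (n : Fin t → ℕ) : AddCommGroup (ProjSum Γ n) :=
  inferInstanceAs (AddCommGroup ((I : Quotient (stripSetoid (Γ : Set (Matrix (Fin t) (Fin t) k)))) →
    Fin (n I.out) → projModule Γ I))

noncomputable instance instModuleProjSum {k : Type u} [Field k] {t : ℕ}
    (Γ : Subalgebra k (Matrix (Fin t) (Fin t) k)) (n : Fin t → ℕ) : Module Γᵐᵒᵖ (ProjSum Γ n) :=
  inferInstanceAs (Module Γᵐᵒᵖ ((I : Quotient (stripSetoid (Γ : Set (Matrix (Fin t) (Fin t) k)))) →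
    Fin (n I.out) → projModule Γ I))

/-- The upper right `m × n` part of a matrix, where the sizes of the strips are
`(m₁, …, m_t, n₁, …, n_t)`. -/
def BlockMatrix.upperRight {k : Type u} {t : ℕ} (X : BlockMatrix k (t + t)) :
    Matrix (Idx fun i : Fin t => X.size (Fin.castAdd t i))
      (Idx fun j : Fin t => X.size (Fin.natAdd t j)) k :=
  fun a b => blk X.mat (Fin.castAdd t (ofLex a).1) (Fin.natAdd t (ofLex b).1) (ofLex a).2 (ofLex b).2

open scoped Classical in
/-- Let `N` be the upper right `m × n` part of `X`. It determines the homomorphism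
`φ : ⨁_J (E_J Γ)^(n_J) → ⨁_I (E_I Γ)^(m_I)` given by the block matrix `Φ` with entries
`Φ_{(I,p),(J,q)} ∈ E_I Γ E_J`, which consist of the `(p, q)` entries of the blocks `N_ij`,
`(i, j) ∈ I × J`.  This is the image of `φ`. -/
def presentationImage {k : Type u} [Field k] {t : ℕ} (Γ : Subalgebra k (Matrix (Fin t) (Fin t) k))
    (X : BlockMatrix k (t + t)) :
    Submodule Γᵐᵒᵖ (ProjSum Γ fun i => X.size (Fin.castAdd t i)) where
  carrier := {y | ∃ x : ProjSum Γ fun j => X.size (Fin.natAdd t j), ∀ I p,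
    ((y I p : Γ) : Matrix (Fin t) (Fin t) k) =
      ∑ J, ∑ q : Fin (X.size (Fin.natAdd t J.out)),
        cell (Γ : Set (Matrix (Fin t) (Fin t) k)) X.upperRight I p J q *
          ((x J q : Γ) : Matrix (Fin t) (Fin t) k)}
  add_mem' := by
    rintro a b ⟨x, hx⟩ ⟨y, hy⟩
    refine ⟨x + y, fun I p => ?_⟩
    change ((a I p : Γ) : Matrix (Fin t) (Fin t) k) + ((b I p : Γ) : Matrix (Fin t) (Fin t) k) = _
    rw [hx, hy, ← Finset.sum_add_distrib]
    refine Finset.sum_congr rfl fun J _ => ?_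
    rw [← Finset.sum_add_distrib]
    exact Finset.sum_congr rfl fun q _ => (mul_add _ _ _).symm
  zero_mem' := ⟨0, fun I p => by
    symm
    exact Finset.sum_eq_zero fun J _ => Finset.sum_eq_zero fun q _ => mul_zero _⟩
  smul_mem' := by
    rintro c a ⟨x, hx⟩
    refine ⟨c • x, fun I p => ?_⟩
    change ((a I p : Γ) : Matrix (Fin t) (Fin t) k) *
      ((MulOpposite.unop c : Γ) : Matrix (Fin t) (Fin t) k) = _
    rw [hx, Finset.sum_mul]
    refine Finset.sum_congr rfl fun J _ => ?_
    rw [Finset.sum_mul]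
    exact Finset.sum_congr rfl fun q _ => mul_assoc _ _ _

/-- The right `Γ`-module presented by `X`: the cokernel of `φ`. -/
noncomputable def presentedModule {k : Type u} [Field k] {t : ℕ} (Γ : Subalgebra k (Matrix (Fin t) (Fin t) k))
    (X : BlockMatrix k (t + t)) : ModuleCat.{u} Γᵐᵒᵖ :=
  ModuleCat.of Γᵐᵒᵖ ((ProjSum Γ fun i => X.size (Fin.castAdd t i)) ⧸ presentationImage Γ X)

/-- The isomorphism class of a right `Γ`-module. -/
def isoclass {k : Type u} [Field k] {t : ℕ} {Γ : Subalgebra k (Matrix (Fin t) (Fin t) k)}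
    (V : ModuleCat.{u} Γᵐᵒᵖ) : Quotient (CategoryTheory.isIsomorphicSetoid (ModuleCat.{u} Γᵐᵒᵖ)) :=
  Quotient.mk _ V

/-- A right `Γ`-module is finite-dimensional over `k`. -/
def IsFiniteDimensional {k : Type u} [Field k] {t : ℕ}
    {Γ : Subalgebra k (Matrix (Fin t) (Fin t) k)} (V : ModuleCat.{u} Γᵐᵒᵖ) : Prop :=
  letI : Module k V := Module.compHom V (algebraMap k Γᵐᵒᵖ)
  FiniteDimensional k V

/-- The isomorphism classes of indecomposable finite-dimensional right `Γ`-modules. -/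
def indecomposableIsoclasses {k : Type u} [Field k] {t : ℕ}
    (Γ : Subalgebra k (Matrix (Fin t) (Fin t) k)) :
    Set (Quotient (CategoryTheory.isIsomorphicSetoid (ModuleCat.{u} Γᵐᵒᵖ))) :=
  {c | ∃ V : ModuleCat.{u} Γᵐᵒᵖ, isoclass V = c ∧ IsFiniteDimensional V ∧
    CategoryTheory.Indecomposable V}

/-! A matrix of the problem is the same thing as a homomorphism `φ : P → Q` of finitely generated
projective right modules whose image lies in the radical of `Q`. Indeed, homomorphisms between sums
of the modules `E_I Γ` are block matrices over `Γ` (`ProjSum.exists_homMap_eq`), and the radical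
consists of the elements with zero diagonals (`range_homMap_le_rad_iff`). Conjugation by `A ⊕ B`
changes bases in `Q` and `P`, so equivalence of matrices is isomorphism of homomorphisms
(`lamSimilar_iff_arrowEquiv`), and block-direct sums are direct sums.

Modulo its radical, `Γ` is a product of copies of `k`, one for each class. By Nakayama's lemma every
finitely generated module has a projective cover of the form `ProjSum Γ n` (`exists_cover`). Hence
it has a minimal presentation, in which the image and the kernel of `φ` both lie in the radicals,
and this presentation is unique up to isomorphism. Every `φ` with radical image is the sum of a
minimal presentation and a map `P' → 0` (`exists_splitting`). An indecomposable `φ` is therefore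
either a map `P' → 0`, which is an excluded zero matrix, or minimal. On minimal presentations the
cokernel reflects isomorphisms and direct decompositions. So the nonexcluded indecomposable
matrices, up to equivalence, correspond bijectively to the indecomposable modules.

It remains to see that every equivalence class contains exactly one canonical matrix. For existence,
consider the first nonstable block. If there are additions to it, they fill the whole space of
matrices, being a bimodule over two full matrix algebras, and the block can be made zero
(`exists_addition_eq`). Otherwise it changes by equivalence or by similarity, and takes the form `[0
I; 0 0]` or a Weyr form. The new algebra is strictly smaller, which bounds the number of steps, and
it is again reduced. This is the reason for Weyr matrices in place of Jordan ones: the matrices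
commuting with a Weyr matrix are block triangular after the strips are cut further. Reducedness is
handled through labellings (`IsLabelled`), which tell the rows of one strip and the corresponding
rows of equivalent strips, and require the matching sums of matrix units to lie in the algebra.

For uniqueness, the algorithm applied to similar matrices meets the same place, produces the same
reduced block, passes to the same algebra, and leaves matrices that are similar under that algebra
(`BelitskiiStep.lamSimilar_next`). A step may use any partition that exhibits the algebra as
reduced, so one also needs that two such partitions differ only in empty strips
(`strip_eq_of_strip_eq`). -/

set_option linter.unusedSectionVars false

/-! ### Jordan bases. -/

-- Taylor expansion at `a` writes a polynomial through powers of `X - C a`, and those of exponent at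
-- least `e` vanish in the quotient. The exponents decrease with `j`, so multiplication by `X - C a`
-- lowers the index by one, as in a Jordan chain.
open Polynomial in
theorem span_pow_sub_C_quotient {k : Type u} [Field k] (a : k) (e : ℕ) :
    ⊤ ≤ Submodule.span k (Set.range fun j : Fin e =>
      (Submodule.Quotient.mk ((X - C a) ^ (e - 1 - (j : ℕ))) : k[X] ⧸ k[X] ∙ (X - C a) ^ e)) := by
  rintro x -
  obtain ⟨f, rfl⟩ := Submodule.Quotient.mk_surjective _ x
  rw [← sum_taylor_eq f a, Polynomial.sum_def, ← Submodule.mkQ_apply, map_sum]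
  refine Submodule.sum_mem _ fun i _ => ?_
  rw [Submodule.mkQ_apply]
  by_cases hi : i < e
  · rw [← smul_eq_C_mul, Submodule.Quotient.mk_smul]
    refine Submodule.smul_mem _ _ (Submodule.subset_span ⟨⟨e - 1 - i, by omega⟩, ?_⟩)
    simp only
    congr 2
    omega
  · rw [(Submodule.Quotient.mk_eq_zero _).2]
    · exact zero_mem _
    · refine Submodule.mem_span_singleton.2 ⟨C (coeff ((taylor a) f) i) * (X - C a) ^ (i - e), ?_⟩
      rw [smul_eq_mul, mul_assoc, ← pow_add]
      congr 2
      omega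

open Polynomial in
theorem exists_basis_quotient_pow_sub_C {k : Type u} [Field k] (a : k) (e : ℕ) :
    ∃ b : Module.Basis (Fin e) k (k[X] ⧸ k[X] ∙ (X - C a) ^ e), ∀ j : Fin e,
      (X : k[X]) • b j = a • b j + if h : 0 < (j : ℕ) then b ⟨j - 1, by omega⟩ else 0 := by
  have hcard : Fintype.card (Fin e) = Module.finrank k (k[X] ⧸ k[X] ∙ (X - C a) ^ e) := by
    have := finrank_quotient_span_eq_natDegree (K := k) (f := (X - C a) ^ e)
    rw [natDegree_pow, natDegree_X_sub_C, mul_one] at this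
    rw [Fintype.card_fin]
    exact this.symm
  have hli := linearIndependent_of_top_le_span_of_card_eq_finrank
    (span_pow_sub_C_quotient a e) hcard
  refine ⟨Module.Basis.mk hli (span_pow_sub_C_quotient a e), fun j => ?_⟩
  simp only [Module.Basis.mk_apply]
  have h1 : ∀ v : k[X] ⧸ k[X] ∙ (X - C a) ^ e, (X : k[X]) • v = a • v + (X - C a) • v := by
    intro v
    rw [sub_smul]
    have : (C a : k[X]) • v = a • v := algebraMap_smul k[X] a v
    rw [this]
    abel
  rw [h1]
  congr 1
  rw [← Submodule.Quotient.mk_smul, smul_eq_mul, ← pow_succ']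
  have hj := j.2
  split_ifs with h
  · congr 2
    omega
  · rw [Submodule.Quotient.mk_eq_zero]
    refine Submodule.mem_span_singleton.2 ⟨1, ?_⟩
    rw [one_smul]
    congr 1
    omega

open Polynomial in
/-- A linear operator on a finite-dimensional space over an algebraically closed field has a
Jordan basis. -/
theorem exists_jordan_basis {k : Type u} [Field k] [IsAlgClosed k] {V : Type u} [AddCommGroup V]
    [Module k V] [FiniteDimensional k V] (f : V →ₗ[k] V) :
    ∃ (ι : Type u) (_ : Fintype ι) (lam : ι → k) (e : ι → ℕ)
      (b : Module.Basis (Σ i, Fin (e i)) k V), ∀ i (j : Fin (e i)),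
        f (b ⟨i, j⟩) = lam i • b ⟨i, j⟩ + if h : 0 < (j : ℕ) then b ⟨i, ⟨j - 1, by omega⟩⟩ else 0 := by
  have htors : Module.IsTorsion k[X] (Module.AEval' f) := by
    intro x
    refine ⟨⟨minpoly k f, mem_nonZeroDivisors_of_ne_zero
      (minpoly.ne_zero (Algebra.IsIntegral.isIntegral f))⟩, ?_⟩
    change minpoly k f • x = 0
    obtain ⟨v, rfl⟩ := (Module.AEval'.of f).surjective x
    rw [← Module.AEval.of_aeval_smul]
    simp
  -- The structure theorem over the principal ideal domain `k[X]`, with `X` acting as `f`. Over an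
  -- algebraically closed field each irreducible `p i` is linear up to a unit.
  obtain ⟨ι, hι, p, hp, e, ⟨φ⟩⟩ := Module.equiv_directSum_of_isTorsion htors
  have hdeg : ∀ i, ∃ a, Associated (p i) (X - C a) := by
    intro i
    obtain ⟨a, ha⟩ := IsAlgClosed.exists_root (p i) (by
      rw [IsAlgClosed.degree_eq_one_of_irreducible k (hp i)]; exact one_ne_zero)
    exact ⟨a, ((irreducible_X_sub_C a).associated_of_dvd (hp i) (dvd_iff_isRoot.2 ha)).symm⟩
  choose a ha using hdeg
  have hsp : ∀ i, (k[X] ∙ p i ^ e i) = (k[X] ∙ (X - C (a i)) ^ e i) := fun i =>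
    Ideal.span_singleton_eq_span_singleton.2 ((ha i).pow_pow)
  choose b hb using fun i => exists_basis_quotient_pow_sub_C (a i) (e i)
  let ψ : (DirectSum ι fun i => k[X] ⧸ k[X] ∙ p i ^ e i) ≃ₗ[k[X]]
      (Π₀ i : ι, k[X] ⧸ k[X] ∙ (X - C (a i)) ^ e i) :=
    DFinsupp.mapRange.linearEquiv fun i => Submodule.quotEquivOfEq _ _ (hsp i)
  let B := DFinsupp.basis b
  let θ : V ≃ₗ[k] (Π₀ i : ι, k[X] ⧸ k[X] ∙ (X - C (a i)) ^ e i) :=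
    (Module.AEval'.of f).trans ((φ.trans ψ).restrictScalars k)
  have hθ : ∀ v, θ (f v) = (X : k[X]) • θ v := by
    intro v
    change (φ.trans ψ) (Module.AEval'.of f (f v)) = X • (φ.trans ψ) (Module.AEval'.of f v)
    rw [← map_smul, Module.AEval'.X_smul_of]
  classical
  have hB : ∀ i j, B ⟨i, j⟩ = DFinsupp.single i (b i j) := by
    intro i j
    apply B.repr.injective
    rw [Module.Basis.repr_self]
    ext ⟨i', j'⟩
    change _ = (b i').repr ((DFinsupp.single i (b i j) :
      Π₀ i : ι, k[X] ⧸ k[X] ∙ (X - C (a i)) ^ e i) i') j'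
    by_cases h : i = i'
    · subst h
      rw [DFinsupp.single_eq_same, Module.Basis.repr_self]
      simp [Finsupp.single_apply, Sigma.ext_iff]
    · rw [DFinsupp.single_eq_of_ne (Ne.symm h)]
      simp [h]
  refine ⟨ι, hι, a, e, B.map θ.symm, fun i j => ?_⟩
  apply θ.injective
  rw [hθ]
  have h2 : ∀ j, θ ((B.map θ.symm) ⟨i, j⟩) = DFinsupp.single i (b i j) := by
    intro j
    rw [Module.Basis.map_apply, LinearEquiv.apply_symm_apply, hB]
  rw [map_add, map_smul, h2, ← DFinsupp.single_smul, hb, DFinsupp.single_add, DFinsupp.single_smul]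
  congr 1
  split_ifs with h
  · rw [h2]
  · simp

/-! ### Weyr matrices in coordinates. -/

/-- Coordinates of the rows of a Weyr matrix: the `p`-th row belongs to the eigenvalue `lam p`, to
the strip `j p` of its Weyr block, and has number `q p` in this strip; `m x i` is the size
of the `i`-th strip of the block with eigenvalue `x`. -/
structure IsWeyrCoord {k : Type u} [LinearOrder k] {N : ℕ} (lam : Fin N → k) (j q : Fin N → ℕ)
    (m : k → ℕ → ℕ) : Prop where
  strictMono : StrictMono fun p => toLex (lam p, toLex (j p, q p))
  antitone : ∀ x, Antitone (m x)
  lt_iff : ∀ x i c, c < m x i ↔ ∃ p, lam p = x ∧ j p = i ∧ q p = c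

/-- The Weyr matrix with given coordinates of rows. -/
def weyrMatrix {k : Type u} [Field k] [DecidableEq k] {N : ℕ} (lam : Fin N → k) (j q : Fin N → ℕ) :
    Matrix (Fin N) (Fin N) k :=
  fun p p' => if lam p = lam p' ∧ q p = q p' then
    (if j p' = j p then lam p else if j p' = j p + 1 then 1 else 0) else 0

namespace IsWeyrCoord

variable {k : Type u} [LinearOrder k] {N : ℕ} {lam : Fin N → k} {j q : Fin N → ℕ} {m : k → ℕ → ℕ}

theorem lt (h : IsWeyrCoord lam j q m) (p : Fin N) : q p < m (lam p) (j p) :=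
  (h.lt_iff _ _ _).2 ⟨p, rfl, rfl, rfl⟩

theorem ext (h : IsWeyrCoord lam j q m) {p p' : Fin N} (h1 : lam p = lam p') (h2 : j p = j p')
    (h3 : q p = q p') : p = p' :=
  h.strictMono.injective (by simp only [h1, h2, h3])

theorem exists_of_lt (h : IsWeyrCoord lam j q m) {p : Fin N} {i : ℕ} (hi : q p < m (lam p) i) :
    ∃ s, lam s = lam p ∧ j s = i ∧ q s = q p :=
  (h.lt_iff _ _ _).1 hi

theorem exists_of_le (h : IsWeyrCoord lam j q m) {p : Fin N} {i : ℕ} (hi : i ≤ j p) :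
    ∃ s, lam s = lam p ∧ j s = i ∧ q s = q p :=
  h.exists_of_lt ((h.lt p).trans_le (h.antitone _ hi))

/-- The sum has at most one term, the row with the same number in the next strip. Writing it as a
sum covers the case when that row does not exist. -/
theorem weyrMatrix_mul_apply [Field k] {M : ℕ} (h : IsWeyrCoord lam j q m)
    (T : Matrix (Fin N) (Fin M) k) (p : Fin N) (p' : Fin M) :
    (weyrMatrix lam j q * T) p p' =
      lam p * T p p' + ∑ s with lam s = lam p ∧ j s = j p + 1 ∧ q s = q p, T s p' := by
  rw [Matrix.mul_apply]
  have e1 : ∀ s, weyrMatrix lam j q p s * T s p' = (if p = s then lam p * T p p' else 0) +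
      (if lam s = lam p ∧ j s = j p + 1 ∧ q s = q p then T s p' else 0) := by
    intro s
    unfold weyrMatrix
    by_cases hs : p = s
    · subst hs
      simp
    · rw [if_neg hs, zero_add]
      by_cases h2 : lam p = lam s ∧ q p = q s
      · have h3 : j s ≠ j p := fun h3 => hs (h.ext h2.1 h3.symm h2.2)
        rw [if_pos h2, if_neg h3]
        by_cases h4 : j s = j p + 1
        · rw [if_pos h4, if_pos ⟨h2.1.symm, h4, h2.2.symm⟩, one_mul]
        · rw [if_neg h4, if_neg (fun h5 => h4 h5.2.1), zero_mul]
      · rw [if_neg h2, if_neg (fun h5 => h2 ⟨h5.1.symm, h5.2.2.symm⟩), zero_mul]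
  simp only [e1, Finset.sum_add_distrib, Finset.sum_ite_eq, Finset.mem_univ, if_true,
    Finset.sum_filter]

theorem mul_weyrMatrix_apply [Field k] {M : ℕ} (h : IsWeyrCoord lam j q m)
    (T : Matrix (Fin M) (Fin N) k) (p : Fin M) (p' : Fin N) :
    (T * weyrMatrix lam j q) p p' =
      T p p' * lam p' + ∑ s with lam s = lam p' ∧ j s + 1 = j p' ∧ q s = q p', T p s := by
  rw [Matrix.mul_apply]
  have e2 : ∀ s, T p s * weyrMatrix lam j q s p' = (if p' = s then T p p' * lam p' else 0) +
      (if lam s = lam p' ∧ j s + 1 = j p' ∧ q s = q p' then T p s else 0) := by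
    intro s
    unfold weyrMatrix
    by_cases hs : p' = s
    · subst hs
      simp
    · rw [if_neg hs, zero_add]
      by_cases h2 : lam s = lam p' ∧ q s = q p'
      · have h3 : j p' ≠ j s := fun h3 => hs (h.ext h2.1.symm h3 h2.2.symm)
        rw [if_pos h2, if_neg h3]
        by_cases h4 : j p' = j s + 1
        · rw [if_pos h4, if_pos ⟨h2.1, h4.symm, h2.2⟩, mul_one]
        · rw [if_neg h4, if_neg (fun h5 => h4 h5.2.1.symm), mul_zero]
      · rw [if_neg h2, if_neg (fun h5 => h2 ⟨h5.1, h5.2.2⟩), mul_zero]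
  simp only [e2, Finset.sum_add_distrib, Finset.sum_ite_eq, Finset.mem_univ, if_true,
    Finset.sum_filter]

theorem mul_eq_mul [Field k] {M : ℕ} {lam' : Fin M → k} {j' q' : Fin M → ℕ}
    {T : Matrix (Fin N) (Fin M) k}
    (hT : weyrMatrix lam j q * T = T * weyrMatrix lam' j' q')
    (h : IsWeyrCoord lam j q m) {m' : k → ℕ → ℕ} (h' : IsWeyrCoord lam' j' q' m')
    (p : Fin N) (p' : Fin M) :
    lam p * T p p' + ∑ s with lam s = lam p ∧ j s = j p + 1 ∧ q s = q p, T s p' =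
      T p p' * lam' p' + ∑ s with lam' s = lam' p' ∧ j' s + 1 = j' p' ∧ q' s = q' p', T p s := by
  rw [← h.weyrMatrix_mul_apply, ← h'.mul_weyrMatrix_apply, hT]

/-! ### Intertwiners of Weyr matrices. -/

section Intertwiner

variable [Field k] {M : ℕ} {lam' : Fin M → k} {j' q' : Fin M → ℕ} {m' : k → ℕ → ℕ}
  {T : Matrix (Fin N) (Fin M) k}

/-- For distinct eigenvalues the equation at the place `(p, p')` expresses `T p p'` through entries
in the next strip of rows and in the preceding strip of columns. These vanish by induction on `B - j
p + j' p'`, where `B` bounds the numbers of strips. -/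
theorem lam_eq (h : IsWeyrCoord lam j q m) (h' : IsWeyrCoord lam' j' q' m')
    (hT : weyrMatrix lam j q * T = T * weyrMatrix lam' j' q') {p : Fin N} {p' : Fin M}
    (hne : T p p' ≠ 0) : lam p = lam' p' := by
  by_contra hl
  apply hne
  obtain ⟨B, hB⟩ : ∃ B, ∀ s, j s ≤ B := ⟨Finset.univ.sup j, fun s => Finset.le_sup (Finset.mem_univ s)⟩
  suffices H : ∀ n p p', lam p ≠ lam' p' → B - j p + j' p' = n → T p p' = 0 from H _ p p' hl rfl
  intro n
  induction n using Nat.strong_induction_on with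
  | _ n ih =>
    intro p p' hl hn
    have := mul_eq_mul hT h h' p p'
    rw [Finset.sum_eq_zero, Finset.sum_eq_zero, add_zero, add_zero] at this
    · have h3 : (lam p - lam' p') * T p p' = 0 := by rw [sub_mul, this]; ring
      exact (mul_eq_zero.1 h3).resolve_left (sub_ne_zero.2 hl)
    · intro s hs
      rw [Finset.mem_filter] at hs
      exact ih (B - j p + j' s) (by omega) p s (by rw [hs.2.1]; exact hl) rfl
    · intro s hs
      rw [Finset.mem_filter] at hs
      have := hB s
      exact ih (B - j s + j' p') (by omega) s p' (by rw [hs.2.1]; exact hl) rfl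

theorem sum_succ_eq (h : IsWeyrCoord lam j q m) (h' : IsWeyrCoord lam' j' q' m')
    (hT : weyrMatrix lam j q * T = T * weyrMatrix lam' j' q') {p : Fin N} {p' : Fin M}
    (hl : lam p = lam' p') :
    ∑ s with lam s = lam p ∧ j s = j p + 1 ∧ q s = q p, T s p' =
      ∑ s with lam' s = lam' p' ∧ j' s + 1 = j' p' ∧ q' s = q' p', T p s := by
  have := mul_eq_mul hT h h' p p'
  rw [hl, mul_comm] at this
  rw [hl]
  exact add_left_cancel this

theorem sum_succ (h : IsWeyrCoord lam j q m) (f : Fin N → k) {p s : Fin N} (h1 : lam s = lam p)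
    (h2 : j s = j p + 1) (h3 : q s = q p) :
    ∑ s with lam s = lam p ∧ j s = j p + 1 ∧ q s = q p, f s = f s := by
  rw [Finset.sum_eq_single_of_mem s (by simp [h1, h2, h3])]
  intro s' hs' hne
  rw [Finset.mem_filter] at hs'
  exact (hne (h.ext (hs'.2.1.trans h1.symm) (hs'.2.2.1.trans h2.symm)
    (hs'.2.2.2.trans h3.symm))).elim

theorem sum_pred (h : IsWeyrCoord lam j q m) (f : Fin N → k) {p s : Fin N} (h1 : lam s = lam p)
    (h2 : j s + 1 = j p) (h3 : q s = q p) :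
    ∑ s with lam s = lam p ∧ j s + 1 = j p ∧ q s = q p, f s = f s := by
  rw [Finset.sum_eq_single_of_mem s (by simp [h1, h2, h3])]
  intro s' hs' hne
  rw [Finset.mem_filter] at hs'
  exact (hne (h.ext (hs'.2.1.trans h1.symm) (Nat.succ_injective (hs'.2.2.1.trans h2.symm))
    (hs'.2.2.2.trans h3.symm))).elim

/-- For equal eigenvalues the diagonal terms cancel and an equality of two entries remains: an
intertwiner is constant when both indices advance along their Jordan chains. The next two lemmas
treat the ends of chains, where one of the entries is missing and the other must be zero. -/
theorem apply_succ (h : IsWeyrCoord lam j q m) (h' : IsWeyrCoord lam' j' q' m')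
    (hT : weyrMatrix lam j q * T = T * weyrMatrix lam' j' q') {p s : Fin N} {p' s' : Fin M}
    (hl : lam p = lam' p') (h1 : lam s = lam p) (h2 : j s = j p + 1) (h3 : q s = q p)
    (h1' : lam' s' = lam' p') (h2' : j' s' = j' p' + 1) (h3' : q' s' = q' p') :
    T s s' = T p p' := by
  have := sum_succ_eq h h' hT (p := p) (p' := s') (hl.trans h1'.symm)
  rwa [h.sum_succ (fun s => T s s') h1 h2 h3, h'.sum_pred _ h1'.symm h2'.symm h3'.symm] at this

theorem apply_succ_zero (h : IsWeyrCoord lam j q m) (h' : IsWeyrCoord lam' j' q' m')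
    (hT : weyrMatrix lam j q * T = T * weyrMatrix lam' j' q') {p s : Fin N} {p' : Fin M}
    (hl : lam p = lam' p') (h1 : lam s = lam p) (h2 : j s = j p + 1) (h3 : q s = q p)
    (h2' : j' p' = 0) : T s p' = 0 := by
  have := sum_succ_eq h h' hT hl
  rwa [h.sum_succ (fun s => T s p') h1 h2 h3, Finset.sum_eq_zero] at this
  intro s hs
  rw [Finset.mem_filter] at hs
  omega

theorem apply_last (h : IsWeyrCoord lam j q m) (h' : IsWeyrCoord lam' j' q' m')
    (hT : weyrMatrix lam j q * T = T * weyrMatrix lam' j' q') {p : Fin N} {p' s' : Fin M}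
    (hl : lam p = lam' p') (hp : ¬ q p < m (lam p) (j p + 1))
    (h1' : lam' s' = lam' p') (h2' : j' s' = j' p' + 1) (h3' : q' s' = q' p') : T p p' = 0 := by
  have := sum_succ_eq h h' hT (p := p) (p' := s') (hl.trans h1'.symm)
  rw [h'.sum_pred _ h1'.symm h2'.symm h3'.symm, Finset.sum_eq_zero] at this
  · exact this.symm
  · intro s hs
    rw [Finset.mem_filter] at hs
    refine (hp ?_).elim
    rw [h.lt_iff]
    exact ⟨s, hs.2⟩

/-- An entry with `j' p' < j p` is equal to the one a step back along both chains, until the column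
is in the first strip, where `apply_succ_zero` applies. Thus intertwiners are block triangular. -/
theorem strip_le (h : IsWeyrCoord lam j q m) (h' : IsWeyrCoord lam' j' q' m')
    (hT : weyrMatrix lam j q * T = T * weyrMatrix lam' j' q') {p : Fin N} {p' : Fin M}
    (hne : T p p' ≠ 0) : j p ≤ j' p' := by
  have hl := lam_eq h h' hT hne
  by_contra hj
  apply hne
  rw [not_le] at hj
  obtain ⟨n, hn⟩ : ∃ n, j' p' = n := ⟨_, rfl⟩
  clear hne
  induction n generalizing p p' with
  | zero =>
    obtain ⟨s, h1, h2, h3⟩ := h.exists_of_le (p := p) (i := j p - 1) (by omega)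
    exact apply_succ_zero h h' hT (h1.trans hl) h1.symm (by omega) h3.symm hn
  | succ n ih =>
    obtain ⟨s, h1, h2, h3⟩ := h.exists_of_le (p := p) (i := j p - 1) (by omega)
    obtain ⟨s', h1', h2', h3'⟩ := h'.exists_of_le (p := p') (i := j' p' - 1) (by omega)
    have hl' : lam s = lam' s' := by rw [h1, h1', hl]
    rw [apply_succ h h' hT hl' h1.symm (by omega) h3.symm h1'.symm (by omega)
      h3'.symm]
    exact ih hl' (by omega) (by omega)

/-- The chain of `p` does not reach the strip `D`, while that of `p'` does. Moving forward along
both chains, one comes to the end of the chain of `p` while the other continues, and `apply_last`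
applies. -/
theorem apply_eq_zero_of_length_lt (h : IsWeyrCoord lam j q m) (h' : IsWeyrCoord lam' j' q' m')
    (hT : weyrMatrix lam j q * T = T * weyrMatrix lam' j' q') {p : Fin N} {p' : Fin M}
    (hl : lam p = lam' p') (hj : j p = j' p') {D : ℕ} (hD : ¬ q p < m (lam p) D)
    (hD' : q' p' < m' (lam' p') D) : T p p' = 0 := by
  have hjD : j p < D := by
    by_contra hc
    exact hD ((h.lt p).trans_le (h.antitone _ (not_lt.1 hc)))
  obtain ⟨n, hn⟩ : ∃ n, D - j p = n := ⟨_, rfl⟩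
  induction n generalizing p p' with
  | zero => omega
  | succ n ih =>
    obtain ⟨s', h1', h2', h3'⟩ := h'.exists_of_lt (p := p') (i := j' p' + 1)
      (hD'.trans_le (h'.antitone _ (by omega)))
    by_cases hs : q p < m (lam p) (j p + 1)
    · obtain ⟨s, h1, h2, h3⟩ := h.exists_of_lt hs
      rw [← apply_succ h h' hT hl h1 h2 h3 h1' h2' h3']
      have hlt : j s < D := by
        by_contra hc
        exact hD (hs.trans_le (h.antitone _ (by omega)))
      exact ih (by rw [h1, h1', hl]) (by omega) (by rwa [h3, h1]) (by rwa [h3', h1']) hlt (by omega)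
    · exact apply_last h h' hT hl hs h1' h2' h3'

theorem apply_eq_apply (h : IsWeyrCoord lam j q m) (h' : IsWeyrCoord lam' j' q' m')
    (hT : weyrMatrix lam j q * T = T * weyrMatrix lam' j' q') {p s : Fin N} {p' s' : Fin M}
    (hl : lam p = lam' p') (hj : j p = j' p') (hjs : j s = j' s') (h1 : lam s = lam p)
    (h3 : q s = q p) (h1' : lam' s' = lam' p') (h3' : q' s' = q' p') : T s s' = T p p' := by
  wlog hle : j p ≤ j s generalizing p s p' s'
  · exact (this (by rw [h1, h1', hl]) hjs hj h1.symm h3.symm h1'.symm h3'.symm (by omega)).symm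
  obtain ⟨n, hn⟩ : ∃ n, j s - j p = n := ⟨_, rfl⟩
  induction n generalizing s s' with
  | zero => rw [h.ext h1 (by omega) h3, h'.ext h1' (by omega) h3']
  | succ n ih =>
    obtain ⟨r, e1, e2, e3⟩ := h.exists_of_le (p := s) (i := j s - 1) (by omega)
    obtain ⟨r', e1', e2', e3'⟩ := h'.exists_of_le (p := s') (i := j' s' - 1) (by omega)
    rw [apply_succ h h' hT (by rw [e1, e1', h1, h1', hl]) e1.symm (by omega) e3.symm e1'.symm
      (by omega) e3'.symm]
    exact ih (by omega) (e1.trans h1) (e3.trans h3) (e1'.trans h1') (e3'.trans h3') (by omega)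
      (by omega)

end Intertwiner

end IsWeyrCoord

/-! ### Counting, and the invariants of a Weyr matrix. -/

/-- Elements are inserted in increasing order of `key`: a new maximum has as its rank the size of
the previous set. This finds the Jordan chain with a prescribed rank. -/
theorem exists_card_filter_lt {ι α : Type*} [DecidableEq ι] [LinearOrder α] (F : Finset ι) (key : ι → α)
    (hk : Function.Injective key) {c : ℕ} (hc : c < F.card) :
    ∃ a ∈ F, (F.filter fun b => key b < key a).card = c := by
  induction F using Finset.induction_on_max_value key with
  | empty => simp at hc
  | insert a s ha hmax ih =>
    rw [Finset.card_insert_of_notMem ha] at hc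
    rcases Nat.lt_succ_iff_lt_or_eq.1 hc with h | h
    · obtain ⟨b, hb, hb'⟩ := ih h
      refine ⟨b, Finset.mem_insert_of_mem hb, ?_⟩
      rw [Finset.filter_insert, if_neg (not_lt.2 (hmax b hb)), hb']
    · refine ⟨a, Finset.mem_insert_self _ _, ?_⟩
      rw [Finset.filter_insert, if_neg (lt_irrefl _), Finset.filter_true_of_mem, h]
      intro b hb
      exact lt_of_le_of_ne (hmax b hb) fun hab => ha (hk hab ▸ hb)

/-- Some product in the Leibniz expansion of the determinant is nonzero. Such a permutation turns
the vanishing of entries into inequalities between cardinalities. -/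
theorem exists_perm_apply_ne_zero {k n : Type*} [Field k] [Fintype n] [DecidableEq n]
    {T : Matrix n n k} (hT : IsUnit T) : ∃ σ : Equiv.Perm n, ∀ i, T (σ i) i ≠ 0 := by
  by_contra! h
  have hdet := (Matrix.isUnit_iff_isUnit_det T).1 hT
  rw [Matrix.det_apply, Finset.sum_eq_zero] at hdet
  · exact not_isUnit_zero hdet
  · intro σ _
    obtain ⟨i, hi⟩ := h σ
    have : ∏ i, T (σ i) i = 0 := Finset.prod_eq_zero (Finset.mem_univ i) hi
    rw [this, smul_zero]

namespace IsWeyrCoord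

variable {k : Type u} [LinearOrder k] {N : ℕ} {lam : Fin N → k} {j q : Fin N → ℕ} {m : k → ℕ → ℕ}

theorem card_eq (h : IsWeyrCoord lam j q m) (x : k) (i : ℕ) :
    m x i = (Finset.univ.filter fun p => lam p = x ∧ j p = i).card := by
  rw [← Finset.card_range (m x i)]
  symm
  refine Finset.card_bij (fun p _ => q p) ?_ ?_ ?_
  · intro p hp
    simp only [Finset.mem_filter, Finset.mem_univ, true_and] at hp
    rw [Finset.mem_range, h.lt_iff]
    exact ⟨p, hp.1, hp.2, rfl⟩
  · intro p hp p' hp' hq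
    simp only [Finset.mem_filter, Finset.mem_univ, true_and] at hp hp'
    exact h.ext (hp.1.trans hp'.1.symm) (hp.2.trans hp'.2.symm) hq
  · intro c hc
    rw [Finset.mem_range, h.lt_iff] at hc
    obtain ⟨p, h1, h2, h3⟩ := hc
    exact ⟨p, by simp [h1, h2], h3⟩

/-- Closedness makes the numbers of rows in a strip an initial segment of `ℕ`, so a cardinality
describes them; it also gives an inclusion of the segment of a later strip in that of an earlier
one. -/
theorem of_closed (hs : StrictMono fun p => toLex (lam p, toLex (j p, q p)))
    (hcl : ∀ p i c, i ≤ j p → c ≤ q p → ∃ s, lam s = lam p ∧ j s = i ∧ q s = c) :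
    IsWeyrCoord lam j q fun x i => (Finset.univ.filter fun p => lam p = x ∧ j p = i).card := by
  have hext : ∀ {p p'}, lam p = lam p' → j p = j p' → q p = q p' → p = p' := fun h1 h2 h3 =>
    hs.injective (by simp only [h1, h2, h3])
  have hinj : ∀ x i, Set.InjOn q ↑(Finset.univ.filter fun p => lam p = x ∧ j p = i) := by
    intro x i p hp p' hp' hq
    simp only [Finset.coe_filter, Finset.mem_univ, true_and, Set.mem_ofPred_eq] at hp hp'
    exact hext (hp.1.trans hp'.1.symm) (hp.2.trans hp'.2.symm) hq
  refine ⟨hs, fun x i i' hi => ?_, fun x i c => ⟨fun hc => ?_, ?_⟩⟩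
  · rw [← Finset.card_image_of_injOn (hinj x i), ← Finset.card_image_of_injOn (hinj x i')]
    refine Finset.card_le_card fun c hc => ?_
    simp only [Finset.mem_image, Finset.mem_filter, Finset.mem_univ, true_and] at hc ⊢
    obtain ⟨p, ⟨h1, h2⟩, h3⟩ := hc
    obtain ⟨s, e1, e2, e3⟩ := hcl p i c (by omega) (by omega)
    exact ⟨s, ⟨e1.trans h1, e2⟩, e3⟩
  · by_contra hne
    rw [← Finset.card_image_of_injOn (hinj x i)] at hc
    refine absurd (Finset.card_le_card (t := Finset.range c) ?_) (not_le.2 (by simpa using hc))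
    intro c' hc'
    simp only [Finset.mem_image, Finset.mem_filter, Finset.mem_univ, true_and] at hc'
    obtain ⟨p, ⟨h1, h2⟩, h3⟩ := hc'
    rw [Finset.mem_range]
    by_contra hlt
    obtain ⟨s, e1, e2, e3⟩ := hcl p i c h2.ge (by omega)
    exact hne ⟨s, e1.trans h1, e2, e3⟩
  · rintro ⟨p, h1, h2, h3⟩
    rw [← Finset.card_image_of_injOn (hinj x i), ← Finset.card_range c, Nat.lt_iff_add_one_le,
      Finset.card_range, ← Finset.card_range (c + 1)]
    refine Finset.card_le_card fun c' hc' => ?_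
    rw [Finset.mem_range] at hc'
    obtain ⟨s, e1, e2, e3⟩ := hcl p i c' h2.ge (by omega)
    simp only [Finset.mem_image, Finset.mem_filter, Finset.mem_univ, true_and]
    exact ⟨s, ⟨e1.trans h1, e2⟩, e3⟩

/-- A permutation through nonzero entries of `T` preserves eigenvalues by `lam_eq` and does not
increase the strip by `strip_le`, so it injects the columns counted on the left into the rows
counted on the right. -/
theorem card_le [Field k] {lam' : Fin N → k} {j' q' : Fin N → ℕ} {m' : k → ℕ → ℕ}
    {T : Matrix (Fin N) (Fin N) k} (h : IsWeyrCoord lam j q m) (h' : IsWeyrCoord lam' j' q' m')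
    (hT : weyrMatrix lam j q * T = T * weyrMatrix lam' j' q') (hu : IsUnit T) (x : k) (i : ℕ) :
    (Finset.univ.filter fun p => lam' p = x ∧ j' p < i).card ≤
      (Finset.univ.filter fun p => lam p = x ∧ j p < i).card := by
  obtain ⟨σ, hσ⟩ := exists_perm_apply_ne_zero hu
  refine Finset.card_le_card_of_injOn σ ?_ σ.injective.injOn
  intro p hp
  simp only [Finset.coe_filter, Finset.mem_univ, true_and, Set.mem_ofPred_eq] at hp ⊢
  have h1 := lam_eq h h' hT (hσ p)
  have h2 := strip_le h h' hT (hσ p)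
  exact ⟨h1.trans hp.1, by omega⟩

/-- By `card_le` for `T` and for `T⁻¹`, the numbers of rows in the first `i` strips agree for all
`i`; the sizes of strips are their differences. -/
theorem size_eq [Field k] {lam' : Fin N → k} {j' q' : Fin N → ℕ} {m' : k → ℕ → ℕ}
    {T : Matrix (Fin N) (Fin N) k} (h : IsWeyrCoord lam j q m) (h' : IsWeyrCoord lam' j' q' m')
    (hT : weyrMatrix lam j q * T = T * weyrMatrix lam' j' q') (hu : IsUnit T) : m = m' := by
  have hdet := (Matrix.isUnit_iff_isUnit_det T).1 hu
  have hT' : weyrMatrix lam' j' q' * T⁻¹ = T⁻¹ * weyrMatrix lam j q := by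
    have : T⁻¹ * (weyrMatrix lam j q * T) * T⁻¹ = T⁻¹ * (T * weyrMatrix lam' j' q') * T⁻¹ := by
      rw [hT]
    rw [← mul_assoc T⁻¹ T, Matrix.nonsing_inv_mul _ hdet, one_mul, mul_assoc, mul_assoc,
      Matrix.mul_nonsing_inv _ hdet, mul_one] at this
    exact this.symm
  have hu' : IsUnit T⁻¹ := (Matrix.isUnit_nonsing_inv_iff).2 hu
  have key : ∀ x i, (Finset.univ.filter fun p => lam p = x ∧ j p < i).card =
      (Finset.univ.filter fun p => lam' p = x ∧ j' p < i).card := fun x i =>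
    le_antisymm (card_le h' h hT' hu' x i) (card_le h h' hT hu x i)
  have split : ∀ (l : Fin N → k) (f : Fin N → ℕ) (x : k) (i : ℕ),
      (Finset.univ.filter fun p => l p = x ∧ f p < i + 1).card =
      (Finset.univ.filter fun p => l p = x ∧ f p < i).card +
      (Finset.univ.filter fun p => l p = x ∧ f p = i).card := by
    intro l f x i
    rw [← Finset.card_union_of_disjoint]
    · congr 1
      ext p
      simp only [Finset.mem_filter, Finset.mem_univ, true_and, Finset.mem_union]
      rw [Nat.lt_succ_iff_lt_or_eq]
      tauto
    · rw [Finset.disjoint_filter]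
      intro p _ h1 h2
      omega
  funext x i
  rw [h.card_eq, h'.card_eq]
  have h1 := split lam j x i
  have h2 := split lam' j' x i
  rw [key, key] at h1
  omega

/-- The coordinates enumerate increasingly the set of triples described by `m`, and a finite
linearly ordered set has only one increasing enumeration. -/
theorem coord_eq {lam' : Fin N → k} {j' q' : Fin N → ℕ} (h : IsWeyrCoord lam j q m)
    (h' : IsWeyrCoord lam' j' q' m) : lam = lam' ∧ j = j' ∧ q = q' := by
  have hr : ∀ {l : Fin N → k} {i c : Fin N → ℕ}, IsWeyrCoord l i c m →
      Set.range (fun p => toLex (l p, toLex (i p, c p))) =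
        {y | (ofLex (ofLex y).2).2 < m (ofLex y).1 (ofLex (ofLex y).2).1} := by
    intro l i c hc
    ext y
    rw [Set.mem_range, Set.mem_ofPred_eq, hc.lt_iff]
    refine exists_congr fun p => ⟨?_, ?_⟩
    · rintro rfl
      simp
    · rintro ⟨h1, h2, h3⟩
      rw [h1, h2, h3]
      rfl
  have := (h.strictMono.range_inj h'.strictMono).1 ((hr h).trans (hr h').symm)
  refine ⟨funext fun p => ?_, funext fun p => ?_, funext fun p => ?_⟩
  · exact congrArg (fun y => (ofLex y).1) (congrFun this p)
  · exact congrArg (fun y => (ofLex (ofLex y).2).1) (congrFun this p)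
  · exact congrArg (fun y => (ofLex (ofLex y).2).2) (congrFun this p)

open Classical in
/-- The number of rows in the Jordan chain of the row `p`. -/
noncomputable def length {k : Type u} {N : ℕ} (lam : Fin N → k) (q : Fin N → ℕ)
    (p : Fin N) : ℕ := (Finset.univ.filter fun s => lam s = lam p ∧ q s = q p).card

/-- As `m x` is antitone, a chain occupies an initial segment of the strips, one row in each, so its
length tells which strips it reaches. -/
theorem lt_length_iff (h : IsWeyrCoord lam j q m) (p : Fin N) (i : ℕ) :
    i < length lam q p ↔ q p < m (lam p) i := by
  classical
  let D := Nat.findGreatest (fun i => q p < m (lam p) i) (Finset.univ.sup j)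
  have hbd : ∀ i, q p < m (lam p) i → i ≤ D := by
    intro i hi
    obtain ⟨s, -, h2, -⟩ := h.exists_of_lt hi
    exact Nat.le_findGreatest (h2 ▸ Finset.le_sup (Finset.mem_univ s)) hi
  have h0 : q p < m (lam p) 0 := (h.lt p).trans_le (h.antitone _ (Nat.zero_le _))
  have hD : q p < m (lam p) D :=
    Nat.findGreatest_spec (P := fun i => q p < m (lam p) i) (Nat.zero_le _) h0
  have hiff : ∀ i, q p < m (lam p) i ↔ i < D + 1 := fun i =>
    ⟨fun hi => Nat.lt_succ_of_le (hbd i hi), fun hi =>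
      hD.trans_le (h.antitone _ (Nat.le_of_lt_succ hi))⟩
  have hlen : length lam q p = D + 1 := by
    unfold length
    rw [← Finset.card_range (D + 1)]
    refine Finset.card_bij (fun s _ => j s) ?_ ?_ ?_
    · intro s hs
      simp only [Finset.mem_filter, Finset.mem_univ, true_and] at hs
      rw [Finset.mem_range, ← hiff, ← hs.1, ← hs.2]
      exact h.lt s
    · intro s hs s' hs' hj
      simp only [Finset.mem_filter, Finset.mem_univ, true_and] at hs hs'
      exact h.ext (hs.1.trans hs'.1.symm) hj (hs.2.trans hs'.2.symm)
    · intro i hi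
      rw [Finset.mem_range, ← hiff] at hi
      obtain ⟨s, h1, h2, h3⟩ := h.exists_of_lt hi
      exact ⟨s, by simp [h1, h3], h2⟩
  rw [hlen, hiff]

theorem length_eq_of_eq {k : Type u} {N : ℕ} {lam : Fin N → k} {q : Fin N → ℕ} {p p' : Fin N}
    (h1 : lam p = lam p') (h2 : q p = q p') : length lam q p = length lam q p' := by
  unfold length
  rw [h1, h2]

theorem length_anti (h : IsWeyrCoord lam j q m) {p p' : Fin N} (h1 : lam p = lam p') (h2 : q p ≤ q p') :
    length lam q p' ≤ length lam q p := by
  by_contra! hc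
  rw [h.lt_length_iff, ← h1] at hc
  exact lt_irrefl _ ((h.lt_length_iff p _).2 (h2.trans_lt hc))

theorem length_le_of_apply_ne_zero [Field k] {T : Matrix (Fin N) (Fin N) k} (h : IsWeyrCoord lam j q m)
    (hT : weyrMatrix lam j q * T = T * weyrMatrix lam j q) {p p' : Fin N} (hj : j p = j p')
    (hne : T p p' ≠ 0) : length lam q p' ≤ length lam q p := by
  by_contra! hc
  refine hne (h.apply_eq_zero_of_length_lt h hT (lam_eq h h hT hne) hj (D := length lam q p) ?_ ?_)
  · rw [← h.lt_length_iff]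
    exact lt_irrefl _
  · rwa [← h.lt_length_iff]

/-- The elements of the centralizer of a Weyr matrix that generate its diagonal blocks. -/
theorem commute_of_apply_eq [Field k] (h : IsWeyrCoord lam j q m) {T : Matrix (Fin N) (Fin N) k} {y z : k × ℕ}
    (h1 : ∀ p p', lam p = lam p' → j p = j p' → length lam q p = length lam q p' →
      (lam p, q p) = y → (lam p', q p') = z → T p p' = 1)
    (h0 : ∀ p p', ¬ (lam p = lam p' ∧ j p = j p' ∧ length lam q p = length lam q p' ∧
      (lam p, q p) = y ∧ (lam p', q p') = z) → T p p' = 0) :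
    weyrMatrix lam j q * T = T * weyrMatrix lam j q := by
  ext p p'
  rw [h.weyrMatrix_mul_apply, h.mul_weyrMatrix_apply]
  congr 1
  · by_cases hl : lam p = lam p'
    · rw [hl, mul_comm]
    · rw [h0 p p' fun h' => hl h'.1, mul_zero, zero_mul]
  -- If `p'` lies one strip further than a place of the support, the equality of lengths ensures
  -- that `p` has a successor, and both sums are equal to `1`. Otherwise all terms vanish.
  · by_cases hc : lam p = lam p' ∧ j p + 1 = j p' ∧ length lam q p = length lam q p' ∧
      (lam p, q p) = y ∧ (lam p', q p') = z
    · obtain ⟨c1, c2, c3, c4, c5⟩ := hc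
      have hlt : q p < m (lam p) (j p + 1) := by
        rw [← h.lt_length_iff, c3, h.lt_length_iff, c2]
        exact h.lt p'
      obtain ⟨s, e1, e2, e3⟩ := h.exists_of_lt hlt
      obtain ⟨s', e1', e2', e3'⟩ := h.exists_of_le (p := p') (i := j p) (by omega)
      rw [h.sum_succ (fun s => T s p') e1 e2 e3, h.sum_pred _ e1' (by omega) e3',
        h1 s p' (e1.trans c1) (by omega) ((length_eq_of_eq e1 e3).trans c3) (by rw [e1, e3, c4]) c5,
        h1 p s' (c1.trans e1'.symm) e2'.symm (c3.trans (length_eq_of_eq e1' e3').symm) c4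
          (by rw [e1', e3', c5])]
    · rw [Finset.sum_eq_zero, Finset.sum_eq_zero]
      · intro s hs
        rw [Finset.mem_filter] at hs
        obtain ⟨-, e1, e2, e3⟩ := hs
        refine h0 _ _ fun h' => hc ⟨h'.1.trans e1, by omega,
          h'.2.2.1.trans (length_eq_of_eq e1 e3), h'.2.2.2.1, by rw [← e1, ← e3, h'.2.2.2.2]⟩
      · intro s hs
        rw [Finset.mem_filter] at hs
        obtain ⟨-, e1, e2, e3⟩ := hs
        refine h0 _ _ fun h' => hc ⟨e1.symm.trans h'.1, by omega,
          (length_eq_of_eq e1 e3).symm.trans h'.2.2.1, by rw [← e1, ← e3, h'.2.2.2.1], h'.2.2.2.2⟩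

end IsWeyrCoord

/-! ### Existence and uniqueness of the Weyr form. -/

theorem IsWeyr.exists_coord {k : Type u} [Field k] [LinearOrder k] {N : ℕ}
    {W : Matrix (Fin N) (Fin N) k} (hW : IsWeyr W) :
    ∃ (lam : Fin N → k) (j q : Fin N → ℕ) (m : k → ℕ → ℕ), IsWeyrCoord lam j q m ∧
      W = weyrMatrix lam j q := by
  obtain ⟨r, l, c, m, e, hl, hc, hm, hpos, hne, hW⟩ := hW
  let I : Fin N → Fin r := fun p => (ofLex (e.symm p)).1
  let jf : Fin N → ℕ := fun p => ((ofLex (ofLex (e.symm p)).2).1 : Fin _)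
  let qf : Fin N → ℕ := fun p => ((ofLex (ofLex (e.symm p)).2).2 : Fin _)
  have hI : ∀ i a b, I (e (toLex ⟨i, toLex ⟨a, b⟩⟩)) = i := fun i a b => by simp [I]
  have hj : ∀ i a b, jf (e (toLex ⟨i, toLex ⟨a, b⟩⟩)) = a := fun i a b => by
    simp only [jf]
    rw [e.symm_apply_apply]
    rfl
  have hq : ∀ i a b, qf (e (toLex ⟨i, toLex ⟨a, b⟩⟩)) = b := fun i a b => by
    simp only [qf]
    rw [e.symm_apply_apply]
    rfl
  have hsurj : ∀ p, ∃ i a b, e (toLex ⟨i, toLex ⟨a, b⟩⟩) = p := fun p =>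
    ⟨_, _, _, e.apply_symm_apply p⟩
  refine ⟨fun p => l (I p), jf, qf, _, IsWeyrCoord.of_closed ?_ ?_, ?_⟩
  · intro p p' hpp
    obtain ⟨i, a, b, rfl⟩ := hsurj p
    obtain ⟨i', a', b', rfl⟩ := hsurj p'
    simp only [hI, hj, hq]
    rw [e.lt_iff_lt, Sigma.Lex.lt_def] at hpp
    rw [Prod.Lex.toLex_lt_toLex]
    rcases hpp with h | ⟨h, h2⟩
    · exact Or.inl (hl h)
    · change i = i' at h
      subst h
      refine Or.inr ⟨rfl, ?_⟩
      change (toLex ⟨a, b⟩ : Idx (m i)) < toLex ⟨a', b'⟩ at h2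
      rw [Sigma.Lex.lt_def] at h2
      rw [Prod.Lex.toLex_lt_toLex]
      rcases h2 with h | ⟨h, h3⟩
      · exact Or.inl h
      · change a = a' at h
        subst h
        exact Or.inr ⟨rfl, h3⟩
  · intro p x y hx hy
    obtain ⟨i, a, b, rfl⟩ := hsurj p
    rw [hj] at hx
    rw [hq] at hy
    refine ⟨e (toLex ⟨i, toLex ⟨⟨x, hx.trans_lt a.2⟩, ⟨y, hy.trans_lt (b.2.trans_le (hm i ?_))⟩⟩⟩),
      ?_, ?_, ?_⟩
    · exact hx
    · rw [hI, hI]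
    · rw [hj]
    · rw [hq]
  · ext p p'
    obtain ⟨i, a, b, rfl⟩ := hsurj p
    obtain ⟨i', a', b', rfl⟩ := hsurj p'
    simp only [weyrMatrix, hI, hj, hq]
    by_cases h : i = i'
    · subst h
      rw [hW]
      simp
    · rw [hne _ _ _ _ h, if_neg (fun h1 => h (hl.injective h1.1))]

theorem IsWeyr.eq_of_similar {k : Type u} [Field k] [LinearOrder k] {N : ℕ}
    {W W' T : Matrix (Fin N) (Fin N) k} (hW : IsWeyr W) (hW' : IsWeyr W') (hu : IsUnit T)
    (hT : W * T = T * W') : W = W' := by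
  obtain ⟨lam, j, q, m, h, rfl⟩ := hW.exists_coord
  obtain ⟨lam', j', q', m', h', rfl⟩ := hW'.exists_coord
  obtain rfl := h.size_eq h' hT hu
  obtain ⟨rfl, rfl, rfl⟩ := h.coord_eq h'
  rfl

theorem IsWeyrCoord.isWeyr {k : Type u} [Field k] [LinearOrder k] {N : ℕ} {lam : Fin N → k}
    {j q : Fin N → ℕ} {m : k → ℕ → ℕ} (h : IsWeyrCoord lam j q m) : IsWeyr (weyrMatrix lam j q) := by
  classical
  let L := Finset.univ.image lam
  let l : Fin L.card ↪o k := L.orderEmbOfFin rfl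
  have hl : ∀ i, ∃ p, lam p = l i := fun i => by
    have := L.orderEmbOfFin_mem rfl i
    obtain ⟨p, -, hp⟩ := Finset.mem_image.1 this
    exact ⟨p, hp⟩
  have hl' : ∀ p, ∃ i, l i = lam p := fun p => by
    have : lam p ∈ Set.range l := by
      rw [Finset.range_orderEmbOfFin]
      simp [L]
    exact this
  have hc : ∀ i, ∃ c, 0 < c ∧ ∀ a, a < c ↔ 0 < m (l i) a := by
    intro i
    obtain ⟨p, hp⟩ := hl i
    have h0 : 0 < m (lam p) 0 := (Nat.zero_le _).trans_lt
      ((h.lt p).trans_le (h.antitone _ (Nat.zero_le _)))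
    obtain ⟨p0, e1, e2, e3⟩ := (h.lt_iff _ _ _).1 h0
    -- The row with number `0` in the first strip begins a longest chain, so its length is the
    -- number of nonempty strips.
    refine ⟨IsWeyrCoord.length lam q p0, ?_, fun a => ?_⟩
    · rw [h.lt_length_iff, e1, e3]
      exact h0
    · rw [h.lt_length_iff, e1, e3, hp]
  choose c hc0 hc using hc
  let M : (i : Fin L.card) → Fin (c i) → ℕ := fun i a => m (l i) a
  have hF : ∀ x : (Σₗ i, Idx (M i)), ∃ p, lam p = l (ofLex x).1 ∧ j p = (ofLex (ofLex x).2).1 ∧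
      q p = (ofLex (ofLex x).2).2 := fun x => (h.lt_iff _ _ _).1 (ofLex (ofLex x).2).2.2
  choose F hF1 hF2 hF3 using hF
  have hmono' : ∀ i a b i' a' b', (toLex ⟨i, toLex ⟨a, b⟩⟩ : Σₗ i, Idx (M i)) <
      toLex ⟨i', toLex ⟨a', b'⟩⟩ → F (toLex ⟨i, toLex ⟨a, b⟩⟩) < F (toLex ⟨i', toLex ⟨a', b'⟩⟩) := by
    intro i a b i' a' b' hxy
    rw [← h.strictMono.lt_iff_lt]
    simp only [hF1, hF2, hF3]
    rw [Prod.Lex.toLex_lt_toLex]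
    rw [Sigma.Lex.lt_def] at hxy
    rcases hxy with h | ⟨h, h2⟩
    · exact Or.inl (l.strictMono h)
    · change i = i' at h
      subst h
      refine Or.inr ⟨rfl, ?_⟩
      change (toLex ⟨a, b⟩ : Idx (M i)) < toLex ⟨a', b'⟩ at h2
      rw [Sigma.Lex.lt_def] at h2
      rw [Prod.Lex.toLex_lt_toLex]
      rcases h2 with h | ⟨h, h3⟩
      · exact Or.inl h
      · change a = a' at h
        subst h
        exact Or.inr ⟨rfl, h3⟩
  have hmono : StrictMono F := fun x y => hmono' _ _ _ _ _ _
  have hsurj : Function.Surjective F := by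
    intro p
    obtain ⟨i, hi⟩ := hl' p
    have hq : q p < m (l i) (j p) := hi ▸ h.lt p
    refine ⟨toLex ⟨i, toLex ⟨⟨j p, (hc _ _).2 ((Nat.zero_le _).trans_lt hq)⟩, ⟨q p, hq⟩⟩⟩, ?_⟩
    refine h.ext ?_ ?_ ?_
    · rw [hF1]
      exact hi
    · rw [hF2]
      rfl
    · rw [hF3]
      rfl
  refine ⟨L.card, l, c, M, StrictMono.orderIsoOfSurjective F hmono hsurj, l.strictMono, hc0,
    fun i a a' haa => h.antitone _ haa, fun i a => (hc i a).1 a.2, ?_, ?_⟩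
  · intro i i' a b hii
    rw [StrictMono.coe_orderIsoOfSurjective]
    unfold weyrMatrix
    rw [if_neg]
    rintro ⟨h1, -⟩
    rw [hF1, hF1] at h1
    exact hii (l.injective h1)
  · intro i a a' b b'
    rw [StrictMono.coe_orderIsoOfSurjective]
    unfold weyrMatrix
    simp only [hF1, hF2, hF3]
    change (if l i = l i ∧ (b : ℕ) = b' then _ else _) = _
    simp only [true_and]
    rfl

/-- Every square matrix over an algebraically closed field is similar to a Weyr matrix. -/
theorem exists_isWeyr {k : Type u} [Field k] [IsAlgClosed k] [LinearOrder k] {N : ℕ}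
    (M : Matrix (Fin N) (Fin N) k) :
    ∃ S : Matrix (Fin N) (Fin N) k, IsUnit S ∧ IsWeyr (S⁻¹ * M * S) := by
  classical
  obtain ⟨ι, _, lam, e, b, hb⟩ := exists_jordan_basis (Matrix.toLin' M)
  -- Chains are ordered by decreasing length, with ties broken by an enumeration. The rank `qr` of a
  -- chain among those of its eigenvalue becomes the number of its rows within their strips.
  let key : ι → Lex (ℕᵒᵈ × Fin (Fintype.card ι)) := fun i =>
    toLex (OrderDual.toDual (e i), Fintype.equivFin ι i)
  have hkey : Function.Injective key := fun i i' h =>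
    (Fintype.equivFin ι).injective (congrArg (fun y => (ofLex y).2) h)
  have hkey_le : ∀ {i i'}, key i ≤ key i' → e i' ≤ e i := by
    intro i i' h
    rw [Prod.Lex.toLex_le_toLex] at h
    rcases h with h | h
    · exact (OrderDual.toDual_lt_toDual.1 h).le
    · exact (OrderDual.toDual_inj.1 h.1).ge
  let qr : ι → ℕ := fun i => (Finset.univ.filter fun i' => lam i' = lam i ∧ key i' < key i).card
  have hqr : ∀ {i i'}, lam i = lam i' → qr i = qr i' → i = i' := by
    have : ∀ {i i'}, lam i = lam i' → key i < key i' → qr i < qr i' := by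
      intro i i' hl hlt
      refine Finset.card_lt_card ((Finset.ssubset_iff_of_subset ?_).2 ⟨i, ?_, ?_⟩)
      · intro s hs
        simp only [Finset.mem_filter, Finset.mem_univ, true_and] at hs ⊢
        exact ⟨hs.1.trans hl, hs.2.trans hlt⟩
      · simp [hl, hlt]
      · simp
    intro i i' hl hq
    rcases lt_trichotomy (key i) (key i') with h | h | h
    · exact absurd hq (this hl h).ne
    · exact hkey h
    · exact absurd hq (this hl.symm h).ne'
  -- Sorting the Jordan basis by eigenvalue, then by position in the chain, then by the rank of the
  -- chain turns the Jordan form into the Weyr form.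
  let κ : (Σ i, Fin (e i)) → Lex (k × Lex (ℕ × ℕ)) := fun x =>
    toLex (lam x.1, toLex ((x.2 : ℕ), qr x.1))
  have hκ : Function.Injective κ := by
    rintro ⟨i, a⟩ ⟨i', a'⟩ h
    have h1 : lam i = lam i' := congrArg (fun y => (ofLex y).1) h
    have h2 : (a : ℕ) = a' := congrArg (fun y => (ofLex (ofLex y).2).1) h
    have h3 : qr i = qr i' := congrArg (fun y => (ofLex (ofLex y).2).2) h
    obtain rfl := hqr h1 h3
    rw [Fin.ext h2]
  have hcard : (Finset.univ.image κ).card = N := by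
    rw [Finset.card_image_of_injective _ hκ, Finset.card_univ, ← Module.finrank_eq_card_basis b,
      Module.finrank_fin_fun]
  let g := (Finset.univ.image κ).orderEmbOfFin hcard
  have hg : ∀ p, ∃ x, κ x = g p := fun p => by
    obtain ⟨x, -, hx⟩ := Finset.mem_image.1 (Finset.orderEmbOfFin_mem _ hcard p)
    exact ⟨x, hx⟩
  choose ε hε using hg
  have hεbij : Function.Bijective ε := by
    refine (Fintype.bijective_iff_injective_and_card ε).2 ⟨fun p p' h => ?_, ?_⟩
    · apply g.injective
      rw [← hε, ← hε, h]
    · rw [← hcard, Finset.card_image_of_injective _ hκ, Finset.card_univ, Fintype.card_fin]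
  let E : Fin N ≃ Σ i, Fin (e i) := Equiv.ofBijective ε hεbij
  let B : Module.Basis (Fin N) k (Fin N → k) := b.reindex E.symm
  have hB : ∀ p, B p = b (ε p) := fun p => by
    rw [Module.Basis.reindex_apply]
    rfl
  have hmono : StrictMono fun p => toLex (lam (ε p).1, toLex (((ε p).2 : ℕ), qr (ε p).1)) := by
    have : (fun p => toLex (lam (ε p).1, toLex (((ε p).2 : ℕ), qr (ε p).1))) = g :=
      funext hε
    rw [this]
    exact g.strictMono
  -- A chain of smaller or equal rank with the same eigenvalue is at least as long, so it has a
  -- vector in the position `i`.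
  have hclosed : ∀ (p : Fin N) (i c : ℕ), i ≤ ((ε p).2 : ℕ) → c ≤ qr (ε p).1 →
      ∃ s, lam (ε s).1 = lam (ε p).1 ∧ ((ε s).2 : ℕ) = i ∧ qr (ε s).1 = c := by
    intro p i c hi hc
    obtain ⟨a, ha, hac⟩ := exists_card_filter_lt
      (Finset.univ.filter fun i' => lam i' = lam (ε p).1 ∧ key i' ≤ key (ε p).1) key hkey (c := c) (by
        refine hc.trans_lt (Finset.card_lt_card ((Finset.ssubset_iff_of_subset ?_).2
          ⟨(ε p).1, ?_, ?_⟩))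
        · intro s hs
          simp only [Finset.mem_filter, Finset.mem_univ, true_and] at hs ⊢
          exact ⟨hs.1, hs.2.le⟩
        · simp
        · simp)
    simp only [Finset.mem_filter, Finset.mem_univ, true_and] at ha
    have hea := hkey_le ha.2
    have h2 := (ε p).2.2
    obtain ⟨s, hs⟩ := hεbij.2 ⟨a, ⟨i, by omega⟩⟩
    refine ⟨s, by rw [hs]; exact ha.1, by rw [hs], ?_⟩
    rw [hs, ← hac, Finset.filter_filter]
    simp only [qr]
    congr 1
    ext i'
    simp only [Finset.mem_filter, Finset.mem_univ, true_and, ha.1]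
    exact ⟨fun h => ⟨⟨h.1, h.2.le.trans ha.2⟩, h.2⟩, fun h => ⟨h.1.1, h.2⟩⟩
  have hW := IsWeyrCoord.of_closed hmono hclosed
  have hmat : LinearMap.toMatrix B B (Matrix.toLin' M) =
      weyrMatrix (fun p => lam (ε p).1) (fun p => ((ε p).2 : ℕ)) (fun p => qr (ε p).1) := by
    ext p p'
    rw [LinearMap.toMatrix_apply, hB, hb, map_add, map_smul, ← hB, Module.Basis.repr_self]
    unfold weyrMatrix
    beta_reduce
    rw [Finsupp.add_apply, Finsupp.smul_apply, Finsupp.single_apply, smul_eq_mul]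
    by_cases h0 : 0 < ((ε p').2 : ℕ)
    · rw [dif_pos h0]
      have h2 := (ε p').2.2
      obtain ⟨s, hs⟩ := hεbij.2 ⟨(ε p').1, ⟨(ε p').2 - 1, by omega⟩⟩
      rw [← hs, ← hB, Module.Basis.repr_self, Finsupp.single_apply]
      have hs1 : (ε s).1 = (ε p').1 := by rw [hs]
      have hs2 : ((ε s).2 : ℕ) = (ε p').2 - 1 := by rw [hs]
      by_cases h3 : lam (ε p).1 = lam (ε p').1 ∧ qr (ε p).1 = qr (ε p').1
      · rw [if_pos h3]
        by_cases h4 : ((ε p').2 : ℕ) = (ε p).2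
        · have : p' = p := hW.ext h3.1.symm h4 h3.2.symm
          subst this
          rw [if_neg (c := s = p') (by rintro rfl; omega)]
          simp
        · rw [if_neg (c := p' = p) (by rintro rfl; exact h4 rfl), if_neg h4, mul_zero, zero_add]
          by_cases h5 : ((ε p').2 : ℕ) = (ε p).2 + 1
          · rw [if_pos h5, if_pos]
            exact hW.ext (by rw [hs1, h3.1]) (by omega) (by rw [hs1, h3.2])
          · rw [if_neg h5, if_neg]
            rintro rfl
            omega
      · rw [if_neg h3, if_neg (by rintro rfl; exact h3 ⟨rfl, rfl⟩), if_neg, mul_zero, zero_add]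
        rintro rfl
        rw [hs1] at h3
        exact h3 ⟨rfl, rfl⟩
    · rw [dif_neg h0, map_zero, Finsupp.zero_apply, add_zero]
      by_cases h3 : p' = p
      · subst h3
        simp
      · rw [if_neg h3, mul_zero]
        split_ifs with h4 h5 h6
        · exact absurd (hW.ext h4.1.symm h5 h4.2.symm) h3
        · omega
        · rfl
        · rfl
  refine ⟨(Pi.basisFun k (Fin N)).toMatrix B, ?_, ?_⟩
  · exact IsUnit.of_mul_eq_one _ ((Pi.basisFun k (Fin N)).toMatrix_mul_toMatrix_flip B)
  · have hinv : ((Pi.basisFun k (Fin N)).toMatrix B)⁻¹ = B.toMatrix (Pi.basisFun k (Fin N)) :=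
      Matrix.inv_eq_left_inv (B.toMatrix_mul_toMatrix_flip (Pi.basisFun k (Fin N)))
    have h2 := basis_toMatrix_mul_linearMap_toMatrix_mul_basis_toMatrix B (Pi.basisFun k (Fin N)) B
      (Pi.basisFun k (Fin N)) (Matrix.toLin' M)
    have h3 : LinearMap.toMatrix (Pi.basisFun k (Fin N)) (Pi.basisFun k (Fin N)) (Matrix.toLin' M) = M := by
      rw [← Matrix.toLin_eq_toLin', LinearMap.toMatrix_toLin]
    rw [h3, hmat] at h2
    rw [hinv, h2]
    exact hW.isWeyr

/-! ### The normal form of a rectangular matrix under equivalence. -/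

/-- Every rectangular matrix is equivalent to a matrix of the form `[0 I; 0 0]`. -/
theorem exists_isUpperRightIdentity {k : Type u} [Field k] {a b : ℕ} (M : Matrix (Fin a) (Fin b) k) :
    ∃ (U : Matrix (Fin a) (Fin a) k) (V : Matrix (Fin b) (Fin b) k), IsUnit U ∧ IsUnit V ∧
      IsUpperRightIdentity (U⁻¹ * M * V) := by
  classical
  let f := Matrix.toLin' M
  obtain ⟨C, hC⟩ := (LinearMap.ker f).exists_isCompl
  obtain ⟨D, hD⟩ := (LinearMap.range f).exists_isCompl
  let s := Module.finrank k C
  have hs : Module.finrank k (LinearMap.range f) = s :=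
    (LinearEquiv.finrank_eq (LinearMap.kerComplementEquivRange f hC.symm)).symm
  have hb : Module.finrank k (LinearMap.ker f) + s = b := by
    rw [Submodule.finrank_add_eq_of_isCompl hC, Module.finrank_fin_fun]
  have ha : s + Module.finrank k D = a := by
    rw [← hs, Submodule.finrank_add_eq_of_isCompl hD, Module.finrank_fin_fun]
  let bC := Module.finBasis k C
  let bR := bC.map (LinearMap.kerComplementEquivRange f hC.symm)
  -- The source basis lists the kernel first and its complement last; the target basis lists the
  -- images of the complement first. This puts the identity into the upper right corner.
  let B2 := (((Module.finBasis k (LinearMap.ker f)).prod bC).map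
    (Submodule.prodEquivOfIsCompl _ _ hC)).reindex (finSumFinEquiv.trans (finCongr hb))
  let B1 := ((bR.prod (Module.finBasis k D)).map
    (Submodule.prodEquivOfIsCompl _ _ hD)).reindex (finSumFinEquiv.trans (finCongr ha))
  have hker : ∀ i, f (B2 (finCongr hb (Fin.castAdd s i))) = 0 := by
    intro i
    simp only [B2, Module.Basis.reindex_apply, Equiv.symm_trans_apply, Equiv.symm_apply_apply,
      Module.Basis.map_apply, Module.Basis.prod_apply]
    rw [finSumFinEquiv_symm_apply_castAdd]
    simp
  have hran : ∀ i, f (B2 (finCongr hb (Fin.natAdd _ i))) = B1 (finCongr ha (Fin.castAdd _ i)) := by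
    intro i
    simp [B2, B1, bR]
  have hmat : IsUpperRightIdentity (LinearMap.toMatrix B2 B1 f) := by
    refine ⟨s, by omega, by omega, fun p q => ?_⟩
    rw [LinearMap.toMatrix_apply]
    obtain ⟨q, rfl⟩ := (finSumFinEquiv.trans (finCongr hb)).surjective q
    rcases q with q | q
    · have : f (B2 ((finSumFinEquiv.trans (finCongr hb)) (Sum.inl q))) = 0 := hker q
      rw [this, map_zero, Finsupp.zero_apply, if_neg]
      rintro ⟨-, h⟩
      have h2 : (((finSumFinEquiv.trans (finCongr hb)) (Sum.inl q) : Fin b) : ℕ) = q := by simp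
      omega
    · have : f (B2 ((finSumFinEquiv.trans (finCongr hb)) (Sum.inr q))) =
        B1 (finCongr ha (Fin.castAdd _ q)) := hran q
      rw [this, Module.Basis.repr_self, Finsupp.single_apply]
      have h2 : (((finSumFinEquiv.trans (finCongr hb)) (Sum.inr q) : Fin b) : ℕ) =
        Module.finrank k (LinearMap.ker f) + q := by simp
      refine if_congr ?_ rfl rfl
      rw [h2, Fin.ext_iff]
      have h3 : ((finCongr ha (Fin.castAdd _ q) : Fin a) : ℕ) = q := by simp
      rw [h3]
      omega
  refine ⟨(Pi.basisFun k (Fin a)).toMatrix B1, (Pi.basisFun k (Fin b)).toMatrix B2,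
    IsUnit.of_mul_eq_one _ ((Pi.basisFun k (Fin a)).toMatrix_mul_toMatrix_flip B1),
    IsUnit.of_mul_eq_one _ ((Pi.basisFun k (Fin b)).toMatrix_mul_toMatrix_flip B2), ?_⟩
  have hinv : ((Pi.basisFun k (Fin a)).toMatrix B1)⁻¹ = B1.toMatrix (Pi.basisFun k (Fin a)) :=
    Matrix.inv_eq_left_inv (B1.toMatrix_mul_toMatrix_flip (Pi.basisFun k (Fin a)))
  have h2 := basis_toMatrix_mul_linearMap_toMatrix_mul_basis_toMatrix B2 (Pi.basisFun k (Fin b)) B1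
    (Pi.basisFun k (Fin a)) (Matrix.toLin' M)
  have h3 : LinearMap.toMatrix (Pi.basisFun k (Fin b)) (Pi.basisFun k (Fin a)) (Matrix.toLin' M) = M := by
    rw [← Matrix.toLin_eq_toLin', LinearMap.toMatrix_toLin]
  rw [h3] at h2
  rw [hinv, h2]
  exact hmat

/-- The two identity blocks have equal sizes by symmetry: the first `s'` columns of `U` vanish from
the row `s` on, so a permutation through nonzero entries of `U` gives `s' ≤ s`. -/
theorem IsUpperRightIdentity.eq_of_equivalent {k : Type u} [Field k] {a b : ℕ}
    {E E' : Matrix (Fin a) (Fin b) k} (hE : IsUpperRightIdentity E) (hE' : IsUpperRightIdentity E')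
    {U : Matrix (Fin a) (Fin a) k} {V : Matrix (Fin b) (Fin b) k} (hU : IsUnit U) (hV : IsUnit V)
    (h : E * V = U * E') : E = E' := by
  have key : ∀ {E E' : Matrix (Fin a) (Fin b) k} {s s' : ℕ}, s ≤ a → s' ≤ a → s ≤ b → s' ≤ b →
      (∀ p q, E p q = if (p : ℕ) < s ∧ (q : ℕ) = p + (b - s) then 1 else 0) →
      (∀ p q, E' p q = if (p : ℕ) < s' ∧ (q : ℕ) = p + (b - s') then 1 else 0) →
      ∀ {U : Matrix (Fin a) (Fin a) k} {V : Matrix (Fin b) (Fin b) k}, IsUnit U →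
      E * V = U * E' → s' ≤ s := by
    intro E E' s s' hsa hsa' hs hs' hE hE' U V hU h
    obtain ⟨σ, hσ⟩ := exists_perm_apply_ne_zero hU
    have hz : ∀ (p : Fin a) (c : Fin a), s ≤ (p : ℕ) → (c : ℕ) < s' → U p c = 0 := by
      intro p c hp hc
      have h1 := congrFun (congrFun h p) (⟨c + (b - s'), by omega⟩ : Fin b)
      rw [Matrix.mul_apply, Matrix.mul_apply, Finset.sum_eq_zero, Finset.sum_eq_single c] at h1
      · rw [hE', if_pos ⟨hc, rfl⟩, mul_one] at h1
        exact h1.symm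
      · intro c' _ hne
        rw [hE', if_neg, mul_zero]
        rintro ⟨-, h⟩
        simp only at h
        exact hne (Fin.ext (by omega))
      · simp
      · intro x _
        rw [hE, if_neg (by omega), zero_mul]
    have hcard : ∀ {x : ℕ}, x ≤ a → (Finset.univ.filter fun p : Fin a => (p : ℕ) < x).card = x := by
      intro x hx
      rw [Fin.card_filter_val_lt, min_eq_right hx]
    rw [← hcard hsa, ← hcard hsa']
    refine Finset.card_le_card_of_injOn σ ?_ σ.injective.injOn
    intro c hc
    simp only [Finset.coe_filter, Finset.mem_univ, true_and, Set.mem_ofPred_eq] at hc ⊢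
    by_contra hp
    exact hσ c (hz _ _ (not_lt.1 hp) hc)
  obtain ⟨s, hsa, hsb, hs⟩ := hE
  obtain ⟨s', hsa', hsb', hs'⟩ := hE'
  have hdU := (Matrix.isUnit_iff_isUnit_det U).1 hU
  have hdV := (Matrix.isUnit_iff_isUnit_det V).1 hV
  have h' : E' * V⁻¹ = U⁻¹ * E := by
    have : U⁻¹ * (E * V) * V⁻¹ = U⁻¹ * (U * E') * V⁻¹ := by rw [h]
    rw [← Matrix.mul_assoc U⁻¹ U, Matrix.nonsing_inv_mul _ hdU, Matrix.one_mul, Matrix.mul_assoc,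
      Matrix.mul_assoc, Matrix.mul_nonsing_inv _ hdV, Matrix.mul_one] at this
    exact this.symm
  have h1 := key hsa hsa' hsb hsb' hs hs' hU h
  have h2 := key hsa' hsa hsb' hsb hs' hs (Matrix.isUnit_nonsing_inv_iff.2 hU) h'
  obtain rfl := le_antisymm h1 h2
  ext p q
  rw [hs, hs']

/-! ### Strips and positions of rows. -/

namespace StripPartition

variable {ι : Type} [LinearOrder ι] (P : StripPartition ι)

/-- The number of the strip that contains the row `a`. -/
def strip (a : ι) : Fin P.count := (ofLex (P.equiv.symm a)).1

/-- The position of the row `a` in its strip. -/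
def pos (a : ι) : ℕ := (ofLex (P.equiv.symm a)).2

variable {P}

theorem pos_lt (a : ι) : P.pos a < P.size (P.strip a) := (ofLex (P.equiv.symm a)).2.2

@[simp] theorem strip_equiv (i : Fin P.count) (p : Fin (P.size i)) :
    P.strip (P.equiv (toLex ⟨i, p⟩)) = i := by
  unfold strip
  rw [P.equiv.symm_apply_apply]
  rfl

@[simp] theorem pos_equiv (i : Fin P.count) (p : Fin (P.size i)) :
    P.pos (P.equiv (toLex ⟨i, p⟩)) = p := by
  unfold pos
  rw [P.equiv.symm_apply_apply]
  rfl

theorem equiv_strip_pos (a : ι) : P.equiv (toLex ⟨P.strip a, ⟨P.pos a, pos_lt a⟩⟩) = a :=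
  P.equiv.apply_symm_apply a

theorem exists_equiv (a : ι) : ∃ i p, P.equiv (toLex ⟨i, p⟩) = a := ⟨_, _, equiv_strip_pos a⟩

theorem lt_iff {a b : ι} :
    a < b ↔ P.strip a < P.strip b ∨ P.strip a = P.strip b ∧ P.pos a < P.pos b := by
  obtain ⟨i, p, rfl⟩ := exists_equiv (P := P) a
  obtain ⟨i', p', rfl⟩ := exists_equiv (P := P) b
  rw [P.equiv.lt_iff_lt, Sigma.Lex.lt_def]
  simp only [strip_equiv, pos_equiv]
  refine or_congr Iff.rfl ⟨?_, ?_⟩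
  · rintro ⟨h, h2⟩
    change i = i' at h
    subst h
    exact ⟨rfl, h2⟩
  · rintro ⟨h, h2⟩
    subst h
    exact ⟨rfl, h2⟩

theorem ext {a b : ι} (h : P.strip a = P.strip b) (h' : P.pos a = P.pos b) : a = b := by
  rcases lt_trichotomy a b with hlt | rfl | hlt
  · rw [lt_iff (P := P)] at hlt
    omega
  · rfl
  · rw [lt_iff (P := P)] at hlt
    omega

theorem strip_mono : Monotone P.strip := by
  intro a b hab
  rcases hab.lt_or_eq with h | rfl
  · rw [lt_iff (P := P)] at h
    omega
  · exact le_rfl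

theorem exists_of_lt {i : Fin P.count} {x : ℕ} (hx : x < P.size i) :
    ∃ a, P.strip a = i ∧ P.pos a = x :=
  ⟨P.equiv (toLex ⟨i, ⟨x, hx⟩⟩), by simp, by simp⟩

theorem blkEntry_part {k : Type u} [Zero k] (S : Matrix ι ι k) (a b : ι) :
    blkEntry (P.part S) (P.strip a) (P.pos a) (P.strip b) (P.pos b) = S a b := by
  unfold blkEntry
  rw [dif_pos ⟨pos_lt a, pos_lt b⟩]
  unfold blk part
  rw [Matrix.submatrix_apply]
  congr 1
  · exact equiv_strip_pos a
  · exact equiv_strip_pos b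

theorem blkEntry_part' {k : Type u} [Zero k] (S : Matrix ι ι k) {a b : ι} {i j : Fin P.count} {x y : ℕ}
    (h1 : P.strip a = i) (h2 : P.pos a = x) (h3 : P.strip b = j) (h4 : P.pos b = y) :
    blkEntry (P.part S) i x j y = S a b := by
  subst h1 h2 h3 h4
  exact blkEntry_part S a b

theorem blkEntry_eq_zero {k : Type u} [Zero k] (S : Matrix ι ι k) {i j : Fin P.count} {x y : ℕ}
    (h : ¬ (x < P.size i ∧ y < P.size j)) : blkEntry (P.part S) i x j y = 0 := dif_neg h

theorem block_apply {k : Type u} (S : Matrix ι ι k) (i j : Fin P.count) (p : Fin (P.size i))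
    (q : Fin (P.size j)) : P.block S i j p q = S (P.equiv (toLex ⟨i, p⟩)) (P.equiv (toLex ⟨j, q⟩)) := rfl

theorem block_mul {k : Type u} [NonUnitalNonAssocSemiring k] [Fintype ι] (S T : Matrix ι ι k)
    (i j : Fin P.count) :
    P.block (S * T) i j = ∑ c, P.block S i c * P.block T c j := by
  ext p q
  rw [block_apply, Matrix.mul_apply, Matrix.sum_apply]
  simp only [Matrix.mul_apply]
  rw [← (P.equiv.toEquiv).sum_comp, ← (toLex : (Σ i : Fin P.count, Fin (P.size i)) ≃ Idx P.size).sum_comp,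
    Fintype.sum_sigma]
  rfl

/-- The position depends only on the order of rows and on the relation of lying in one strip, which
makes positions comparable for different partitions and labellings. -/
theorem pos_eq_card [Fintype ι] (a : ι) :
    P.pos a = (Finset.univ.filter fun b => P.strip b = P.strip a ∧ b < a).card := by
  rw [← Finset.card_range (P.pos a)]
  symm
  refine Finset.card_bij (fun b _ => P.pos b) ?_ ?_ ?_
  · intro b hb
    simp only [Finset.mem_filter, Finset.mem_univ, true_and] at hb
    rw [Finset.mem_range]
    rcases (lt_iff (P := P)).1 hb.2 with h | h
    · exact absurd hb.1 h.ne
    · exact h.2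
  · intro b hb b' hb' h
    simp only [Finset.mem_filter, Finset.mem_univ, true_and] at hb hb'
    exact ext (hb.1.trans hb'.1.symm) h
  · intro x hx
    rw [Finset.mem_range] at hx
    obtain ⟨b, h1, h2⟩ := exists_of_lt (hx.trans (pos_lt a))
    refine ⟨b, ?_, h2⟩
    simp only [Finset.mem_filter, Finset.mem_univ, true_and]
    exact ⟨h1, lt_iff.2 (Or.inr ⟨h1, h2 ▸ hx⟩)⟩

/-- The strips are the fibres of `σ` over its values, so none is empty; without this the equivalence
of strips derived from a labelling would not be reflexive. -/
theorem exists_of_monotone [Fintype ι] {A : Type*} [LinearOrder A] (σ : ι → A) (hσ : Monotone σ) :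
    ∃ P : StripPartition ι, (∀ a b, P.strip a < P.strip b ↔ σ a < σ b) ∧
      Function.Surjective P.strip := by
  classical
  let L := Finset.univ.image σ
  have hL : ∀ a, σ a ∈ L := fun a => Finset.mem_image_of_mem σ (Finset.mem_univ a)
  let s : ι → Fin L.card := fun a => (L.orderIsoOfFin rfl).symm ⟨σ a, hL a⟩
  have hs : ∀ a b, s a < s b ↔ σ a < σ b := fun a b => by
    simp only [s]
    rw [OrderIso.lt_iff_lt]
    rfl
  have hsurj : Function.Surjective s := by
    intro i
    obtain ⟨a, -, ha⟩ := Finset.mem_image.1 (L.orderIsoOfFin rfl i).2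
    refine ⟨a, ?_⟩
    simp only [s]
    rw [OrderIso.symm_apply_eq]
    exact Subtype.ext ha
  let F : Fin L.card → Finset ι := fun i => Finset.univ.filter fun a => s a = i
  let size : Fin L.card → ℕ := fun i => (F i).card
  let g : Idx size → ι := fun x => (F (ofLex x).1).orderEmbOfFin rfl (ofLex x).2
  have hg : ∀ x, s (g x) = (ofLex x).1 := fun x => by
    have := (F (ofLex x).1).orderEmbOfFin_mem rfl (ofLex x).2
    exact (Finset.mem_filter.1 this).2
  have hmono : StrictMono g := by
    intro x y hxy
    rw [Sigma.Lex.lt_def] at hxy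
    rcases hxy with h | ⟨h, h2⟩
    · by_contra hc
      have h3 := hσ (not_lt.1 hc)
      rw [← not_lt, ← hs, hg, hg] at h3
      exact h3 h
    · obtain ⟨i, p, rfl⟩ : ∃ i p, toLex ⟨i, p⟩ = x := ⟨_, _, rfl⟩
      obtain ⟨i', p', rfl⟩ : ∃ i p, toLex ⟨i, p⟩ = y := ⟨_, _, rfl⟩
      change i = i' at h
      subst h
      exact ((F i).orderEmbOfFin rfl).strictMono h2
  have hgsurj : Function.Surjective g := by
    intro a
    have : a ∈ Set.range ((F (s a)).orderEmbOfFin rfl) := by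
      rw [Finset.range_orderEmbOfFin]
      simp [F]
    obtain ⟨p, hp⟩ := this
    exact ⟨toLex ⟨s a, p⟩, hp⟩
  let P : StripPartition ι := ⟨L.card, size, StrictMono.orderIsoOfSurjective g hmono hgsurj⟩
  have hP : ∀ a, P.strip a = s a := by
    intro a
    rw [← equiv_strip_pos (P := P) a]
    rw [strip_equiv]
    exact (hg _).symm
  refine ⟨P, fun a b => ?_, fun i => ?_⟩
  · rw [hP, hP]
    exact hs a b
  · obtain ⟨a, ha⟩ := hsurj i
    exact ⟨a, (hP a).trans ha⟩

end StripPartition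

/-! ### Reduced algebras as subalgebras. -/

namespace IsReducedAlgebra

open StripPartition

variable {k : Type u} [Field k] {ι : Type} [Fintype ι] [LinearOrder ι] {P : StripPartition ι}
  {r : Setoid (Fin P.count)} {Lam : Set (Matrix ι ι k)}

theorem apply_eq_zero (h : IsReducedAlgebra P r Lam) {S : Matrix ι ι k} (hS : S ∈ Lam) {a b : ι}
    (hab : P.strip b < P.strip a) : S a b = 0 := by
  obtain ⟨-, -, q, c, hc⟩ := h
  have := ((hc S).1 hS).1 _ _ hab
  have := congrFun (congrFun this ⟨P.pos a, pos_lt a⟩) ⟨P.pos b, pos_lt b⟩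
  rwa [block_apply, equiv_strip_pos, equiv_strip_pos] at this

theorem apply_eq (h : IsReducedAlgebra P r Lam) {S : Matrix ι ι k} (hS : S ∈ Lam) {a b a' b' : ι}
    (hab : P.strip a = P.strip b) (hab' : P.strip a' = P.strip b') (hr : r (P.strip a) (P.strip a'))
    (ha : P.pos a = P.pos a') (hb : P.pos b = P.pos b') : S a b = S a' b' := by
  obtain ⟨-, -, q, c, hc⟩ := h
  have := ((hc S).1 hS).2.1 _ _ hr (P.pos a) (P.pos b)
  rwa [blkEntry_part' S rfl rfl hab.symm rfl, blkEntry_part' S rfl ha.symm hab'.symm hb.symm] at this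

theorem size_eq (h : IsReducedAlgebra P r Lam) {i j : Fin P.count} (hr : r i j) :
    P.size i = P.size j := h.2.1 i j hr

/-- The linear equations involve only places with `i < j`, so a block-diagonal matrix satisfies them
trivially and only the equality of equivalent diagonal blocks remains. -/
theorem mem_of_diag (h : IsReducedAlgebra P r Lam) {S : Matrix ι ι k}
    (h0 : ∀ a b, P.strip a ≠ P.strip b → S a b = 0)
    (h1 : ∀ a b a' b', P.strip a = P.strip b → P.strip a' = P.strip b' → r (P.strip a) (P.strip a') →
      P.pos a = P.pos a' → P.pos b = P.pos b' → S a b = S a' b') : S ∈ Lam := by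
  classical
  have hsz := h.2.1
  obtain ⟨-, -, q, c, hc⟩ := h
  rw [hc]
  have h00 : ∀ (i j : Fin P.count) (x y : ℕ), i ≠ j → blkEntry (P.part S) i x j y = 0 := by
    intro i j x y hij
    by_cases hxy : x < P.size i ∧ y < P.size j
    · obtain ⟨a, ha, ha'⟩ := exists_of_lt hxy.1
      obtain ⟨b, hb, hb'⟩ := exists_of_lt hxy.2
      rw [blkEntry_part' S ha ha' hb hb']
      exact h0 a b (by rw [ha, hb]; exact hij)
    · exact blkEntry_eq_zero S hxy
  refine ⟨?_, ?_, ?_⟩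
  · intro i j hij
    ext p q
    rw [block_apply, h0]
    · rfl
    · rw [strip_equiv, strip_equiv]
      exact hij.ne'
  · intro i j hr x y
    have := hsz i j hr
    by_cases hxy : x < P.size i ∧ y < P.size i
    · obtain ⟨a, ha, ha'⟩ := exists_of_lt hxy.1
      obtain ⟨b, hb, hb'⟩ := exists_of_lt hxy.2
      rw [this] at hxy
      obtain ⟨c, hc, hc'⟩ := exists_of_lt hxy.1
      obtain ⟨d, hd, hd'⟩ := exists_of_lt hxy.2
      rw [blkEntry_part' S ha ha' hb hb', blkEntry_part' S hc hc' hd hd']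
      exact h1 a b c d (ha.trans hb.symm) (hc.trans hd.symm) (by rw [ha, hc]; exact hr)
        (ha'.trans hc'.symm) (hb'.trans hd'.symm)
    · rw [blkEntry_eq_zero S hxy, blkEntry_eq_zero S (by rwa [this] at hxy)]
  · intro I J l x y
    refine Finset.sum_eq_zero fun ij hij => ?_
    rw [h00 _ _ _ _ (Finset.mem_filter.1 hij).2.2.1.ne, mul_zero]

/-- A reduced algebra as a subalgebra of the algebra of matrices. -/
def toSubalgebra (h : IsReducedAlgebra P r Lam) : Subalgebra k (Matrix ι ι k) where
  carrier := Lam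
  mul_mem' := fun {a b} ha hb => h.1 a ha b hb
  add_mem' := by
    intro a b ha hb
    have hadd : ∀ i x j y, blkEntry (P.part (a + b)) i x j y =
        blkEntry (P.part a) i x j y + blkEntry (P.part b) i x j y := by
      intro i x j y
      unfold blkEntry
      split_ifs
      · rfl
      · rw [add_zero]
    obtain ⟨-, -, q, c, hc⟩ := h
    rw [hc] at ha hb ⊢
    refine ⟨fun i j hij => ?_, fun i j hr x y => ?_, fun I J l x y => ?_⟩
    · have : P.block (a + b) i j = P.block a i j + P.block b i j := rfl
      rw [this, ha.1 i j hij, hb.1 i j hij, add_zero]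
    · rw [hadd, hadd, ha.2.1 i j hr, hb.2.1 i j hr]
    · simp only [hadd, mul_add, Finset.sum_add_distrib, ha.2.2, hb.2.2, add_zero]
  algebraMap_mem' := by
    intro x
    refine h.mem_of_diag (fun a b hab => ?_) (fun a b a' b' hab hab' _ ha hb => ?_)
    · rw [Matrix.algebraMap_matrix_apply, if_neg]
      rintro rfl
      exact hab rfl
    · rw [Matrix.algebraMap_matrix_apply, Matrix.algebraMap_matrix_apply]
      refine if_congr ⟨?_, ?_⟩ rfl rfl
      · rintro rfl
        exact ext hab' (by rw [← ha, ← hb])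
      · rintro rfl
        exact ext hab (by rw [ha, hb])

end IsReducedAlgebra

/-! ### Labellings of rows, and the algebras that they show to be reduced. -/

/-- A labelling of rows that exhibits `Lam` as a reduced algebra: `σ a` is the strip of the row `a`, and
`τ a = τ b` for the corresponding rows of equivalent strips. -/
structure IsLabelled {k : Type u} [Field k] {ι : Type} [Fintype ι] [LinearOrder ι] {A Y : Type*}
    [LinearOrder A] (Lam : Subalgebra k (Matrix ι ι k)) (σ : ι → A) (τ : ι → Y) : Prop where
  mono : Monotone σ
  ext : ∀ {a b}, σ a = σ b → τ a = τ b → a = b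
  exists_eq : ∀ {a b a'}, σ a = σ b → τ a = τ a' → ∃ b', σ b' = σ a' ∧ τ b' = τ b
  lt : ∀ {a b a' b'}, σ a = σ b → σ a' = σ b' → τ a = τ a' → τ b = τ b' → a < b → a' < b'
  apply_eq_zero : ∀ {S}, S ∈ Lam → ∀ {a b}, σ b < σ a → S a b = 0
  apply_eq : ∀ {S}, S ∈ Lam → ∀ {a b a' b'}, σ a = σ b → σ a' = σ b' → τ a = τ a' → τ b = τ b' →
    S a b = S a' b'
  unit_mem : ∀ {c d} {u : Matrix ι ι k}, σ c = σ d →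
    (∀ a b, σ a = σ b → τ a = τ c → τ b = τ d → u a b = 1) →
    (∀ a b, ¬ (σ a = σ b ∧ τ a = τ c ∧ τ b = τ d) → u a b = 0) → u ∈ Lam

namespace IsLabelled

variable {k : Type u} [Field k] {ι : Type} [Fintype ι] [LinearOrder ι] {A Y : Type*}
    [LinearOrder A] {Lam : Subalgebra k (Matrix ι ι k)} {σ : ι → A} {τ : ι → Y}

open Classical in
/-- The sum of the matrix units `e_ab` for the pairs `(a, b)` of rows of the same strip that correspond to
the pair `(c, d)`. -/
noncomputable def unit (k : Type u) [Field k] {ι : Type} {A Y : Type*} (σ : ι → A) (τ : ι → Y)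
    (c d : ι) : Matrix ι ι k :=
  fun a b => if σ a = σ b ∧ τ a = τ c ∧ τ b = τ d then 1 else 0

theorem unit_mem' (h : IsLabelled Lam σ τ) {c d : ι} (hcd : σ c = σ d) : unit k σ τ c d ∈ Lam :=
  h.unit_mem hcd (fun _ _ h1 h2 h3 => if_pos ⟨h1, h2, h3⟩) fun _ _ h' => if_neg h'

theorem unit_mul_apply (h : IsLabelled Lam σ τ) (S : Matrix ι ι k) {a c d e b : ι} (h1 : τ a = τ c)
    (h2 : σ e = σ a) (h3 : τ e = τ d) : (unit k σ τ c d * S) a b = S e b := by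
  rw [Matrix.mul_apply, Finset.sum_eq_single e]
  · rw [unit, if_pos ⟨h2.symm, h1, h3⟩, one_mul]
  · intro e' _ hne
    rw [unit, if_neg, zero_mul]
    rintro ⟨h4, -, h5⟩
    exact hne (h.ext (h4.symm.trans h2.symm) (h5.trans h3.symm))
  · simp

theorem unit_mul_apply_zero {k : Type u} [Field k] {ι : Type} [Fintype ι] {A Y : Type*} {σ : ι → A}
    {τ : ι → Y} (S : Matrix ι ι k) {a c d b : ι} (h1 : τ a ≠ τ c) :
    (unit k σ τ c d * S) a b = 0 := by
  rw [Matrix.mul_apply, Finset.sum_eq_zero]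
  intro e _
  rw [unit, if_neg (fun h => h1 h.2.1), zero_mul]

theorem mul_unit_apply (h : IsLabelled Lam σ τ) (S : Matrix ι ι k) {a c d e b : ι} (h1 : τ b = τ d)
    (h2 : σ e = σ b) (h3 : τ e = τ c) : (S * unit k σ τ c d) a b = S a e := by
  rw [Matrix.mul_apply, Finset.sum_eq_single e]
  · rw [unit, if_pos ⟨h2, h3, h1⟩, mul_one]
  · intro e' _ hne
    rw [unit, if_neg, mul_zero]
    rintro ⟨h4, h5, -⟩
    exact hne (h.ext (h4.trans h2.symm) (h5.trans h3.symm))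
  · simp

theorem mul_unit_apply_zero {k : Type u} [Field k] {ι : Type} [Fintype ι] {A Y : Type*} {σ : ι → A}
    {τ : ι → Y} (S : Matrix ι ι k) {a c d b : ι} (h1 : τ b ≠ τ d) :
    (S * unit k σ τ c d) a b = 0 := by
  rw [Matrix.mul_apply, Finset.sum_eq_zero]
  intro e _
  rw [unit, if_neg (fun h => h1 h.2.2), mul_zero]

theorem unit_mul_unit (h : IsLabelled Lam σ τ) {c d e : ι} (hcd : σ c = σ d) :
    unit k σ τ c d * unit k σ τ d e = unit k σ τ c e := by
  classical
  ext a b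
  by_cases h1 : τ a = τ c
  · obtain ⟨x, hx1, hx2⟩ := h.exists_eq hcd h1.symm
    rw [h.unit_mul_apply _ h1 hx1 hx2]
    by_cases h2 : σ a = σ b ∧ τ b = τ e
    · rw [unit, if_pos ⟨hx1.trans h2.1, hx2, h2.2⟩, unit, if_pos ⟨h2.1, h1, h2.2⟩]
    · rw [unit, if_neg fun h' => h2 ⟨hx1.symm.trans h'.1, h'.2.2⟩, unit,
        if_neg fun h' => h2 ⟨h'.1, h'.2.2⟩]
  · rw [unit_mul_apply_zero _ h1, unit, if_neg (fun h' => h1 h'.2.1)]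

theorem unit_self_apply (h : IsLabelled Lam σ τ) (c a b : ι) [Decidable (a = b ∧ τ a = τ c)] :
    unit k σ τ c c a b = if a = b ∧ τ a = τ c then 1 else 0 := by
  by_cases h1 : a = b ∧ τ a = τ c
  · rw [if_pos h1, unit, if_pos ⟨by rw [h1.1], h1.2, by rw [← h1.1, h1.2]⟩]
  · rw [if_neg h1, unit, if_neg fun h' => h1 ⟨h.ext h'.1 (h'.2.1.trans h'.2.2.symm), h'.2.1⟩]

/-- Peirce decomposition: the elements `unit c c` for the different labels add up to `1`. -/
theorem mem_of_unit_mul_mul_unit (h : IsLabelled Lam σ τ) {S : Matrix ι ι k}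
    (hS : ∀ c d, unit k σ τ c c * S * unit k σ τ d d ∈ Lam) : S ∈ Lam := by
  classical
  let p : Y → Matrix ι ι k := fun y a b => if a = b ∧ τ a = y then 1 else 0
  have hp : ∀ c, p (τ c) = unit k σ τ c c := fun c => by
    ext a b
    rw [h.unit_self_apply]
  have h1 : (1 : Matrix ι ι k) = ∑ y ∈ Finset.univ.image τ, p y := by
    ext a b
    rw [Matrix.sum_apply, Matrix.one_apply, Finset.sum_eq_single (τ a)]
    · simp [p]
    · intro y _ hy
      simp only [p]
      rw [if_neg (fun h' => hy h'.2.symm)]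
    · intro h'
      exact (h' (Finset.mem_image_of_mem τ (Finset.mem_univ a))).elim
  have h2 : S = 1 * S * 1 := by simp
  rw [h2, h1, Finset.sum_mul, Finset.sum_mul]
  refine Subalgebra.sum_mem _ fun y hy => ?_
  rw [Finset.mul_sum]
  refine Subalgebra.sum_mem _ fun z hz => ?_
  obtain ⟨c, -, rfl⟩ := Finset.mem_image.1 hy
  obtain ⟨d, -, rfl⟩ := Finset.mem_image.1 hz
  rw [hp, hp]
  exact hS c d

theorem congr_strip {B : Type*} [LinearOrder B] (h : IsLabelled Lam σ τ) {σ' : ι → B}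
    (hσ : ∀ a b, σ' a < σ' b ↔ σ a < σ b) : IsLabelled Lam σ' τ := by
  have heq : ∀ {a b}, σ' a = σ' b ↔ σ a = σ b := by
    intro a b
    rw [le_antisymm_iff, le_antisymm_iff, ← not_lt, ← not_lt, ← not_lt, ← not_lt, hσ, hσ]
  refine ⟨fun a b hab => ?_, fun h1 h2 => h.ext (heq.1 h1) h2, fun h1 h2 => ?_,
    fun h1 h2 => h.lt (heq.1 h1) (heq.1 h2), fun hS _ _ h1 => h.apply_eq_zero hS ((hσ _ _).1 h1),
    fun hS _ _ _ _ h1 h2 => h.apply_eq hS (heq.1 h1) (heq.1 h2), fun h1 h2 h3 =>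
    h.unit_mem (heq.1 h1) (fun a b h4 => h2 a b (heq.2 h4)) fun a b h4 => h3 a b ?_⟩
  · rw [← not_lt, hσ, not_lt]
    exact h.mono hab
  · obtain ⟨b', h3, h4⟩ := h.exists_eq (heq.1 h1) h2
    exact ⟨b', heq.2 h3, h4⟩
  · rwa [heq]

end IsLabelled

/-- The coordinates of the quotient by `W` serve as equations. -/
theorem exists_finite_equations {k n : Type*} [Field k] [Fintype n] (W : Submodule k (n → k)) :
    ∃ (q : ℕ) (c : Fin q → n → k), ∀ x : n → k, x ∈ W ↔ ∀ l, ∑ i, c l i * x i = 0 := by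
  classical
  obtain ⟨q, f, hf⟩ : ∃ (q : ℕ) (f : (n → k) →ₗ[k] (Fin q → k)), LinearMap.ker f = W := by
    refine ⟨_, (Module.finBasis k ((n → k) ⧸ W)).equivFun.toLinearMap ∘ₗ W.mkQ, ?_⟩
    rw [LinearMap.ker_comp, LinearEquiv.ker]
    exact W.ker_mkQ
  refine ⟨q, fun l i => f (Pi.single i 1) l, fun x => ?_⟩
  rw [← hf, LinearMap.mem_ker, funext_iff]
  refine forall_congr' fun l => ?_
  have : f x l = ∑ i, f (Pi.single i 1) l * x i := by
    conv_lhs => rw [← Finset.univ_sum_single x, map_sum, Finset.sum_apply]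
    refine Finset.sum_congr rfl fun i _ => ?_
    have : (Pi.single i (x i) : n → k) = x i • Pi.single i 1 := by
      rw [← Pi.single_smul, smul_eq_mul, mul_one]
    rw [this, map_smul, Pi.smul_apply, smul_eq_mul, mul_comm]
  rw [this]
  rfl

namespace IsLabelled

open StripPartition

variable {k : Type u} [Field k] {ι : Type} [Fintype ι] [LinearOrder ι] {Y : Type*}
  {Lam : Subalgebra k (Matrix ι ι k)} {P : StripPartition ι} {τ : ι → Y}

/-- Rows with equal labels lie in strips with a label-preserving and order-preserving
correspondence, so they are preceded by equally many rows of their strips. -/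
theorem pos_eq (h : IsLabelled Lam P.strip τ) {a a' : ι} (haa : τ a = τ a') :
    P.pos a = P.pos a' := by
  classical
  have key : ∀ {a a'}, τ a = τ a' → P.pos a ≤ P.pos a' := by
    intro a a' haa
    rw [pos_eq_card, pos_eq_card]
    have hinj : Set.InjOn τ ↑(Finset.univ.filter fun b => P.strip b = P.strip a ∧ b < a) := by
      intro b hb b' hb' hbb
      simp only [Finset.coe_filter, Finset.mem_univ, true_and, Set.mem_ofPred_eq] at hb hb'
      exact h.ext (hb.1.trans hb'.1.symm) hbb
    rw [← Finset.card_image_of_injOn hinj]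
    refine (Finset.card_le_card ?_).trans (Finset.card_image_le (s := Finset.univ.filter fun b =>
      P.strip b = P.strip a' ∧ b < a') (f := τ))
    intro y hy
    simp only [Finset.mem_image, Finset.mem_filter, Finset.mem_univ, true_and] at hy ⊢
    obtain ⟨b, ⟨h1, h2⟩, rfl⟩ := hy
    obtain ⟨b', h3, h4⟩ := h.exists_eq h1.symm haa
    exact ⟨b', ⟨h3, h.lt h1 h3 h4.symm haa h2⟩, h4⟩
  exact le_antisymm (key haa) (key haa.symm)

/-- The equivalence of strips given by a labelling. -/
def setoid (h : IsLabelled Lam P.strip τ) (hs : Function.Surjective P.strip) :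
    Setoid (Fin P.count) where
  r i j := ∃ a a', P.strip a = i ∧ P.strip a' = j ∧ τ a = τ a'
  iseqv := by
    refine ⟨fun i => ?_, ?_, ?_⟩
    · obtain ⟨a, ha⟩ := hs i
      exact ⟨a, a, ha, ha, rfl⟩
    · rintro i j ⟨a, a', h1, h2, h3⟩
      exact ⟨a', a, h2, h1, h3.symm⟩
    · rintro i j l ⟨a, a', h1, h2, h3⟩ ⟨b, b', h4, h5, h6⟩
      obtain ⟨c, h7, h8⟩ := h.exists_eq (h2.trans h4.symm) h3.symm
      exact ⟨c, b', h7.trans h1, h5, h8.trans h6⟩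

/-- A label carries the same information as the class of the strip together with the position in it,
which is what the definition of a reduced algebra speaks of. -/
theorem eq_iff (h : IsLabelled Lam P.strip τ) (hs : Function.Surjective P.strip) {a a' : ι} :
    τ a = τ a' ↔ h.setoid hs (P.strip a) (P.strip a') ∧ P.pos a = P.pos a' := by
  refine ⟨fun haa => ⟨⟨a, a', rfl, rfl, haa⟩, h.pos_eq haa⟩, ?_⟩
  rintro ⟨⟨b, b', h1, h2, h3⟩, h4⟩
  obtain ⟨c, h5, h6⟩ := h.exists_eq h1 h3
  have h7 := h.pos_eq h6
  have : c = a' := StripPartition.ext (h5.trans h2) (h7.trans h4)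
  rw [← this, h6]

theorem setoid_size_eq (h : IsLabelled Lam P.strip τ) (hs : Function.Surjective P.strip)
    {i j : Fin P.count} (hij : h.setoid hs i j) : P.size i = P.size j := by
  have key : ∀ {i j}, h.setoid hs i j → P.size i ≤ P.size j := by
    rintro i j ⟨a, a', h1, h2, h3⟩
    by_contra hlt
    obtain ⟨b, h4, h5⟩ := exists_of_lt (not_le.1 hlt)
    obtain ⟨b', h6, h7⟩ := h.exists_eq (h1.trans h4.symm) h3
    have := pos_lt (P := P) b'
    rw [h.pos_eq h7, h5, h6, h2] at this
    exact lt_irrefl _ this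
  exact le_antisymm (key hij) (key ((h.setoid hs).symm hij))

end IsLabelled

namespace IsLabelled

open StripPartition

variable {k : Type u} [Field k] {ι : Type} [Fintype ι] [LinearOrder ι] {Y : Type*}
  {Lam : Subalgebra k (Matrix ι ι k)} {P : StripPartition ι} {τ : ι → Y}

/-- The matrix with given entries in the upper left corners of blocks, and with zeros elsewhere. -/
def corner (P : StripPartition ι) (C : Fin P.count × Fin P.count → k) : Matrix ι ι k :=
  fun a b => if P.pos a = 0 ∧ P.pos b = 0 then C (P.strip a, P.strip b) else 0

/-- The linear space of families of coefficients for a pair of classes of strips. -/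
def cornerSpace (h : IsLabelled Lam P.strip τ) (hs : Function.Surjective P.strip)
    (I J : Quotient (h.setoid hs)) : Submodule k (Fin P.count × Fin P.count → k) where
  carrier := {C | (∀ ij, ¬ (Quotient.mk (h.setoid hs) ij.1 = I ∧ ij.1 < ij.2 ∧
    Quotient.mk (h.setoid hs) ij.2 = J) → C ij = 0) ∧ corner P C ∈ Lam}
  add_mem' := by
    rintro C D ⟨hC, hC'⟩ ⟨hD, hD'⟩
    refine ⟨fun ij hij => ?_, ?_⟩
    · rw [Pi.add_apply, hC ij hij, hD ij hij, add_zero]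
    · have : corner P (C + D) = corner P C + corner P D := by
        ext a b
        rw [Matrix.add_apply]
        unfold corner
        split_ifs
        · rfl
        · rw [add_zero]
      rw [this]
      exact Lam.add_mem hC' hD'
  zero_mem' := by
    refine ⟨fun ij hij => rfl, ?_⟩
    have : corner P (0 : Fin P.count × Fin P.count → k) = 0 := by
      ext a b
      unfold corner
      split_ifs <;> rfl
    rw [this]
    exact Lam.zero_mem
  smul_mem' := by
    rintro x C ⟨hC, hC'⟩
    refine ⟨fun ij hij => ?_, ?_⟩
    · rw [Pi.smul_apply, hC ij hij, smul_zero]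
    · have : corner P (x • C) = x • corner P C := by
        ext a b
        rw [Matrix.smul_apply]
        unfold corner
        split_ifs
        · rfl
        · rw [smul_zero]
      rw [this]
      exact Lam.smul_mem hC' x

open Classical in
/-- The `(x, y)` entries of the blocks of `S` above the diagonal from a pair of classes. -/
noncomputable def upperEntries (r : Setoid (Fin P.count)) (S : Matrix ι ι k) (I J : Quotient r)
    (x y : ℕ) : Fin P.count × Fin P.count → k :=
  fun ij => if Quotient.mk r ij.1 = I ∧ ij.1 < ij.2 ∧ Quotient.mk r ij.2 = J
    then blkEntry (P.part S) ij.1 x ij.2 y else 0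

/-- Multiplication by units moves the entries at the positions of `c` and `d` into the upper left
corners of the blocks. The entries below the diagonal blocks are zero, and those in the diagonal
blocks coincide, so they contribute a multiple of a unit. -/
theorem unit_mul_mul_unit_eq (h : IsLabelled Lam P.strip τ) (hs : Function.Surjective P.strip)
    {S : Matrix ι ι k} (h0 : ∀ a b, P.strip b < P.strip a → S a b = 0)
    (h1 : ∀ a b a' b', P.strip a = P.strip b → P.strip a' = P.strip b' → τ a = τ a' → τ b = τ b' →
      S a b = S a' b') {c d c0 d0 : ι} (hc : P.strip c0 = P.strip c) (hc0 : P.pos c0 = 0)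
    (hd : P.strip d0 = P.strip d) (hd0 : P.pos d0 = 0) :
    ∃ x : k, unit k P.strip τ c0 c * S * unit k P.strip τ d d0 =
      corner P (upperEntries (h.setoid hs) S (Quotient.mk _ (P.strip c)) (Quotient.mk _ (P.strip d))
        (P.pos c) (P.pos d)) + x • unit k P.strip τ c0 c0 := by
  classical
  have hval : ∀ {a b e f}, τ a = τ c0 → P.strip e = P.strip a → τ e = τ c → τ b = τ d0 →
      P.strip f = P.strip b → τ f = τ d →
      (unit k P.strip τ c0 c * S * unit k P.strip τ d d0) a b = S e f := by
    intro a b e f e1 e2 e3 e4 e5 e6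
    rw [h.mul_unit_apply _ e4 e5 e6, h.unit_mul_apply _ e1 e2 e3]
  have hcorner : ∀ a b, corner P (upperEntries (h.setoid hs) S (Quotient.mk _ (P.strip c))
      (Quotient.mk _ (P.strip d)) (P.pos c) (P.pos d)) a b =
      if τ a = τ c0 ∧ P.strip a < P.strip b ∧ τ b = τ d0 then
        blkEntry (P.part S) (P.strip a) (P.pos c) (P.strip b) (P.pos d) else 0 := by
    intro a b
    unfold corner upperEntries
    rw [← ite_and]
    refine if_congr ?_ rfl rfl
    rw [h.eq_iff hs, h.eq_iff hs, hc0, hd0, hc, hd, Quotient.eq, Quotient.eq]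
    tauto
  -- The common value of the entries at these positions in the diagonal blocks of the class; it is
  -- `0` when `c0` and `d0` belong to different classes, for then there are no such entries.
  obtain ⟨x, hx⟩ : ∃ x, ∀ a e f, τ a = τ c0 → τ a = τ d0 → P.strip e = P.strip a → τ e = τ c →
      P.strip f = P.strip a → τ f = τ d → S e f = x := by
    by_cases hex : ∃ a e f, τ a = τ c0 ∧ τ a = τ d0 ∧ P.strip e = P.strip a ∧ τ e = τ c ∧
      P.strip f = P.strip a ∧ τ f = τ d
    · obtain ⟨a, e, f, e1, e2, e3, e4, e5, e6⟩ := hex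
      refine ⟨S e f, fun a' e' f' e1' e2' e3' e4' e5' e6' => ?_⟩
      exact h1 _ _ _ _ (e3'.trans e5'.symm) (e3.trans e5.symm) (e4'.trans e4.symm)
        (e6'.trans e6.symm)
    · exact ⟨0, fun a e f e1 e2 e3 e4 e5 e6 => (hex ⟨a, e, f, e1, e2, e3, e4, e5, e6⟩).elim⟩
  refine ⟨if τ c0 = τ d0 then x else 0, ?_⟩
  ext a b
  rw [Matrix.add_apply, Matrix.smul_apply, smul_eq_mul, hcorner, h.unit_self_apply]
  by_cases ha : τ a = τ c0
  · by_cases hb : τ b = τ d0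
    · obtain ⟨e, e1, e2⟩ := h.exists_eq hc ha.symm
      obtain ⟨f, f1, f2⟩ := h.exists_eq hd hb.symm
      rw [hval ha e1 e2 hb f1 f2]
      rcases lt_trichotomy (P.strip a) (P.strip b) with hlt | heq | hlt
      · have : a ≠ b := by
          rintro rfl
          exact lt_irrefl _ hlt
        rw [if_pos ⟨ha, hlt, hb⟩, if_neg (c := a = b ∧ τ a = τ c0) (fun h' => this h'.1), mul_zero, add_zero]
        exact (blkEntry_part' S e1 (h.pos_eq e2) f1 (h.pos_eq f2)).symm
      · have hab : a = b := StripPartition.ext heq (by rw [h.pos_eq ha, h.pos_eq hb, hc0, hd0])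
        subst hab
        rw [if_neg (fun h' => lt_irrefl _ h'.2.1), if_pos (ha.symm.trans hb), if_pos ⟨rfl, ha⟩,
          mul_one, zero_add]
        exact hx a e f ha hb e1 e2 f1 f2
      · rw [if_neg (fun h' => lt_asymm h'.2.1 hlt), if_neg (c := a = b ∧ τ a = τ c0) (fun h' => ?_), mul_zero,
          add_zero]
        · exact h0 _ _ (by rwa [e1, f1])
        · rw [h'.1] at hlt
          exact lt_irrefl _ hlt
    · rw [mul_unit_apply_zero _ hb, if_neg (fun h' => hb h'.2.2)]
      by_cases hab : a = b ∧ τ a = τ c0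
      · rw [if_neg (c := τ c0 = τ d0), zero_mul, add_zero]
        intro h'
        rw [← hab.1, ha] at hb
        exact hb h'
      · rw [if_neg hab, mul_zero, add_zero]
  · rw [if_neg (fun h' => ha h'.1), if_neg (c := a = b ∧ τ a = τ c0) (fun h' => ha h'.2),
      mul_zero, add_zero, Matrix.mul_assoc,
      unit_mul_apply_zero _ ha]

/-- After a Peirce decomposition, membership in `Lam` is tested separately for each pair of classes
and each pair of positions. Moving the positions to the corners shows that the test is always
membership in the same finite-dimensional `cornerSpace`, whose equations are the required relations
between blocks. -/
theorem isReducedAlgebra (h : IsLabelled Lam P.strip τ) (hs : Function.Surjective P.strip) :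
    IsReducedAlgebra P (h.setoid hs) (Lam : Set (Matrix ι ι k)) := by
  classical
  refine ⟨fun A hA B hB => Lam.mul_mem hA hB, fun i j => h.setoid_size_eq hs, ?_⟩
  choose q c hc using fun I J => exists_finite_equations (h.cornerSpace hs I J)
  refine ⟨q, fun I J l i j => c I J l (i, j), fun S => ?_⟩
  have hsum : ∀ I J l x y, (∑ ij : Fin P.count × Fin P.count with
      Quotient.mk (h.setoid hs) ij.1 = I ∧ ij.1 < ij.2 ∧ Quotient.mk (h.setoid hs) ij.2 = J,
        c I J l (ij.1, ij.2) * blkEntry (P.part S) ij.1 x ij.2 y) =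
      ∑ ij, c I J l ij * upperEntries (h.setoid hs) S I J x y ij := by
    intro I J l x y
    rw [Finset.sum_filter]
    refine Finset.sum_congr rfl fun ij _ => ?_
    unfold upperEntries
    split_ifs
    · rfl
    · rw [mul_zero]
  have hanchor : ∀ a, ∃ a0, P.strip a0 = P.strip a ∧ P.pos a0 = 0 := fun a =>
    exists_of_lt ((Nat.zero_le _).trans_lt (pos_lt a))
  have hent : (∀ i j, j < i → P.block S i j = 0) ↔ ∀ a b, P.strip b < P.strip a → S a b = 0 := by
    refine ⟨fun h' a b hab => ?_, fun h' i j hij => ?_⟩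
    · have := congrFun (congrFun (h' _ _ hab) ⟨P.pos a, pos_lt a⟩) ⟨P.pos b, pos_lt b⟩
      rwa [block_apply, equiv_strip_pos, equiv_strip_pos] at this
    · ext p p'
      rw [block_apply, h' _ _ (by rwa [strip_equiv, strip_equiv])]
      rfl
  have hdiag : (∀ i j, h.setoid hs i j → ∀ x y : ℕ,
      blkEntry (P.part S) i x i y = blkEntry (P.part S) j x j y) ↔
      ∀ a b a' b', P.strip a = P.strip b → P.strip a' = P.strip b' → τ a = τ a' → τ b = τ b' →
      S a b = S a' b' := by
    refine ⟨fun h' a b a' b' hab hab' ha hb => ?_, fun h' i j hij x y => ?_⟩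
    · have := h' _ _ ((h.eq_iff hs).1 ha).1 (P.pos a) (P.pos b)
      rwa [blkEntry_part' S rfl rfl hab.symm rfl,
        blkEntry_part' S rfl (h.pos_eq ha).symm hab'.symm (h.pos_eq hb).symm] at this
    · have hsz := h.setoid_size_eq hs hij
      by_cases hxy : x < P.size i ∧ y < P.size i
      · obtain ⟨a, ha, ha'⟩ := exists_of_lt hxy.1
        obtain ⟨b, hb, hb'⟩ := exists_of_lt hxy.2
        rw [hsz] at hxy
        obtain ⟨e, he, he'⟩ := exists_of_lt hxy.1
        obtain ⟨f, hf, hf'⟩ := exists_of_lt hxy.2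
        rw [blkEntry_part' S ha ha' hb hb', blkEntry_part' S he he' hf hf']
        refine h' _ _ _ _ (ha.trans hb.symm) (he.trans hf.symm) ((h.eq_iff hs).2 ⟨?_, ?_⟩)
          ((h.eq_iff hs).2 ⟨?_, ?_⟩)
        · rwa [ha, he]
        · rw [ha', he']
        · rwa [hb, hf]
        · rw [hb', hf']
      · rw [blkEntry_eq_zero S hxy, blkEntry_eq_zero S (by rwa [hsz] at hxy)]
  have hrel : (∀ I J (l : Fin (q I J)) (x y : ℕ), (∑ ij : Fin P.count × Fin P.count with
      Quotient.mk (h.setoid hs) ij.1 = I ∧ ij.1 < ij.2 ∧ Quotient.mk (h.setoid hs) ij.2 = J,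
        c I J l (ij.1, ij.2) * blkEntry (P.part S) ij.1 x ij.2 y) = 0) ↔
      ∀ I J x y, corner P (upperEntries (h.setoid hs) S I J x y) ∈ Lam := by
    simp only [hsum]
    refine forall_congr' fun I => forall_congr' fun J => ?_
    rw [forall_comm]
    refine forall_congr' fun x => ?_
    rw [forall_comm]
    refine forall_congr' fun y => ?_
    rw [← hc]
    exact ⟨fun h' => h'.2, fun h' => ⟨fun ij hij => if_neg hij, h'⟩⟩
  have hmain : (S ∈ (Lam : Set (Matrix ι ι k))) ↔ (∀ a b, P.strip b < P.strip a → S a b = 0) ∧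
      (∀ a b a' b', P.strip a = P.strip b → P.strip a' = P.strip b' → τ a = τ a' → τ b = τ b' →
      S a b = S a' b') ∧ ∀ I J x y, corner P (upperEntries (h.setoid hs) S I J x y) ∈ Lam := by
    constructor
    · intro hS
      have h0 : ∀ a b, P.strip b < P.strip a → S a b = 0 := fun a b => h.apply_eq_zero hS
      have h1 : ∀ a b a' b', P.strip a = P.strip b → P.strip a' = P.strip b' → τ a = τ a' →
        τ b = τ b' → S a b = S a' b' := fun a b a' b' => h.apply_eq hS
      refine ⟨h0, h1, fun I J x y => ?_⟩
      obtain ⟨i, rfl⟩ := Quotient.exists_rep I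
      obtain ⟨j, rfl⟩ := Quotient.exists_rep J
      by_cases hxy : x < P.size i ∧ y < P.size j
      · obtain ⟨a, rfl, rfl⟩ := exists_of_lt hxy.1
        obtain ⟨b, rfl, rfl⟩ := exists_of_lt hxy.2
        obtain ⟨a0, ha, ha0⟩ := hanchor a
        obtain ⟨b0, hb, hb0⟩ := hanchor b
        obtain ⟨z, hz⟩ := h.unit_mul_mul_unit_eq hs h0 h1 ha ha0 hb hb0
        rw [← sub_eq_iff_eq_add] at hz
        rw [← hz]
        exact Lam.sub_mem (Lam.mul_mem (Lam.mul_mem (h.unit_mem' ha) hS) (h.unit_mem' hb.symm))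
          (Lam.smul_mem (h.unit_mem' rfl) z)
      -- Positions out of the range of the two classes give only default zeros.
      · have : corner P (upperEntries (h.setoid hs) S (Quotient.mk _ i) (Quotient.mk _ j) x y) = 0 := by
          ext a b
          unfold corner upperEntries
          rw [← ite_and]
          split_ifs with h'
          · rw [Quotient.eq, Quotient.eq] at h'
            refine blkEntry_eq_zero S ?_
            rwa [h.setoid_size_eq hs h'.2.1, h.setoid_size_eq hs h'.2.2.2]
          · rfl
        rw [this]
        exact Lam.zero_mem
    · rintro ⟨h0, h1, h2⟩
      refine h.mem_of_unit_mul_mul_unit fun a b => ?_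
      obtain ⟨a0, ha, ha0⟩ := hanchor a
      obtain ⟨b0, hb, hb0⟩ := hanchor b
      obtain ⟨z, hz⟩ := h.unit_mul_mul_unit_eq hs h0 h1 ha ha0 hb hb0
      rw [← h.unit_mul_unit ha.symm, ← h.unit_mul_unit hb.symm]
      have : unit k P.strip τ a a0 * unit k P.strip τ a0 a * S *
          (unit k P.strip τ b b0 * unit k P.strip τ b0 b) = unit k P.strip τ a a0 *
          (unit k P.strip τ a0 a * S * unit k P.strip τ b b0) * unit k P.strip τ b0 b := by
        simp only [Matrix.mul_assoc]
      rw [this, hz]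
      refine Lam.mul_mem (Lam.mul_mem (h.unit_mem' ha.symm) (Lam.add_mem (h2 _ _ _ _)
        (Lam.smul_mem (h.unit_mem' rfl) z))) (h.unit_mem' hb)
  rw [hmain, hent, hdiag, ← hrel]

theorem exists_isReducedAlgebra {A : Type*} [LinearOrder A] {σ : ι → A} (h : IsLabelled Lam σ τ) :
    ∃ (P : StripPartition ι) (r : Setoid (Fin P.count)),
      IsReducedAlgebra P r (Lam : Set (Matrix ι ι k)) := by
  obtain ⟨P, hP, hs⟩ := StripPartition.exists_of_monotone σ h.mono
  exact ⟨P, _, (h.congr_strip hP).isReducedAlgebra hs⟩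

end IsLabelled

-- The units of this labelling are block-diagonal, with equal blocks in equivalent strips, and so
-- lie in the algebra by `mem_of_diag`. With `exists_isReducedAlgebra` this shows that a reduced
-- algebra is the same as a subalgebra with a labelling.
open StripPartition in
theorem IsReducedAlgebra.isLabelled {k : Type u} [Field k] {ι : Type} [Fintype ι] [LinearOrder ι]
    {P : StripPartition ι} {r : Setoid (Fin P.count)} {Lam : Set (Matrix ι ι k)}
    (h : IsReducedAlgebra P r Lam) :
    IsLabelled h.toSubalgebra P.strip fun a => (Quotient.mk r (P.strip a), P.pos a) := by
  have hτ : ∀ {a b}, (Quotient.mk r (P.strip a), P.pos a) = (Quotient.mk r (P.strip b), P.pos b) ↔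
      r (P.strip a) (P.strip b) ∧ P.pos a = P.pos b := by
    intro a b
    rw [Prod.ext_iff, Quotient.eq]
  refine ⟨strip_mono, fun h1 h2 => StripPartition.ext h1 (hτ.1 h2).2, fun {a b a'} h1 h2 => ?_,
    fun {a b a' b'} h1 h2 h3 h4 h5 => ?_, fun hS _ _ => h.apply_eq_zero hS,
    fun hS _ _ _ _ h1 h2 h3 h4 => h.apply_eq hS h1 h2 (hτ.1 h3).1 (hτ.1 h3).2 (hτ.1 h4).2,
    fun {c d u} hcd h1 h2 => ?_⟩
  · have hr := (hτ.1 h2).1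
    obtain ⟨b', h3, h4⟩ := exists_of_lt (P := P) (i := P.strip a') (x := P.pos b) (by
      rw [← h.size_eq hr, h1]
      exact pos_lt b)
    refine ⟨b', h3, hτ.2 ⟨?_, h4⟩⟩
    rw [h3, ← h1]
    exact r.symm hr
  · rw [lt_iff (P := P)] at h5 ⊢
    rw [hτ] at h3 h4
    refine Or.inr ⟨h2, ?_⟩
    rcases h5 with h5 | h5
    · exact absurd h1 h5.ne
    · rw [← h3.2, ← h4.2]
      exact h5.2
  · refine h.mem_of_diag (fun a b hab => h2 a b fun h' => hab h'.1) fun a b a' b' hab hab' hr ha hb => ?_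
    have ea : (Quotient.mk r (P.strip a), P.pos a) = (Quotient.mk r (P.strip a'), P.pos a') :=
      hτ.2 ⟨hr, ha⟩
    have eb : (Quotient.mk r (P.strip b), P.pos b) = (Quotient.mk r (P.strip b'), P.pos b') :=
      hτ.2 ⟨by rwa [← hab, ← hab'], hb⟩
    by_cases hc : (Quotient.mk r (P.strip a), P.pos a) = (Quotient.mk r (P.strip c), P.pos c) ∧
      (Quotient.mk r (P.strip b), P.pos b) = (Quotient.mk r (P.strip d), P.pos d)
    · rw [h1 a b hab hc.1 hc.2, h1 a' b' hab' (ea.symm.trans hc.1) (eb.symm.trans hc.2)]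
    · rw [h2 a b fun h' => hc h'.2, h2 a' b' fun h' => hc ⟨ea.trans h'.2.1, eb.trans h'.2.2⟩]

/-! ### Similarity under a subalgebra. -/

section LamSimilar

variable {k : Type u} [Field k] {ι : Type} [Fintype ι] [LinearOrder ι]

/-- Left multiplication by `S` is an injective operator on the finite-dimensional space `Lam`, so it
attains `1`. -/
theorem Subalgebra.matrix_inv_mem (Lam : Subalgebra k (Matrix ι ι k)) {S : Matrix ι ι k} (hS : S ∈ Lam)
    (hu : IsUnit S) : S⁻¹ ∈ Lam := by
  have hdet := (Matrix.isUnit_iff_isUnit_det S).1 hu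
  have hinj : Function.Injective (LinearMap.mulLeft k (⟨S, hS⟩ : Lam)) := by
    intro x y hxy
    have h1 : S * (x : Matrix ι ι k) = S * (y : Matrix ι ι k) := congrArg Subtype.val hxy
    exact Subtype.ext (hu.mul_left_cancel h1)
  obtain ⟨T, hT⟩ := LinearMap.surjective_of_injective hinj 1
  have h1 : S * (T : Matrix ι ι k) = 1 := congrArg Subtype.val hT
  rw [Matrix.inv_eq_right_inv h1]
  exact T.2

theorem lamSimilar_iff {Lam : Set (Matrix ι ι k)} {M N : Matrix ι ι k} :
    LamSimilar Lam M N ↔ ∃ S ∈ Lam, IsUnit S ∧ M * S = S * N := by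
  refine exists_congr fun S => and_congr_right fun _ => and_congr_right fun hu => ?_
  have hdet := (Matrix.isUnit_iff_isUnit_det S).1 hu
  constructor
  · rintro rfl
    rw [← Matrix.mul_assoc, ← Matrix.mul_assoc, Matrix.mul_nonsing_inv _ hdet, Matrix.one_mul]
  · intro h
    rw [Matrix.mul_assoc, h, ← Matrix.mul_assoc, Matrix.nonsing_inv_mul _ hdet, Matrix.one_mul]

theorem LamSimilar.refl (Lam : Subalgebra k (Matrix ι ι k)) (M : Matrix ι ι k) :
    LamSimilar (Lam : Set (Matrix ι ι k)) M M :=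
  lamSimilar_iff.2 ⟨1, Lam.one_mem, isUnit_one, by simp⟩

theorem LamSimilar.symm {Lam : Subalgebra k (Matrix ι ι k)} {M N : Matrix ι ι k}
    (h : LamSimilar (Lam : Set (Matrix ι ι k)) M N) : LamSimilar (Lam : Set (Matrix ι ι k)) N M := by
  obtain ⟨S, hS, hu, h⟩ := lamSimilar_iff.1 h
  have hdet := (Matrix.isUnit_iff_isUnit_det S).1 hu
  refine lamSimilar_iff.2 ⟨S⁻¹, Lam.matrix_inv_mem hS hu, Matrix.isUnit_nonsing_inv_iff.2 hu, ?_⟩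
  have : S⁻¹ * (M * S) * S⁻¹ = S⁻¹ * (S * N) * S⁻¹ := by rw [h]
  rw [← Matrix.mul_assoc S⁻¹ S, Matrix.nonsing_inv_mul _ hdet, Matrix.one_mul, Matrix.mul_assoc,
    Matrix.mul_assoc, Matrix.mul_nonsing_inv _ hdet, Matrix.mul_one] at this
  exact this.symm

theorem LamSimilar.trans {Lam : Subalgebra k (Matrix ι ι k)} {M N L : Matrix ι ι k}
    (h : LamSimilar (Lam : Set (Matrix ι ι k)) M N) (h' : LamSimilar (Lam : Set (Matrix ι ι k)) N L) :
    LamSimilar (Lam : Set (Matrix ι ι k)) M L := by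
  obtain ⟨S, hS, hu, h⟩ := lamSimilar_iff.1 h
  obtain ⟨T, hT, hu', h'⟩ := lamSimilar_iff.1 h'
  refine lamSimilar_iff.2 ⟨S * T, Lam.mul_mem hS hT, hu.mul hu', ?_⟩
  rw [← Matrix.mul_assoc, h, Matrix.mul_assoc, h', Matrix.mul_assoc]

/-- Any `c` that is not an eigenvalue of `-B` will do. In this way linear statements about
nonsingular elements extend to the whole algebra. -/
theorem exists_isUnit_add_smul_one [Infinite k] (B : Matrix ι ι k) : ∃ c : k, IsUnit (B + c • 1) := by
  classical
  obtain ⟨c, hc⟩ := (((-B).charpoly.roots.toFinset.finite_toSet).infinite_compl).nonempty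
  refine ⟨c, (Matrix.isUnit_iff_isUnit_det _).2 (isUnit_iff_ne_zero.2 fun h => hc ?_)⟩
  rw [Finset.mem_coe, Multiset.mem_toFinset, Polynomial.mem_roots (Matrix.charpoly_monic _).ne_zero,
    Polynomial.IsRoot, Matrix.eval_charpoly, sub_neg_eq_add, add_comm, Matrix.scalar_apply,
    ← Matrix.smul_one_eq_diagonal]
  exact h

theorem isStableBlock_iff_of_similar {P : StripPartition ι} {Lam : Subalgebra k (Matrix ι ι k)}
    {M N : Matrix ι ι k} (hMN : LamSimilar (Lam : Set (Matrix ι ι k)) M N) {i j : Fin P.count} :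
    IsStableBlock P (Lam : Set (Matrix ι ι k)) M i j ↔ IsStableBlock P (Lam : Set (Matrix ι ι k)) N i j := by
  have key : ∀ {M N : Matrix ι ι k}, LamSimilar (Lam : Set (Matrix ι ι k)) M N →
      IsStableBlock P (Lam : Set (Matrix ι ι k)) M i j → IsStableBlock P (Lam : Set (Matrix ι ι k)) N i j := by
    intro M N hMN h L hL
    rw [h L (hMN.trans hL), h N hMN]
  exact ⟨key hMN, key hMN.symm⟩

end LamSimilar

/-! ### Stable blocks, additions and the next algebra. -/

namespace IsReducedAlgebra

open StripPartition

variable {k : Type u} [Field k] {ι : Type} [Fintype ι] [LinearOrder ι] {P : StripPartition ι}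
  {r : Setoid (Fin P.count)} {Lam : Set (Matrix ι ι k)}

theorem block_eq_zero (h : IsReducedAlgebra P r Lam) {S : Matrix ι ι k} (hS : S ∈ Lam)
    {i j : Fin P.count} (hij : j < i) : P.block S i j = 0 := by
  ext p q
  rw [block_apply, h.apply_eq_zero hS (by rwa [strip_equiv, strip_equiv])]
  rfl

theorem block_mul_of_mem (h : IsReducedAlgebra P r Lam) {S : Matrix ι ι k} (hS : S ∈ Lam)
    (M : Matrix ι ι k) (l s : Fin P.count) :
    P.block (S * M) l s = P.block S l l * P.block M l s +
      ∑ i ∈ Finset.Ioi l, P.block S l i * P.block M i s := by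
  rw [block_mul, ← Finset.sum_subset (Finset.subset_univ (Finset.Ici l)),
    ← Finset.Ioi_insert, Finset.sum_insert (by simp)]
  intro c _ hc
  rw [Finset.mem_Ici, not_le] at hc
  rw [h.block_eq_zero hS hc, Matrix.zero_mul]

theorem block_mul_of_mem' (h : IsReducedAlgebra P r Lam) {S : Matrix ι ι k} (hS : S ∈ Lam)
    (M : Matrix ι ι k) (l s : Fin P.count) :
    P.block (M * S) l s = P.block M l s * P.block S s s +
      ∑ j ∈ Finset.Iio s, P.block M l j * P.block S j s := by
  rw [block_mul, ← Finset.sum_subset (Finset.subset_univ (Finset.Iic s)),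
    ← Finset.Iio_insert, Finset.sum_insert (by simp)]
  intro c _ hc
  rw [Finset.mem_Iic, not_le] at hc
  rw [h.block_eq_zero hS hc, Matrix.mul_zero]

/-- Stable blocks commute with the algebra. -/
theorem block_mul_comm [Infinite k] (h : IsReducedAlgebra P r Lam) {M B : Matrix ι ι k}
    {i j : Fin P.count} (hst : ∀ i', i ≤ i' → IsStableBlock P Lam M i' j) (hB : B ∈ Lam) :
    P.block (B * M) i j = P.block (M * B) i j := by
  have key : ∀ {B}, B ∈ Lam → IsUnit B → P.block (B * M) i j = P.block (M * B) i j := by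
    intro B hB hu
    have hN : LamSimilar Lam M (B⁻¹ * M * B) := ⟨B, hB, hu, rfl⟩
    have hdet := (Matrix.isUnit_iff_isUnit_det B).1 hu
    have hMB : M * B = B * (B⁻¹ * M * B) := by
      rw [← Matrix.mul_assoc, ← Matrix.mul_assoc, Matrix.mul_nonsing_inv _ hdet, Matrix.one_mul]
    rw [hMB, h.block_mul_of_mem hB, h.block_mul_of_mem hB, hst i le_rfl _ hN]
    congr 1
    refine Finset.sum_congr rfl fun c hc => ?_
    rw [hst c (Finset.mem_Ioi.1 hc).le _ hN]
  -- The assertion is linear in `B` and holds for scalars, so it passes from the nonsingular `B + c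
  -- • 1` to `B`.
  obtain ⟨c, hc⟩ := exists_isUnit_add_smul_one B
  have h1 := key (h.toSubalgebra.add_mem hB (h.toSubalgebra.smul_mem h.toSubalgebra.one_mem c)) hc
  rw [Matrix.add_mul, Matrix.mul_add, smul_mul_assoc, mul_smul_comm, Matrix.one_mul,
    Matrix.mul_one] at h1
  have hadd : ∀ X Y : Matrix ι ι k, P.block (X + Y) i j = P.block X i j + P.block Y i j :=
    fun _ _ => rfl
  rw [hadd, hadd] at h1
  exact add_right_cancel h1

/-- All blocks that precede the `(l, s)` block are stable. -/
def PrecedingStable (P : StripPartition ι) (Lam : Set (Matrix ι ι k)) (M : Matrix ι ι k)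
    (l s : Fin P.count) : Prop :=
  ∀ i j, (l < i ∨ (i = l ∧ j < s)) → IsStableBlock P Lam M i j

theorem PrecedingStable.comm [Infinite k] {M : Matrix ι ι k} {l s : Fin P.count}
    (hM : PrecedingStable P Lam M l s) (h : IsReducedAlgebra P r Lam) {B : Matrix ι ι k} (hB : B ∈ Lam)
    {i j : Fin P.count} (hij : l < i ∨ (i = l ∧ j < s)) :
    P.block (B * M) i j = P.block (M * B) i j := by
  refine h.block_mul_comm (fun i' hi' => hM i' j ?_) hB
  omega

theorem PrecedingStable.of_similar {M N : Matrix ι ι k} {l s : Fin P.count}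
    (hM : PrecedingStable P Lam M l s) (h : IsReducedAlgebra P r Lam) (hMN : LamSimilar Lam M N) :
    PrecedingStable P Lam N l s := fun i j hij =>
  (isStableBlock_iff_of_similar (Lam := h.toSubalgebra) hMN).1 (hM i j hij)

/-- The addition to the `(l, s)` block of `M`. -/
def addition (P : StripPartition ι) (M : Matrix ι ι k) (l s : Fin P.count) (S : Matrix ι ι k) :
    Matrix (Fin (P.size l)) (Fin (P.size s)) k :=
  ∑ j ∈ Finset.Iio s, P.block M l j * P.block S j s - ∑ i ∈ Finset.Ioi l, P.block S l i * P.block M i s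

theorem noAddition_iff {M : Matrix ι ι k} {l s : Fin P.count} :
    NoAddition P Lam M l s ↔ ∀ S ∈ Lam, addition P M l s S = 0 := by
  refine forall₂_congr fun S _ => ?_
  unfold addition
  rw [sub_eq_zero]

theorem PrecedingStable.addition_eq {M N : Matrix ι ι k} {l s : Fin P.count}
    (hM : PrecedingStable P Lam M l s) (hMN : LamSimilar Lam M N) (S : Matrix ι ι k) :
    addition P N l s S = addition P M l s S := by
  unfold addition
  congr 1
  · refine Finset.sum_congr rfl fun j hj => ?_
    rw [hM l j (Or.inr ⟨rfl, Finset.mem_Iio.1 hj⟩) N hMN]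
  · refine Finset.sum_congr rfl fun i hi => ?_
    rw [hM i s (Or.inl (Finset.mem_Ioi.1 hi)) N hMN]

theorem block_mul_sub_block_mul (h : IsReducedAlgebra P r Lam) {S : Matrix ι ι k} (hS : S ∈ Lam)
    (M : Matrix ι ι k) (l s : Fin P.count) : P.block (M * S) l s - P.block (S * M) l s =
      P.block M l s * P.block S s s - P.block S l l * P.block M l s + addition P M l s S := by
  rw [h.block_mul_of_mem hS, h.block_mul_of_mem' hS]
  unfold addition
  abel

/-- The other blocks of `N` entering this product precede `(l, s)` and agree with those of `M`.
Hence a transformation acts on the block by its diagonal blocks and by an addition that depends on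
`M` only. -/
theorem PrecedingStable.mul_block (h : IsReducedAlgebra P r Lam) {M N S : Matrix ι ι k}
    {l s : Fin P.count} (hM : PrecedingStable P Lam M l s) (hS : S ∈ Lam) (hu : IsUnit S)
    (hMN : M * S = S * N) :
    P.block S l l * P.block N l s = P.block M l s * P.block S s s + addition P M l s S := by
  have h1 : P.block (M * S) l s = P.block (S * N) l s := by rw [hMN]
  have hs : LamSimilar Lam M N := lamSimilar_iff.2 ⟨S, hS, hu, hMN⟩
  rw [h.block_mul_of_mem hS, h.block_mul_of_mem' hS] at h1
  have h2 : ∑ i ∈ Finset.Ioi l, P.block S l i * P.block N i s =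
      ∑ i ∈ Finset.Ioi l, P.block S l i * P.block M i s := by
    refine Finset.sum_congr rfl fun i hi => ?_
    rw [hM i s (Or.inl (Finset.mem_Ioi.1 hi)) N hs]
  rw [h2, ← eq_sub_iff_add_eq] at h1
  rw [h1]
  unfold addition
  abel

/-- The algebra that replaces `Lam` after the reduction of the `(l, s)` block of `M`. -/
def next [Infinite k] (h : IsReducedAlgebra P r Lam) {M : Matrix ι ι k} {l s : Fin P.count}
    (hM : PrecedingStable P Lam M l s) : Subalgebra k (Matrix ι ι k) where
  carrier := {S | S ∈ Lam ∧ P.block (S * M) l s = P.block (M * S) l s}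
  mul_mem' := by
    rintro A B ⟨hA, hA'⟩ ⟨hB, hB'⟩
    refine ⟨h.1 A hA B hB, ?_⟩
    -- All blocks below the row `l` in the column `s`, and to the left of the column `s` in the row
    -- `l`, are stable, and elements of `Lam` commute with `M` there. So in the block `(l, s)` one
    -- may replace `A (B M)` by `A (M B) = (A M) B`, and this by `(M A) B`.
    have h1 : ∑ i ∈ Finset.Ioi l, P.block A l i * P.block (B * M) i s =
        ∑ i ∈ Finset.Ioi l, P.block A l i * P.block (M * B) i s := by
      refine Finset.sum_congr rfl fun i hi => ?_
      rw [hM.comm h hB (Or.inl (Finset.mem_Ioi.1 hi))]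
    have h2 : ∑ j ∈ Finset.Iio s, P.block (M * A) l j * P.block B j s =
        ∑ j ∈ Finset.Iio s, P.block (A * M) l j * P.block B j s := by
      refine Finset.sum_congr rfl fun j hj => ?_
      rw [hM.comm h hA (Or.inr ⟨rfl, Finset.mem_Iio.1 hj⟩)]
    rw [Matrix.mul_assoc, h.block_mul_of_mem hA (B * M), hB', h1, ← h.block_mul_of_mem hA,
      ← Matrix.mul_assoc, h.block_mul_of_mem' hB (A * M), hA', ← h2, ← h.block_mul_of_mem' hB,
      Matrix.mul_assoc]
  add_mem' := by
    rintro A B ⟨hA, hA'⟩ ⟨hB, hB'⟩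
    refine ⟨h.toSubalgebra.add_mem hA hB, ?_⟩
    rw [Matrix.add_mul, Matrix.mul_add]
    change P.block (A * M) l s + P.block (B * M) l s = P.block (M * A) l s + P.block (M * B) l s
    rw [hA', hB']
  algebraMap_mem' := by
    intro x
    refine ⟨h.toSubalgebra.algebraMap_mem x, ?_⟩
    rw [Algebra.commutes]

theorem mem_next [Infinite k] (h : IsReducedAlgebra P r Lam) {M : Matrix ι ι k} {l s : Fin P.count}
    (hM : PrecedingStable P Lam M l s) {S : Matrix ι ι k} :
    S ∈ h.next hM ↔ S ∈ Lam ∧ P.block (S * M) l s = P.block (M * S) l s := Iff.rfl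

end IsReducedAlgebra

/-! ### Refinement of strips, and block-diagonal elements with a prescribed block. -/

namespace IsReducedAlgebra

open StripPartition

variable {k : Type u} [Field k] {ι : Type} [Fintype ι] [LinearOrder ι] {P : StripPartition ι}
  {r : Setoid (Fin P.count)} {Lam : Set (Matrix ι ι k)}

/-- A refinement of the strips of a reduced algebra, where the row in position `p` of a strip from the class
`c` belongs to the substrip `G c p` and has the label `F c p`, gives a reduced algebra. -/
theorem isLabelled_refine (h : IsReducedAlgebra P r Lam) (Lam' : Subalgebra k (Matrix ι ι k))
    (hle : ∀ S ∈ Lam', S ∈ Lam) {B Y : Type*} [LinearOrder B] (G : Quotient r → ℕ → B)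
    (F : Quotient r → ℕ → Y) (sz : Quotient r → ℕ) (hsz : ∀ i, sz (Quotient.mk r i) = P.size i)
    (hmono : ∀ c p p', p ≤ p' → p' < sz c → G c p ≤ G c p')
    (hext : ∀ c p p', p < sz c → p' < sz c → G c p = G c p' → F c p = F c p' → p = p')
    (hex : ∀ c c' p q p', p < sz c → q < sz c → p' < sz c' → G c p = G c q → F c p = F c' p' →
      ∃ q', q' < sz c' ∧ G c' q' = G c' p' ∧ F c' q' = F c q)
    (hlt : ∀ c c' p q p' q', p < sz c → q < sz c → p' < sz c' → q' < sz c' → G c p = G c q →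
      G c' p' = G c' q' → F c p = F c' p' → F c q = F c' q' → p < q → p' < q')
    (hzero : ∀ S ∈ Lam', ∀ a b, P.strip a = P.strip b →
      G (Quotient.mk r (P.strip a)) (P.pos b) < G (Quotient.mk r (P.strip a)) (P.pos a) → S a b = 0)
    (heq : ∀ S ∈ Lam', ∀ a b a' b', P.strip a = P.strip b → P.strip a' = P.strip b' →
      G (Quotient.mk r (P.strip a)) (P.pos a) = G (Quotient.mk r (P.strip a)) (P.pos b) →
      G (Quotient.mk r (P.strip a')) (P.pos a') = G (Quotient.mk r (P.strip a')) (P.pos b') →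
      F (Quotient.mk r (P.strip a)) (P.pos a) = F (Quotient.mk r (P.strip a')) (P.pos a') →
      F (Quotient.mk r (P.strip a)) (P.pos b) = F (Quotient.mk r (P.strip a')) (P.pos b') →
      S a b = S a' b')
    (hunit : ∀ u ∈ Lam, ∀ y z, (∀ a b, P.strip a ≠ P.strip b → u a b = 0) →
      (∀ a b, P.strip a = P.strip b →
        G (Quotient.mk r (P.strip a)) (P.pos a) = G (Quotient.mk r (P.strip a)) (P.pos b) →
        F (Quotient.mk r (P.strip a)) (P.pos a) = y →
        F (Quotient.mk r (P.strip a)) (P.pos b) = z → u a b = 1) →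
      (∀ a b, P.strip a = P.strip b →
        ¬ (G (Quotient.mk r (P.strip a)) (P.pos a) = G (Quotient.mk r (P.strip a)) (P.pos b) ∧
        F (Quotient.mk r (P.strip a)) (P.pos a) = y ∧
        F (Quotient.mk r (P.strip a)) (P.pos b) = z) → u a b = 0) → u ∈ Lam') :
    IsLabelled Lam' (fun x => toLex (P.strip x, G (Quotient.mk r (P.strip x)) (P.pos x)))
      fun x => F (Quotient.mk r (P.strip x)) (P.pos x) := by
  have hσ : ∀ {a b : ι}, toLex (P.strip a, G (Quotient.mk r (P.strip a)) (P.pos a)) =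
      toLex (P.strip b, G (Quotient.mk r (P.strip b)) (P.pos b)) ↔ P.strip a = P.strip b ∧
      G (Quotient.mk r (P.strip a)) (P.pos a) = G (Quotient.mk r (P.strip a)) (P.pos b) := by
    intro a b
    rw [toLex_inj, Prod.ext_iff]
    refine and_congr_right fun h' => ?_
    change P.strip a = P.strip b at h'
    simp only [h']
  have hpos : ∀ a, P.pos a < sz (Quotient.mk r (P.strip a)) := fun a => by
    rw [hsz]
    exact pos_lt a
  have hpos' : ∀ {a b}, P.strip a = P.strip b → P.pos b < sz (Quotient.mk r (P.strip a)) :=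
    fun {a b} h' => by
      rw [h']
      exact hpos b
  refine ⟨fun a b hab => ?_, fun {a b} h1 h2 => ?_, fun {a b a'} h1 h2 => ?_,
    fun {a b a' b'} h1 h2 h3 h4 h5 => ?_, fun {S} hS {a b} hab => ?_,
    fun {S} hS {a b a' b'} h1 h2 h3 h4 => ?_, fun {c d u} hcd h1 h2 => ?_⟩
  · rw [Prod.Lex.toLex_le_toLex]
    rcases (strip_mono (P := P) hab).lt_or_eq with h' | h'
    · exact Or.inl h'
    · refine Or.inr ⟨h', ?_⟩
      simp only [h']
      refine hmono _ _ _ ?_ (hpos b)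
      rcases hab.lt_or_eq with h'' | rfl
      · rcases (lt_iff (P := P)).1 h'' with h3 | h3
        · exact absurd h' h3.ne
        · exact h3.2.le
      · exact le_rfl
  · rw [hσ] at h1
    refine StripPartition.ext h1.1 (hext _ _ _ (hpos a) (hpos' h1.1) h1.2 ?_)
    rw [h2, ← h1.1]
  · rw [hσ] at h1
    obtain ⟨x, hx, h3, h4⟩ := hex _ _ _ _ _ (hpos a) (hpos' h1.1) (hpos a') h1.2 h2
    rw [hsz] at hx
    obtain ⟨b', h5, h6⟩ := exists_of_lt hx
    refine ⟨b', hσ.2 ⟨h5, ?_⟩, ?_⟩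
    · rw [h5, h6, h3]
    · rw [h5, h6, h4, h1.1]
  · rw [hσ] at h1 h2
    rw [lt_iff (P := P)] at h5 ⊢
    have h6 := h5.resolve_left (by rw [h1.1]; exact lt_irrefl _)
    refine Or.inr ⟨h2.1, hlt _ _ _ _ _ _ (hpos a) (hpos' h1.1) (hpos a') (hpos' h2.1) h1.2 h2.2 h3
      ?_ h6.2⟩
    rw [h1.1, h2.1, h4]
  · rw [Prod.Lex.toLex_lt_toLex] at hab
    rcases hab with h' | ⟨h', h''⟩
    · exact h.apply_eq_zero (hle S hS) h'
    · simp only at h' h''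
      refine hzero S hS a b h'.symm ?_
      rwa [h'] at h''
  · rw [hσ] at h1 h2
    refine heq S hS a b a' b' h1.1 h2.1 h1.2 h2.2 h3 ?_
    rw [h1.1, h2.1]
    exact h4
  · rw [hσ] at hcd
    have hone : ∀ a b, P.strip a = P.strip b →
        G (Quotient.mk r (P.strip a)) (P.pos a) = G (Quotient.mk r (P.strip a)) (P.pos b) →
        F (Quotient.mk r (P.strip a)) (P.pos a) = F (Quotient.mk r (P.strip c)) (P.pos c) →
        F (Quotient.mk r (P.strip a)) (P.pos b) = F (Quotient.mk r (P.strip d)) (P.pos d) →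
        u a b = 1 := by
      intro a b e1 e2 e3 e4
      exact h1 a b (hσ.2 ⟨e1, e2⟩) e3 (by rwa [← e1])
    have hnil : ∀ a b, P.strip a ≠ P.strip b → u a b = 0 := fun a b hab =>
      h2 a b fun h' => hab (hσ.1 h'.1).1
    have hzer : ∀ a b, P.strip a = P.strip b →
        ¬ (G (Quotient.mk r (P.strip a)) (P.pos a) = G (Quotient.mk r (P.strip a)) (P.pos b) ∧
        F (Quotient.mk r (P.strip a)) (P.pos a) = F (Quotient.mk r (P.strip c)) (P.pos c) ∧
        F (Quotient.mk r (P.strip a)) (P.pos b) = F (Quotient.mk r (P.strip d)) (P.pos d)) →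
        u a b = 0 := by
      intro a b e1 e2
      refine h2 a b fun h' => e2 ⟨(hσ.1 h'.1).2, h'.2.1, ?_⟩
      rw [e1]
      exact h'.2.2
    refine hunit u (h.mem_of_diag hnil ?_) _ _ hnil hone hzer
    intro a b a' b' hab hab' hr ha hb
    have hq : Quotient.mk r (P.strip a) = Quotient.mk r (P.strip a') := Quotient.sound hr
    by_cases hc : G (Quotient.mk r (P.strip a)) (P.pos a) = G (Quotient.mk r (P.strip a)) (P.pos b) ∧
        F (Quotient.mk r (P.strip a)) (P.pos a) = F (Quotient.mk r (P.strip c)) (P.pos c) ∧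
        F (Quotient.mk r (P.strip a)) (P.pos b) = F (Quotient.mk r (P.strip d)) (P.pos d)
    · rw [hone a b hab hc.1 hc.2.1 hc.2.2]
      rw [hq, ha, hb] at hc
      rw [hone a' b' hab' hc.1 hc.2.1 hc.2.2]
    · rw [hzer a b hab hc]
      rw [hq, ha, hb] at hc
      rw [hzer a' b' hab' hc]

/-- The common size of the strips of a class. -/
noncomputable def classSize (P : StripPartition ι) (r : Setoid (Fin P.count)) (c : Quotient r) : ℕ :=
  P.size c.out

theorem classSize_mk (h : IsReducedAlgebra P r Lam) (i : Fin P.count) :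
    classSize P r (Quotient.mk r i) = P.size i :=
  h.size_eq (Quotient.mk_out i)

/-- The block-diagonal element of a reduced algebra with the block `C` in the places of the class of `l`, and
zeros elsewhere. -/
noncomputable def diagExt (P : StripPartition ι) (r : Setoid (Fin P.count)) (l : Fin P.count)
    (C : Matrix (Fin (P.size l)) (Fin (P.size l)) k) : Matrix ι ι k :=
  ∑ p, ∑ q, C p q • IsLabelled.unit k P.strip (fun a => (Quotient.mk r (P.strip a), P.pos a))
    (P.equiv (toLex ⟨l, p⟩)) (P.equiv (toLex ⟨l, q⟩))

theorem diagExt_mem (h : IsReducedAlgebra P r Lam) (l : Fin P.count)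
    (C : Matrix (Fin (P.size l)) (Fin (P.size l)) k) : diagExt P r l C ∈ Lam := by
  change _ ∈ h.toSubalgebra
  refine Subalgebra.sum_mem _ fun p _ => Subalgebra.sum_mem _ fun q _ => Subalgebra.smul_mem _ ?_ _
  exact h.isLabelled.unit_mem' (by rw [strip_equiv, strip_equiv])

theorem diagExt_apply_of_ne (l : Fin P.count) (C : Matrix (Fin (P.size l)) (Fin (P.size l)) k) {a b : ι}
    (hab : P.strip a ≠ P.strip b) : diagExt P r l C a b = 0 := by
  simp only [diagExt, Matrix.sum_apply, Matrix.smul_apply, IsLabelled.unit]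
  refine Finset.sum_eq_zero fun p _ => Finset.sum_eq_zero fun q _ => ?_
  rw [if_neg fun h' => hab h'.1, smul_zero]

theorem diagExt_apply_of_not_rel (l : Fin P.count) (C : Matrix (Fin (P.size l)) (Fin (P.size l)) k) {a b : ι}
    (hab : ¬ r (P.strip a) l) : diagExt P r l C a b = 0 := by
  simp only [diagExt, Matrix.sum_apply, Matrix.smul_apply, IsLabelled.unit]
  refine Finset.sum_eq_zero fun p _ => Finset.sum_eq_zero fun q _ => ?_
  rw [if_neg, smul_zero]
  rintro ⟨-, h', -⟩
  rw [Prod.ext_iff, Quotient.eq, strip_equiv] at h'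
  exact hab h'.1

theorem diagExt_apply (l : Fin P.count) (C : Matrix (Fin (P.size l)) (Fin (P.size l)) k)
    {i : Fin P.count} (hi : r i l) (p q : Fin (P.size i)) (hsz : P.size i = P.size l) :
    diagExt P r l C (P.equiv (toLex ⟨i, p⟩)) (P.equiv (toLex ⟨i, q⟩)) =
      C (Fin.cast hsz p) (Fin.cast hsz q) := by
  simp only [diagExt, Matrix.sum_apply, Matrix.smul_apply, IsLabelled.unit]
  rw [Finset.sum_eq_single (Fin.cast hsz p), Finset.sum_eq_single (Fin.cast hsz q), if_pos]
  · simp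
  · simpa using Quotient.sound hi
  · intro q' _ hne
    rw [if_neg, smul_zero]
    rintro ⟨-, -, h'⟩
    rw [Prod.ext_iff] at h'
    simp only [pos_equiv] at h'
    exact hne (Fin.ext h'.2.symm)
  · simp
  · intro p' _ hne
    refine Finset.sum_eq_zero fun q' _ => ?_
    rw [if_neg, smul_zero]
    rintro ⟨-, h', -⟩
    rw [Prod.ext_iff] at h'
    simp only [pos_equiv] at h'
    exact hne (Fin.ext h'.2.symm)
  · simp

/-- The units of the labelling multiply like matrix units. This is what makes `unitExt` of a
nonsingular block nonsingular. -/
theorem diagExt_mul (h : IsReducedAlgebra P r Lam) (l : Fin P.count)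
    (C D : Matrix (Fin (P.size l)) (Fin (P.size l)) k) :
    diagExt P r l C * diagExt P r l D = diagExt P r l (C * D) := by
  have hu : ∀ p q q' p' : Fin (P.size l), IsLabelled.unit k P.strip (fun a =>
      (Quotient.mk r (P.strip a), P.pos a)) (P.equiv (toLex ⟨l, p⟩)) (P.equiv (toLex ⟨l, q⟩)) *
      IsLabelled.unit k P.strip (fun a =>
      (Quotient.mk r (P.strip a), P.pos a)) (P.equiv (toLex ⟨l, q'⟩)) (P.equiv (toLex ⟨l, p'⟩)) =
      if q = q' then IsLabelled.unit k P.strip (fun a =>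
      (Quotient.mk r (P.strip a), P.pos a)) (P.equiv (toLex ⟨l, p⟩)) (P.equiv (toLex ⟨l, p'⟩))
      else 0 := by
    intro p q q' p'
    split_ifs with hq
    · subst hq
      exact h.isLabelled.unit_mul_unit (by rw [strip_equiv, strip_equiv])
    · ext a b
      by_cases ha : (Quotient.mk r (P.strip a), P.pos a) = (Quotient.mk r (P.strip
          (P.equiv (toLex ⟨l, p⟩))), P.pos (P.equiv (toLex ⟨l, p⟩)))
      · obtain ⟨e, e1, e2⟩ := h.isLabelled.exists_eq (a := P.equiv (toLex ⟨l, p⟩))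
          (b := P.equiv (toLex ⟨l, q⟩)) (by rw [strip_equiv, strip_equiv]) ha.symm
        rw [h.isLabelled.unit_mul_apply _ ha e1 e2, IsLabelled.unit, if_neg]
        · rfl
        · rintro ⟨-, h', -⟩
          rw [e2] at h'
          rw [Prod.ext_iff] at h'
          simp only [pos_equiv] at h'
          exact hq (Fin.ext h'.2)
      · rw [IsLabelled.unit_mul_apply_zero _ ha]
        rfl
  unfold diagExt
  rw [Finset.sum_mul]
  refine Finset.sum_congr rfl fun p _ => ?_
  rw [Finset.sum_mul]
  have hq : ∀ q, (C p q • IsLabelled.unit k P.strip (fun a => (Quotient.mk r (P.strip a), P.pos a))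
      (P.equiv (toLex ⟨l, p⟩)) (P.equiv (toLex ⟨l, q⟩))) * (∑ q', ∑ p', D q' p' • IsLabelled.unit k P.strip
      (fun a => (Quotient.mk r (P.strip a), P.pos a)) (P.equiv (toLex ⟨l, q'⟩)) (P.equiv (toLex ⟨l, p'⟩)))
      = ∑ p', (C p q * D q p') • IsLabelled.unit k P.strip (fun a => (Quotient.mk r (P.strip a), P.pos a))
      (P.equiv (toLex ⟨l, p⟩)) (P.equiv (toLex ⟨l, p'⟩)) := by
    intro q
    rw [Finset.mul_sum, Finset.sum_eq_single q]
    · rw [Finset.mul_sum]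
      refine Finset.sum_congr rfl fun p' _ => ?_
      rw [smul_mul_smul_comm, hu, if_pos rfl]
    · intro q' _ hne
      rw [Finset.mul_sum]
      refine Finset.sum_eq_zero fun p' _ => ?_
      rw [smul_mul_smul_comm, hu, if_neg hne.symm, smul_zero]
    · simp
  simp only [hq]
  rw [Finset.sum_comm]
  refine Finset.sum_congr rfl fun p' _ => ?_
  rw [Matrix.mul_apply, Finset.sum_smul]

theorem diagExt_add (l : Fin P.count) (C D : Matrix (Fin (P.size l)) (Fin (P.size l)) k) :
    diagExt P r l (C + D) = diagExt P r l C + diagExt P r l D := by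
  simp only [diagExt, Matrix.add_apply, add_smul, Finset.sum_add_distrib]

/-- The block-diagonal element of a reduced algebra with the block `C` in the places of the class of `l`, and
identity blocks elsewhere. -/
noncomputable def unitExt (P : StripPartition ι) (r : Setoid (Fin P.count)) (l : Fin P.count)
    (C : Matrix (Fin (P.size l)) (Fin (P.size l)) k) : Matrix ι ι k :=
  1 + diagExt P r l (C - 1)

theorem unitExt_mem (h : IsReducedAlgebra P r Lam) (l : Fin P.count)
    (C : Matrix (Fin (P.size l)) (Fin (P.size l)) k) : unitExt P r l C ∈ Lam :=
  h.toSubalgebra.add_mem h.toSubalgebra.one_mem (h.diagExt_mem l _)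

theorem unitExt_mul (h : IsReducedAlgebra P r Lam) (l : Fin P.count)
    (C D : Matrix (Fin (P.size l)) (Fin (P.size l)) k) :
    unitExt P r l C * unitExt P r l D = unitExt P r l (C * D) := by
  unfold unitExt
  have h1 : C * D - 1 = (C - 1) * (D - 1) + (C - 1) + (D - 1) := by noncomm_ring
  rw [h1, diagExt_add, diagExt_add, ← h.diagExt_mul]
  noncomm_ring

theorem isUnit_unitExt (h : IsReducedAlgebra P r Lam) {l : Fin P.count}
    {C : Matrix (Fin (P.size l)) (Fin (P.size l)) k} (hC : IsUnit C) : IsUnit (unitExt P r l C) := by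
  refine IsUnit.of_mul_eq_one (unitExt P r l C⁻¹) ?_
  rw [h.unitExt_mul, Matrix.mul_nonsing_inv _ ((Matrix.isUnit_iff_isUnit_det C).1 hC), unitExt, sub_self]
  simp [diagExt]

theorem unitExt_apply_of_ne (l : Fin P.count) (C : Matrix (Fin (P.size l)) (Fin (P.size l)) k) {a b : ι}
    (hab : P.strip a ≠ P.strip b) : unitExt P r l C a b = 0 := by
  rw [unitExt, Matrix.add_apply, diagExt_apply_of_ne l _ hab, Matrix.one_apply_ne, add_zero]
  rintro rfl
  exact hab rfl

theorem block_one (i : Fin P.count) : P.block (1 : Matrix ι ι k) i i = 1 := by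
  ext p q
  rw [block_apply, Matrix.one_apply, Matrix.one_apply]
  refine if_congr ?_ rfl rfl
  rw [P.equiv.injective.eq_iff, toLex_inj]
  simp

theorem block_unitExt (l : Fin P.count) (C : Matrix (Fin (P.size l)) (Fin (P.size l)) k)
    {i : Fin P.count} (hi : r i l) (hsz : P.size i = P.size l) :
    P.block (unitExt P r l C) i i = C.submatrix (Fin.cast hsz) (Fin.cast hsz) := by
  have h1 : P.block (unitExt P r l C) i i = P.block 1 i i + P.block (diagExt P r l (C - 1)) i i := rfl
  have h2 : P.block (diagExt P r l (C - 1)) i i = C.submatrix (Fin.cast hsz) (Fin.cast hsz) - 1 := by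
    ext p q
    rw [block_apply, diagExt_apply l _ hi _ _ hsz, Matrix.sub_apply, Matrix.sub_apply, Matrix.one_apply,
      Matrix.one_apply]
    simp [Fin.ext_iff]
  rw [h1, h2, block_one]
  abel

theorem block_unitExt_self (l : Fin P.count) (C : Matrix (Fin (P.size l)) (Fin (P.size l)) k) :
    P.block (unitExt P r l C) l l = C :=
  block_unitExt l C (r.refl l) rfl

theorem block_unitExt_of_not_rel (l : Fin P.count) (C : Matrix (Fin (P.size l)) (Fin (P.size l)) k)
    {i : Fin P.count} (hi : ¬ r i l) : P.block (unitExt P r l C) i i = 1 := by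
  have h1 : P.block (unitExt P r l C) i i = P.block 1 i i + P.block (diagExt P r l (C - 1)) i i := rfl
  have h2 : P.block (diagExt P r l (C - 1)) i i = 0 := by
    ext p q
    rw [block_apply, diagExt_apply_of_not_rel]
    · rfl
    · rwa [strip_equiv]
  rw [h1, h2, block_one, add_zero]

theorem block_eq_zero_of_diag {D : Matrix ι ι k} (hD : ∀ a b, P.strip a ≠ P.strip b → D a b = 0)
    {i j : Fin P.count} (hij : i ≠ j) : P.block D i j = 0 := by
  ext p q
  rw [block_apply, hD]
  · rfl
  · rwa [strip_equiv, strip_equiv]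

theorem block_diag_mul {D : Matrix ι ι k} (hD : ∀ a b, P.strip a ≠ P.strip b → D a b = 0)
    (S : Matrix ι ι k) (i j : Fin P.count) :
    P.block (D * S) i j = P.block D i i * P.block S i j := by
  rw [block_mul, Finset.sum_eq_single i]
  · intro c _ hc
    rw [block_eq_zero_of_diag hD hc.symm, Matrix.zero_mul]
  · simp

theorem block_mul_diag {D : Matrix ι ι k} (hD : ∀ a b, P.strip a ≠ P.strip b → D a b = 0)
    (S : Matrix ι ι k) (i j : Fin P.count) :
    P.block (S * D) i j = P.block S i j * P.block D j j := by
  rw [block_mul, Finset.sum_eq_single j]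
  · intro c _ hc
    rw [block_eq_zero_of_diag hD hc, Matrix.mul_zero]
  · simp

end IsReducedAlgebra

/-! ### The space of additions to a block. -/

namespace IsReducedAlgebra

open StripPartition

variable {k : Type u} [Field k] {ι : Type} [Fintype ι] [LinearOrder ι] {P : StripPartition ι}
  {r : Setoid (Fin P.count)} {Lam : Set (Matrix ι ι k)}

theorem isUnit_block (h : IsReducedAlgebra P r Lam) {S : Matrix ι ι k} (hS : S ∈ Lam) (hu : IsUnit S)
    (l : Fin P.count) : IsUnit (P.block S l l) := by
  have h1 : S⁻¹ ∈ Lam := h.toSubalgebra.matrix_inv_mem hS hu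
  have h2 : P.block (S⁻¹ * S) l l = 1 := by
    rw [Matrix.nonsing_inv_mul _ ((Matrix.isUnit_iff_isUnit_det S).1 hu), block_one]
  rw [h.block_mul_of_mem h1, Finset.sum_eq_zero, add_zero] at h2
  · exact IsUnit.of_mul_eq_one_right _ h2
  · intro i hi
    rw [h.block_eq_zero hS (Finset.mem_Ioi.1 hi), Matrix.mul_zero]

theorem addition_add (M : Matrix ι ι k) (l s : Fin P.count) (S T : Matrix ι ι k) :
    addition P M l s (S + T) = addition P M l s S + addition P M l s T := by
  have h1 : ∀ i j, P.block (S + T) i j = P.block S i j + P.block T i j := fun _ _ => rfl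
  simp only [addition, h1, Matrix.mul_add, Matrix.add_mul, Finset.sum_add_distrib]
  abel

theorem addition_smul (M : Matrix ι ι k) (l s : Fin P.count) (c : k) (S : Matrix ι ι k) :
    addition P M l s (c • S) = c • addition P M l s S := by
  have h1 : ∀ i j, P.block (c • S) i j = c • P.block S i j := fun _ _ => rfl
  simp only [addition, h1, smul_sub, Finset.smul_sum,
    Matrix.mul_smul, Matrix.smul_mul]

theorem addition_diag (M : Matrix ι ι k) (l s : Fin P.count) {D : Matrix ι ι k}
    (hD : ∀ a b, P.strip a ≠ P.strip b → D a b = 0) : addition P M l s D = 0 := by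
  unfold addition
  rw [Finset.sum_eq_zero, Finset.sum_eq_zero, sub_zero]
  · intro i hi
    rw [block_eq_zero_of_diag hD (Finset.mem_Ioi.1 hi).ne, Matrix.zero_mul]
  · intro j hj
    rw [block_eq_zero_of_diag hD (Finset.mem_Iio.1 hj).ne, Matrix.mul_zero]

/-- Block-diagonal elements of the algebra commute with the preceding blocks. Together with
`addition_mul_diag` this makes the set of additions a bimodule over the diagonal blocks. -/
theorem addition_diag_mul [Infinite k] (h : IsReducedAlgebra P r Lam) {M : Matrix ι ι k} {l s : Fin P.count}
    (hM : PrecedingStable P Lam M l s) {D : Matrix ι ι k} (hD' : D ∈ Lam)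
    (hD : ∀ a b, P.strip a ≠ P.strip b → D a b = 0) (S : Matrix ι ι k) :
    addition P M l s (D * S) = P.block D l l * addition P M l s S := by
  unfold addition
  rw [Matrix.mul_sub, Matrix.mul_sum, Matrix.mul_sum]
  congr 1
  · refine Finset.sum_congr rfl fun j hj => ?_
    have := hM.comm h hD' (Or.inr ⟨rfl, Finset.mem_Iio.1 hj⟩)
    rw [block_diag_mul hD, block_mul_diag hD] at this
    rw [block_diag_mul hD, ← Matrix.mul_assoc, ← this, Matrix.mul_assoc]
  · refine Finset.sum_congr rfl fun i hi => ?_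
    rw [block_diag_mul hD, Matrix.mul_assoc]

theorem addition_mul_diag [Infinite k] (h : IsReducedAlgebra P r Lam) {M : Matrix ι ι k} {l s : Fin P.count}
    (hM : PrecedingStable P Lam M l s) {D : Matrix ι ι k} (hD' : D ∈ Lam)
    (hD : ∀ a b, P.strip a ≠ P.strip b → D a b = 0) (S : Matrix ι ι k) :
    addition P M l s (S * D) = addition P M l s S * P.block D s s := by
  unfold addition
  rw [Matrix.sub_mul, Matrix.sum_mul, Matrix.sum_mul]
  congr 1
  · refine Finset.sum_congr rfl fun j hj => ?_
    rw [block_mul_diag hD, Matrix.mul_assoc]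
  · refine Finset.sum_congr rfl fun i hi => ?_
    have := hM.comm h hD' (i := i) (j := s) (Or.inl (Finset.mem_Ioi.1 hi))
    rw [block_diag_mul hD, block_mul_diag hD] at this
    rw [block_mul_diag hD, Matrix.mul_assoc, this, Matrix.mul_assoc]

/-- The block-diagonal part of a matrix. -/
def diagPart (P : StripPartition ι) (S : Matrix ι ι k) : Matrix ι ι k :=
  fun a b => if P.strip a = P.strip b then S a b else 0

theorem diagPart_mem (h : IsReducedAlgebra P r Lam) {S : Matrix ι ι k} (hS : S ∈ Lam) :
    diagPart P S ∈ Lam := by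
  refine h.mem_of_diag (fun a b hab => if_neg hab) fun a b a' b' hab hab' hr ha hb => ?_
  rw [diagPart, diagPart, if_pos hab, if_pos hab']
  exact h.apply_eq hS hab hab' hr ha hb

/-- The additions form a bimodule over two full matrix algebras, so a single nonzero one generates
everything. The block-diagonal part of an element contributes nothing to the addition and is removed
first, so that `1 + S` will have identity diagonal blocks. -/
theorem exists_addition_eq [Infinite k] (h : IsReducedAlgebra P r Lam) {M : Matrix ι ι k} {l s : Fin P.count}
    (hM : PrecedingStable P Lam M l s) (hadd : ¬ NoAddition P Lam M l s)
    (A : Matrix (Fin (P.size l)) (Fin (P.size s)) k) :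
    ∃ S ∈ Lam, (∀ a b, P.strip a = P.strip b → S a b = 0) ∧ addition P M l s S = A := by
  rw [noAddition_iff] at hadd
  push Not at hadd
  obtain ⟨S, hS, hne⟩ := hadd
  have hT : S + (-1 : k) • diagPart P S ∈ Lam :=
    h.toSubalgebra.add_mem hS (h.toSubalgebra.smul_mem (h.diagPart_mem hS) _)
  have hT0 : ∀ a b, P.strip a = P.strip b → (S + (-1 : k) • diagPart P S) a b = 0 := by
    intro a b hab
    rw [Matrix.add_apply, Matrix.smul_apply, diagPart, if_pos hab, neg_one_smul, add_neg_cancel]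
  have hTa : addition P M l s (S + (-1 : k) • diagPart P S) = addition P M l s S := by
    rw [addition_add, addition_smul, addition_diag (D := diagPart P S) M l s (fun a b hab => if_neg hab),
      smul_zero, add_zero]
  generalize S + (-1 : k) • diagPart P S = T at hT hT0 hTa
  rw [← hTa] at hne
  obtain ⟨p0, q0, hpq⟩ : ∃ p q, addition P M l s T p q ≠ 0 := by
    by_contra! hc
    exact hne (Matrix.ext hc)
  have key : ∀ p q, ∃ S ∈ Lam, (∀ a b, P.strip a = P.strip b → S a b = 0) ∧
      addition P M l s S = Matrix.single p q 1 := by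
    intro p q
    -- Matrix units at `l` and `s` move the nonzero entry from `(p0, q0)` to `(p, q)` and remove all
    -- others.
    let U := diagExt P r l (Matrix.single p p0 (1 : k))
    let V := diagExt P r s (Matrix.single q0 q (1 : k))
    have hU : ∀ a b, P.strip a ≠ P.strip b → U a b = 0 := fun a b => diagExt_apply_of_ne l _
    have hV : ∀ a b, P.strip a ≠ P.strip b → V a b = 0 := fun a b => diagExt_apply_of_ne s _
    have hUb : P.block U l l = Matrix.single p p0 1 := by
      ext p' q'
      exact diagExt_apply l _ (r.refl l) p' q' rfl
    have hVb : P.block V s s = Matrix.single q0 q 1 := by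
      ext p' q'
      exact diagExt_apply s _ (r.refl s) p' q' rfl
    refine ⟨(addition P M l s T p0 q0)⁻¹ • (U * T * V), ?_, ?_, ?_⟩
    · exact h.toSubalgebra.smul_mem (h.toSubalgebra.mul_mem (h.toSubalgebra.mul_mem
        (h.diagExt_mem l _) hT) (h.diagExt_mem s _)) _
    · intro a b hab
      rw [Matrix.smul_apply, Matrix.mul_apply, Finset.sum_eq_zero, smul_zero]
      intro e _
      by_cases he : P.strip e = P.strip b
      · rw [Matrix.mul_apply, Finset.sum_eq_zero, zero_mul]
        intro f _
        by_cases hf : P.strip a = P.strip f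
        · rw [hT0 f e (by rw [← hf, he, hab]), mul_zero]
        · rw [hU a f hf, zero_mul]
      · rw [hV e b he, mul_zero]
    · rw [addition_smul, h.addition_mul_diag hM (h.diagExt_mem s _) hV,
        h.addition_diag_mul hM (h.diagExt_mem l _) hU, hUb, hVb, Matrix.single_mul_mul_single,
        Matrix.smul_single, one_mul, mul_one, smul_eq_mul, inv_mul_cancel₀ hpq]
  choose E hE hE0 hEa using key
  refine ⟨∑ p, ∑ q, A p q • E p q, ?_, ?_, ?_⟩
  · exact h.toSubalgebra.sum_mem fun p _ => h.toSubalgebra.sum_mem fun q _ =>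
      h.toSubalgebra.smul_mem (hE p q) _
  · intro a b hab
    simp only [Matrix.sum_apply, Matrix.smul_apply, hE0 _ _ a b hab, smul_zero, Finset.sum_const_zero]
  · have hsum : ∀ {κ : Type} (F : Finset κ) (f : κ → Matrix ι ι k),
        addition P M l s (∑ x ∈ F, f x) = ∑ x ∈ F, addition P M l s (f x) := by
      intro κ F f
      classical
      induction F using Finset.induction_on with
      | empty => exact addition_diag M l s (fun _ _ _ => rfl)
      | insert x F hx ih => rw [Finset.sum_insert hx, Finset.sum_insert hx, addition_add, ih]
    simp only [hsum, addition_smul, hEa]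
    conv_rhs => rw [Matrix.matrix_eq_sum_single A]
    simp

theorem isUnit_one_add (h : IsReducedAlgebra P r Lam) {S : Matrix ι ι k} (hS : S ∈ Lam)
    (h0 : ∀ a b, P.strip a = P.strip b → S a b = 0) : IsUnit (1 + S) := by
  have hz : ∀ a b, b ≤ a → S a b = 0 := by
    intro a b hab
    rcases (strip_mono (P := P) hab).lt_or_eq with h' | h'
    · exact h.apply_eq_zero hS h'
    · exact h0 a b h'.symm
  rw [Matrix.isUnit_iff_isUnit_det, Matrix.det_of_isUpperTriangular]
  · simp [hz _ _ le_rfl]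
  · intro a b hab
    have hab : b < a := hab
    rw [Matrix.add_apply, Matrix.one_apply_ne hab.ne', hz a b hab.le, zero_add]

/-- If every element satisfied the condition of `next`, then, in the absence of additions, no
similarity transformation would change the block and it would be stable. Hence the algebra really
shrinks. -/
theorem exists_next_ne_of_noAddition [Infinite k] (h : IsReducedAlgebra P r Lam) {M : Matrix ι ι k}
    {l s : Fin P.count} (hM : PrecedingStable P Lam M l s) (hns : ¬ IsStableBlock P Lam M l s)
    (hadd : NoAddition P Lam M l s) : ∃ S ∈ Lam, S ∉ h.next hM := by
  by_contra! hc
  apply hns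
  intro N hN
  obtain ⟨S, hS, hu, hMN⟩ := lamSimilar_iff.1 hN
  have h1 := PrecedingStable.mul_block h hM hS hu hMN
  have h2 := h.block_mul_sub_block_mul hS M l s
  rw [noAddition_iff.1 hadd S hS, add_zero] at h1 h2
  rw [((h.mem_next hM).1 (hc S hS)).2, sub_self] at h2
  rw [sub_eq_zero.1 h2.symm] at h1
  have h3 := (Matrix.isUnit_iff_isUnit_det _).1 (h.isUnit_block hS hu l)
  have h4 := congrArg (fun X => (P.block S l l)⁻¹ * X) h1
  simp only [← Matrix.mul_assoc, Matrix.nonsing_inv_mul _ h3, Matrix.one_mul] at h4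
  exact h4

/-- The refined labelling in the case of a nonzero addition is the old one. -/
theorem isLabelled_next_of_block_eq_zero [Infinite k] (h : IsReducedAlgebra P r Lam) {Y : Matrix ι ι k}
    {l s : Fin P.count} (hY : PrecedingStable P Lam Y l s) (h0 : P.block Y l s = 0) :
    IsLabelled (h.next hY) P.strip fun a => (Quotient.mk r (P.strip a), P.pos a) := by
  have hl := h.isLabelled
  refine ⟨hl.mono, hl.ext, hl.exists_eq, hl.lt, fun hS => hl.apply_eq_zero hS.1,
    fun hS => hl.apply_eq hS.1, fun {c d u} hcd h1 h2 => ⟨hl.unit_mem hcd h1 h2, ?_⟩⟩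
  have hu : ∀ a b, P.strip a ≠ P.strip b → u a b = 0 := fun a b hab => h2 a b fun h' => hab h'.1
  rw [block_diag_mul hu, block_mul_diag hu, h0, Matrix.mul_zero, Matrix.zero_mul]

end IsReducedAlgebra

/-! ### The algebra after a reduction to `[0 I; 0 0]`. -/

/-- This dictates the new strips: `l` is cut after its first `n` rows and `s` before its last `n`;
both diagonal blocks become block triangular, and the substrips joined by the identity block become
equivalent. -/
theorem mul_upperRight_eq_iff {k : Type u} [Field k] {a b n : ℕ} (hna : n ≤ a) (hnb : n ≤ b)
    {E : Matrix (Fin a) (Fin b) k}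
    (hE : ∀ p q, E p q = if (p : ℕ) < n ∧ (q : ℕ) = p + (b - n) then 1 else 0)
    (X : Matrix (Fin a) (Fin a) k) (Z : Matrix (Fin b) (Fin b) k) :
    X * E = E * Z ↔ (∀ (p j : Fin a) (hj : (j : ℕ) < n) (hp : (p : ℕ) < n),
        X p j = Z ⟨p + (b - n), by omega⟩ ⟨j + (b - n), by omega⟩) ∧
      (∀ p j : Fin a, (j : ℕ) < n → n ≤ (p : ℕ) → X p j = 0) ∧
      (∀ p q : Fin b, b - n ≤ (p : ℕ) → (q : ℕ) < b - n → Z p q = 0) := by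
  have h1 : ∀ p q, (X * E) p q = if h : b - n ≤ (q : ℕ) then X p ⟨q - (b - n), by omega⟩ else 0 := by
    intro p q
    rw [Matrix.mul_apply]
    have hq := q.2
    split_ifs with h
    · rw [Finset.sum_eq_single ⟨q - (b - n), by omega⟩]
      · rw [hE, if_pos, mul_one]
        simp only
        omega
      · intro p' _ hne
        rw [hE, if_neg, mul_zero]
        rintro ⟨-, h'⟩
        exact hne (Fin.ext (by simp only; omega))
      · simp
    · refine Finset.sum_eq_zero fun p' _ => ?_
      rw [hE, if_neg, mul_zero]
      omega
  have h2 : ∀ p q, (E * Z) p q = if h : (p : ℕ) < n then Z ⟨p + (b - n), by omega⟩ q else 0 := by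
    intro p q
    rw [Matrix.mul_apply]
    split_ifs with h
    · rw [Finset.sum_eq_single ⟨p + (b - n), by omega⟩]
      · rw [hE, if_pos ⟨h, rfl⟩, one_mul]
      · intro p' _ hne
        rw [hE, if_neg, zero_mul]
        rintro ⟨-, h'⟩
        exact hne (Fin.ext h')
      · simp
    · refine Finset.sum_eq_zero fun p' _ => ?_
      rw [hE, if_neg, zero_mul]
      omega
  rw [← Matrix.ext_iff]
  simp only [h1, h2]
  constructor
  · intro h
    refine ⟨fun p j hj hp => ?_, fun p j hj hp => ?_, fun p q hp hq => ?_⟩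
    · have := h p ⟨j + (b - n), by omega⟩
      rw [dif_pos (by simp only; omega), dif_pos hp] at this
      rw [← this]
      exact congrArg (X p) (Fin.ext (by simp))
    · have := h p ⟨j + (b - n), by omega⟩
      rw [dif_pos (by simp only; omega), dif_neg (by omega)] at this
      rw [← this]
      exact congrArg (X p) (Fin.ext (by simp))
    · have hp2 := p.2
      have := h ⟨p - (b - n), by omega⟩ q
      rw [dif_neg (by omega), dif_pos (by simp only; omega)] at this
      rw [this]
      exact congrArg (fun x => Z x q) (Fin.ext (by simp only; omega))
  · rintro ⟨e1, e2, e3⟩ p q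
    have hq := q.2
    have hp := p.2
    by_cases hp' : (p : ℕ) < n
    · rw [dif_pos hp']
      split_ifs with h
      · rw [e1 _ _ (by simp only; omega) hp']
        congr 2
        simp only
        omega
      · exact (e3 _ _ (by simp only; omega) (by omega)).symm
    · rw [dif_neg hp']
      split_ifs with h
      · exact e2 _ _ (by simp only; omega) (by omega)
      · rfl

namespace IsReducedAlgebra

open StripPartition

variable {k : Type u} [Field k] {ι : Type} [Fintype ι] [LinearOrder ι] {P : StripPartition ι}
  {r : Setoid (Fin P.count)} {Lam : Set (Matrix ι ι k)}

theorem apply_eq_block (h : IsReducedAlgebra P r Lam) {S : Matrix ι ι k} (hS : S ∈ Lam) {a b : ι}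
    (hab : P.strip a = P.strip b) {l : Fin P.count} (hl : Quotient.mk r (P.strip a) = Quotient.mk r l)
    (ha : P.pos a < P.size l) (hb : P.pos b < P.size l) :
    S a b = P.block S l l ⟨P.pos a, ha⟩ ⟨P.pos b, hb⟩ := by
  rw [block_apply]
  exact h.apply_eq hS hab (by rw [strip_equiv, strip_equiv])
    (by rw [strip_equiv]; exact Quotient.exact hl) (by rw [pos_equiv]) (by rw [pos_equiv])

theorem block_comm_of_mem_next [Infinite k] (h : IsReducedAlgebra P r Lam) {Y : Matrix ι ι k}
    {l s : Fin P.count} (hY : PrecedingStable P Lam Y l s) (hadd : NoAddition P Lam Y l s)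
    {S : Matrix ι ι k} (hS : S ∈ h.next hY) :
    P.block S l l * P.block Y l s = P.block Y l s * P.block S s s := by
  have h2 := h.block_mul_sub_block_mul hS.1 Y l s
  rw [noAddition_iff.1 hadd S hS.1, add_zero, hS.2, sub_self] at h2
  exact (sub_eq_zero.1 h2.symm).symm

-- The cuts and identifications come from `mul_upperRight_eq_iff` and are made in all strips
-- equivalent to `l` or to `s`; non-equivalence of `l` and `s` keeps the two cuts from interfering.
open Classical in
theorem exists_isLabelled_next_of_upperRight [Infinite k] (h : IsReducedAlgebra P r Lam) {Y : Matrix ι ι k}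
    {l s : Fin P.count} (hY : PrecedingStable P Lam Y l s) (hadd : NoAddition P Lam Y l s)
    (hls : ¬ r l s) (hE : IsUpperRightIdentity (P.block Y l s)) :
    ∃ (G : Quotient r → ℕ → ℕ) (F : Quotient r → ℕ → Quotient r × ℕ), IsLabelled (h.next hY)
      (fun x => toLex (P.strip x, G (Quotient.mk r (P.strip x)) (P.pos x)))
      fun x => F (Quotient.mk r (P.strip x)) (P.pos x) := by
  obtain ⟨n, hna, hnb, hE⟩ := hE
  set a := P.size l with ha
  set b := P.size s with hb
  set L := Quotient.mk r l with hL
  set R := Quotient.mk r s with hR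
  have hLR : L ≠ R := fun h' => hls (Quotient.exact h')
  have hszL : classSize P r L = a := h.classSize_mk l
  have hszR : classSize P r R = b := h.classSize_mk s
  -- `G` numbers the two substrips, and is constant in the classes that are not cut. `F` gives the
  -- last `n` positions of the class of `s` the labels of the first `n` positions of the class of
  -- `l`; other labels are not changed.
  let G : Quotient r → ℕ → ℕ := fun c p =>
    if c = L then (if p < n then 0 else 1) else if c = R then (if p < b - n then 0 else 1) else 0
  let F : Quotient r → ℕ → Quotient r × ℕ := fun c p =>
    if c = R ∧ b - n ≤ p then (L, p - (b - n)) else (c, p)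
  have hGL : ∀ p, G L p = if p < n then 0 else 1 := fun p => by simp only [G, if_pos]
  have hGR : ∀ p, G R p = if p < b - n then 0 else 1 := fun p => by
    simp only [G, if_neg hLR.symm, if_pos]
  have hGO : ∀ c p, c ≠ L → c ≠ R → G c p = 0 := fun c p h1 h2 => by
    simp only [G, if_neg h1, if_neg h2]
  have hFR : ∀ p, b - n ≤ p → F R p = (L, p - (b - n)) := fun p h1 => by
    simp only [F, if_pos (And.intro rfl h1)]
  have hFR' : ∀ p, p < b - n → F R p = (R, p) := fun p h1 => by
    simp only [F, if_neg (fun h' : R = R ∧ b - n ≤ p => absurd h'.2 (not_le.2 h1))]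
  have hFO : ∀ c p, c ≠ R → F c p = (c, p) := fun c p h1 => by
    simp only [F, if_neg (fun h' : c = R ∧ b - n ≤ p => h1 h'.1)]
  have hF : ∀ {c p c' p'}, F c p = F c' p' → (c = c' ∧ p = p') ∨
      (c = R ∧ c' = L ∧ b - n ≤ p ∧ p' = p - (b - n)) ∨
      (c = L ∧ c' = R ∧ b - n ≤ p' ∧ p = p' - (b - n)) := by
    intro c p c' p' hf
    simp only [F] at hf
    split_ifs at hf with h1 h2 h2 <;> rw [Prod.ext_iff] at hf <;> simp only at hf
    · left
      exact ⟨h1.1.trans h2.1.symm, by omega⟩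
    · right; left
      exact ⟨h1.1, hf.1.symm, h1.2, hf.2.symm⟩
    · right; right
      exact ⟨hf.1, h2.1, h2.2, hf.2⟩
    · left
      exact hf
  have hFc : ∀ {c p p'}, F c p = F c p' → p = p' := by
    intro c p p' hf
    rcases hF hf with h' | h' | h'
    · exact h'.2
    · exact absurd (h'.2.1.symm.trans h'.1) hLR
    · exact absurd (h'.1.symm.trans h'.2.1) hLR
  refine ⟨G, F, h.isLabelled_refine _ (fun S hS => ((h.mem_next hY).1 hS).1) G F (classSize P r) h.classSize_mk
    ?_ (fun c p p' _ _ _ => hFc) ?_ ?_ ?_ ?_ ?_⟩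
  · intro c p p' hpp _
    simp only [G]
    split_ifs <;> omega
  · intro c c' p q p' hp hq hp' hg hf
    rcases hF hf with ⟨rfl, rfl⟩ | ⟨rfl, rfl, h1, rfl⟩ | ⟨rfl, rfl, h1, rfl⟩
    · exact ⟨q, hq, hg.symm, rfl⟩
    · rw [hGR, hGR] at hg
      rw [hszR] at hp hq
      rw [hszL]
      have hq' : b - n ≤ q := by
        split_ifs at hg <;> omega
      refine ⟨q - (b - n), by omega, ?_, ?_⟩
      · rw [hGL, hGL, if_pos (by omega), if_pos (by omega)]
      · rw [hFR _ hq', hFO _ _ hLR]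
    · rw [hszR] at hp' ⊢
      rw [hszL] at hp hq
      rw [hGL, hGL] at hg
      have hq' : q < n := by
        rw [if_pos (by omega)] at hg
        split_ifs at hg; omega
      refine ⟨q + (b - n), by omega, ?_, ?_⟩
      · rw [hGR, hGR, if_neg (by omega), if_neg (by omega)]
      · rw [hFR _ (by omega), hFO _ _ hLR, Nat.add_sub_cancel]
  · intro c c' p q p' q' hp hq hp' hq' hg hg' hf hf' hlt
    rcases hF hf with ⟨rfl, rfl⟩ | ⟨rfl, rfl, h1, rfl⟩ | ⟨rfl, rfl, h1, rfl⟩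
    · rwa [← hFc hf']
    · rcases hF hf' with ⟨h2, -⟩ | ⟨-, -, h2, rfl⟩ | ⟨h2, -⟩
      · exact absurd h2.symm hLR
      · omega
      · exact absurd h2.symm hLR
    · rcases hF hf' with ⟨h2, -⟩ | ⟨h2, -⟩ | ⟨-, -, h2, rfl⟩
      · exact absurd h2 hLR
      · exact absurd h2 hLR
      · omega
  · intro S hS x y hxy hg
    have hcomm := (mul_upperRight_eq_iff hna hnb hE _ _).1 (h.block_comm_of_mem_next hY hadd hS)
    have hx := pos_lt (P := P) x
    have hy := pos_lt (P := P) y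
    rw [← hxy] at hy
    rw [← h.classSize_mk] at hx hy
    by_cases hcL : Quotient.mk r (P.strip x) = L
    · rw [hcL, hszL] at hx hy
      rw [hcL, hGL, hGL] at hg
      rw [h.apply_eq_block hS.1 hxy hcL hx hy]
      refine hcomm.2.1 _ _ ?_ ?_ <;> simp only <;> split_ifs at hg <;> omega
    · by_cases hcR : Quotient.mk r (P.strip x) = R
      · rw [hcR, hszR] at hx hy
        rw [hcR, hGR, hGR] at hg
        rw [h.apply_eq_block hS.1 hxy hcR hx hy]
        refine hcomm.2.2 _ _ ?_ ?_ <;> simp only <;> split_ifs at hg <;> omega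
      · rw [hGO _ _ hcL hcR, hGO _ _ hcL hcR] at hg
        exact absurd hg (lt_irrefl _)
  · intro S hS
    have hcomm := (mul_upperRight_eq_iff hna hnb hE _ _).1 (h.block_comm_of_mem_next hY hadd hS)
    have key : ∀ x y x' y', P.strip x = P.strip y → P.strip x' = P.strip y' →
        Quotient.mk r (P.strip x) = R → Quotient.mk r (P.strip x') = L → b - n ≤ P.pos x →
        b - n ≤ P.pos y → P.pos x' = P.pos x - (b - n) → P.pos y' = P.pos y - (b - n) →
        S x y = S x' y' := by
      intro x y x' y' e1 e2 e3 e4 e5 e6 e7 e8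
      have hx := pos_lt (P := P) x
      have hy := pos_lt (P := P) y
      rw [← e1] at hy
      rw [← h.classSize_mk, e3, hszR] at hx hy
      have hx' : P.pos x' < a := by omega
      have hy' : P.pos y' < a := by omega
      rw [h.apply_eq_block hS.1 e1 e3 hx hy, h.apply_eq_block hS.1 e2 e4 hx' hy',
        hcomm.1 _ _ (by simp only; omega) (by simp only; omega)]
      exact congr (congrArg (P.block S s s) (Fin.ext (show P.pos x = P.pos x' + (b - n) by omega)))
        (Fin.ext (show P.pos y = P.pos y' + (b - n) by omega))
    intro x y x' y' e1 e2 hg hg' hf hf'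
    rcases hF hf with ⟨h1, h2⟩ | ⟨h1, h2, h3, h4⟩ | ⟨h1, h2, h3, h4⟩
    · rw [h1] at hf'
      exact h.apply_eq hS.1 e1 e2 (Quotient.exact h1) h2 (hFc hf')
    · rcases hF hf' with ⟨h5, -⟩ | ⟨-, -, h5, h6⟩ | ⟨h5, -⟩
      · exact absurd (h2.symm.trans (h5.symm.trans h1)) hLR
      · exact key x y x' y' e1 e2 h1 h2 h3 h5 h4 h6
      · exact absurd (h5.symm.trans h1) hLR
    · rcases hF hf' with ⟨h5, -⟩ | ⟨h5, -⟩ | ⟨-, -, h5, h6⟩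
      · exact absurd (h1.symm.trans (h5.trans h2)) hLR
      · exact absurd (h1.symm.trans h5) hLR
      · exact (key x' y' x y e2 e1 h2 h1 h3 h5 h4 h6).symm
  · intro u hu y z hu0 hone hzer
    refine ⟨hu, ?_⟩
    rw [block_diag_mul hu0, block_mul_diag hu0, mul_upperRight_eq_iff hna hnb hE]
    have hst : ∀ i (p : Fin (P.size i)), Quotient.mk r (P.strip (P.equiv (toLex ⟨i, p⟩))) =
        Quotient.mk r i := fun i p => by rw [strip_equiv]
    refine ⟨fun p j hj hp => ?_, fun p j hj hp => ?_, fun p q hp hq => ?_⟩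
    · rw [block_apply, block_apply]
      by_cases hc : F L p = y ∧ F L j = z
      · rw [hone, hone]
        · rw [strip_equiv, strip_equiv]
        · rw [hst, pos_equiv, pos_equiv, hGR, hGR, if_neg, if_neg] <;> simp only <;> omega
        · rw [hst, pos_equiv, hFR _ (by simp only; omega), ← hc.1, hFO _ _ hLR]
          simp
        · rw [hst, pos_equiv, hFR _ (by simp only; omega), ← hc.2, hFO _ _ hLR]
          simp
        · rw [strip_equiv, strip_equiv]
        · rw [hst, pos_equiv, pos_equiv, hGL, hGL, if_pos hp, if_pos hj]
        · rw [hst, pos_equiv]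
          exact hc.1
        · rw [hst, pos_equiv]
          exact hc.2
      · rw [hzer, hzer]
        · rw [strip_equiv, strip_equiv]
        · rw [hst, pos_equiv, pos_equiv]
          rintro ⟨-, h1, h2⟩
          rw [hFR _ (by simp only; omega)] at h1 h2
          refine hc ⟨?_, ?_⟩
          · rw [← h1, hFO _ _ hLR]
            simp
          · rw [← h2, hFO _ _ hLR]
            simp
        · rw [strip_equiv, strip_equiv]
        · rw [hst, pos_equiv, pos_equiv]
          rintro ⟨-, h1, h2⟩
          exact hc ⟨h1, h2⟩
    · rw [block_apply, hzer]
      · rw [strip_equiv, strip_equiv]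
      · rintro ⟨h1, -⟩
        rw [hst, pos_equiv, pos_equiv, hGL, hGL, if_neg (not_lt.2 hp), if_pos hj] at h1
        omega
    · rw [block_apply, hzer]
      · rw [strip_equiv, strip_equiv]
      · rintro ⟨h1, -⟩
        rw [hst, pos_equiv, pos_equiv, hGR, hGR, if_neg (not_lt.2 hp), if_pos hq] at h1
        omega

end IsReducedAlgebra

/-! ### The algebra after a reduction to a Weyr matrix. -/

namespace IsReducedAlgebra

open StripPartition

variable {k : Type u} [Field k] {ι : Type} [Fintype ι] [LinearOrder ι] {P : StripPartition ι}
  {r : Setoid (Fin P.count)} {Lam : Set (Matrix ι ι k)}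

theorem block_eq_submatrix (h : IsReducedAlgebra P r Lam) {S : Matrix ι ι k} (hS : S ∈ Lam)
    {l s : Fin P.count} (hls : r l s) (hsz : P.size l = P.size s) :
    P.block S l l = (P.block S s s).submatrix (Fin.cast hsz) (Fin.cast hsz) := by
  ext p q
  rw [Matrix.submatrix_apply, block_apply, block_apply]
  refine h.apply_eq hS ?_ ?_ ?_ ?_ ?_ <;> simp [hls]

/-- Equivalent strips carry the same diagonal block, so the intertwining condition becomes
commutation with one square matrix. -/
theorem mul_block_eq_iff (h : IsReducedAlgebra P r Lam) {S : Matrix ι ι k} (hS : S ∈ Lam)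
    {l s : Fin P.count} (hls : r l s) (hsz : P.size l = P.size s)
    (E : Matrix (Fin (P.size l)) (Fin (P.size s)) k) :
    P.block S l l * E = E * P.block S s s ↔
      E.submatrix id (Fin.cast hsz) * P.block S l l = P.block S l l * E.submatrix id (Fin.cast hsz) := by
  rw [h.block_eq_submatrix hS hls hsz]
  have hb : Function.Bijective (Fin.cast hsz) := (finCongr hsz).bijective
  have h1 : E.submatrix id (Fin.cast hsz) * (P.block S s s).submatrix (Fin.cast hsz) (Fin.cast hsz) =
      (E * P.block S s s).submatrix id (Fin.cast hsz) :=
    Matrix.submatrix_mul_equiv E (P.block S s s) id (finCongr hsz) (Fin.cast hsz)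
  have h2 : (P.block S s s).submatrix (Fin.cast hsz) (Fin.cast hsz) * E.submatrix id (Fin.cast hsz) =
      ((P.block S s s).submatrix (Fin.cast hsz) (Fin.cast hsz) * E).submatrix id (Fin.cast hsz) := by
    ext p q
    rfl
  rw [h1, h2]
  constructor
  · intro h'
    rw [h']
  · intro h'
    ext p q
    obtain ⟨q, rfl⟩ := hb.2 q
    exact (congrFun (congrFun h' p) q).symm

-- A matrix commuting with a Weyr matrix is block triangular with respect to eigenvalues and strips,
-- and inside a strip with respect to the lengths of chains (`lam_eq`, `strip_le`,
-- `length_le_of_apply_ne_zero`). Its diagonal blocks repeat along the chains (`apply_eq_apply`). So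
-- a new strip collects the rows with the same eigenvalue, strip and chain length, and rows of one
-- chain correspond to each other.
open Classical in
theorem exists_isLabelled_next_of_weyr [Infinite k] [LinearOrder k] (h : IsReducedAlgebra P r Lam)
    {Y : Matrix ι ι k} {l s : Fin P.count} (hY : PrecedingStable P Lam Y l s)
    (hadd : NoAddition P Lam Y l s) (hls : r l s) (hsz : P.size l = P.size s)
    (hW : IsWeyr ((P.block Y l s).submatrix id (Fin.cast hsz))) :
    ∃ (G : Quotient r → ℕ → Lex (k × Lex (ℕ × ℕᵒᵈ))) (F : Quotient r → ℕ → (k × ℕ) ⊕ (Quotient r × ℕ)),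
      IsLabelled (h.next hY)
      (fun x => toLex (P.strip x, G (Quotient.mk r (P.strip x)) (P.pos x)))
      fun x => F (Quotient.mk r (P.strip x)) (P.pos x) := by
  obtain ⟨lam, j, q, m, hc, hW⟩ := hW.exists_coord
  let N := P.size l
  let L := Quotient.mk r l
  have hszL : classSize P r L = N := h.classSize_mk l
  let len := IsWeyrCoord.length lam q
  -- The order dual puts longer chains first, in agreement with the order of rows. Classes other
  -- than that of `l` are not cut and receive a constant; in `F` the sum type keeps their labels
  -- apart from the labels of chains.
  let G : Quotient r → ℕ → Lex (k × Lex (ℕ × ℕᵒᵈ)) := fun c p =>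
    if h : c = L ∧ p < N then
      toLex (lam ⟨p, h.2⟩, toLex (j ⟨p, h.2⟩, OrderDual.toDual (len ⟨p, h.2⟩))) else toLex (0, toLex (0, 0))
  let F : Quotient r → ℕ → (k × ℕ) ⊕ (Quotient r × ℕ) := fun c p =>
    if h : c = L ∧ p < N then Sum.inl (lam ⟨p, h.2⟩, q ⟨p, h.2⟩) else Sum.inr (c, p)
  have hGL : ∀ p (hp : p < N), G L p =
      toLex (lam ⟨p, hp⟩, toLex (j ⟨p, hp⟩, OrderDual.toDual (len ⟨p, hp⟩))) := fun p hp => by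
    simp only [G, dif_pos (And.intro rfl hp)]
  have hGO : ∀ c p, c ≠ L → G c p = toLex (0, toLex (0, 0)) := fun c p h1 => by
    simp only [G, dif_neg (fun h' : c = L ∧ p < N => h1 h'.1)]
  have hFL : ∀ p (hp : p < N), F L p = Sum.inl (lam ⟨p, hp⟩, q ⟨p, hp⟩) := fun p hp => by
    simp only [F, dif_pos (And.intro rfl hp)]
  have hFO : ∀ c p, c ≠ L → F c p = Sum.inr (c, p) := fun c p h1 => by
    simp only [F, dif_neg (fun h' : c = L ∧ p < N => h1 h'.1)]
  have hFL' : ∀ {p p'} (hp : p < N) (hp' : p' < N), F L p = F L p' →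
      lam ⟨p, hp⟩ = lam ⟨p', hp'⟩ ∧ q ⟨p, hp⟩ = q ⟨p', hp'⟩ := by
    intro p p' hp hp' hf
    rwa [hFL _ hp, hFL _ hp', Sum.inl.injEq, Prod.ext_iff] at hf
  have hGL' : ∀ {p p'} (hp : p < N) (hp' : p' < N), G L p = G L p' ↔
      lam ⟨p, hp⟩ = lam ⟨p', hp'⟩ ∧ j ⟨p, hp⟩ = j ⟨p', hp'⟩ ∧ len ⟨p, hp⟩ = len ⟨p', hp'⟩ := by
    intro p p' hp hp'
    rw [hGL _ hp, hGL _ hp', toLex_inj, Prod.ext_iff, toLex_inj, Prod.ext_iff, OrderDual.toDual_inj]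
  have hF : ∀ {c p c' p'}, p < classSize P r c → p' < classSize P r c' → F c p = F c' p' →
      (c = L ∧ c' = L) ∨ (c ≠ L ∧ c = c' ∧ p = p') := by
    intro c p c' p' hp hp' hf
    by_cases hcL : c = L
    · left
      refine ⟨hcL, ?_⟩
      by_contra hcL'
      subst hcL
      rw [hszL] at hp
      rw [hFL _ hp, hFO _ _ hcL'] at hf
      exact absurd hf (by simp)
    · right
      refine ⟨hcL, ?_⟩
      by_cases hcL' : c' = L
      · subst hcL'
        rw [hszL] at hp'
        rw [hFL _ hp', hFO _ _ hcL] at hf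
        exact absurd hf (by simp)
      · rw [hFO _ _ hcL, hFO _ _ hcL', Sum.inr.injEq, Prod.ext_iff] at hf
        exact hf
  have hmemL : ∀ {x y}, P.strip x = P.strip y → Quotient.mk r (P.strip x) = L →
      P.pos x < N ∧ P.pos y < N := by
    intro x y hxy hx
    have h1 := pos_lt (P := P) x
    have h2 := pos_lt (P := P) y
    rw [← hxy] at h2
    rw [← h.classSize_mk, hx, hszL] at h1 h2
    exact ⟨h1, h2⟩
  have hcomm : ∀ S ∈ h.next hY, weyrMatrix lam j q * P.block S l l =
      P.block S l l * weyrMatrix lam j q := by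
    intro S hS
    rw [← hW]
    exact (h.mul_block_eq_iff hS.1 hls hsz _).1 (h.block_comm_of_mem_next hY hadd hS)
  refine ⟨G, F, h.isLabelled_refine _ (fun S hS => ((h.mem_next hY).1 hS).1) G F (classSize P r)
    h.classSize_mk ?_ ?_ ?_ ?_ ?_ ?_ ?_⟩
  · intro c p p' hpp hp'
    by_cases hcL : c = L
    · subst hcL
      rw [hszL] at hp'
      have hp : p < N := by omega
      rw [hGL _ hp, hGL _ hp', Prod.Lex.toLex_le_toLex]
      have h1 := hc.strictMono.monotone (show (⟨p, hp⟩ : Fin N) ≤ ⟨p', hp'⟩ from hpp)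
      rw [Prod.Lex.toLex_le_toLex] at h1
      rcases h1 with h1 | ⟨h1, h2⟩
      · exact Or.inl h1
      · refine Or.inr ⟨h1, ?_⟩
        rw [Prod.Lex.toLex_le_toLex] at h2 ⊢
        rcases h2 with h2 | ⟨h2, h3⟩
        · exact Or.inl h2
        · exact Or.inr ⟨h2, OrderDual.toDual_le_toDual.2 (hc.length_anti h1 h3)⟩
    · rw [hGO _ _ hcL, hGO _ _ hcL]
  · intro c p p' hp hp' hg hf
    rcases hF hp hp' hf with ⟨rfl, -⟩ | h'
    · rw [hszL] at hp hp'
      obtain ⟨h1, h2⟩ := hFL' hp hp' hf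
      obtain ⟨-, h3, -⟩ := (hGL' hp hp').1 hg
      exact congrArg Fin.val (hc.ext h1 h3 h2)
    · exact h'.2.2
  · intro c c' p q' p' hp hq hp' hg hf
    rcases hF hp hp' hf with ⟨rfl, rfl⟩ | ⟨h1, rfl, rfl⟩
    · rw [hszL] at hp hp' hq
      obtain ⟨h1, h2⟩ := hFL' hp hp' hf
      obtain ⟨g1, g2, g3⟩ := (hGL' hp hq).1 hg
      -- The chain of `q'` is as long as that of `p'`, so it reaches the strip of `p'`.
      have hlt : q ⟨q', hq⟩ < m (lam ⟨q', hq⟩) (j ⟨p', hp'⟩) := by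
        rw [← hc.lt_length_iff]
        change _ < len _
        rw [← g3, show len ⟨p, hp⟩ = len ⟨p', hp'⟩ from IsWeyrCoord.length_eq_of_eq h1 h2]
        exact (hc.lt_length_iff _ _).2 (hc.lt _)
      obtain ⟨⟨x, hx⟩, e1, e2, e3⟩ := hc.exists_of_lt hlt
      refine ⟨x, by rwa [hszL], (hGL' hx hp').2 ⟨?_, e2, ?_⟩, ?_⟩
      · rw [e1, ← g1, h1]
      · rw [show len ⟨x, hx⟩ = len ⟨q', hq⟩ from IsWeyrCoord.length_eq_of_eq e1 e3, ← g3]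
        exact IsWeyrCoord.length_eq_of_eq h1 h2
      · rw [hFL _ hx, hFL _ hq, e1, e3]
    · exact ⟨q', hq, hg.symm, rfl⟩
  · intro c c' p q1 p' q1' hp hq hp' hq' hg hg' hf hf' hlt
    rcases hF hp hp' hf with ⟨rfl, rfl⟩ | ⟨h1, rfl, rfl⟩
    · rw [hszL] at hp hp' hq hq'
      obtain ⟨h1, h2⟩ := hFL' hp hp' hf
      obtain ⟨h3, h4⟩ := hFL' hq hq' hf'
      obtain ⟨g1, g2, -⟩ := (hGL' hp hq).1 hg
      obtain ⟨g1', g2', -⟩ := (hGL' hp' hq').1 hg'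
      have h5 := hc.strictMono (show (⟨p, hp⟩ : Fin N) < ⟨q1, hq⟩ from hlt)
      beta_reduce at h5
      rw [g1, g2, Prod.Lex.toLex_lt_toLex] at h5
      have h6 := h5.resolve_left (lt_irrefl _)
      have h7 := (Prod.Lex.toLex_lt_toLex.1 h6.2).resolve_left (lt_irrefl _)
      have h8 : q ⟨p', hp'⟩ < q ⟨q1', hq'⟩ := by
        rw [← h2, ← h4]
        exact h7.2
      have h9 : (⟨p', hp'⟩ : Fin N) < ⟨q1', hq'⟩ := by
        rw [← hc.strictMono.lt_iff_lt]
        rw [g1', g2', Prod.Lex.toLex_lt_toLex]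
        refine Or.inr ⟨rfl, ?_⟩
        rw [Prod.Lex.toLex_lt_toLex]
        exact Or.inr ⟨rfl, h8⟩
      exact h9
    · rcases hF hq hq' hf' with ⟨h2, -⟩ | ⟨-, -, rfl⟩
      · exact absurd h2 h1
      · exact hlt
  · intro S hS x y hxy hg
    by_cases hcL : Quotient.mk r (P.strip x) = L
    · obtain ⟨hx, hy⟩ := hmemL hxy hcL
      rw [h.apply_eq_block hS.1 hxy hcL hx hy]
      by_contra hne
      have h1 := hc.lam_eq hc (hcomm S hS) hne
      have h2 := hc.strip_le hc (hcomm S hS) hne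
      rw [hcL, hGL _ hx, hGL _ hy] at hg
      refine absurd hg (not_lt.2 ?_)
      rw [Prod.Lex.toLex_le_toLex]
      refine Or.inr ⟨h1, ?_⟩
      rw [Prod.Lex.toLex_le_toLex]
      rcases h2.lt_or_eq with h3 | h3
      · exact Or.inl h3
      · exact Or.inr ⟨h3, OrderDual.toDual_le_toDual.2
          (hc.length_le_of_apply_ne_zero (hcomm S hS) h3 hne)⟩
    · rw [hGO _ _ hcL, hGO _ _ hcL] at hg
      exact absurd hg (lt_irrefl _)
  · intro S hS x y x' y' e1 e2 hg hg' hf hf'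
    have b1 := pos_lt (P := P) x
    have b2 := pos_lt (P := P) y
    have b3 := pos_lt (P := P) x'
    have b4 := pos_lt (P := P) y'
    rw [← e1] at b2
    rw [← e2] at b4
    rw [← h.classSize_mk] at b1 b2 b3 b4
    rcases hF b1 b3 hf with ⟨h1, h2⟩ | ⟨h1, h2, h3⟩
    · obtain ⟨hx, hy⟩ := hmemL e1 h1
      obtain ⟨hx', hy'⟩ := hmemL e2 h2
      rw [h1, h2] at hf hf'
      rw [h1] at hg
      rw [h2] at hg'
      obtain ⟨f1, f2⟩ := hFL' hx hx' hf
      obtain ⟨f3, f4⟩ := hFL' hy hy' hf'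
      obtain ⟨g1, g2, -⟩ := (hGL' hx hy).1 hg
      obtain ⟨g1', g2', -⟩ := (hGL' hx' hy').1 hg'
      rw [h.apply_eq_block hS.1 e1 h1 hx hy, h.apply_eq_block hS.1 e2 h2 hx' hy']
      exact hc.apply_eq_apply hc (hcomm S hS) g1' g2' g2 f1 f2 f3 f4
    · rcases hF b2 b4 hf' with ⟨h4, -⟩ | ⟨-, -, h4⟩
      · exact absurd h4 h1
      · exact h.apply_eq hS.1 e1 e2 (Quotient.exact h2) h3 h4
  · intro u hu y z hu0 hone hzer
    refine ⟨hu, ?_⟩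
    rw [block_diag_mul hu0, block_mul_diag hu0, h.mul_block_eq_iff hu hls hsz, hW]
    have hst : ∀ (p : Fin N), Quotient.mk r (P.strip (P.equiv (toLex ⟨l, p⟩))) = L :=
      fun p => by rw [strip_equiv]
    by_cases hyz : ∃ y' z', y = Sum.inl y' ∧ z = Sum.inl z'
    · obtain ⟨y, z, rfl, rfl⟩ := hyz
      refine hc.commute_of_apply_eq (y := y) (z := z) ?_ ?_
      · intro p p' h1 h2 h3 h4 h5
        rw [block_apply]
        refine hone _ _ ?_ ?_ ?_ ?_
        · rw [strip_equiv, strip_equiv]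
        · rw [hst, pos_equiv, pos_equiv, hGL' p.2 p'.2]
          exact ⟨h1, h2, h3⟩
        · rw [hst, pos_equiv, hFL _ p.2]
          exact congrArg _ h4
        · rw [hst, pos_equiv, hFL _ p'.2]
          exact congrArg _ h5
      · intro p p' hn
        rw [block_apply]
        refine hzer _ _ ?_ fun h' => hn ?_
        · rw [strip_equiv, strip_equiv]
        · rw [hst, pos_equiv, pos_equiv, hGL' p.2 p'.2, hFL _ p.2, hFL _ p'.2, Sum.inl.injEq,
            Sum.inl.injEq] at h'
          exact ⟨h'.1.1, h'.1.2.1, h'.1.2.2, h'.2.1, h'.2.2⟩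
    · have h0 : P.block u l l = 0 := by
        ext p p'
        rw [block_apply]
        refine hzer _ _ ?_ fun h' => hyz ?_
        · rw [strip_equiv, strip_equiv]
        · rw [hst, pos_equiv, pos_equiv, hFL _ p.2, hFL _ p'.2] at h'
          exact ⟨_, _, h'.2.1.symm, h'.2.2.symm⟩
      rw [h0, Matrix.mul_zero, Matrix.zero_mul]

end IsReducedAlgebra

/-! ### Steps of the algorithm and its termination. -/

namespace IsReducedAlgebra

open StripPartition

variable {k : Type u} [Field k] {ι : Type} [Fintype ι] [LinearOrder ι] {P : StripPartition ι}
  {r : Setoid (Fin P.count)} {Lam : Set (Matrix ι ι k)}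

/-- A first nonstable block can be reduced, and the reduction makes the algebra smaller. -/
theorem exists_belitskiiStep_of_isFirstNonstable [IsAlgClosed k] [LinearOrder k]
    (h : IsReducedAlgebra P r Lam) {M : Matrix ι ι k} {l s : Fin P.count}
    (hM : IsFirstNonstable P Lam M l s) :
    ∃ (Y : Matrix ι ι k) (Lam' : Set (Matrix ι ι k)) (P' : StripPartition ι) (r' : Setoid (Fin P'.count)),
      BelitskiiStep (M, Lam) (Y, Lam') ∧ IsReducedAlgebra P' r' Lam' ∧ Lam' ⊂ Lam := by
  have : Infinite k := IsAlgClosed.instInfinite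
  have hp : PrecedingStable P Lam M l s := hM.2
  have hsim : ∀ {S : Matrix ι ι k}, IsUnit S → M * S = S * (S⁻¹ * M * S) := by
    intro S hu
    rw [← Matrix.mul_assoc, ← Matrix.mul_assoc,
      Matrix.mul_nonsing_inv _ ((Matrix.isUnit_iff_isUnit_det S).1 hu), Matrix.one_mul]
  by_cases hadd : NoAddition P Lam M l s
  · -- the block is reduced by block-diagonal matrices
    have hfin : ∀ S ∈ Lam, IsUnit S → ((¬ r l s ∧ IsUpperRightIdentity (P.block (S⁻¹ * M * S) l s)) ∨
        (r l s ∧ ∃ h : P.size l = P.size s,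
          IsWeyr ((P.block (S⁻¹ * M * S) l s).submatrix id (Fin.cast h)))) →
        ∃ (Y : Matrix ι ι k) (Lam' : Set (Matrix ι ι k)) (P' : StripPartition ι)
          (r' : Setoid (Fin P'.count)),
          BelitskiiStep (M, Lam) (Y, Lam') ∧ IsReducedAlgebra P' r' Lam' ∧ Lam' ⊂ Lam := by
      intro S hS hu hor
      have hMY : LamSimilar Lam M (S⁻¹ * M * S) := ⟨S, hS, hu, rfl⟩
      have hY := hp.of_similar h hMY
      have hadd' : NoAddition P Lam (S⁻¹ * M * S) l s := by
        rw [noAddition_iff] at hadd ⊢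
        intro T hT
        rw [hp.addition_eq hMY, hadd T hT]
      have hns : ¬ IsStableBlock P Lam (S⁻¹ * M * S) l s := fun h' =>
        hM.1 ((isStableBlock_iff_of_similar (Lam := h.toSubalgebra) hMY).2 h')
      have hred : ∃ (P' : StripPartition ι) (r' : Setoid (Fin P'.count)),
          IsReducedAlgebra P' r' (h.next hY : Set (Matrix ι ι k)) := by
        rcases hor with ⟨hls, hE⟩ | ⟨hls, hsz, hW⟩
        · obtain ⟨G, F, hl⟩ := h.exists_isLabelled_next_of_upperRight hY hadd' hls hE
          exact hl.exists_isReducedAlgebra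
        · obtain ⟨G, F, hl⟩ := h.exists_isLabelled_next_of_weyr hY hadd' hls hsz hW
          exact hl.exists_isReducedAlgebra
      obtain ⟨P', r', hr⟩ := hred
      obtain ⟨T, hT, hT'⟩ := h.exists_next_ne_of_noAddition hY hns hadd'
      refine ⟨S⁻¹ * M * S, h.next hY, P', r', ⟨P, r, l, s, h, hM, ⟨S, hS, hu, rfl, ?_⟩, rfl⟩, hr,
        fun A hA => hA.1, fun hsub => hT' (hsub hT)⟩
      rcases hor with h' | h'
      · exact Or.inr (Or.inl ⟨hadd, h'⟩)
      · exact Or.inr (Or.inr ⟨hadd, h'⟩)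
    have hblk : ∀ S ∈ Lam, IsUnit S →
        P.block S l l * P.block (S⁻¹ * M * S) l s = P.block M l s * P.block S s s := by
      intro S hS hu
      rw [hp.mul_block h hS hu (hsim hu), noAddition_iff.1 hadd S hS, add_zero]
    by_cases hls : r l s
    · have hsz := h.size_eq hls
      -- The same `T` stands in the equivalent strips `l` and `s`, so the block undergoes a
      -- similarity.
      obtain ⟨T, hT, hW⟩ := exists_isWeyr ((P.block M l s).submatrix id (Fin.cast hsz))
      have hTd := (Matrix.isUnit_iff_isUnit_det T).1 hT
      have hS := h.unitExt_mem l T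
      have hu := h.isUnit_unitExt hT
      refine hfin _ hS hu (Or.inr ⟨hls, hsz, ?_⟩)
      have h1 := hblk _ hS hu
      rw [block_unitExt_self, block_unitExt l T (r.symm hls) hsz.symm] at h1
      convert hW using 1
      have h2 : (P.block M l s).submatrix id (Fin.cast hsz) * T =
          T * (P.block ((unitExt P r l T)⁻¹ * M * unitExt P r l T) l s).submatrix id (Fin.cast hsz) := by
        have h3 : T * (P.block ((unitExt P r l T)⁻¹ * M * unitExt P r l T) l s).submatrix id
            (Fin.cast hsz) = (T * P.block ((unitExt P r l T)⁻¹ * M * unitExt P r l T) l s).submatrix id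
            (Fin.cast hsz) := by
          ext p q
          rfl
        rw [h3, h1]
        have h4 := Matrix.submatrix_mul_equiv (P.block M l s)
          (T.submatrix (Fin.cast hsz.symm) (Fin.cast hsz.symm)) id (finCongr hsz) (Fin.cast hsz)
        exact h4
      rw [Matrix.mul_assoc T⁻¹, h2, ← Matrix.mul_assoc, Matrix.nonsing_inv_mul _ hTd, Matrix.one_mul]
    · obtain ⟨U, V, hU, hV, hE⟩ := exists_isUpperRightIdentity (P.block M l s)
      have hUd := (Matrix.isUnit_iff_isUnit_det U).1 hU
      have hsl : ¬ r s l := fun h' => hls (r.symm h')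
      -- The strips are in different classes, so `U` and `V` can be chosen independently.
      have hS : unitExt P r l U * unitExt P r s V ∈ Lam := h.1 _ (h.unitExt_mem l U) _ (h.unitExt_mem s V)
      have hu := (h.isUnit_unitExt hU).mul (h.isUnit_unitExt hV)
      refine hfin _ hS hu (Or.inl ⟨hls, ?_⟩)
      have h1 := hblk _ hS hu
      rw [block_diag_mul (fun a b => unitExt_apply_of_ne l U), block_diag_mul
        (fun a b => unitExt_apply_of_ne l U), block_unitExt_self, block_unitExt_self,
        block_unitExt_of_not_rel s V hls, block_unitExt_of_not_rel l U hsl, Matrix.mul_one,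
        Matrix.one_mul] at h1
      convert hE using 1
      rw [Matrix.mul_assoc U⁻¹, ← h1, ← Matrix.mul_assoc U⁻¹, Matrix.nonsing_inv_mul _ hUd, Matrix.one_mul]
  -- The addition produced by `S` cancels the block, and `1 + S` has identity diagonal blocks.
  · obtain ⟨S, hS, h0, hSA⟩ := h.exists_addition_eq hp hadd (-P.block M l s)
    have h1S : 1 + S ∈ Lam := h.toSubalgebra.add_mem h.toSubalgebra.one_mem hS
    have hu := h.isUnit_one_add hS h0
    have hdiag : ∀ i, P.block (1 + S) i i = 1 := by
      intro i
      have h1 : P.block (1 + S) i i = P.block 1 i i + P.block S i i := rfl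
      have h2 : P.block S i i = 0 := by
        ext p q
        rw [block_apply, h0]
        · rfl
        · rw [strip_equiv, strip_equiv]
      rw [h1, h2, add_zero, block_one]
    have h1 : addition P M l s (1 + S) = -P.block M l s := by
      rw [addition_add, hSA, addition_diag, zero_add]
      intro a b hab
      exact Matrix.one_apply_ne fun h' => hab (congrArg _ h')
    have hMY : LamSimilar Lam M ((1 + S)⁻¹ * M * (1 + S)) := ⟨1 + S, h1S, hu, rfl⟩
    have hY := hp.of_similar h hMY
    have hY0 : P.block ((1 + S)⁻¹ * M * (1 + S)) l s = 0 := by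
      have h2 := hp.mul_block h h1S hu (hsim hu)
      rwa [hdiag, hdiag, Matrix.one_mul, Matrix.mul_one, h1, add_neg_cancel] at h2
    obtain ⟨P', r', hr⟩ := (h.isLabelled_next_of_block_eq_zero hY hY0).exists_isReducedAlgebra
    refine ⟨_, h.next hY, P', r', ⟨P, r, l, s, h, hM, ⟨1 + S, h1S, hu, rfl, Or.inl ⟨hadd, hdiag, hY0⟩⟩,
      rfl⟩, hr, fun A hA => hA.1, fun hsub => hadd ?_⟩
    rw [noAddition_iff]
    intro T hT
    -- Since the block is now zero, the condition of `next` is the vanishing of the addition. If all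
    -- elements satisfied it, there would be no additions.
    have h2 := h.block_mul_sub_block_mul hT ((1 + S)⁻¹ * M * (1 + S)) l s
    rw [(hsub hT).2, sub_self, hY0, Matrix.mul_zero, Matrix.zero_mul, sub_zero, zero_add,
      hp.addition_eq hMY] at h2
    exact h2.symm

theorem exists_isFirstNonstable {M N : Matrix ι ι k} (hMN : LamSimilar Lam M N) (hne : N ≠ M) :
    ∃ l s, IsFirstNonstable P Lam M l s := by
  classical
  have h1 : ∃ l s, ¬ IsStableBlock P Lam M l s := by
    by_contra! hc
    apply hne
    ext a b
    obtain ⟨i, p, rfl⟩ := exists_equiv (P := P) a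
    obtain ⟨j, q, rfl⟩ := exists_equiv (P := P) b
    exact congrFun (congrFun (hc i j N hMN) p) q
  obtain ⟨l, s, hls⟩ := h1
  let A : Finset (Lex ((Fin P.count)ᵒᵈ × Fin P.count)) := Finset.univ.filter fun x =>
    ¬ IsStableBlock P Lam M (OrderDual.ofDual (ofLex x).1) (ofLex x).2
  have hA : A.Nonempty := ⟨toLex (OrderDual.toDual l, s), Finset.mem_filter.2 ⟨Finset.mem_univ _, hls⟩⟩
  obtain ⟨x, hx, hmin⟩ := A.exists_min_image id hA
  refine ⟨OrderDual.ofDual (ofLex x).1, (ofLex x).2, (Finset.mem_filter.1 hx).2, fun i j hij => ?_⟩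
  by_contra hns
  have h2 := hmin (toLex (OrderDual.toDual i, j)) (Finset.mem_filter.2 ⟨Finset.mem_univ _, hns⟩)
  refine absurd h2 (not_le.2 ?_)
  change toLex (OrderDual.toDual i, j) < toLex ((ofLex x).1, (ofLex x).2)
  rw [Prod.Lex.toLex_lt_toLex]
  rcases hij with hij | ⟨rfl, hij⟩
  · exact Or.inl hij
  · exact Or.inr ⟨rfl, hij⟩

end IsReducedAlgebra

section CanonicalForm

variable {k : Type u} [Field k] {ι : Type} [Fintype ι] [LinearOrder ι]

theorem BelitskiiStep.lamSimilar [LinearOrder k] {X Y : Matrix ι ι k × Set (Matrix ι ι k)}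
    (h : BelitskiiStep X Y) : LamSimilar X.2 X.1 Y.1 := by
  obtain ⟨P, r, l, s, -, -, ⟨S, hS, hu, hY, -⟩, -⟩ := h
  exact ⟨S, hS, hu, hY.symm⟩

/-- As long as some transformation changes the matrix there is a first nonstable block and a step,
and each step lowers the dimension of the algebra. -/
theorem IsReducedAlgebra.exists_isLamCanonicalForm [IsAlgClosed k] [LinearOrder k]
    {P : StripPartition ι} {r : Setoid (Fin P.count)} {Lam : Set (Matrix ι ι k)}
    (h : IsReducedAlgebra P r Lam) (M : Matrix ι ι k) :
    ∃ N, IsLamCanonicalForm Lam M N ∧ LamSimilar Lam M N := by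
  induction hd : Module.finrank k (Subalgebra.toSubmodule h.toSubalgebra) using Nat.strong_induction_on
    generalizing P Lam M with
  | _ d ih =>
  by_cases hterm : ∀ N', LamSimilar Lam M N' → N' = M
  · exact ⟨M, ⟨Lam, Relation.ReflTransGen.refl, hterm⟩, LamSimilar.refl h.toSubalgebra M⟩
  · push Not at hterm
    obtain ⟨N', hN', hne⟩ := hterm
    obtain ⟨l, s, hls⟩ := IsReducedAlgebra.exists_isFirstNonstable (P := P) hN' hne
    obtain ⟨Y, Lam', P', r', hstep, hred, hlt⟩ := h.exists_belitskiiStep_of_isFirstNonstable hls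
    have hfr : Module.finrank k (Subalgebra.toSubmodule hred.toSubalgebra) < d := by
      rw [← hd]
      exact Submodule.finrank_lt_finrank_of_lt hlt
    obtain ⟨N, ⟨Lam'', hN, hN'⟩, hYN⟩ := ih _ hfr hred Y rfl
    refine ⟨N, ⟨Lam'', Relation.ReflTransGen.head hstep hN, hN'⟩, ?_⟩
    have h1 : LamSimilar Lam M Y := hstep.lamSimilar
    obtain ⟨S, hS, h2⟩ := hYN
    exact LamSimilar.trans (Lam := h.toSubalgebra) h1 ⟨S, hlt.1 hS, h2⟩

end CanonicalForm

/-! ### Independence of the partition, and uniqueness of the reduced block. -/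

theorem IsUpperRightIdentity.of_cast {k : Type u} [Zero k] [One k] {a b a' b' : ℕ} (ha : a = a') (hb : b = b')
    {E : Matrix (Fin a') (Fin b') k}
    (h : IsUpperRightIdentity (E.submatrix (Fin.cast ha) (Fin.cast hb))) : IsUpperRightIdentity E := by
  subst ha hb
  exact h

theorem IsWeyr.of_cast {k : Type u} [Field k] [LinearOrder k] {a b a' b' : ℕ} (ha : a = a') (hb : b = b')
    (h1 : a = b) (h2 : a' = b') {E : Matrix (Fin a') (Fin b') k}
    (h : IsWeyr ((E.submatrix (Fin.cast ha) (Fin.cast hb)).submatrix id (Fin.cast h1))) :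
    IsWeyr (E.submatrix id (Fin.cast h2)) := by
  subst ha hb
  exact h

namespace StripPartition

variable {k : Type u} {ι : Type} [LinearOrder ι] {P : StripPartition ι}

theorem block_eq_block_iff {M N : Matrix ι ι k} {i j : Fin P.count} :
    P.block M i j = P.block N i j ↔ ∀ a b, P.strip a = i → P.strip b = j → M a b = N a b := by
  constructor
  · rintro h a b rfl rfl
    have := congrFun (congrFun h ⟨P.pos a, pos_lt a⟩) ⟨P.pos b, pos_lt b⟩
    rwa [block_apply, block_apply, equiv_strip_pos, equiv_strip_pos] at this
  · intro h
    ext p q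
    exact h _ _ (strip_equiv _ _) (strip_equiv _ _)

theorem block_eq_zero_iff [Zero k] {M : Matrix ι ι k} {i j : Fin P.count} :
    P.block M i j = 0 ↔ ∀ a b, P.strip a = i → P.strip b = j → M a b = 0 :=
  block_eq_block_iff (N := 0)

end StripPartition

theorem isStableBlock_iff_apply {k : Type u} [Field k] {ι : Type} [Fintype ι] [LinearOrder ι]
    {P : StripPartition ι} {Lam : Set (Matrix ι ι k)} {M : Matrix ι ι k} {i j : Fin P.count} :
    IsStableBlock P Lam M i j ↔ ∀ a b, P.strip a = i → P.strip b = j →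
      ∀ N, LamSimilar Lam M N → N a b = M a b := by
  unfold IsStableBlock
  simp only [StripPartition.block_eq_block_iff]
  exact ⟨fun h a b ha hb N hN => h N hN a b ha hb, fun h N hN a b ha hb => h a b ha hb N hN⟩

namespace IsReducedAlgebra

open StripPartition

variable {k : Type u} [Field k] {ι : Type} [Fintype ι] [LinearOrder ι] {P P' : StripPartition ι}
  {r : Setoid (Fin P.count)} {r' : Setoid (Fin P'.count)} {Lam : Set (Matrix ι ι k)}

/-- For two rows of a strip of `P` the algebra contains a unit with a nonzero entry at their place,
and triangularity with respect to `P'` then orders their strips in `P'`; exchanging the rows gives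
equality. So the two partitions differ only in empty strips, and hence possibly in the numbering. -/
theorem strip_eq_of_strip_eq (h : IsReducedAlgebra P r Lam) (h' : IsReducedAlgebra P' r' Lam) {a b : ι}
    (hab : P.strip a = P.strip b) : P'.strip a = P'.strip b := by
  have key : ∀ {a b : ι}, P.strip a = P.strip b → P'.strip a ≤ P'.strip b := by
    intro a b hab
    by_contra hlt
    have h1 := h'.apply_eq_zero (h.isLabelled.unit_mem' hab) (not_le.1 hlt)
    rw [IsLabelled.unit, if_pos ⟨hab, rfl, rfl⟩] at h1
    exact one_ne_zero h1
  exact le_antisymm (key hab) (key hab.symm)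

theorem strip_lt_of_strip_lt (h : IsReducedAlgebra P r Lam) (h' : IsReducedAlgebra P' r' Lam) {a b : ι}
    (hab : P.strip a < P.strip b) : P'.strip a < P'.strip b := by
  have h1 : a < b := lt_iff.2 (Or.inl hab)
  exact lt_of_le_of_ne (strip_mono h1.le) fun he => hab.ne (h'.strip_eq_of_strip_eq h he)

theorem pos_eq_pos (h : IsReducedAlgebra P r Lam) (h' : IsReducedAlgebra P' r' Lam) (a : ι) :
    P.pos a = P'.pos a := by
  rw [pos_eq_card, pos_eq_card]
  congr 1
  ext b
  simp only [Finset.mem_filter, Finset.mem_univ, true_and]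
  exact and_congr_left fun _ => ⟨h.strip_eq_of_strip_eq h', h'.strip_eq_of_strip_eq h⟩

theorem size_strip_eq (h : IsReducedAlgebra P r Lam) (h' : IsReducedAlgebra P' r' Lam) (a : ι) :
    P.size (P.strip a) = P'.size (P'.strip a) := by
  have key : ∀ {P P' : StripPartition ι} {r : Setoid (Fin P.count)} {r' : Setoid (Fin P'.count)},
      IsReducedAlgebra P r Lam → IsReducedAlgebra P' r' Lam →
      P.size (P.strip a) ≤ P'.size (P'.strip a) := by
    intro P P' r r' h h'
    by_contra! hlt
    obtain ⟨b, h1, h2⟩ := exists_of_lt hlt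
    have h3 := pos_lt (P := P') b
    rw [h'.pos_eq_pos h, h2, h.strip_eq_of_strip_eq h' h1] at h3
    exact lt_irrefl _ h3
  exact le_antisymm (key h h') (key h' h)

theorem equiv_eq_equiv (h : IsReducedAlgebra P r Lam) (h' : IsReducedAlgebra P' r' Lam) (a : ι)
    (p : Fin (P.size (P.strip a))) :
    P.equiv (toLex ⟨P.strip a, p⟩) =
      P'.equiv (toLex ⟨P'.strip a, Fin.cast (h.size_strip_eq h' a) p⟩) := by
  refine StripPartition.ext (P := P') ?_ ?_
  · rw [strip_equiv]
    exact h.strip_eq_of_strip_eq h' (strip_equiv _ _)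
  · rw [pos_equiv, h'.pos_eq_pos h, pos_equiv]
    rfl

theorem block_eq_submatrix_cast (h : IsReducedAlgebra P r Lam) (h' : IsReducedAlgebra P' r' Lam) (a b : ι)
    (M : Matrix ι ι k) : P.block M (P.strip a) (P.strip b) =
      (P'.block M (P'.strip a) (P'.strip b)).submatrix (Fin.cast (h.size_strip_eq h' a))
        (Fin.cast (h.size_strip_eq h' b)) := by
  ext p q
  rw [Matrix.submatrix_apply, block_apply, block_apply, h.equiv_eq_equiv h', h.equiv_eq_equiv h']

/-- The unit of `P'` at `a` has the entry `1` at `(a, a)`. Equality of the diagonal blocks for `r`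
forces a nonzero entry at the corresponding row `c`, which by definition of the unit means
equivalence for `r'`. -/
theorem rel_of_rel (h : IsReducedAlgebra P r Lam) (h' : IsReducedAlgebra P' r' Lam) {a b : ι}
    (hab : r (P.strip a) (P.strip b)) : r' (P'.strip a) (P'.strip b) := by
  have hlt := pos_lt (P := P) a
  rw [h.size_eq hab] at hlt
  obtain ⟨c, hc, hpos⟩ := exists_of_lt hlt
  have hbc := h.strip_eq_of_strip_eq h' hc
  rw [← hc] at hab
  rw [← hbc]
  have h1 := h.apply_eq (h'.isLabelled.unit_mem' (c := a) (d := a) rfl) rfl rfl hab hpos.symm hpos.symm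
  have h2 : IsLabelled.unit k P'.strip (fun a => (Quotient.mk r' (P'.strip a), P'.pos a)) a a c c ≠ 0 := by
    rw [← h1, IsLabelled.unit, if_pos ⟨rfl, rfl, rfl⟩]
    exact one_ne_zero
  by_contra hc
  exact h2 (if_neg fun h3 => hc (r'.symm (Quotient.exact (Prod.ext_iff.1 h3.2.1).1)))

/-- The diagonal part of `S` does not enter the additions, and for zero diagonal blocks the two sums
are blocks of products. This form mentions strips only through the relation of lying in one strip,
so it carries over to another partition. -/
theorem noAddition_iff_commute [Infinite k] (h : IsReducedAlgebra P r Lam) {M : Matrix ι ι k} {l s : Fin P.count} :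
    NoAddition P Lam M l s ↔ ∀ S ∈ Lam, (∀ a b, P.strip a = P.strip b → S a b = 0) →
      P.block (M * S) l s = P.block (S * M) l s := by
  have key : ∀ S ∈ Lam, (∀ a b, P.strip a = P.strip b → S a b = 0) →
      P.block (M * S) l s - P.block (S * M) l s = addition P M l s S := by
    intro S hS h0
    have h1 : ∀ i, P.block S i i = 0 := fun i =>
      block_eq_zero_iff.2 fun a b ha hb => h0 a b (ha.trans hb.symm)
    rw [h.block_mul_sub_block_mul hS, h1, h1, Matrix.mul_zero, Matrix.zero_mul, sub_zero, zero_add]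
  rw [noAddition_iff]
  constructor
  · intro hadd S hS h0
    rw [← sub_eq_zero, key S hS h0, hadd S hS]
  · intro hc S hS
    have hD := h.diagPart_mem hS
    have h1 : S - diagPart P S ∈ Lam := h.toSubalgebra.sub_mem hS hD
    have h0 : ∀ a b, P.strip a = P.strip b → (S - diagPart P S) a b = 0 := by
      intro a b hab
      rw [Matrix.sub_apply, diagPart, if_pos hab, sub_self]
    have h2 := key _ h1 h0
    rw [hc _ h1 h0, sub_self] at h2
    have h3 : addition P M l s (diagPart P S) = 0 := addition_diag M l s fun a b hab => if_neg hab
    rw [← sub_add_cancel S (diagPart P S), addition_add, ← h2, h3, add_zero]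

theorem noAddition_of_noAddition [Infinite k] (h : IsReducedAlgebra P r Lam) (h' : IsReducedAlgebra P' r' Lam)
    {M : Matrix ι ι k} {a b : ι} (hadd : NoAddition P Lam M (P.strip a) (P.strip b)) :
    NoAddition P' Lam M (P'.strip a) (P'.strip b) := by
  rw [h.noAddition_iff_commute] at hadd
  rw [h'.noAddition_iff_commute]
  intro S hS h0
  have h1 := hadd S hS fun x y hxy => h0 x y (h.strip_eq_of_strip_eq h' hxy)
  rw [block_eq_block_iff] at h1 ⊢
  exact fun x y hx hy => h1 x y (h'.strip_eq_of_strip_eq h hx) (h'.strip_eq_of_strip_eq h hy)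

/-- The `(l, s)` block of `Y` is the reduced form of the first nonstable block of `X`. -/
def IsReduction [LinearOrder k] (P : StripPartition ι) (r : Setoid (Fin P.count)) (Lam : Set (Matrix ι ι k))
    (X Y : Matrix ι ι k) (l s : Fin P.count) : Prop :=
  IsFirstNonstable P Lam X l s ∧ LamSimilar Lam X Y ∧
    ((¬ NoAddition P Lam X l s ∧ P.block Y l s = 0) ∨
      (NoAddition P Lam X l s ∧ ¬ r l s ∧ IsUpperRightIdentity (P.block Y l s)) ∨
      (NoAddition P Lam X l s ∧ r l s ∧
        ∃ h : P.size l = P.size s, IsWeyr ((P.block Y l s).submatrix id (Fin.cast h))))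

/-- Similar matrices have the same stable blocks and the same additions, so the place and the kind
of reduction agree. Without additions the two reduced blocks are linked by diagonal blocks of an
element of `Lam`, and the uniqueness of the normal forms makes them equal. -/
theorem IsReduction.eq_block [Infinite k] [LinearOrder k] (h : IsReducedAlgebra P r Lam)
    {M N Y Z : Matrix ι ι k} {l s l' s' : Fin P.count} (hMN : LamSimilar Lam M N)
    (hM : IsReduction P r Lam M Y l s) (hN : IsReduction P r Lam N Z l' s') :
    l' = l ∧ s' = s ∧ P.block Z l s = P.block Y l s := by
  obtain ⟨hMf, hMY, hMc⟩ := hM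
  obtain ⟨hNf, hNZ, hNc⟩ := hN
  have hst : ∀ i j, IsStableBlock P Lam M i j ↔ IsStableBlock P Lam N i j := fun i j =>
    isStableBlock_iff_of_similar (Lam := h.toSubalgebra) hMN
  have h1 : ¬ (l < l' ∨ (l' = l ∧ s' < s)) := fun h' => hNf.1 ((hst _ _).1 (hMf.2 _ _ h'))
  have h2 : ¬ (l' < l ∨ (l = l' ∧ s < s')) := fun h' => hMf.1 ((hst _ _).2 (hNf.2 _ _ h'))
  obtain rfl : l' = l := by omega
  obtain rfl : s' = s := by omega
  refine ⟨rfl, rfl, ?_⟩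
  have hp : PrecedingStable P Lam M l' s' := hMf.2
  have haddN : NoAddition P Lam N l' s' ↔ NoAddition P Lam M l' s' := by
    rw [noAddition_iff, noAddition_iff]
    exact forall₂_congr fun S _ => by rw [hp.addition_eq hMN]
  have hYZ : LamSimilar Lam Y Z := LamSimilar.trans (Lam := h.toSubalgebra)
    (LamSimilar.symm (Lam := h.toSubalgebra) hMY) (LamSimilar.trans (Lam := h.toSubalgebra) hMN hNZ)
  obtain ⟨T, hT, hu, hYT⟩ := lamSimilar_iff.1 hYZ
  rw [haddN] at hNc
  by_cases hadd : NoAddition P Lam M l' s'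
  · have hblk := (hp.of_similar h hMY).mul_block h hT hu hYT
    rw [hp.addition_eq hMY, noAddition_iff.1 hadd T hT, add_zero] at hblk
    have hul := h.isUnit_block hT hu l'
    have hus := h.isUnit_block hT hu s'
    by_cases hls : r l' s'
    · obtain ⟨hsz, hW⟩ := ((hMc.resolve_left fun h' => h'.1 hadd).resolve_left fun h' => h'.2.1 hls).2.2
      obtain ⟨_, hW'⟩ := ((hNc.resolve_left fun h' => h'.1 hadd).resolve_left fun h' => h'.2.1 hls).2.2
      have h3 := hW.eq_of_similar hW' hul ?_
      · ext p q
        exact (congrFun (congrFun h3 p) (Fin.cast hsz.symm q)).symm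
      · have h4 := Matrix.submatrix_mul_equiv (P.block Y l' s') (P.block T s' s') id (finCongr hsz)
          (Fin.cast hsz)
        rw [h.block_eq_submatrix hT hls hsz]
        refine h4.trans ?_
        rw [← hblk, h.block_eq_submatrix hT hls hsz]
        rfl
    · have hE := ((hMc.resolve_left fun h' => h'.1 hadd).resolve_right fun h' => hls h'.2.1).2.2
      have hE' := ((hNc.resolve_left fun h' => h'.1 hadd).resolve_right fun h' => hls h'.2.1).2.2
      exact (hE.eq_of_equivalent hE' hul hus hblk.symm).symm
  · rw [(hMc.resolve_right (by tauto)).2, (hNc.resolve_right (by tauto)).2]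

/-- A nonstable block contains an entry that changes, so it can be named by rows `a` and `b` instead
of numbers of strips; everything else transfers by the comparison of partitions. -/
theorem IsReduction.of_isReducedAlgebra [Infinite k] [LinearOrder k] (h : IsReducedAlgebra P r Lam)
    (h' : IsReducedAlgebra P' r' Lam) {X Y : Matrix ι ι k} {a b : ι}
    (hX : IsReduction P r Lam X Y (P.strip a) (P.strip b)) (hab : ∃ N, LamSimilar Lam X N ∧ N a b ≠ X a b) :
    IsReduction P' r' Lam X Y (P'.strip a) (P'.strip b) := by
  obtain ⟨hf, hXY, hc⟩ := hX
  refine ⟨⟨fun hst => ?_, fun i j hij => ?_⟩, hXY, ?_⟩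
  · obtain ⟨N, hN, hne⟩ := hab
    exact hne (isStableBlock_iff_apply.1 hst a b rfl rfl N hN)
  · rw [isStableBlock_iff_apply]
    rintro x y rfl rfl
    have hst := hf.2 (P.strip x) (P.strip y) ?_
    · exact isStableBlock_iff_apply.1 hst x y rfl rfl
    · rcases hij with hij | ⟨hij, hij'⟩
      · exact Or.inl (h'.strip_lt_of_strip_lt h hij)
      · exact Or.inr ⟨h'.strip_eq_of_strip_eq h hij, h'.strip_lt_of_strip_lt h hij'⟩
  · rcases hc with ⟨h1, h2⟩ | ⟨h1, h2, h3⟩ | ⟨h1, h2, h3, h4⟩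
    · refine Or.inl ⟨fun h3 => h1 (h'.noAddition_of_noAddition h h3), ?_⟩
      rw [block_eq_zero_iff] at h2 ⊢
      exact fun x y hx hy => h2 x y (h'.strip_eq_of_strip_eq h hx) (h'.strip_eq_of_strip_eq h hy)
    · refine Or.inr (Or.inl ⟨h.noAddition_of_noAddition h' h1, fun h4 => h2 (h'.rel_of_rel h h4), ?_⟩)
      rw [h.block_eq_submatrix_cast h'] at h3
      exact h3.of_cast
    · have h5 := h.rel_of_rel h' h2
      refine Or.inr (Or.inr ⟨h.noAddition_of_noAddition h' h1, h5, h'.size_eq h5, ?_⟩)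
      rw [h.block_eq_submatrix_cast h'] at h4
      exact IsWeyr.of_cast _ _ _ _ h4

end IsReducedAlgebra

/-! ### Uniqueness of the canonical form. -/

section Uniqueness

open StripPartition IsReducedAlgebra

variable {k : Type u} [Field k] [Infinite k] [LinearOrder k] {ι : Type} [Fintype ι] [LinearOrder ι]
  {Lam LamM LamN : Set (Matrix ι ι k)} {M N M' N' : Matrix ι ι k}

/-- After transport to one partition, `M'` and `N'` agree in the reduced block and in the preceding
ones, so the conditions defining the new algebras coincide. If `T` transforms `M'` into `N'`, then
`M' T = T N'`, and in the block `(l, s)` the right side is also that of `T M'`; hence `T` lies in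
the new algebra. -/
theorem BelitskiiStep.lamSimilar_next (hMN : LamSimilar Lam M N) (hM : BelitskiiStep (M, Lam) (M', LamM))
    (hN : BelitskiiStep (N, Lam) (N', LamN)) : LamN = LamM ∧ LamSimilar LamM M' N' := by
  obtain ⟨P, r, l, s, h, hf, ⟨S, hS, hu, hMM', hc⟩, hLM⟩ := hM
  obtain ⟨P', r', l', s', h', hf', ⟨S', hS', hu', hNN', hc'⟩, hLN⟩ := hN
  dsimp only at hf hS hMM' hc hLM hf' hS' hNN' hc' hLN h h'
  have hN1 : IsReduction P' r' Lam N N' l' s' := by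
    refine ⟨hf', ⟨S', hS', hu', hNN'.symm⟩, hc'.imp_left fun h1 => ⟨h1.1, h1.2.2⟩⟩
  have hM1 : IsReduction P r Lam M M' l s :=
    ⟨hf, ⟨S, hS, hu, hMM'.symm⟩, hc.imp_left fun h1 => ⟨h1.1, h1.2.2⟩⟩
  have hns := hf'.1
  rw [isStableBlock_iff_apply] at hns
  push Not at hns
  obtain ⟨a, b, rfl, rfl, L, hL, hne⟩ := hns
  have hN2 := hN1.of_isReducedAlgebra h' h ⟨L, hL, hne⟩
  obtain ⟨rfl, rfl, hbl⟩ := hM1.eq_block h hMN hN2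
  have hYZ : LamSimilar Lam M' N' := LamSimilar.trans (Lam := h.toSubalgebra)
    (LamSimilar.symm (Lam := h.toSubalgebra) hM1.2.1)
    (LamSimilar.trans (Lam := h.toSubalgebra) hMN hN1.2.1)
  have hp : PrecedingStable P Lam M' (P.strip a) (P.strip b) :=
    PrecedingStable.of_similar hf.2 h hM1.2.1
  have e1 : ∀ T ∈ Lam, P.block (T * N') (P.strip a) (P.strip b) = P.block (T * M') (P.strip a) (P.strip b) := by
    intro T hT
    rw [h.block_mul_of_mem hT, h.block_mul_of_mem hT, hbl]
    congr 1
    refine Finset.sum_congr rfl fun i hi => ?_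
    rw [hp i _ (Or.inl (Finset.mem_Ioi.1 hi)) N' hYZ]
  have e2 : ∀ T ∈ Lam, P.block (N' * T) (P.strip a) (P.strip b) = P.block (M' * T) (P.strip a) (P.strip b) := by
    intro T hT
    rw [h.block_mul_of_mem' hT, h.block_mul_of_mem' hT, hbl]
    congr 1
    refine Finset.sum_congr rfl fun j hj => ?_
    rw [hp _ j (Or.inr ⟨rfl, Finset.mem_Iio.1 hj⟩) N' hYZ]
  constructor
  · rw [hLM, hLN]
    ext T
    refine and_congr_right fun hT => ?_
    rw [← e1 T hT, ← e2 T hT, block_eq_block_iff, block_eq_block_iff]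
    exact ⟨fun h1 x y hx hy => h1 x y (h.strip_eq_of_strip_eq h' hx) (h.strip_eq_of_strip_eq h' hy),
      fun h1 x y hx hy => h1 x y (h'.strip_eq_of_strip_eq h hx) (h'.strip_eq_of_strip_eq h hy)⟩
  · obtain ⟨T, hT, hTu, hTe⟩ := lamSimilar_iff.1 hYZ
    refine lamSimilar_iff.2 ⟨T, ?_, hTu, hTe⟩
    rw [hLM]
    refine ⟨hT, ?_⟩
    rw [← e1 T hT, hTe]

theorem BelitskiiStep.not_of_terminal {Y : Matrix ι ι k × Set (Matrix ι ι k)}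
    (hM : ∀ N, LamSimilar Lam M N → N = M) : ¬ BelitskiiStep (M, Lam) Y := by
  rintro ⟨P, r, l, s, -, hf, -⟩
  exact hf.1 fun N hN => by rw [hM N hN]

/-- Similar matrices have the same canonical form. -/
theorem IsLamCanonicalForm.eq_of_lamSimilar {A B : Matrix ι ι k} (hMN : LamSimilar Lam M N)
    (hA : IsLamCanonicalForm Lam M A) (hB : IsLamCanonicalForm Lam N B) : A = B := by
  obtain ⟨LA, hMA, hA⟩ := hA
  obtain ⟨LB, hNB, hB⟩ := hB
  -- The two runs are compared step by step. If one of them has stopped, the other matrix is similar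
  -- to one that no transformation changes, so it is the same matrix and admits no step.
  have key : ∀ X : Matrix ι ι k × Set (Matrix ι ι k), Relation.ReflTransGen BelitskiiStep X (A, LA) →
      ∀ N, LamSimilar X.2 X.1 N → Relation.ReflTransGen BelitskiiStep (N, X.2) (B, LB) → A = B := by
    intro X hX
    induction hX using Relation.ReflTransGen.head_induction_on with
    | refl =>
      intro N hN hNB
      obtain rfl := hA N hN
      rcases hNB.cases_head with h1 | ⟨Y, hY, -⟩
      · exact (Prod.ext_iff.1 h1).1
      · exact absurd hY (BelitskiiStep.not_of_terminal hA)
    | head hstep _ ih =>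
      rename_i X Y _
      intro N hN hNB
      rcases hNB.cases_head with h1 | ⟨Z, hZ, hZB⟩
      · obtain ⟨P, r, l, s, h, -⟩ := id hstep
        obtain ⟨rfl, h2⟩ := Prod.ext_iff.1 h1
        dsimp only at h2
        rw [← h2] at hB
        have h3 := hB _ (LamSimilar.symm (Lam := h.toSubalgebra) hN)
        subst h3
        exact absurd hstep (BelitskiiStep.not_of_terminal hB)
      · obtain ⟨h2, h3⟩ := BelitskiiStep.lamSimilar_next (M' := Y.1) (LamM := Y.2) (N' := Z.1) (LamN := Z.2)
          hN hstep hZ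
        refine ih Z.1 h3 ?_
        rw [← h2]
        exact hZB
  exact key _ hMA N hMN hNB

/-- The canonical form is similar to the matrix. -/
theorem IsLamCanonicalForm.lamSimilar {A : Matrix ι ι k} {P : StripPartition ι} {r : Setoid (Fin P.count)}
    (h : IsReducedAlgebra P r Lam) (hA : IsLamCanonicalForm Lam M A) : LamSimilar Lam M A := by
  obtain ⟨LA, hMA, -⟩ := hA
  have key : ∀ Y : Matrix ι ι k × Set (Matrix ι ι k), Relation.ReflTransGen BelitskiiStep (M, Lam) Y →
      Y.2 ⊆ Lam ∧ LamSimilar Lam M Y.1 := by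
    intro Y hY
    induction hY with
    | refl => exact ⟨subset_rfl, LamSimilar.refl h.toSubalgebra M⟩
    | tail _ hstep ih =>
      rename_i Y Z
      obtain ⟨S, hS, h2⟩ := hstep.lamSimilar
      refine ⟨?_, LamSimilar.trans (Lam := h.toSubalgebra) ih.2 ⟨S, ih.1 hS, h2⟩⟩
      obtain ⟨P, r, l, s, -, -, -, hZ⟩ := hstep
      rw [hZ]
      exact fun T hT => ih.1 hT.1
  exact (key _ hMA).2

theorem IsLamCanonical.eq_of_lamSimilar {A B : Matrix ι ι k} {P : StripPartition ι}
    {r : Setoid (Fin P.count)} (h : IsReducedAlgebra P r Lam) (hA : IsLamCanonical Lam A)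
    (hB : IsLamCanonical Lam B) (hAB : LamSimilar Lam A B) : A = B := by
  obtain ⟨M, hM⟩ := hA
  obtain ⟨N, hN⟩ := hB
  refine IsLamCanonicalForm.eq_of_lamSimilar ?_ hM hN
  exact LamSimilar.trans (Lam := h.toSubalgebra) (hM.lamSimilar h) (LamSimilar.trans
    (Lam := h.toSubalgebra) hAB (LamSimilar.symm (Lam := h.toSubalgebra) (hN.lamSimilar h)))

end Uniqueness

/-! ### Cells of block matrices. -/

section Cells

variable {k : Type u} [Field k] {T : ℕ} {𝓓 : Set (Matrix (Fin T) (Fin T) k)} {m n l : Fin T → ℕ}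

theorem blkEntry_of_lt (M : Matrix (Idx m) (Idx n) k) {i j : Fin T} {x y : ℕ} (hx : x < m i) (hy : y < n j) :
    blkEntry M i x j y = M (toLex ⟨i, ⟨x, hx⟩⟩) (toLex ⟨j, ⟨y, hy⟩⟩) := dif_pos ⟨hx, hy⟩

theorem blkEntry_of_not (M : Matrix (Idx m) (Idx n) k) {i j : Fin T} {x y : ℕ} (h : ¬ (x < m i ∧ y < n j)) :
    blkEntry M i x j y = 0 := dif_neg h

theorem sum_idx {A : Type*} [AddCommMonoid A] (F : Fin T → ℕ → A) :
    ∑ b : Idx n, F (ofLex b).1 (ofLex b).2 = ∑ c, ∑ z : Fin (n c), F c z := by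
  rw [← (toLex : (Σ i : Fin T, Fin (n i)) ≃ Idx n).sum_comp, Fintype.sum_sigma]
  rfl

theorem blkEntry_mul (M : Matrix (Idx m) (Idx n) k) (N : Matrix (Idx n) (Idx l) k) (i j : Fin T) (x y : ℕ) :
    blkEntry (M * N) i x j y = ∑ c, ∑ z : Fin (n c), blkEntry M i x c z * blkEntry N c z j y := by
  rw [← sum_idx fun c z => blkEntry M i x c z * blkEntry N c z j y]
  by_cases hx : x < m i
  · by_cases hy : y < l j
    · rw [blkEntry_of_lt _ hx hy, Matrix.mul_apply]
      refine Finset.sum_congr rfl fun b _ => ?_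
      rw [blkEntry_of_lt M hx (ofLex b).2.2, blkEntry_of_lt N (ofLex b).2.2 hy]
      rfl
    · rw [blkEntry_of_not _ fun h => hy h.2, Finset.sum_eq_zero]
      intro b _
      rw [blkEntry_of_not N fun h => hy h.2, mul_zero]
  · rw [blkEntry_of_not _ fun h => hx h.1, Finset.sum_eq_zero]
    intro b _
    rw [blkEntry_of_not M fun h => hx h.1, zero_mul]

open Classical in
theorem sum_class {A : Type*} [AddCommMonoid A] (hn : IsStepSequence 𝓓 n) (F : Fin T → ℕ → A) :
    ∑ K : Quotient (stripSetoid 𝓓), ∑ z : Fin (n K.out), ∑ c,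
      (if Quotient.mk (stripSetoid 𝓓) c = K then F c z else 0) = ∑ c, ∑ z : Fin (n c), F c z := by
  have h1 : ∀ K : Quotient (stripSetoid 𝓓), ∑ z : Fin (n K.out), ∑ c,
      (if Quotient.mk (stripSetoid 𝓓) c = K then F c z else 0) =
      ∑ c, if Quotient.mk (stripSetoid 𝓓) c = K then ∑ z : Fin (n c), F c z else 0 := by
    intro K
    rw [Finset.sum_comm]
    refine Finset.sum_congr rfl fun c _ => ?_
    by_cases hc : Quotient.mk (stripSetoid 𝓓) c = K
    · subst hc
      simp only [if_true]
      rw [Fin.sum_univ_eq_sum_range (F c), Fin.sum_univ_eq_sum_range (F c), hn _ _ (Quotient.mk_out c)]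
    · simp only [if_neg hc, Finset.sum_const_zero]
  rw [Finset.sum_congr rfl fun K _ => h1 K, Finset.sum_comm]
  refine Finset.sum_congr rfl fun c _ => ?_
  rw [Finset.sum_ite_eq]
  simp

theorem cell_apply_mk (M : Matrix (Idx m) (Idx n) k) (i j : Fin T) (x y : ℕ) :
    cell 𝓓 M (Quotient.mk _ i) x (Quotient.mk _ j) y i j = blkEntry M i x j y := if_pos ⟨rfl, rfl⟩

theorem cell_apply_of_left (M : Matrix (Idx m) (Idx n) k) {I J : Quotient (stripSetoid 𝓓)} {i : Fin T}
    (hi : Quotient.mk _ i ≠ I) (x y : ℕ) (j : Fin T) : cell 𝓓 M I x J y i j = 0 := if_neg fun h => hi h.1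

theorem cell_apply_of_right (M : Matrix (Idx m) (Idx n) k) {I J : Quotient (stripSetoid 𝓓)} {j : Fin T}
    (hj : Quotient.mk _ j ≠ J) (x y : ℕ) (i : Fin T) : cell 𝓓 M I x J y i j = 0 := if_neg fun h => hj h.2

theorem cell_ext (𝓓 : Set (Matrix (Fin T) (Fin T) k)) {M N : Matrix (Idx m) (Idx n) k}
    (h : ∀ I x J y, cell 𝓓 M I x J y = cell 𝓓 N I x J y) :
    M = N := by
  ext a b
  obtain ⟨i, p, rfl⟩ : ∃ i p, toLex ⟨i, p⟩ = a := ⟨_, _, rfl⟩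
  obtain ⟨j, q, rfl⟩ : ∃ i p, toLex ⟨i, p⟩ = b := ⟨_, _, rfl⟩
  have h1 := congrFun (congrFun (h (Quotient.mk _ i) p (Quotient.mk _ j) q) i) j
  rwa [cell_apply_mk, cell_apply_mk, blkEntry_of_lt _ p.2 q.2, blkEntry_of_lt _ p.2 q.2] at h1

-- Once the summation index is grouped by classes, cells multiply like entries of matrices with
-- coefficients in the algebra of `T × T` matrices. Products of blown-up matrices are thereby
-- controlled by products in the original spaces.
open scoped Classical in
theorem cell_mul (hn : IsStepSequence 𝓓 n) (M : Matrix (Idx m) (Idx n) k) (N : Matrix (Idx n) (Idx l) k)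
    (I J : Quotient (stripSetoid 𝓓)) (x y : ℕ) :
    cell 𝓓 (M * N) I x J y = ∑ K, ∑ z : Fin (n K.out), cell 𝓓 M I x K z * cell 𝓓 N K z J y := by
  classical
  ext i j
  simp only [Matrix.sum_apply, Matrix.mul_apply]
  by_cases hij : Quotient.mk (stripSetoid 𝓓) i = I ∧ Quotient.mk (stripSetoid 𝓓) j = J
  · obtain ⟨rfl, rfl⟩ := hij
    rw [cell_apply_mk, blkEntry_mul, ← sum_class hn fun c z => blkEntry M i x c z * blkEntry N c z j y]
    refine Finset.sum_congr rfl fun K _ => Finset.sum_congr rfl fun z _ => Finset.sum_congr rfl fun c _ => ?_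
    by_cases hc : Quotient.mk (stripSetoid 𝓓) c = K
    · subst hc
      rw [if_pos rfl, cell_apply_mk, cell_apply_mk]
    · rw [if_neg hc, cell_apply_of_right M hc, zero_mul]
  · rw [cell, if_neg hij]
    symm
    refine Finset.sum_eq_zero fun K _ => Finset.sum_eq_zero fun z _ => Finset.sum_eq_zero fun c _ => ?_
    rw [not_and_or] at hij
    rcases hij with hi | hj
    · rw [cell_apply_of_left M hi, zero_mul]
    · rw [cell_apply_of_right N hj, mul_zero]

theorem mul_mem_blowUp {𝓐 𝓑 : Set (Matrix (Fin T) (Fin T) k)} (𝓒 : AddSubmonoid (Matrix (Fin T) (Fin T) k))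
    (h𝓒 : ∀ A ∈ 𝓐, ∀ B ∈ 𝓑, A * B ∈ 𝓒) (hn : IsStepSequence 𝓓 n) {M : Matrix (Idx m) (Idx n) k}
    {N : Matrix (Idx n) (Idx l) k} (hM : M ∈ blowUp 𝓓 𝓐 m n) (hN : N ∈ blowUp 𝓓 𝓑 n l) :
    M * N ∈ blowUp 𝓓 𝓒 m l := by
  intro I x J y
  rw [cell_mul hn]
  exact sum_mem fun K _ => sum_mem fun z _ => h𝓒 _ (hM I x K z) _ (hN K z J y)

/-- The matrix with the given cells. -/
def ofCells (𝓓 : Set (Matrix (Fin T) (Fin T) k)) (m n : Fin T → ℕ)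
    (c : Quotient (stripSetoid 𝓓) → ℕ → Quotient (stripSetoid 𝓓) → ℕ → Matrix (Fin T) (Fin T) k) :
    Matrix (Idx m) (Idx n) k :=
  fun a b => c (Quotient.mk _ (ofLex a).1) (ofLex a).2 (Quotient.mk _ (ofLex b).1) (ofLex b).2
    (ofLex a).1 (ofLex b).1

open Classical in
theorem cell_ofCells (hm : IsStepSequence 𝓓 m) (hn : IsStepSequence 𝓓 n)
    {c : Quotient (stripSetoid 𝓓) → ℕ → Quotient (stripSetoid 𝓓) → ℕ → Matrix (Fin T) (Fin T) k}
    (hc : ∀ I x J y i j, ¬ (Quotient.mk _ i = I ∧ Quotient.mk _ j = J) → c I x J y i j = 0)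
    (I : Quotient (stripSetoid 𝓓)) (x : ℕ) (J : Quotient (stripSetoid 𝓓)) (y : ℕ) :
    cell 𝓓 (ofCells 𝓓 m n c) I x J y = if x < m I.out ∧ y < n J.out then c I x J y else 0 := by
  ext i j
  by_cases hij : Quotient.mk (stripSetoid 𝓓) i = I ∧ Quotient.mk (stripSetoid 𝓓) j = J
  · obtain ⟨rfl, rfl⟩ := hij
    rw [cell_apply_mk, hm _ _ (Quotient.mk_out i), hn _ _ (Quotient.mk_out j)]
    by_cases h : x < m i ∧ y < n j
    · rw [if_pos h, blkEntry_of_lt _ h.1 h.2]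
      rfl
    · rw [if_neg h, blkEntry_of_not _ h]
      rfl
  · rw [cell, if_neg hij]
    split_ifs
    · exact (hc _ _ _ _ _ _ hij).symm
    · rfl

theorem cell_eq_zero (hm : IsStepSequence 𝓓 m) (hn : IsStepSequence 𝓓 n) (M : Matrix (Idx m) (Idx n) k)
    {I J : Quotient (stripSetoid 𝓓)} {x y : ℕ} (h : ¬ (x < m I.out ∧ y < n J.out)) :
    cell 𝓓 M I x J y = 0 := by
  ext i j
  by_cases hij : Quotient.mk (stripSetoid 𝓓) i = I ∧ Quotient.mk (stripSetoid 𝓓) j = J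
  · obtain ⟨rfl, rfl⟩ := hij
    rw [hm _ _ (Quotient.mk_out i), hn _ _ (Quotient.mk_out j)] at h
    rw [cell_apply_mk, blkEntry_of_not _ h]
    rfl
  · exact if_neg hij

end Cells

/-! ### Basic matrix algebras: idempotents, blow-ups and the radical. -/

namespace IsBasicMatrixAlgebra

variable {k : Type u} [Field k] {T : ℕ} {Δ : Subalgebra k (Matrix (Fin T) (Fin T) k)} {m n l : Fin T → ℕ}

/-- The diagonals of elements of `Δ` form a subalgebra of `k^T`. For each `j` not equivalent to `i`
it has an element equal to `1` at `i` and to `0` at `j`; the product of these over all `j` is the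
indicator of the class, because elements of the subalgebra are constant on classes. -/
theorem classIdempotent_mem (h : IsBasicMatrixAlgebra Δ)
    (I : Quotient (stripSetoid (Δ : Set (Matrix (Fin T) (Fin T) k)))) : classIdempotent Δ I ∈ Δ := by
  classical
  obtain ⟨i, rfl⟩ := Quotient.exists_rep I
  let D : Subalgebra k (Fin T → k) := Δ.comap (Matrix.diagonalAlgHom k)
  have hD : ∀ {v : Fin T → k}, v ∈ D ↔ Matrix.diagonal v ∈ Δ := Iff.rfl
  have h1 : ∀ j, ∃ f ∈ D, f i = 1 ∧ (¬ stripSetoid (Δ : Set (Matrix (Fin T) (Fin T) k)) j i → f j = 0) := by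
    intro j
    by_cases hj : stripSetoid (Δ : Set (Matrix (Fin T) (Fin T) k)) j i
    · exact ⟨1, D.one_mem, rfl, fun h' => absurd hj h'⟩
    · obtain ⟨A, hA, hne⟩ : ∃ A ∈ Δ, A j j ≠ A i i := by
        by_contra! hc
        exact hj hc
      have hne' : A i i - A j j ≠ 0 := sub_ne_zero.2 hne.symm
      refine ⟨(A i i - A j j)⁻¹ • (A.diag - algebraMap k _ (A j j)),
        D.smul_mem (D.sub_mem (hD.2 (h A hA).2) (D.algebraMap_mem _)) _, ?_, fun _ => ?_⟩
      · simp only [Pi.smul_apply, Pi.sub_apply, Matrix.diag_apply, Pi.algebraMap_apply, smul_eq_mul,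
          Algebra.algebraMap_self, RingHom.id_apply]
        exact inv_mul_cancel₀ hne'
      · simp
  choose f hf hfi hfj using h1
  have h2 : ∏ j, f j ∈ D := Subalgebra.prod_mem _ fun j _ => hf j
  have h3 : ∀ {v}, v ∈ D → ∀ {a b}, stripSetoid (Δ : Set (Matrix (Fin T) (Fin T) k)) a b → v a = v b := by
    intro v hv a b hab
    have := hab _ (hD.1 hv)
    simpa using this
  convert hD.1 h2 using 1
  unfold classIdempotent
  congr 1
  ext j
  by_cases hj : stripSetoid (Δ : Set (Matrix (Fin T) (Fin T) k)) j i
  · rw [if_pos (Quotient.sound hj), h3 h2 hj, Finset.prod_apply, Finset.prod_eq_one fun c _ => hfi c]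
  · rw [if_neg fun h' => hj (Quotient.exact h'), Finset.prod_apply]
    exact (Finset.prod_eq_zero (f := fun c => f c j) (Finset.mem_univ j) (hfj j hj)).symm

theorem classIdempotent_mul_apply (I : Quotient (stripSetoid (Δ : Set (Matrix (Fin T) (Fin T) k))))
    (A : Matrix (Fin T) (Fin T) k) (i j : Fin T) [Decidable (Quotient.mk (stripSetoid (Δ : Set (Matrix (Fin T) (Fin T) k))) i = I)] :
    (classIdempotent Δ I * A) i j = if Quotient.mk (stripSetoid (Δ : Set (Matrix (Fin T) (Fin T) k))) i = I then A i j else 0 := by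
  rw [classIdempotent, Matrix.diagonal_mul]
  split_ifs <;> simp

theorem mul_classIdempotent_apply (I : Quotient (stripSetoid (Δ : Set (Matrix (Fin T) (Fin T) k))))
    (A : Matrix (Fin T) (Fin T) k) (i j : Fin T) [Decidable (Quotient.mk (stripSetoid (Δ : Set (Matrix (Fin T) (Fin T) k))) j = I)] :
    (A * classIdempotent Δ I) i j = if Quotient.mk (stripSetoid (Δ : Set (Matrix (Fin T) (Fin T) k))) j = I then A i j else 0 := by
  rw [classIdempotent, Matrix.mul_diagonal]
  split_ifs <;> simp

theorem classIdempotent_mul_cell (M : Matrix (Idx m) (Idx n) k)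
    (I J : Quotient (stripSetoid (Δ : Set (Matrix (Fin T) (Fin T) k)))) (x y : ℕ) :
    classIdempotent Δ I * cell (Δ : Set _) M I x J y = cell (Δ : Set _) M I x J y := by
  classical
  ext i j
  rw [classIdempotent_mul_apply]
  split_ifs with hi
  · rfl
  · exact (cell_apply_of_left M hi x y j).symm

theorem cell_mul_classIdempotent (M : Matrix (Idx m) (Idx n) k)
    (I J : Quotient (stripSetoid (Δ : Set (Matrix (Fin T) (Fin T) k)))) (x y : ℕ) :
    cell (Δ : Set _) M I x J y * classIdempotent Δ J = cell (Δ : Set _) M I x J y := by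
  classical
  ext i j
  rw [mul_classIdempotent_apply]
  split_ifs with hi
  · rfl
  · exact (cell_apply_of_right M hi x y i).symm

open Classical in
theorem classIdempotent_apply (I : Quotient (stripSetoid (Δ : Set (Matrix (Fin T) (Fin T) k)))) (i j : Fin T) :
    classIdempotent Δ I i j = if i = j ∧ Quotient.mk (stripSetoid (Δ : Set (Matrix (Fin T) (Fin T) k))) i = I then 1 else 0 := by
  rw [classIdempotent, Matrix.diagonal_apply]
  by_cases hij : i = j
  · simp [hij]
  · simp [hij]

open Classical in
theorem cell_one (hn : IsStepSequence (Δ : Set (Matrix (Fin T) (Fin T) k)) n)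
    (I J : Quotient (stripSetoid (Δ : Set (Matrix (Fin T) (Fin T) k)))) (x y : ℕ) :
    cell (Δ : Set _) (1 : Matrix (Idx n) (Idx n) k) I x J y =
      if I = J ∧ x = y ∧ x < n I.out then classIdempotent Δ I else 0 := by
  ext i j
  by_cases hij : Quotient.mk (stripSetoid (Δ : Set (Matrix (Fin T) (Fin T) k))) i = I ∧
    Quotient.mk (stripSetoid (Δ : Set (Matrix (Fin T) (Fin T) k))) j = J
  · obtain ⟨rfl, rfl⟩ := hij
    rw [cell_apply_mk, hn _ _ (Quotient.mk_out i)]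
    by_cases hx : x < n i ∧ y < n j
    · rw [blkEntry_of_lt _ hx.1 hx.2, Matrix.one_apply]
      by_cases hij : i = j
      · subst hij
        by_cases hxy : x = y
        · subst hxy
          rw [if_pos rfl, if_pos ⟨rfl, rfl, hx.1⟩, classIdempotent_apply, if_pos ⟨rfl, rfl⟩]
        · rw [if_neg (by rw [toLex_inj]; simpa using hxy), if_neg fun h' => hxy h'.2.1]
          rfl
      · rw [if_neg fun h' => hij (congrArg (fun a => (ofLex a).1) h')]
        split_ifs
        · rw [classIdempotent_apply, if_neg fun h' => hij h'.1]
        · rfl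
    · rw [blkEntry_of_not _ hx]
      split_ifs with h'
      · rw [classIdempotent_apply, if_neg]
        rintro ⟨rfl, -⟩
        exact hx ⟨h'.2.2, h'.2.1 ▸ h'.2.2⟩
      · rfl
  · rw [cell, if_neg hij]
    split_ifs with h'
    · rw [classIdempotent_apply, if_neg]
      rintro ⟨rfl, h''⟩
      exact hij ⟨h'', h''.trans h'.1⟩
    · rfl

theorem cell_add (𝓓 : Set (Matrix (Fin T) (Fin T) k)) (M N : Matrix (Idx m) (Idx n) k)
    (I J : Quotient (stripSetoid 𝓓)) (x y : ℕ) :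
    cell 𝓓 (M + N) I x J y = cell 𝓓 M I x J y + cell 𝓓 N I x J y := by
  classical
  ext i j
  simp only [cell, blkEntry, blk, Matrix.add_apply]
  split_ifs <;> simp

theorem cell_smul (𝓓 : Set (Matrix (Fin T) (Fin T) k)) (c : k) (M : Matrix (Idx m) (Idx n) k)
    (I J : Quotient (stripSetoid 𝓓)) (x y : ℕ) :
    cell 𝓓 (c • M) I x J y = c • cell 𝓓 M I x J y := by
  classical
  ext i j
  simp only [cell, blkEntry, blk, Matrix.smul_apply]
  split_ifs <;> simp

/-- The algebra `Δ_{n × n}`. -/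
def blowUpSubalgebra (h : IsBasicMatrixAlgebra Δ) (hn : IsStepSequence (Δ : Set (Matrix (Fin T) (Fin T) k)) n) :
    Subalgebra k (Matrix (Idx n) (Idx n) k) where
  carrier := blowUp (Δ : Set _) (Δ : Set _) n n
  mul_mem' := fun {a b} ha hb => mul_mem_blowUp (Subalgebra.toSubmodule Δ).toAddSubmonoid (fun A hA B hB => Δ.mul_mem hA hB) hn ha hb
  add_mem' := fun {a b} ha hb I x J y => by
    rw [cell_add]
    exact Δ.add_mem (ha I x J y) (hb I x J y)
  algebraMap_mem' := fun c I x J y => by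
    classical
    rw [Algebra.algebraMap_eq_smul_one, cell_smul, cell_one hn]
    refine Δ.smul_mem ?_ c
    split_ifs
    · exact h.classIdempotent_mem I
    · exact Δ.zero_mem

end IsBasicMatrixAlgebra

namespace IsBasicMatrixAlgebra

variable {k : Type u} [Field k] {T : ℕ} {Δ : Subalgebra k (Matrix (Fin T) (Fin T) k)} {m n l : Fin T → ℕ}

theorem apply_of_mem_blowUp {𝓓 𝓐 : Set (Matrix (Fin T) (Fin T) k)} {S : Matrix (Idx m) (Idx n) k}
    (hS : S ∈ blowUp 𝓓 𝓐 m n) (i j : Fin T) (p : Fin (m i)) (q : Fin (n j)) :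
    ∃ A ∈ 𝓐, ∀ i' j' (p' : Fin (m i')) (q' : Fin (n j')), stripSetoid 𝓓 i' i → stripSetoid 𝓓 j' j →
      (p' : ℕ) = p → (q' : ℕ) = q → S (toLex ⟨i', p'⟩) (toLex ⟨j', q'⟩) = A i' j' := by
  refine ⟨_, hS (Quotient.mk _ i) p (Quotient.mk _ j) q, fun i' j' p' q' hi hj hp hq => ?_⟩
  rw [← Quotient.sound hi, ← Quotient.sound hj, cell_apply_mk, ← hp, ← hq, blkEntry_of_lt _ p'.2 q'.2]

/-- This starts the algorithm. The strips are the given ones and the label of a row is its class and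
its number in the strip. A unit lies in the blow-up because its only nonzero cell is a class
idempotent. -/
theorem isLabelled_blowUp (h : IsBasicMatrixAlgebra Δ)
    (hn : IsStepSequence (Δ : Set (Matrix (Fin T) (Fin T) k)) n) :
    IsLabelled (h.blowUpSubalgebra hn) (fun a => (ofLex a).1)
      fun a => (Quotient.mk (stripSetoid (Δ : Set (Matrix (Fin T) (Fin T) k))) (ofLex a).1,
        ((ofLex a).2 : ℕ)) := by
  classical
  have hrep : ∀ a : Idx n, ∃ i p, toLex ⟨i, p⟩ = a := fun a => ⟨_, _, rfl⟩
  have hlt : ∀ {i j : Fin T} {p : Fin (n i)} {q : Fin (n j)}, i = j →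
      ((toLex ⟨i, p⟩ : Idx n) < toLex ⟨j, q⟩ ↔ (p : ℕ) < q) := by
    rintro i j p q rfl
    rw [Sigma.Lex.lt_def]
    refine ⟨?_, fun h' => Or.inr ⟨rfl, h'⟩⟩
    rintro (h' | ⟨_, h'⟩)
    · exact absurd h' (lt_irrefl i)
    · exact h'
  refine ⟨?_, ?_, ?_, ?_, ?_, ?_, ?_⟩
  · intro a b hab
    obtain ⟨i, p, rfl⟩ := hrep a
    obtain ⟨j, q, rfl⟩ := hrep b
    rw [Sigma.Lex.le_def] at hab
    rcases hab with hab | ⟨hab, -⟩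
    · exact hab.le
    · exact hab.le
  · intro a b hab hab'
    obtain ⟨i, p, rfl⟩ := hrep a
    obtain ⟨j, q, rfl⟩ := hrep b
    obtain rfl : i = j := hab
    obtain rfl : p = q := Fin.ext (Prod.ext_iff.1 hab').2
    rfl
  · intro a b a' hab hab'
    obtain ⟨i, p, rfl⟩ := hrep a
    obtain ⟨j, q, rfl⟩ := hrep b
    obtain ⟨i', p', rfl⟩ := hrep a'
    obtain rfl : i = j := hab
    have hr : stripSetoid (Δ : Set (Matrix (Fin T) (Fin T) k)) i i' := Quotient.exact (Prod.ext_iff.1 hab').1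
    refine ⟨toLex ⟨i', ⟨q, by rw [← hn _ _ hr]; exact q.2⟩⟩, rfl, ?_⟩
    exact Prod.ext (Quotient.sound hr).symm rfl
  · intro a b a' b' hab hab' h1 h2 hlt'
    obtain ⟨i, p, rfl⟩ := hrep a
    obtain ⟨j, q, rfl⟩ := hrep b
    obtain ⟨i', p', rfl⟩ := hrep a'
    obtain ⟨j', q', rfl⟩ := hrep b'
    replace hlt' := (hlt (i := i) (j := j) hab).1 hlt'
    refine (hlt (i := i') (j := j') hab').2 ?_
    have h3 : (p : ℕ) = p' := (Prod.ext_iff.1 h1).2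
    have h4 : (q : ℕ) = q' := (Prod.ext_iff.1 h2).2
    omega
  · intro S hS a b hab
    obtain ⟨i, p, rfl⟩ := hrep a
    obtain ⟨j, q, rfl⟩ := hrep b
    obtain ⟨A, hA, hSA⟩ := apply_of_mem_blowUp hS i j p q
    rw [hSA i j p q ((stripSetoid _).refl _) ((stripSetoid _).refl _) rfl rfl]
    exact (h A hA).1 i j hab
  · intro S hS a b a' b' hab hab' h1 h2
    obtain ⟨i, p, rfl⟩ := hrep a
    obtain ⟨j, q, rfl⟩ := hrep b
    obtain ⟨i', p', rfl⟩ := hrep a'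
    obtain ⟨j', q', rfl⟩ := hrep b'
    obtain rfl : i = j := hab
    obtain rfl : i' = j' := hab'
    obtain ⟨A, hA, hSA⟩ := apply_of_mem_blowUp hS i i p q
    have hr : stripSetoid (Δ : Set (Matrix (Fin T) (Fin T) k)) i i' := Quotient.exact (Prod.ext_iff.1 h1).1
    rw [hSA i i p q ((stripSetoid _).refl _) ((stripSetoid _).refl _) rfl rfl,
      hSA i' i' p' q' ((stripSetoid _).symm hr) ((stripSetoid _).symm hr) (Prod.ext_iff.1 h1).2.symm (Prod.ext_iff.1 h2).2.symm]
    exact hr A hA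
  · intro c d u hcd h1 h2
    obtain ⟨i, p, rfl⟩ := hrep c
    obtain ⟨j, q, rfl⟩ := hrep d
    obtain rfl : i = j := hcd
    intro I x J y
    have hu : cell (Δ : Set (Matrix (Fin T) (Fin T) k)) u I x J y =
        if I = J ∧ I = Quotient.mk _ i ∧ x = p ∧ y = q then classIdempotent Δ I else 0 := by
      ext a b
      by_cases hab : Quotient.mk (stripSetoid (Δ : Set (Matrix (Fin T) (Fin T) k))) a = I ∧
        Quotient.mk (stripSetoid (Δ : Set (Matrix (Fin T) (Fin T) k))) b = J
      · obtain ⟨rfl, rfl⟩ := hab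
        rw [cell_apply_mk]
        by_cases hxy : x < n a ∧ y < n b
        · rw [blkEntry_of_lt _ hxy.1 hxy.2]
          by_cases hc : a = b ∧ Quotient.mk (stripSetoid (Δ : Set (Matrix (Fin T) (Fin T) k))) a =
              Quotient.mk _ i ∧ x = p ∧ y = q
          · obtain ⟨rfl, hr, rfl, rfl⟩ := hc
            rw [h1 (toLex ⟨a, ⟨_, hxy.1⟩⟩) (toLex ⟨a, ⟨_, hxy.2⟩⟩) rfl (Prod.ext hr rfl) (Prod.ext hr rfl), if_pos ⟨rfl, hr, rfl, rfl⟩,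
              classIdempotent_apply, if_pos ⟨rfl, rfl⟩]
          · rw [h2]
            · split_ifs with h3
              · rw [classIdempotent_apply, if_neg]
                exact fun h4 => hc ⟨h4.1, h3.2⟩
              · rfl
            · rintro ⟨h3, h4, h5⟩
              exact hc ⟨h3, (Prod.ext_iff.1 h4).1, (Prod.ext_iff.1 h4).2, (Prod.ext_iff.1 h5).2⟩
        · rw [blkEntry_of_not _ hxy]
          split_ifs with h3
          · rw [classIdempotent_apply, if_neg]
            rintro ⟨rfl, -⟩
            obtain ⟨-, hr, rfl, rfl⟩ := h3
            have := hn _ _ (Quotient.exact hr)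
            exact hxy ⟨by rw [this]; exact p.2, by rw [this]; exact q.2⟩
          · rfl
      · rw [cell, if_neg hab]
        split_ifs with h3
        · rw [classIdempotent_apply, if_neg]
          rintro ⟨rfl, h4⟩
          exact hab ⟨h4, h4.trans h3.1⟩
        · rfl
    rw [hu]
    split_ifs
    · exact h.classIdempotent_mem I
    · exact Δ.zero_mem

theorem exists_isReducedAlgebra_blowUp (h : IsBasicMatrixAlgebra Δ)
    (hn : IsStepSequence (Δ : Set (Matrix (Fin T) (Fin T) k)) n) :
    ∃ (P : StripPartition (Idx n)) (r : Setoid (Fin P.count)),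
      IsReducedAlgebra P r (blowUp (Δ : Set (Matrix (Fin T) (Fin T) k)) (Δ : Set _) n n) :=
  (h.isLabelled_blowUp hn).exists_isReducedAlgebra

theorem mul_apply_self (h : IsBasicMatrixAlgebra Δ) {A B : Matrix (Fin T) (Fin T) k} (hA : A ∈ Δ) (hB : B ∈ Δ)
    (i : Fin T) : (A * B) i i = A i i * B i i := by
  rw [Matrix.mul_apply, Finset.sum_eq_single i]
  · intro j _ hj
    rcases lt_or_gt_of_ne hj with hj | hj
    · rw [(h A hA).1 i j hj, zero_mul]
    · rw [(h B hB).1 j i hj, mul_zero]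
  · simp

/-- A matrix from a basic matrix algebra with zero diagonal is nilpotent. -/
theorem isNilpotent_of_apply_self_eq_zero (h : IsBasicMatrixAlgebra Δ) {A : Matrix (Fin T) (Fin T) k} (hA : A ∈ Δ)
    (h0 : ∀ i, A i i = 0) : IsNilpotent A := by
  have hz : ∀ (s : ℕ) (i j : Fin T), (j : ℕ) < i + s → (A ^ s) i j = 0 := by
    intro s
    induction s with
    | zero =>
      intro i j hij
      rw [pow_zero, Matrix.one_apply_ne]
      rintro rfl
      simp at hij
    | succ s ih =>
      intro i j hij
      rw [pow_succ, Matrix.mul_apply]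
      refine Finset.sum_eq_zero fun c _ => ?_
      by_cases hc : (c : ℕ) < i + s
      · rw [ih i c hc, zero_mul]
      · rcases lt_trichotomy j c with h1 | rfl | h1
        · rw [(h A hA).1 c j h1, mul_zero]
        · rw [h0, mul_zero]
        · have : (c : ℕ) < j := h1
          omega
  refine ⟨T, ?_⟩
  ext i j
  exact hz T i j (by omega)

theorem isNilpotent_mk {A : Matrix (Fin T) (Fin T) k} (hA : A ∈ Δ) (h : IsNilpotent A) :
    IsNilpotent (⟨A, hA⟩ : Δ) := by
  obtain ⟨s, hs⟩ := h
  exact ⟨s, Subtype.ext hs⟩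

/-- A left ideal that consists of nilpotent elements is contained in the Jacobson radical. -/
theorem _root_.Ideal.le_jacobson_of_isNilpotent {R : Type*} [Ring R] (I : Ideal R)
    (hI : ∀ x ∈ I, IsNilpotent x) : I ≤ Ring.jacobson R := by
  intro x hx
  rw [← Ideal.jacobson_bot, Ideal.mem_jacobson_iff]
  intro y
  obtain ⟨z, hz⟩ := ((hI _ (I.mul_mem_left y hx)).isUnit_one_add).exists_left_inv
  refine ⟨z, ?_⟩
  rw [Ideal.mem_bot, sub_eq_zero, ← hz]
  noncomm_ring

/-- The elements with zero diagonal form a left ideal of nilpotent elements, which lies in the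
radical. Conversely, the radical of an artinian ring is nilpotent, and the diagonal entries of a
power of a triangular matrix are powers of its diagonal entries. -/
theorem mem_jacobson_iff (h : IsBasicMatrixAlgebra Δ) (A : Δ) :
    A ∈ Ring.jacobson Δ ↔ ∀ i, (A : Matrix (Fin T) (Fin T) k) i i = 0 := by
  let I : Ideal Δ :=
    { carrier := {A | ∀ i, (A : Matrix (Fin T) (Fin T) k) i i = 0}
      add_mem' := fun {a b} ha hb i => by
        change (a : Matrix (Fin T) (Fin T) k) i i + (b : Matrix (Fin T) (Fin T) k) i i = 0
        rw [ha i, hb i, add_zero]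
      zero_mem' := fun i => rfl
      smul_mem' := fun c x hx i => by
        change ((c : Matrix (Fin T) (Fin T) k) * (x : Matrix (Fin T) (Fin T) k)) i i = 0
        rw [h.mul_apply_self c.2 x.2, hx i, mul_zero] }
  have hI : I ≤ Ring.jacobson Δ := Ideal.le_jacobson_of_isNilpotent I fun x hx =>
    isNilpotent_mk x.2 (h.isNilpotent_of_apply_self_eq_zero x.2 hx)
  refine ⟨fun hA i => ?_, fun hA => hI hA⟩
  have : IsArtinianRing Δ := isArtinian_of_tower k inferInstance
  obtain ⟨s, hs⟩ := IsSemiprimaryRing.isNilpotent (R := Δ)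
  have h1 : A ^ s = 0 := by
    have h2 := Ideal.pow_mem_pow hA s
    rwa [hs] at h2
  have h3 : ∀ s : ℕ, ((A : Matrix (Fin T) (Fin T) k) ^ s) i i = (A : Matrix (Fin T) (Fin T) k) i i ^ s := by
    intro s
    induction s with
    | zero => simp
    | succ s ih => rw [pow_succ, pow_succ, h.mul_apply_self (Δ.pow_mem A.2 s) A.2, ih]
  have h4 : ((A : Matrix (Fin T) (Fin T) k) ^ s) i i = 0 := by
    have h5 := congrArg (fun B : Δ => (B : Matrix (Fin T) (Fin T) k) i i) h1
    exact h5
  rw [h3] at h4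
  exact eq_zero_of_pow_eq_zero h4

end IsBasicMatrixAlgebra

/-! ### The algebra `Γ ⊕ Γ` and the four parts of a matrix. -/

section Sides

variable {k : Type u} [Field k] {t : ℕ}

/-- The embedding of the first or of the last `t` indices. -/
def side : Bool → Fin t → Fin (t + t)
  | false => Fin.castAdd t
  | true => Fin.natAdd t

theorem exists_side (a : Fin (t + t)) : ∃ b i, side b i = a := by
  refine Fin.addCases (fun i => ⟨false, i, rfl⟩) (fun i => ⟨true, i, rfl⟩) a

theorem side_inj {b b' : Bool} {i j : Fin t} : side b i = side b' j ↔ b = b' ∧ i = j := by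
  have hi := i.2
  have hj := j.2
  cases b <;> cases b' <;> simp [side, Fin.ext_iff] <;> omega

theorem finSumFinEquiv_symm_side_false (i : Fin t) : finSumFinEquiv.symm (side false i) = Sum.inl i :=
  finSumFinEquiv_symm_apply_castAdd i

theorem finSumFinEquiv_symm_side_true (i : Fin t) : finSumFinEquiv.symm (side true i) = Sum.inr i :=
  finSumFinEquiv_symm_apply_natAdd i

theorem sum_side {A : Type*} [AddCommMonoid A] (F : Fin (t + t) → A) :
    ∑ a, F a = ∑ b, ∑ i, F (side b i) := by
  rw [Fin.sum_univ_add, Fintype.sum_bool, add_comm]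
  rfl

/-- One of the four parts of a `2t × 2t` matrix. -/
def corner (b b' : Bool) (C : Matrix (Fin (t + t)) (Fin (t + t)) k) : Matrix (Fin t) (Fin t) k :=
  fun i j => C (side b i) (side b' j)

theorem corner_mul (b b' : Bool) (C D : Matrix (Fin (t + t)) (Fin (t + t)) k) :
    corner b b' (C * D) = ∑ c, corner b c C * corner c b' D := by
  ext i j
  rw [corner, Matrix.mul_apply, sum_side, Matrix.sum_apply]
  rfl

theorem corner_ext {C D : Matrix (Fin (t + t)) (Fin (t + t)) k}
    (h : ∀ b b', corner b b' C = corner b b' D) : C = D := by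
  ext i j
  obtain ⟨b, i, rfl⟩ := exists_side i
  obtain ⟨b', j, rfl⟩ := exists_side j
  exact congrFun (congrFun (h b b') i) j

theorem corner_fromBlocks (A B C D : Matrix (Fin t) (Fin t) k) (b b' : Bool) :
    corner b b' ((Matrix.fromBlocks A B C D).submatrix finSumFinEquiv.symm finSumFinEquiv.symm) =
      match b, b' with
      | false, false => A
      | false, true => B
      | true, false => C
      | true, true => D := by
  ext i j
  cases b <;> cases b' <;> simp [corner, finSumFinEquiv_symm_side_false, finSumFinEquiv_symm_side_true]

theorem mem_doubleAlgebra {Γ : Subalgebra k (Matrix (Fin t) (Fin t) k)}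
    {C : Matrix (Fin (t + t)) (Fin (t + t)) k} : C ∈ doubleAlgebra Γ ↔
      ∀ b b', corner b b' C ∈ (if b = b' then (Γ : Set (Matrix (Fin t) (Fin t) k)) else {0}) := by
  constructor
  · rintro ⟨A, hA, B, hB, rfl⟩ b b'
    rw [corner_fromBlocks]
    cases b <;> cases b' <;> simp [hA, hB]
  · intro h
    refine ⟨_, by simpa using h false false, _, by simpa using h true true, corner_ext fun b b' => ?_⟩
    rw [corner_fromBlocks]
    cases b <;> cases b'
    · rfl
    · simpa using h false true
    · simpa using h true false
    · rfl

/-- The matrices from the radical of `Γ`. -/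
def radSet (Γ : Subalgebra k (Matrix (Fin t) (Fin t) k)) : Set (Matrix (Fin t) (Fin t) k) :=
  {A | ∃ R ∈ Ring.jacobson Γ, A = (R : Matrix (Fin t) (Fin t) k)}

theorem IsBasicMatrixAlgebra.mem_radSet {Γ : Subalgebra k (Matrix (Fin t) (Fin t) k)}
    (h : IsBasicMatrixAlgebra Γ) {A : Matrix (Fin t) (Fin t) k} :
    A ∈ radSet Γ ↔ A ∈ Γ ∧ ∀ i, A i i = 0 := by
  constructor
  · rintro ⟨R, hR, rfl⟩
    exact ⟨R.2, (h.mem_jacobson_iff R).1 hR⟩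
  · rintro ⟨hA, h0⟩
    exact ⟨⟨A, hA⟩, (h.mem_jacobson_iff _).2 h0, rfl⟩

theorem zero_mem_radSet (Γ : Subalgebra k (Matrix (Fin t) (Fin t) k)) : 0 ∈ radSet Γ :=
  ⟨0, Submodule.zero_mem _, rfl⟩

theorem mem_zeroRad {Γ : Subalgebra k (Matrix (Fin t) (Fin t) k)}
    {C : Matrix (Fin (t + t)) (Fin (t + t)) k} : C ∈ zeroRad Γ ↔
      ∀ b b', corner b b' C ∈ (if b = false ∧ b' = true then radSet Γ else {0}) := by
  constructor
  · rintro ⟨A, hA, rfl⟩ b b'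
    rw [corner_fromBlocks]
    cases b <;> cases b' <;> simp
    exact ⟨A, hA, rfl⟩
  · intro h
    obtain ⟨R, hR, h1⟩ : corner false true C ∈ radSet Γ := by simpa using h false true
    refine ⟨R, hR, corner_ext fun b b' => ?_⟩
    rw [corner_fromBlocks]
    cases b <;> cases b'
    · simpa using h false false
    · exact h1
    · simpa using h true false
    · simpa using h true true

/-- The algebra `Γ ⊕ Γ`. -/
def doubleSubalgebra (Γ : Subalgebra k (Matrix (Fin t) (Fin t) k)) :
    Subalgebra k (Matrix (Fin (t + t)) (Fin (t + t)) k) where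
  carrier := doubleAlgebra Γ
  mul_mem' := by
    intro C D hC hD
    rw [mem_doubleAlgebra] at *
    intro b b'
    have h1 := hC b (!b)
    have h2 := hD (!b) b
    have h3 := hC b b
    have h4 := hD b b'
    have h5 := hD (!b) b'
    rw [corner_mul, Fintype.sum_bool]
    cases b <;> cases b' <;> simp_all [Γ.mul_mem]
  add_mem' := by
    intro C D hC hD
    rw [mem_doubleAlgebra] at *
    intro b b'
    have h1 := hC b b'
    have h2 := hD b b'
    change corner b b' C + corner b b' D ∈ _
    split_ifs at * with h
    · exact Γ.add_mem h1 h2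
    · rw [Set.mem_singleton_iff] at *
      rw [h1, h2, add_zero]
  algebraMap_mem' := by
    intro c
    rw [Algebra.algebraMap_eq_smul_one, mem_doubleAlgebra]
    intro b b'
    have h1 : corner b b' (c • (1 : Matrix (Fin (t + t)) (Fin (t + t)) k)) =
        if b = b' then c • 1 else 0 := by
      ext i j
      rw [corner, Matrix.smul_apply, Matrix.one_apply]
      by_cases hb : b = b'
      · subst hb
        simp [side_inj, Matrix.one_apply]
      · simp [side_inj, hb]
    rw [h1]
    split_ifs
    · exact Γ.smul_mem Γ.one_mem c
    · rfl

theorem IsBasicMatrixAlgebra.doubleSubalgebra {Γ : Subalgebra k (Matrix (Fin t) (Fin t) k)}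
    (h : IsBasicMatrixAlgebra Γ) : IsBasicMatrixAlgebra (doubleSubalgebra Γ) := by
  intro C hC
  replace hC := mem_doubleAlgebra.1 hC
  constructor
  · intro i j hij
    obtain ⟨b, i, rfl⟩ := exists_side i
    obtain ⟨b', j, rfl⟩ := exists_side j
    have h1 := hC b b'
    change corner b b' C i j = 0
    split_ifs at h1 with hb
    · subst hb
      refine (h _ h1).1 i j ?_
      cases b
      · exact hij
      · simpa [side] using hij
    · rw [h1]
      rfl
  · refine mem_doubleAlgebra.2 fun b b' => ?_
    have h2 : corner b b' (Matrix.diagonal C.diag) =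
        if b = b' then Matrix.diagonal (corner b b C).diag else 0 := by
      ext i j
      rw [corner, Matrix.diagonal_apply]
      by_cases hb : b = b'
      · subst hb
        simp [side_inj, Matrix.diagonal_apply, corner]
      · simp [side_inj, hb]
    rw [h2]
    have h1 := hC b b
    rw [if_pos rfl] at h1
    split_ifs
    · exact (h _ h1).2
    · rfl

/-- The element `1 ⊕ 0` separates the two halves, and the elements `A ⊕ A` test the equivalence
inside one half. -/
theorem stripSetoid_doubleAlgebra_side (Γ : Subalgebra k (Matrix (Fin t) (Fin t) k)) {b b' : Bool}
    {i j : Fin t} : stripSetoid (doubleAlgebra Γ) (side b i) (side b' j) ↔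
      b = b' ∧ stripSetoid (Γ : Set (Matrix (Fin t) (Fin t) k)) i j := by
  have hmk : ∀ A ∈ Γ, ∀ B ∈ Γ, (Matrix.fromBlocks A 0 0 B).submatrix finSumFinEquiv.symm finSumFinEquiv.symm
      ∈ doubleAlgebra Γ := fun A hA B hB => ⟨A, hA, B, hB, rfl⟩
  constructor
  · intro h
    have hb : b = b' := by
      have h1 := h _ (hmk 1 Γ.one_mem 0 Γ.zero_mem)
      by_contra hb
      have h2 : ∀ (b : Bool) (i : Fin t), ((Matrix.fromBlocks (1 : Matrix (Fin t) (Fin t) k) 0 0 0).submatrix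
          finSumFinEquiv.symm finSumFinEquiv.symm) (side b i) (side b i) = if b = false then 1 else 0 := by
        intro b i
        cases b <;> simp [finSumFinEquiv_symm_side_false, finSumFinEquiv_symm_side_true]
      rw [h2, h2] at h1
      cases b <;> cases b' <;> simp_all
    subst hb
    refine ⟨rfl, fun A hA => ?_⟩
    have h1 := h _ (hmk A hA A hA)
    have h2 : ∀ (i : Fin t), ((Matrix.fromBlocks A 0 0 A).submatrix
        finSumFinEquiv.symm finSumFinEquiv.symm) (side b i) (side b i) = A i i := by
      intro i
      cases b <;> simp [finSumFinEquiv_symm_side_false, finSumFinEquiv_symm_side_true]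
    rwa [h2, h2] at h1
  · rintro ⟨rfl, h⟩ C hC
    have h1 := mem_doubleAlgebra.1 hC b b
    rw [if_pos rfl] at h1
    exact h _ h1

theorem isStepSequence_doubleAlgebra {Γ : Subalgebra k (Matrix (Fin t) (Fin t) k)} {s : Fin (t + t) → ℕ} :
    IsStepSequence (doubleAlgebra Γ) s ↔
      ∀ b, IsStepSequence (Γ : Set (Matrix (Fin t) (Fin t) k)) fun i => s (side b i) := by
  constructor
  · intro h b i j hij
    exact h _ _ ((stripSetoid_doubleAlgebra_side Γ).2 ⟨rfl, hij⟩)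
  · intro h i j hij
    obtain ⟨b, i, rfl⟩ := exists_side i
    obtain ⟨b', j, rfl⟩ := exists_side j
    obtain ⟨rfl, hij'⟩ := (stripSetoid_doubleAlgebra_side Γ).1 hij
    exact h b i j hij'

variable {m n l : Fin (t + t) → ℕ}

/-- One of the four parts of a block matrix with `2t` horizontal and vertical strips. -/
def part (b b' : Bool) (S : Matrix (Idx m) (Idx n) k) :
    Matrix (Idx fun i : Fin t => m (side b i)) (Idx fun j : Fin t => n (side b' j)) k :=
  fun x y => blk S (side b (ofLex x).1) (side b' (ofLex y).1) (ofLex x).2 (ofLex y).2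

theorem sum_idx_side {A : Type*} [AddCommMonoid A] (F : Idx n → A) :
    ∑ a, F a = ∑ b, ∑ x : Idx fun i : Fin t => n (side b i), F (toLex ⟨side b (ofLex x).1, (ofLex x).2⟩) := by
  rw [← (toLex : (Σ i : Fin (t + t), Fin (n i)) ≃ Idx n).sum_comp, Fintype.sum_sigma, sum_side]
  refine Finset.sum_congr rfl fun b _ => ?_
  rw [← (toLex : (Σ i : Fin t, Fin (n (side b i))) ≃ Idx fun i : Fin t => n (side b i)).sum_comp,
    Fintype.sum_sigma]
  rfl

theorem part_mul (b b' : Bool) (S : Matrix (Idx m) (Idx n) k) (T : Matrix (Idx n) (Idx l) k) :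
    part b b' (S * T) = ∑ c, part b c S * part c b' T := by
  ext x y
  rw [part, blk, Matrix.mul_apply, sum_idx_side, Matrix.sum_apply]
  rfl

theorem part_ext {S T : Matrix (Idx m) (Idx n) k} (h : ∀ b b', part b b' S = part b b' T) : S = T := by
  ext x y
  obtain ⟨i, p, rfl⟩ : ∃ i p, toLex ⟨i, p⟩ = x := ⟨_, _, rfl⟩
  obtain ⟨j, q, rfl⟩ : ∃ i p, toLex ⟨i, p⟩ = y := ⟨_, _, rfl⟩
  obtain ⟨b, i, rfl⟩ := exists_side i
  obtain ⟨b', j, rfl⟩ := exists_side j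
  exact congrFun (congrFun (h b b') (toLex ⟨i, p⟩)) (toLex ⟨j, q⟩)

theorem part_one_self (b : Bool) : part b b (1 : Matrix (Idx n) (Idx n) k) = 1 := by
  ext x y
  obtain ⟨i, p, rfl⟩ : ∃ i p, toLex ⟨i, p⟩ = x := ⟨_, _, rfl⟩
  obtain ⟨j, q, rfl⟩ : ∃ i p, toLex ⟨i, p⟩ = y := ⟨_, _, rfl⟩
  change (1 : Matrix (Idx n) (Idx n) k) (toLex ⟨side b i, p⟩) (toLex ⟨side b j, q⟩) = _
  rw [Matrix.one_apply, Matrix.one_apply]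
  refine if_congr ?_ rfl rfl
  rw [toLex_inj, toLex_inj]
  constructor
  · intro h
    obtain ⟨-, rfl⟩ := side_inj.1 (congrArg Sigma.fst h)
    simpa using h
  · intro h
    obtain rfl : i = j := congrArg Sigma.fst h
    simpa using h

theorem part_one_of_ne {b b' : Bool} (hb : b ≠ b') : part b b' (1 : Matrix (Idx n) (Idx n) k) = 0 := by
  ext x y
  refine Matrix.one_apply_ne fun h => hb ?_
  exact (side_inj.1 (congrArg (fun a => (ofLex a).1) h)).1

/-- The block matrix with the given four parts. -/
noncomputable def ofParts (f : ∀ b b', Matrix (Idx fun i : Fin t => m (side b i)) (Idx fun j : Fin t => n (side b' j)) k) :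
    Matrix (Idx m) (Idx n) k := fun x y =>
  let u := exists_side (ofLex x).1
  let v := exists_side (ofLex y).1
  f u.choose v.choose
    (toLex ⟨u.choose_spec.choose, Fin.cast (congrArg m u.choose_spec.choose_spec.symm) (ofLex x).2⟩)
    (toLex ⟨v.choose_spec.choose, Fin.cast (congrArg n v.choose_spec.choose_spec.symm) (ofLex y).2⟩)

theorem part_ofParts
    (f : ∀ b b', Matrix (Idx fun i : Fin t => m (side b i)) (Idx fun j : Fin t => n (side b' j)) k)
    (b b' : Bool) : part b b' (ofParts f) = f b b' := by
  -- A preimage under `side` is unique but was obtained by choice, so the comparison is made for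
  -- arbitrary preimages, where the equalities of indices can be substituted.
  have key : ∀ {b₁ b₂ b₁' b₂' : Bool} {i₁ i₂ j₁ j₂ : Fin t} (h₁ : side b₁ i₁ = side b₂ i₂)
      (h₂ : side b₁' j₁ = side b₂' j₂) (p : Fin (m (side b₂ i₂))) (q : Fin (n (side b₂' j₂))),
      f b₁ b₁' (toLex ⟨i₁, Fin.cast (congrArg m h₁.symm) p⟩) (toLex ⟨j₁, Fin.cast (congrArg n h₂.symm) q⟩) =
      f b₂ b₂' (toLex ⟨i₂, p⟩) (toLex ⟨j₂, q⟩) := by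
    intro b₁ b₂ b₁' b₂' i₁ i₂ j₁ j₂ h₁ h₂ p q
    obtain ⟨rfl, rfl⟩ := side_inj.1 h₁
    obtain ⟨rfl, rfl⟩ := side_inj.1 h₂
    rfl
  ext x y
  exact key (exists_side (side b (ofLex x).1)).choose_spec.choose_spec
    (exists_side (side b' (ofLex y).1)).choose_spec.choose_spec (ofLex x).2 (ofLex y).2

theorem cell_doubleAlgebra (Γ : Subalgebra k (Matrix (Fin t) (Fin t) k)) (S : Matrix (Idx m) (Idx n) k)
    (b b' : Bool) (i j : Fin t) (x y : ℕ) :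
    corner b b' (cell (doubleAlgebra Γ) S (Quotient.mk _ (side b i)) x (Quotient.mk _ (side b' j)) y) =
      cell (Γ : Set (Matrix (Fin t) (Fin t) k)) (part b b' S) (Quotient.mk _ i) x (Quotient.mk _ j) y := by
  classical
  ext a c
  rw [corner, cell, cell]
  refine if_congr ?_ rfl rfl
  rw [Quotient.eq, Quotient.eq, stripSetoid_doubleAlgebra_side, stripSetoid_doubleAlgebra_side, Quotient.eq,
    Quotient.eq]
  simp

theorem corner_cell_of_ne (Γ : Subalgebra k (Matrix (Fin t) (Fin t) k)) (S : Matrix (Idx m) (Idx n) k)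
    {b b' c c' : Bool} (i j : Fin t) (x y : ℕ) (h : ¬ (c = b ∧ c' = b')) :
    corner c c' (cell (doubleAlgebra Γ) S (Quotient.mk _ (side b i)) x (Quotient.mk _ (side b' j)) y) = 0 := by
  classical
  ext u v
  rw [corner, cell, if_neg]
  · rfl
  rw [Quotient.eq, Quotient.eq, stripSetoid_doubleAlgebra_side, stripSetoid_doubleAlgebra_side]
  tauto

/-- Each class of `Γ ⊕ Γ` lies in one half, so every cell is concentrated in one of the four parts
and is there a cell of that part; the other three parts are zero. -/
theorem mem_blowUp_doubleAlgebra {Γ : Subalgebra k (Matrix (Fin t) (Fin t) k)}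
    {𝓒 : Set (Matrix (Fin (t + t)) (Fin (t + t)) k)} {𝓐 : Bool → Bool → Set (Matrix (Fin t) (Fin t) k)}
    (h0 : ∀ b b', 0 ∈ 𝓐 b b') (h𝓒 : ∀ C, C ∈ 𝓒 ↔ ∀ b b', corner b b' C ∈ 𝓐 b b')
    {S : Matrix (Idx m) (Idx n) k} : S ∈ blowUp (doubleAlgebra Γ) 𝓒 m n ↔
      ∀ b b', part b b' S ∈ blowUp (Γ : Set (Matrix (Fin t) (Fin t) k)) (𝓐 b b') _ _ := by
  constructor
  · intro h b b' I x J y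
    obtain ⟨i, rfl⟩ := Quotient.exists_rep I
    obtain ⟨j, rfl⟩ := Quotient.exists_rep J
    rw [← cell_doubleAlgebra]
    exact (h𝓒 _).1 (h _ _ _ _) b b'
  · intro h I x J y
    rw [h𝓒]
    obtain ⟨a, rfl⟩ := Quotient.exists_rep I
    obtain ⟨c, rfl⟩ := Quotient.exists_rep J
    obtain ⟨b, i, rfl⟩ := exists_side a
    obtain ⟨b', j, rfl⟩ := exists_side c
    intro c c'
    by_cases hc : c = b ∧ c' = b'
    · obtain ⟨rfl, rfl⟩ := hc
      rw [cell_doubleAlgebra]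
      exact h _ _ _ _ _ _
    · rw [corner_cell_of_ne Γ S i j x y hc]
      exact h0 c c'

theorem mem_blowUp_zero {𝓓 : Set (Matrix (Fin t) (Fin t) k)} {m n : Fin t → ℕ} {S : Matrix (Idx m) (Idx n) k} :
    S ∈ blowUp 𝓓 {0} m n ↔ S = 0 := by
  have h1 : ∀ I x J y, cell 𝓓 (0 : Matrix (Idx m) (Idx n) k) I x J y = 0 := by
    classical
    intro I x J y
    ext i j
    simp [cell, blkEntry, blk]
  constructor
  · intro h
    refine cell_ext 𝓓 fun I x J y => ?_
    rw [h1]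
    exact h I x J y
  · rintro rfl I x J y
    exact h1 I x J y

theorem mem_blowUp_double {Γ : Subalgebra k (Matrix (Fin t) (Fin t) k)} {S : Matrix (Idx m) (Idx n) k} :
    S ∈ blowUp (doubleAlgebra Γ) (doubleAlgebra Γ) m n ↔
      (∀ b, part b b S ∈ blowUp (Γ : Set (Matrix (Fin t) (Fin t) k)) (Γ : Set _) _ _) ∧
      ∀ b b', b ≠ b' → part b b' S = 0 := by
  rw [mem_blowUp_doubleAlgebra (𝓐 := fun b b' => if b = b' then (Γ : Set (Matrix (Fin t) (Fin t) k)) else {0})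
    (fun b b' => by split_ifs; exacts [Γ.zero_mem, rfl]) (fun C => mem_doubleAlgebra)]
  constructor
  · intro h
    refine ⟨fun b => by simpa using h b b, fun b b' hb => ?_⟩
    have h1 := h b b'
    rwa [if_neg hb, mem_blowUp_zero] at h1
  · rintro ⟨h1, h2⟩ b b'
    split_ifs with hb
    · subst hb
      exact h1 b
    · exact mem_blowUp_zero.2 (h2 b b' hb)

theorem mem_blowUp_zeroRad {Γ : Subalgebra k (Matrix (Fin t) (Fin t) k)} {S : Matrix (Idx m) (Idx n) k} :
    S ∈ blowUp (doubleAlgebra Γ) (zeroRad Γ) m n ↔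
      part false true S ∈ blowUp (Γ : Set (Matrix (Fin t) (Fin t) k)) (radSet Γ) _ _ ∧
      ∀ b b', ¬ (b = false ∧ b' = true) → part b b' S = 0 := by
  rw [mem_blowUp_doubleAlgebra (𝓐 := fun b b' => if b = false ∧ b' = true then radSet Γ else {0})
    (fun b b' => by split_ifs; exacts [zero_mem_radSet Γ, rfl]) (fun C => mem_zeroRad)]
  constructor
  · intro h
    refine ⟨by simpa using h false true, fun b b' hb => ?_⟩
    have h1 := h b b'
    rwa [if_neg hb, mem_blowUp_zero] at h1
  · rintro ⟨h1, h2⟩ b b'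
    split_ifs with hb
    · obtain ⟨rfl, rfl⟩ := hb
      exact h1
    · exact mem_blowUp_zero.2 (h2 b b' hb)

end Sides

/-! ### The projective modules `ProjSum Γ n` and their homomorphisms. -/

namespace ProjSum

open MulOpposite

variable {k : Type u} [Field k] {t : ℕ} {Γ : Subalgebra k (Matrix (Fin t) (Fin t) k)} {n m l : Fin t → ℕ}

/-- The `(I, p)` entry of an element, as a matrix. -/
def val (y : ProjSum Γ n) (I : Quotient (stripSetoid (Γ : Set (Matrix (Fin t) (Fin t) k))))
    (p : Fin (n I.out)) : Matrix (Fin t) (Fin t) k := ((y I p : Γ) : Matrix (Fin t) (Fin t) k)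

theorem ext {x y : ProjSum Γ n} (h : ∀ I p, x.val I p = y.val I p) : x = y := by
  funext I p
  exact Subtype.ext (Subtype.ext (h I p))

theorem val_mem (y : ProjSum Γ n) (I : Quotient (stripSetoid (Γ : Set (Matrix (Fin t) (Fin t) k))))
    (p : Fin (n I.out)) : y.val I p ∈ Γ := (y I p : Γ).2

theorem classIdempotent_mul_val (y : ProjSum Γ n)
    (I : Quotient (stripSetoid (Γ : Set (Matrix (Fin t) (Fin t) k)))) (p : Fin (n I.out)) :
    classIdempotent Γ I * y.val I p = y.val I p := (y I p).2

theorem val_apply_of_ne (y : ProjSum Γ n)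
    {I : Quotient (stripSetoid (Γ : Set (Matrix (Fin t) (Fin t) k)))} (p : Fin (n I.out)) {i : Fin t}
    (hi : Quotient.mk _ i ≠ I) (j : Fin t) : y.val I p i j = 0 := by
  classical
  rw [← classIdempotent_mul_val, IsBasicMatrixAlgebra.classIdempotent_mul_apply, if_neg hi]

/-- The element with the given entries. -/
def mk' (f : (I : Quotient (stripSetoid (Γ : Set (Matrix (Fin t) (Fin t) k)))) → Fin (n I.out) →
    Matrix (Fin t) (Fin t) k) (hf : ∀ I p, f I p ∈ Γ) (hf' : ∀ I p, classIdempotent Γ I * f I p = f I p) :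
    ProjSum Γ n := fun I p => ⟨⟨f I p, hf I p⟩, hf' I p⟩

theorem val_add (x y : ProjSum Γ n) (I : Quotient (stripSetoid (Γ : Set (Matrix (Fin t) (Fin t) k))))
    (p : Fin (n I.out)) : (x + y).val I p = x.val I p + y.val I p := rfl

theorem val_smul (c : Γᵐᵒᵖ) (x : ProjSum Γ n) (I : Quotient (stripSetoid (Γ : Set (Matrix (Fin t) (Fin t) k))))
    (p : Fin (n I.out)) : (c • x).val I p = x.val I p * ((unop c : Γ) : Matrix (Fin t) (Fin t) k) := rfl

theorem val_sum {ι : Type*} (s : Finset ι) (x : ι → ProjSum Γ n)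
    (I : Quotient (stripSetoid (Γ : Set (Matrix (Fin t) (Fin t) k)))) (p : Fin (n I.out)) :
    (∑ a ∈ s, x a).val I p = ∑ a ∈ s, (x a).val I p := by
  classical
  induction s using Finset.induction_on with
  | empty => rfl
  | insert a s ha ih => rw [Finset.sum_insert ha, Finset.sum_insert ha, val_add, ih]

theorem classIdempotent_mul_self (I : Quotient (stripSetoid (Γ : Set (Matrix (Fin t) (Fin t) k)))) :
    classIdempotent Γ I * classIdempotent Γ I = classIdempotent Γ I := by
  rw [classIdempotent, Matrix.diagonal_mul_diagonal]
  congr 1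
  ext i
  split_ifs <;> simp

theorem classIdempotent_mul_of_ne {I J : Quotient (stripSetoid (Γ : Set (Matrix (Fin t) (Fin t) k)))}
    (h : I ≠ J) : classIdempotent Γ I * classIdempotent Γ J = 0 := by
  rw [classIdempotent, classIdempotent, Matrix.diagonal_mul_diagonal, ← Matrix.diagonal_zero]
  congr 1
  ext i
  split_ifs with h1 h2
  · exact absurd (h1.symm.trans h2) h
  all_goals simp

open scoped Classical in
theorem sum_classIdempotent :
    ∑ I : Quotient (stripSetoid (Γ : Set (Matrix (Fin t) (Fin t) k))), classIdempotent Γ I = 1 := by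
  ext i j
  rw [Matrix.sum_apply]
  simp only [IsBasicMatrixAlgebra.classIdempotent_apply]
  by_cases hij : i = j
  · subst hij
    simp
  · simp [hij]

section

variable (h : IsBasicMatrixAlgebra Γ)

/-- The idempotent of a class, as an element of `Γ`. -/
noncomputable def idem (I : Quotient (stripSetoid (Γ : Set (Matrix (Fin t) (Fin t) k)))) : Γ :=
  ⟨classIdempotent Γ I, h.classIdempotent_mem I⟩

open scoped Classical in
/-- The generators of `ProjSum Γ n`. -/
noncomputable def gen (I : Quotient (stripSetoid (Γ : Set (Matrix (Fin t) (Fin t) k)))) (p : Fin (n I.out)) :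
    ProjSum Γ n :=
  mk' (fun J q => if J = I ∧ (q : ℕ) = p then classIdempotent Γ J else 0)
    (fun J q => by split_ifs; exacts [h.classIdempotent_mem J, Γ.zero_mem])
    (fun J q => by split_ifs; exacts [classIdempotent_mul_self J, mul_zero _])

open scoped Classical in
theorem val_gen (I : Quotient (stripSetoid (Γ : Set (Matrix (Fin t) (Fin t) k)))) (p : Fin (n I.out))
    (J : Quotient (stripSetoid (Γ : Set (Matrix (Fin t) (Fin t) k)))) (q : Fin (n J.out)) :
    (gen h I p).val J q = if J = I ∧ (q : ℕ) = p then classIdempotent Γ J else 0 := rfl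

theorem smul_gen (I : Quotient (stripSetoid (Γ : Set (Matrix (Fin t) (Fin t) k)))) (p : Fin (n I.out)) :
    op (idem h I) • gen h I p = (gen h I p : ProjSum Γ n) := by
  classical
  refine ext fun J q => ?_
  rw [val_smul, val_gen]
  split_ifs with hJ
  · rw [hJ.1]
    exact classIdempotent_mul_self I
  · exact zero_mul _

open scoped Classical in
theorem eq_sum (y : ProjSum Γ n) : y = ∑ I, ∑ p : Fin (n I.out), op (y I p : Γ) • gen h I p := by
  refine ext fun J q => ?_
  simp only [val_sum]
  rw [Finset.sum_eq_single J, Finset.sum_eq_single q]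
  · rw [val_smul, val_gen, if_pos ⟨rfl, rfl⟩]
    exact (classIdempotent_mul_val y J q).symm
  · intro p _ hp
    rw [val_smul, val_gen, if_neg, zero_mul]
    exact fun h' => hp (Fin.ext h'.2.symm)
  · simp
  · intro I _ hI
    refine Finset.sum_eq_zero fun p _ => ?_
    rw [val_smul, val_gen, if_neg, zero_mul]
    exact fun h' => hI h'.1.symm
  · simp

end

variable {M : Type*} [AddCommGroup M] [Module Γᵐᵒᵖ M]

open scoped Classical in
/-- The homomorphism that is determined by the images of the generators. -/
noncomputable def lift
    (v : (I : Quotient (stripSetoid (Γ : Set (Matrix (Fin t) (Fin t) k)))) → Fin (n I.out) → M) :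
    ProjSum Γ n →ₗ[Γᵐᵒᵖ] M where
  toFun y := ∑ I, ∑ p : Fin (n I.out), op (y I p : Γ) • v I p
  map_add' x y := by
    rw [← Finset.sum_add_distrib]
    refine Finset.sum_congr rfl fun I _ => ?_
    rw [← Finset.sum_add_distrib]
    refine Finset.sum_congr rfl fun p _ => ?_
    rw [← add_smul]
    rfl
  map_smul' c x := by
    rw [RingHom.id_apply, Finset.smul_sum]
    refine Finset.sum_congr rfl fun I _ => ?_
    rw [Finset.smul_sum]
    refine Finset.sum_congr rfl fun p _ => ?_
    rw [smul_smul]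
    rfl

open scoped Classical in
theorem lift_apply
    (v : (I : Quotient (stripSetoid (Γ : Set (Matrix (Fin t) (Fin t) k)))) → Fin (n I.out) → M) (y : ProjSum Γ n) :
    lift v y = ∑ I, ∑ p : Fin (n I.out), op (y I p : Γ) • v I p := rfl

theorem eq_lift (h : IsBasicMatrixAlgebra Γ) (f : ProjSum Γ n →ₗ[Γᵐᵒᵖ] M) : f = lift fun I p => f (gen h I p) := by
  classical
  refine LinearMap.ext fun y => ?_
  conv_lhs => rw [eq_sum h y]
  simp only [map_sum, map_smul]
  rfl

theorem hom_ext (h : IsBasicMatrixAlgebra Γ) {f g : ProjSum Γ n →ₗ[Γᵐᵒᵖ] M}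
    (hfg : ∀ I p, f (gen h I p) = g (gen h I p)) : f = g := by
  rw [eq_lift h f, eq_lift h g]
  simp only [hfg]

theorem comp_lift {M' : Type*} [AddCommGroup M'] [Module Γᵐᵒᵖ M'] (g : M →ₗ[Γᵐᵒᵖ] M')
    (v : (I : Quotient (stripSetoid (Γ : Set (Matrix (Fin t) (Fin t) k)))) → Fin (n I.out) → M) :
    g ∘ₗ lift v = lift fun I p => g (v I p) := by
  refine LinearMap.ext fun y => ?_
  simp only [LinearMap.comp_apply, lift_apply, map_sum, map_smul]

/-- `ProjSum Γ n` is projective. -/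
theorem exists_comp_eq (h : IsBasicMatrixAlgebra Γ) {M' : Type*} [AddCommGroup M'] [Module Γᵐᵒᵖ M']
    {g : M →ₗ[Γᵐᵒᵖ] M'} (hg : Function.Surjective g) (f : ProjSum Γ n →ₗ[Γᵐᵒᵖ] M') :
    ∃ f' : ProjSum Γ n →ₗ[Γᵐᵒᵖ] M, g ∘ₗ f' = f := by
  choose v hv using fun (I : Quotient (stripSetoid (Γ : Set (Matrix (Fin t) (Fin t) k)))) (p : Fin (n I.out)) =>
    hg (f (gen h I p))
  refine ⟨lift v, ?_⟩
  rw [comp_lift]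
  simp only [hv]
  exact (eq_lift h f).symm

/-- The homomorphism that is given by a block matrix. -/
noncomputable def homMap {N : Matrix (Idx m) (Idx n) k}
    (hN : N ∈ blowUp (Γ : Set (Matrix (Fin t) (Fin t) k)) (Γ : Set _) m n) : ProjSum Γ n →ₗ[Γᵐᵒᵖ] ProjSum Γ m :=
  lift fun J q => mk' (fun I p => cell (Γ : Set _) N I p J q) (fun I p => hN I p J q)
    fun I p => IsBasicMatrixAlgebra.classIdempotent_mul_cell N I J p q

open scoped Classical in
theorem val_homMap {N : Matrix (Idx m) (Idx n) k}
    (hN : N ∈ blowUp (Γ : Set (Matrix (Fin t) (Fin t) k)) (Γ : Set _) m n) (y : ProjSum Γ n)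
    (I : Quotient (stripSetoid (Γ : Set (Matrix (Fin t) (Fin t) k)))) (p : Fin (m I.out)) :
    (homMap hN y).val I p = ∑ J, ∑ q : Fin (n J.out), cell (Γ : Set _) N I p J q * y.val J q := by
  rw [homMap, lift_apply]
  simp only [val_sum]
  rfl

theorem val_homMap_gen (h : IsBasicMatrixAlgebra Γ) {N : Matrix (Idx m) (Idx n) k}
    (hN : N ∈ blowUp (Γ : Set (Matrix (Fin t) (Fin t) k)) (Γ : Set _) m n)
    (J : Quotient (stripSetoid (Γ : Set (Matrix (Fin t) (Fin t) k)))) (q : Fin (n J.out))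
    (I : Quotient (stripSetoid (Γ : Set (Matrix (Fin t) (Fin t) k)))) (p : Fin (m I.out)) :
    (homMap hN (gen h J q)).val I p = cell (Γ : Set _) N I p J q := by
  classical
  rw [val_homMap, Finset.sum_eq_single J, Finset.sum_eq_single q, val_gen, if_pos ⟨rfl, rfl⟩,
    IsBasicMatrixAlgebra.cell_mul_classIdempotent]
  · intro p _ hp
    rw [val_gen, if_neg, mul_zero]
    exact fun h' => hp (Fin.ext h'.2)
  · simp
  · intro I _ hI
    refine Finset.sum_eq_zero fun p _ => ?_
    rw [val_gen, if_neg, mul_zero]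
    exact fun h' => hI h'.1
  · simp

theorem homMap_mul (hn : IsStepSequence (Γ : Set (Matrix (Fin t) (Fin t) k)) n) {A : Matrix (Idx m) (Idx n) k}
    {B : Matrix (Idx n) (Idx l) k}
    (hA : A ∈ blowUp (Γ : Set (Matrix (Fin t) (Fin t) k)) (Γ : Set _) m n)
    (hB : B ∈ blowUp (Γ : Set (Matrix (Fin t) (Fin t) k)) (Γ : Set _) n l)
    (hAB : A * B ∈ blowUp (Γ : Set (Matrix (Fin t) (Fin t) k)) (Γ : Set _) m l) :
    homMap hAB = homMap hA ∘ₗ homMap hB := by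
  classical
  refine LinearMap.ext fun y => ext fun I p => ?_
  rw [LinearMap.comp_apply, val_homMap, val_homMap]
  simp only [val_homMap, cell_mul hn, Finset.sum_mul, Finset.mul_sum]
  have h1 : ∀ J : Quotient (stripSetoid (Γ : Set (Matrix (Fin t) (Fin t) k))), ∑ q : Fin (l J.out), ∑ K,
      ∑ z : Fin (n K.out), cell (Γ : Set _) A I p K z * cell (Γ : Set _) B K z J q * y.val J q =
      ∑ K, ∑ z : Fin (n K.out), ∑ q : Fin (l J.out),
        cell (Γ : Set _) A I p K z * (cell (Γ : Set _) B K z J q * y.val J q) := by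
    intro J
    rw [Finset.sum_comm]
    refine Finset.sum_congr rfl fun K _ => ?_
    rw [Finset.sum_comm]
    simp only [Matrix.mul_assoc]
  rw [Finset.sum_congr rfl fun J _ => h1 J, Finset.sum_comm]
  refine Finset.sum_congr rfl fun K _ => ?_
  rw [Finset.sum_comm]

theorem homMap_one (h : IsBasicMatrixAlgebra Γ) (hn : IsStepSequence (Γ : Set (Matrix (Fin t) (Fin t) k)) n)
    (h1 : (1 : Matrix (Idx n) (Idx n) k) ∈ blowUp (Γ : Set (Matrix (Fin t) (Fin t) k)) (Γ : Set _) n n) :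
    homMap h1 = LinearMap.id := by
  classical
  refine hom_ext h fun J q => ext fun I p => ?_
  rw [val_homMap_gen, IsBasicMatrixAlgebra.cell_one hn, LinearMap.id_apply, val_gen]
  refine if_congr ?_ rfl rfl
  have := p.2
  tauto

theorem homMap_injective (h : IsBasicMatrixAlgebra Γ) (hm : IsStepSequence (Γ : Set (Matrix (Fin t) (Fin t) k)) m)
    (hn : IsStepSequence (Γ : Set (Matrix (Fin t) (Fin t) k)) n) {A B : Matrix (Idx m) (Idx n) k}
    (hA : A ∈ blowUp (Γ : Set (Matrix (Fin t) (Fin t) k)) (Γ : Set _) m n)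
    (hB : B ∈ blowUp (Γ : Set (Matrix (Fin t) (Fin t) k)) (Γ : Set _) m n) (hAB : homMap hA = homMap hB) :
    A = B := by
  refine cell_ext (Γ : Set _) fun I x J y => ?_
  by_cases hxy : x < m I.out ∧ y < n J.out
  · have h1 := val_homMap_gen h hA J ⟨y, hxy.2⟩ I ⟨x, hxy.1⟩
    have h2 := val_homMap_gen h hB J ⟨y, hxy.2⟩ I ⟨x, hxy.1⟩
    rw [hAB] at h1
    exact h1.symm.trans h2
  · rw [cell_eq_zero hm hn A hxy, cell_eq_zero hm hn B hxy]

/-- The cells are read off from the images of the generators. They are supported in the right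
columns because each generator is fixed by its class idempotent. -/
theorem exists_homMap_eq (h : IsBasicMatrixAlgebra Γ) (hm : IsStepSequence (Γ : Set (Matrix (Fin t) (Fin t) k)) m)
    (hn : IsStepSequence (Γ : Set (Matrix (Fin t) (Fin t) k)) n) (f : ProjSum Γ n →ₗ[Γᵐᵒᵖ] ProjSum Γ m) :
    ∃ (N : Matrix (Idx m) (Idx n) k)
      (hN : N ∈ blowUp (Γ : Set (Matrix (Fin t) (Fin t) k)) (Γ : Set _) m n), homMap hN = f := by
  classical
  let c : Quotient (stripSetoid (Γ : Set (Matrix (Fin t) (Fin t) k))) → ℕ →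
      Quotient (stripSetoid (Γ : Set (Matrix (Fin t) (Fin t) k))) → ℕ → Matrix (Fin t) (Fin t) k :=
    fun I x J y => if hxy : x < m I.out ∧ y < n J.out then (f (gen h J ⟨y, hxy.2⟩)).val I ⟨x, hxy.1⟩ else 0
  have hc : ∀ I x J y i j, ¬ (Quotient.mk _ i = I ∧ Quotient.mk _ j = J) → c I x J y i j = 0 := by
    intro I x J y i j hij
    dsimp only [c]
    split_ifs with hxy
    · rw [not_and_or] at hij
      rcases hij with hi | hj
      · exact val_apply_of_ne _ _ hi j
      · have h1 := congrArg f (smul_gen h J (⟨y, hxy.2⟩ : Fin (n J.out)))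
        rw [map_smul] at h1
        rw [← h1, val_smul]
        change ((_ : Matrix (Fin t) (Fin t) k) * classIdempotent Γ J) i j = 0
        rw [IsBasicMatrixAlgebra.mul_classIdempotent_apply, if_neg hj]
    · rfl
  have hcell := cell_ofCells hm hn hc
  have hN : ofCells (Γ : Set (Matrix (Fin t) (Fin t) k)) m n c ∈
      blowUp (Γ : Set (Matrix (Fin t) (Fin t) k)) (Γ : Set _) m n := by
    intro I x J y
    rw [hcell]
    split_ifs with hxy
    · dsimp only [c]
      rw [dif_pos hxy]
      exact val_mem _ _ _
    · exact Γ.zero_mem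
  refine ⟨_, hN, hom_ext h fun J q => ext fun I p => ?_⟩
  rw [val_homMap_gen, hcell, if_pos ⟨p.2, q.2⟩]
  dsimp only [c]
  rw [dif_pos ⟨p.2, q.2⟩]

/-- The radical of `ProjSum Γ n`. -/
def rad (h : IsBasicMatrixAlgebra Γ) (n : Fin t → ℕ) : Submodule Γᵐᵒᵖ (ProjSum Γ n) where
  carrier := {y | ∀ I p i, y.val I p i i = 0}
  add_mem' := fun {x y} hx hy I p i => by
    rw [val_add, Matrix.add_apply, hx I p i, hy I p i, add_zero]
  zero_mem' := fun I p i => rfl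
  smul_mem' := fun c x hx I p i => by
    rw [val_smul, h.mul_apply_self (val_mem x I p) (unop c).2, hx I p i, zero_mul]

/-- The cells of `N` are the entries of the images of the generators, and vanishing of the diagonals
survives multiplication by elements of `Γ`. Hence matrices of the problem are exactly the
homomorphisms with radical image. -/
theorem range_homMap_le_rad_iff (h : IsBasicMatrixAlgebra Γ)
    (hm : IsStepSequence (Γ : Set (Matrix (Fin t) (Fin t) k)) m)
    (hn : IsStepSequence (Γ : Set (Matrix (Fin t) (Fin t) k)) n) {N : Matrix (Idx m) (Idx n) k}
    (hN : N ∈ blowUp (Γ : Set (Matrix (Fin t) (Fin t) k)) (Γ : Set _) m n) :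
    LinearMap.range (homMap hN) ≤ rad h m ↔
      N ∈ blowUp (Γ : Set (Matrix (Fin t) (Fin t) k)) (radSet Γ) m n := by
  classical
  constructor
  · intro hr I x J y
    refine h.mem_radSet.2 ⟨hN I x J y, fun i => ?_⟩
    by_cases hxy : x < m I.out ∧ y < n J.out
    · have h1 := val_homMap_gen h hN J ⟨y, hxy.2⟩ I ⟨x, hxy.1⟩
      have h2 := hr (LinearMap.mem_range_self (homMap hN) (gen h J ⟨y, hxy.2⟩)) I ⟨x, hxy.1⟩ i
      rw [h1] at h2
      exact h2
    · rw [cell_eq_zero hm hn N hxy]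
      rfl
  · rintro hN' _ ⟨y, rfl⟩ I p i
    rw [val_homMap, Matrix.sum_apply]
    refine Finset.sum_eq_zero fun J _ => ?_
    rw [Matrix.sum_apply]
    refine Finset.sum_eq_zero fun q _ => ?_
    obtain ⟨h1, h2⟩ := h.mem_radSet.1 (hN' I p J q)
    rw [h.mul_apply_self h1 (val_mem y J q), h2, zero_mul]

end ProjSum

theorem radSet_subset {k : Type u} [Field k] {t : ℕ} {Γ : Subalgebra k (Matrix (Fin t) (Fin t) k)} :
    radSet Γ ⊆ (Γ : Set (Matrix (Fin t) (Fin t) k)) := by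
  rintro _ ⟨R, -, rfl⟩
  exact R.2

theorem blowUp_mono {k : Type u} [Zero k] {T : ℕ} {𝓓 𝓐 𝓑 : Set (Matrix (Fin T) (Fin T) k)} (h : 𝓐 ⊆ 𝓑)
    {m n : Fin T → ℕ} {M : Matrix (Idx m) (Idx n) k} (hM : M ∈ blowUp 𝓓 𝓐 m n) : M ∈ blowUp 𝓓 𝓑 m n :=
  fun I x J y => h (hM I x J y)

open MulOpposite

/-! ### Nakayama's lemma and projective covers. -/

namespace IsBasicMatrixAlgebra

variable {k : Type u} [Field k] {t : ℕ} {Γ : Subalgebra k (Matrix (Fin t) (Fin t) k)} {n m l : Fin t → ℕ}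

/-- The radical of `Γ`, as an ideal of the opposite algebra. -/
def radIdeal (h : IsBasicMatrixAlgebra Γ) : Ideal Γᵐᵒᵖ where
  carrier := {c | ∀ i, ((unop c : Γ) : Matrix (Fin t) (Fin t) k) i i = 0}
  add_mem' := fun {a b} ha hb i => by
    change ((unop a : Γ) : Matrix (Fin t) (Fin t) k) i i + ((unop b : Γ) : Matrix (Fin t) (Fin t) k) i i = 0
    rw [ha i, hb i, add_zero]
  zero_mem' := fun i => rfl
  smul_mem' := fun c x hx i => by
    change (((unop x : Γ) : Matrix (Fin t) (Fin t) k) * ((unop c : Γ) : Matrix (Fin t) (Fin t) k)) i i = 0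
    rw [h.mul_apply_self (unop x).2 (unop c).2, hx i, zero_mul]

theorem mem_radIdeal (h : IsBasicMatrixAlgebra Γ) {c : Γ} :
    op c ∈ h.radIdeal ↔ ∀ i, (c : Matrix (Fin t) (Fin t) k) i i = 0 := Iff.rfl

theorem radIdeal_le_jacobson (h : IsBasicMatrixAlgebra Γ) : h.radIdeal ≤ Ring.jacobson Γᵐᵒᵖ := by
  refine Ideal.le_jacobson_of_isNilpotent _ fun x hx => ?_
  obtain ⟨s, hs⟩ := isNilpotent_mk (unop x).2 (h.isNilpotent_of_apply_self_eq_zero (unop x).2 hx)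
  exact ⟨s, unop_injective (by rw [unop_pow]; exact hs)⟩

/-- Nakayama's lemma. -/
theorem eq_top_of_sup_eq_top (h : IsBasicMatrixAlgebra Γ) {V : Type*} [AddCommGroup V] [Module Γᵐᵒᵖ V]
    [Module.Finite Γᵐᵒᵖ V] {W : Submodule Γᵐᵒᵖ V} (hW : W ⊔ h.radIdeal • ⊤ = ⊤) : W = ⊤ := by
  rcases eq_top_or_exists_le_coatom W with h1 | ⟨C, hC, hWC⟩
  · exact h1
  · exfalso
    have h2 : h.radIdeal • (⊤ : Submodule Γᵐᵒᵖ V) ≤ C :=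
      (Submodule.smul_mono_left h.radIdeal_le_jacobson).trans
        ((Ring.jacobson_smul_top_le Γᵐᵒᵖ V).trans (sInf_le hC))
    exact hC.1 (top_le_iff.1 (hW ▸ sup_le hWC h2))

instance : IsNoetherianRing Γᵐᵒᵖ :=
  have : Module.Finite k Γᵐᵒᵖ := Module.Finite.equiv (MulOpposite.opLinearEquiv k : Γ ≃ₗ[k] Γᵐᵒᵖ)
  isNoetherian_of_tower k inferInstance

theorem finite_projSum (h : IsBasicMatrixAlgebra Γ) : Module.Finite Γᵐᵒᵖ (ProjSum Γ n) := by
  classical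
  refine ⟨Submodule.fg_def.2 ⟨Set.range fun x : Σ I, Fin (n (Quotient.out I)) => ProjSum.gen h x.1 x.2,
    Set.finite_range _, top_le_iff.1 fun y _ => ?_⟩⟩
  rw [ProjSum.eq_sum h y]
  exact Submodule.sum_mem _ fun I _ => Submodule.sum_mem _ fun p _ =>
    Submodule.smul_mem _ _ (Submodule.subset_span ⟨⟨I, p⟩, rfl⟩)

theorem rad_le (h : IsBasicMatrixAlgebra Γ) : ProjSum.rad h n ≤ h.radIdeal • ⊤ := by
  classical
  intro y hy
  rw [ProjSum.eq_sum h y]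
  exact Submodule.sum_mem _ fun I _ => Submodule.sum_mem _ fun p _ =>
    Submodule.smul_mem_smul (h.mem_radIdeal.2 (hy I p)) trivial

theorem surjective_of_sub_mem_rad (h : IsBasicMatrixAlgebra Γ) {M : Type*} [AddCommGroup M] [Module Γᵐᵒᵖ M]
    {g : M →ₗ[Γᵐᵒᵖ] ProjSum Γ n} (hg : ∀ y, ∃ x, y - g x ∈ ProjSum.rad h n) : Function.Surjective g := by
  have := h.finite_projSum (n := n)
  rw [← LinearMap.range_eq_top]
  refine h.eq_top_of_sup_eq_top (top_le_iff.1 fun y _ => ?_)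
  obtain ⟨x, hx⟩ := hg y
  rw [← add_sub_cancel (g x) y]
  exact Submodule.add_mem_sup (LinearMap.mem_range_self g x) (h.rad_le hx)

/-- Nakayama's lemma gives surjectivity, and a surjective endomorphism of a noetherian module is
injective. -/
theorem bijective_of_sub_mem_rad (h : IsBasicMatrixAlgebra Γ)
    {g : ProjSum Γ n →ₗ[Γᵐᵒᵖ] ProjSum Γ n} (hg : ∀ y, y - g y ∈ ProjSum.rad h n) : Function.Bijective g := by
  have := h.finite_projSum (n := n)
  have h1 := h.surjective_of_sub_mem_rad fun y => ⟨y, hg y⟩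
  exact ⟨IsNoetherian.injective_of_surjective_endomorphism g h1, h1⟩

/-- Projective covers are unique. -/
theorem exists_linearEquiv_of_cover (h : IsBasicMatrixAlgebra Γ) {V : Type*} [AddCommGroup V] [Module Γᵐᵒᵖ V]
    {π : ProjSum Γ m →ₗ[Γᵐᵒᵖ] V} {π' : ProjSum Γ n →ₗ[Γᵐᵒᵖ] V} (hπ : Function.Surjective π)
    (hπ' : Function.Surjective π') (hk : LinearMap.ker π ≤ ProjSum.rad h m)
    (hk' : LinearMap.ker π' ≤ ProjSum.rad h n) :
    ∃ a : ProjSum Γ m ≃ₗ[Γᵐᵒᵖ] ProjSum Γ n, ∀ x, π' (a x) = π x := by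
  obtain ⟨a, ha⟩ := ProjSum.exists_comp_eq h hπ' π
  obtain ⟨a', ha'⟩ := ProjSum.exists_comp_eq h hπ π'
  replace ha : ∀ x, π' (a x) = π x := fun x => LinearMap.congr_fun ha x
  replace ha' : ∀ x, π (a' x) = π' x := fun x => LinearMap.congr_fun ha' x
  -- The composites lift the identity of `V`, so they differ from the identity by elements of the
  -- kernels, which lie in the radicals.
  have h1 : Function.Bijective (a' ∘ₗ a) := h.bijective_of_sub_mem_rad fun y => hk (by
    rw [LinearMap.mem_ker, map_sub, LinearMap.comp_apply, ha', ha, sub_self])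
  have h2 : Function.Bijective (a ∘ₗ a') := h.bijective_of_sub_mem_rad fun y => hk' (by
    rw [LinearMap.mem_ker, map_sub, LinearMap.comp_apply, ha, ha', sub_self])
  refine ⟨LinearEquiv.ofBijective a ⟨?_, ?_⟩, ha⟩
  · exact Function.Injective.of_comp (f := a') (by exact h1.1)
  · exact Function.Surjective.of_comp (g := a') (by exact h2.2)

/-- Modulo the radical an element of `E_I Γ` is a scalar multiple of `E_I`: its diagonal is constant
on the class `I` and zero outside it. -/
theorem val_sub_smul_mem (h : IsBasicMatrixAlgebra Γ) (y : ProjSum Γ n)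
    (I : Quotient (stripSetoid (Γ : Set (Matrix (Fin t) (Fin t) k)))) (p : Fin (n I.out)) :
    op (y I p : Γ) - op (algebraMap k Γ (y.val I p I.out I.out)) * op (ProjSum.idem h I) ∈ h.radIdeal := by
  classical
  intro i
  change y.val I p i i - (classIdempotent Γ I * algebraMap k (Matrix (Fin t) (Fin t) k) _) i i = 0
  rw [classIdempotent_mul_apply, Matrix.algebraMap_matrix_apply, if_pos rfl]
  split_ifs with hi
  · rw [sub_eq_zero]
    have h1 : stripSetoid (Γ : Set (Matrix (Fin t) (Fin t) k)) i I.out :=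
      Quotient.exact (hi.trans (Quotient.out_eq I).symm)
    exact h1 _ (ProjSum.val_mem y I p)
  · rw [ProjSum.val_apply_of_ne y p hi, sub_zero]

section Cover

variable {V : Type*} [AddCommGroup V] [Module Γᵐᵒᵖ V] [Module k V] [IsScalarTower k Γᵐᵒᵖ V]

/-- A basis of the image of `c V` in `V / W` is lifted to `V`, and the lifts are multiplied by the
idempotent `c` so that it fixes them. -/
theorem exists_basis_mod (c : Γᵐᵒᵖ) (hc : c * c = c) [Module.Finite k V] (W : Submodule Γᵐᵒᵖ V) :
    ∃ (d : ℕ) (v : Fin d → V), (∀ p, c • v p = v p) ∧ (∀ a : Fin d → k, ∑ p, a p • v p ∈ W → a = 0) ∧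
      ∀ x, ∃ a : Fin d → k, c • x - ∑ p, a p • v p ∈ W := by
  let W' : Submodule k V := W.restrictScalars k
  let L : V →ₗ[k] V ⧸ W' := W'.mkQ ∘ₗ Algebra.lsmul k k V c
  have hL : ∀ x, L x = W'.mkQ (c • x) := fun x => rfl
  let b := Module.finBasis k (LinearMap.range L)
  choose x hx using fun p => (b p).2
  have hsum : ∀ a : Fin _ → k, W'.mkQ (∑ p, a p • c • x p) = (∑ p, a p • b p : LinearMap.range L) := by
    intro a
    rw [map_sum, Submodule.coe_sum]
    refine Finset.sum_congr rfl fun p _ => ?_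
    rw [map_smul, ← hL, hx, Submodule.coe_smul]
  refine ⟨_, fun p => c • x p, fun p => by rw [smul_smul, hc], fun a ha => ?_, fun y => ?_⟩
  · have h1 : (∑ p, a p • b p : LinearMap.range L) = 0 := by
      refine Subtype.ext ?_
      rw [← hsum]
      exact (Submodule.Quotient.mk_eq_zero W').2 ha
    exact funext fun p => Fintype.linearIndependent_iff.1 b.linearIndependent a h1 p
  · refine ⟨b.repr ⟨L y, LinearMap.mem_range_self L y⟩, ?_⟩
    have h1 : W'.mkQ (c • y - ∑ p, (b.repr ⟨L y, LinearMap.mem_range_self L y⟩) p • c • x p) = 0 := by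
      rw [map_sub, hsum, b.sum_repr, ← hL, sub_self]
    exact (Submodule.Quotient.mk_eq_zero W').1 h1

/-- The multiplicity of `E_I Γ` is the dimension of the `E_I`-part of `V` modulo `W = V rad Γ`.
Lifts of bases of these parts generate `V` by Nakayama's lemma, and their independence modulo `W`
puts the kernel into the radical. -/
theorem exists_cover_aux (h : IsBasicMatrixAlgebra Γ) [Module.Finite Γᵐᵒᵖ V] :
    ∃ (n : Fin t → ℕ) (π : ProjSum Γ n →ₗ[Γᵐᵒᵖ] V),
      IsStepSequence (Γ : Set (Matrix (Fin t) (Fin t) k)) n ∧ Function.Surjective π ∧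
      LinearMap.ker π ≤ ProjSum.rad h n := by
  classical
  have : Module.Finite k Γᵐᵒᵖ := Module.Finite.equiv (MulOpposite.opLinearEquiv k : Γ ≃ₗ[k] Γᵐᵒᵖ)
  have : Module.Finite k V := Module.Finite.trans Γᵐᵒᵖ V
  let W : Submodule Γᵐᵒᵖ V := h.radIdeal • ⊤
  have hidem : ∀ I, op (ProjSum.idem h I) * op (ProjSum.idem h I) = op (ProjSum.idem h I) := fun I => by
    rw [← op_mul]
    exact congrArg op (Subtype.ext (ProjSum.classIdempotent_mul_self I))
  have hsmul : ∀ (c : k) (v : V), op (algebraMap k Γ c) • v = c • v := fun c v => algebraMap_smul Γᵐᵒᵖ c v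
  choose d v hv hind hspan using fun I => exists_basis_mod (V := V) (op (ProjSum.idem h I)) (hidem I) W
  let n : Fin t → ℕ := fun i => d (Quotient.mk _ i)
  have hn : ∀ I : Quotient (stripSetoid (Γ : Set (Matrix (Fin t) (Fin t) k))), n I.out = d I := fun I => by
    change d _ = _
    rw [Quotient.out_eq]
  let w : (I : Quotient (stripSetoid (Γ : Set (Matrix (Fin t) (Fin t) k)))) → Fin (n I.out) → V :=
    fun I p => v I (Fin.cast (hn I) p)
  have hwv : ∀ I (a : Fin (d I) → k), ∑ p, a p • v I p = ∑ p, a (Fin.cast (hn I) p) • w I p := fun I a =>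
    ((finCongr (hn I)).sum_comp fun p => a p • v I p).symm
  have hw : ∀ I p, op (ProjSum.idem h I) • w I p = w I p := fun I p => hv I _
  refine ⟨n, ProjSum.lift w, fun i j hij => congrArg d (Quotient.sound hij), ?_, ?_⟩
  · rw [← LinearMap.range_eq_top]
    refine h.eq_top_of_sup_eq_top (top_le_iff.1 fun x _ => ?_)
    have hgen : ∀ I p, w I p ∈ LinearMap.range (ProjSum.lift w) := by
      intro I p
      refine ⟨ProjSum.gen h I p, ?_⟩
      rw [ProjSum.lift_apply, Finset.sum_eq_single I, Finset.sum_eq_single p]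
      · have h1 : ((ProjSum.gen h I p : ProjSum Γ n) I p : Γ) = ProjSum.idem h I :=
          Subtype.ext ((ProjSum.val_gen h I p I p).trans (if_pos ⟨rfl, rfl⟩))
        rw [h1, hw]
      · intro q _ hq
        have h1 : ((ProjSum.gen h I p : ProjSum Γ n) I q : Γ) = 0 :=
          Subtype.ext ((ProjSum.val_gen h I p I q).trans (if_neg fun h' => hq (Fin.ext h'.2)))
        rw [h1, op_zero, zero_smul]
      · simp
      · intro J _ hJ
        refine Finset.sum_eq_zero fun q _ => ?_
        have h1 : ((ProjSum.gen h I p : ProjSum Γ n) J q : Γ) = 0 :=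
          Subtype.ext ((ProjSum.val_gen h I p J q).trans (if_neg fun h' => hJ h'.1))
        rw [h1, op_zero, zero_smul]
      · simp
    have hx : x = ∑ I, op (ProjSum.idem h I) • x := by
      rw [← Finset.sum_smul]
      have h1 : ∑ I, op (ProjSum.idem h I) = 1 := by
        rw [← Finset.op_sum, ← op_one]
        refine congrArg op (Subtype.ext ?_)
        rw [AddSubmonoidClass.coe_finsetSum]
        exact ProjSum.sum_classIdempotent
      rw [h1, one_smul]
    rw [hx]
    refine Submodule.sum_mem _ fun I _ => ?_
    obtain ⟨a, ha⟩ := hspan I x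
    rw [← add_sub_cancel (∑ p, a p • v I p) (op (ProjSum.idem h I) • x)]
    refine Submodule.add_mem_sup ?_ ha
    rw [hwv]
    refine Submodule.sum_mem _ fun p _ => ?_
    rw [← hsmul]
    exact Submodule.smul_mem _ _ (hgen I p)
  · intro y hy
    rw [LinearMap.mem_ker, ProjSum.lift_apply] at hy
    let a : (I : Quotient (stripSetoid (Γ : Set (Matrix (Fin t) (Fin t) k)))) → Fin (n I.out) → k :=
      fun I p => y.val I p I.out I.out
    have h1 : ∀ I p, op (y I p : Γ) • w I p - a I p • w I p ∈ W := by
      intro I p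
      have h2 := Submodule.smul_mem_smul (h.val_sub_smul_mem y I p) (Submodule.mem_top (x := w I p))
      rw [sub_smul, mul_smul, hw, hsmul] at h2
      exact h2
    have h2 : ∑ I, ∑ p : Fin (n I.out), a I p • w I p ∈ W := by
      have h3 : ∑ I, ∑ p : Fin (n I.out), (op (y I p : Γ) • w I p - a I p • w I p) ∈ W :=
        Submodule.sum_mem _ fun I _ => Submodule.sum_mem _ fun p _ => h1 I p
      simp only [Finset.sum_sub_distrib] at h3
      rw [hy, zero_sub] at h3
      simpa using W.neg_mem h3
    -- Idempotents of different classes are orthogonal, so multiplication by `E_I` isolates the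
    -- terms of the class `I`.
    have h3 : ∀ I, ∑ p : Fin (n I.out), a I p • w I p ∈ W := by
      intro I
      have h4 := W.smul_mem (op (ProjSum.idem h I)) h2
      rw [Finset.smul_sum, Finset.sum_eq_single I] at h4
      · rw [Finset.smul_sum] at h4
        convert h4 using 2 with p
        rw [smul_comm, hw]
      · intro J _ hJ
        rw [Finset.smul_sum]
        refine Finset.sum_eq_zero fun p _ => ?_
        have h5 : op (ProjSum.idem h I) * op (ProjSum.idem h J) = 0 := by
          rw [← op_mul, ← op_zero]
          exact congrArg op (Subtype.ext (ProjSum.classIdempotent_mul_of_ne hJ))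
        rw [smul_comm, ← hw, smul_smul, h5, zero_smul, smul_zero]
      · simp
    have h4 : ∀ I p, a I p = 0 := by
      intro I p
      have h5 := hind I (fun q => a I (Fin.cast (hn I).symm q)) (by
        rw [hwv]
        exact h3 I)
      exact congrFun h5 (Fin.cast (hn I) p)
    intro I p i
    have h5 := h.val_sub_smul_mem y I p
    have h6 : y.val I p I.out I.out = 0 := h4 I p
    rw [h6, map_zero, op_zero, zero_mul, sub_zero] at h5
    exact h5 i

end Cover

/-- Finitely generated modules have projective covers. -/
theorem exists_cover (h : IsBasicMatrixAlgebra Γ) (V : Type*) [AddCommGroup V] [Module Γᵐᵒᵖ V]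
    [Module.Finite Γᵐᵒᵖ V] : ∃ (n : Fin t → ℕ) (π : ProjSum Γ n →ₗ[Γᵐᵒᵖ] V),
      IsStepSequence (Γ : Set (Matrix (Fin t) (Fin t) k)) n ∧ Function.Surjective π ∧
      LinearMap.ker π ≤ ProjSum.rad h n := by
  let _ : Module k V := Module.compHom V (algebraMap k Γᵐᵒᵖ)
  have : IsScalarTower k Γᵐᵒᵖ V := ⟨fun c a v => by
    rw [Algebra.smul_def, mul_smul]
    rfl⟩
  exact h.exists_cover_aux

end IsBasicMatrixAlgebra

open MulOpposite

/-! ### Minimal projective presentations. -/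

namespace IsBasicMatrixAlgebra

variable {k : Type u} [Field k] {t : ℕ} {Γ : Subalgebra k (Matrix (Fin t) (Fin t) k)} {n m n' m' l : Fin t → ℕ}

theorem one_mem_blowUp (h : IsBasicMatrixAlgebra Γ) (hn : IsStepSequence (Γ : Set (Matrix (Fin t) (Fin t) k)) n) :
    (1 : Matrix (Idx n) (Idx n) k) ∈ blowUp (Γ : Set (Matrix (Fin t) (Fin t) k)) (Γ : Set _) n n :=
  (h.blowUpSubalgebra hn).one_mem

theorem mul_mem_blowUp_self (hn : IsStepSequence (Γ : Set (Matrix (Fin t) (Fin t) k)) n)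
    {A : Matrix (Idx m) (Idx n) k} {B : Matrix (Idx n) (Idx l) k}
    (hA : A ∈ blowUp (Γ : Set (Matrix (Fin t) (Fin t) k)) (Γ : Set _) m n)
    (hB : B ∈ blowUp (Γ : Set (Matrix (Fin t) (Fin t) k)) (Γ : Set _) n l) :
    A * B ∈ blowUp (Γ : Set (Matrix (Fin t) (Fin t) k)) (Γ : Set _) m l :=
  mul_mem_blowUp (Subalgebra.toSubmodule Γ).toAddSubmonoid (fun _ hC _ hD => Γ.mul_mem hC hD) hn hA hB

theorem isNoetherian_projSum (h : IsBasicMatrixAlgebra Γ) : IsNoetherian Γᵐᵒᵖ (ProjSum Γ n) :=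
  have := h.finite_projSum (n := n)
  isNoetherian_of_isNoetherianRing_of_finite _ _

/-- Minimal projective presentations are unique. -/
theorem exists_linearEquiv_of_presentation (h : IsBasicMatrixAlgebra Γ)
    {f : ProjSum Γ n →ₗ[Γᵐᵒᵖ] ProjSum Γ m} {f' : ProjSum Γ n' →ₗ[Γᵐᵒᵖ] ProjSum Γ m'}
    (hr : LinearMap.range f ≤ ProjSum.rad h m) (hr' : LinearMap.range f' ≤ ProjSum.rad h m')
    (hk : LinearMap.ker f ≤ ProjSum.rad h n) (hk' : LinearMap.ker f' ≤ ProjSum.rad h n')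
    (θ : (ProjSum Γ m ⧸ LinearMap.range f) ≃ₗ[Γᵐᵒᵖ] (ProjSum Γ m' ⧸ LinearMap.range f')) :
    ∃ (a : ProjSum Γ m ≃ₗ[Γᵐᵒᵖ] ProjSum Γ m') (b : ProjSum Γ n ≃ₗ[Γᵐᵒᵖ] ProjSum Γ n'),
      ∀ x, a (f x) = f' (b x) := by
  let π := θ.toLinearMap ∘ₗ (LinearMap.range f).mkQ
  have hπ : ∀ x, π x = 0 ↔ x ∈ LinearMap.range f := by
    intro x
    change θ ((LinearMap.range f).mkQ x) = 0 ↔ _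
    rw [LinearEquiv.map_eq_zero_iff, Submodule.mkQ_apply, Submodule.Quotient.mk_eq_zero]
  -- Both target modules are projective covers of the same cokernel, with kernels `range f` and
  -- `range f'`.
  obtain ⟨a, ha⟩ := h.exists_linearEquiv_of_cover (π := π) (π' := (LinearMap.range f').mkQ)
    (θ.surjective.comp (Submodule.mkQ_surjective _)) (Submodule.mkQ_surjective _)
    (fun x hx => hr ((hπ x).1 hx)) (by rwa [Submodule.ker_mkQ])
  have hmem : ∀ x, a x ∈ LinearMap.range f' ↔ x ∈ LinearMap.range f := by
    intro x
    rw [← hπ, ← ha, Submodule.mkQ_apply, Submodule.Quotient.mk_eq_zero]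
  -- Since `a` carries one image onto the other, `a ∘ f` and `f'` are two projective covers of
  -- `range f'`.
  let g := (a.toLinearMap ∘ₗ f).codRestrict (LinearMap.range f')
    fun x => (hmem _).2 (LinearMap.mem_range_self f x)
  have hg : ∀ x, (g x : ProjSum Γ m') = a (f x) := fun x => rfl
  obtain ⟨b, hb⟩ := h.exists_linearEquiv_of_cover (V := LinearMap.range f') (π := g) (π' := f'.rangeRestrict) (by
      rintro ⟨y, hy⟩
      obtain ⟨x, hx⟩ := (hmem (a.symm y)).1 (by rwa [LinearEquiv.apply_symm_apply])
      exact ⟨x, Subtype.ext (by rw [hg, hx, LinearEquiv.apply_symm_apply])⟩)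
    (LinearMap.surjective_rangeRestrict f') (by
      intro x hx
      apply hk
      have h1 : a (f x) = 0 := congrArg Subtype.val hx
      exact (LinearEquiv.map_eq_zero_iff a).1 h1) (by rwa [LinearMap.ker_rangeRestrict])
  exact ⟨a, b, fun x => (congrArg Subtype.val (hb x)).symm⟩

/-- Finitely generated modules have minimal projective presentations. -/
theorem exists_presentation (h : IsBasicMatrixAlgebra Γ) (V : Type*) [AddCommGroup V] [Module Γᵐᵒᵖ V]
    [Module.Finite Γᵐᵒᵖ V] : ∃ (m n : Fin t → ℕ) (f : ProjSum Γ n →ₗ[Γᵐᵒᵖ] ProjSum Γ m),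
      IsStepSequence (Γ : Set (Matrix (Fin t) (Fin t) k)) m ∧
      IsStepSequence (Γ : Set (Matrix (Fin t) (Fin t) k)) n ∧
      LinearMap.range f ≤ ProjSum.rad h m ∧ LinearMap.ker f ≤ ProjSum.rad h n ∧
      Nonempty ((ProjSum Γ m ⧸ LinearMap.range f) ≃ₗ[Γᵐᵒᵖ] V) := by
  obtain ⟨m, π, hm, hπ, hk⟩ := h.exists_cover V
  have := h.isNoetherian_projSum (n := m)
  obtain ⟨n, ρ, hn, hρ, hkρ⟩ := h.exists_cover (LinearMap.ker π)
  have hr : LinearMap.range ((LinearMap.ker π).subtype ∘ₗ ρ) = LinearMap.ker π := by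
    rw [LinearMap.range_comp, LinearMap.range_eq_top.2 hρ, Submodule.map_top, Submodule.range_subtype]
  refine ⟨m, n, (LinearMap.ker π).subtype ∘ₗ ρ, hm, hn, hr.le.trans hk, ?_, ⟨?_⟩⟩
  · rwa [LinearMap.ker_comp_of_ker_eq_bot _ (Submodule.ker_subtype _)]
  · exact (Submodule.quotEquivOfEq _ _ hr).trans (π.quotKerEquivOfSurjective hπ)

/-- A presentation splits into a minimal one and a projective summand that is mapped to zero. -/
theorem exists_splitting (h : IsBasicMatrixAlgebra Γ) (f : ProjSum Γ n →ₗ[Γᵐᵒᵖ] ProjSum Γ m) :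
    ∃ (n' l : Fin t → ℕ) (f' : ProjSum Γ n' →ₗ[Γᵐᵒᵖ] ProjSum Γ m)
      (b : ProjSum Γ n ≃ₗ[Γᵐᵒᵖ] (ProjSum Γ n' × ProjSum Γ l)),
      IsStepSequence (Γ : Set (Matrix (Fin t) (Fin t) k)) n' ∧
      IsStepSequence (Γ : Set (Matrix (Fin t) (Fin t) k)) l ∧
      LinearMap.ker f' ≤ ProjSum.rad h n' ∧ LinearMap.range f' = LinearMap.range f ∧
      ∀ x, f x = f' (b x).1 := by
  have hNm := h.isNoetherian_projSum (n := m)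
  have hNn := h.isNoetherian_projSum (n := n)
  obtain ⟨n', π, hn', hπ, hk⟩ := h.exists_cover (LinearMap.range f)
  obtain ⟨β, hβ⟩ := ProjSum.exists_comp_eq (M' := LinearMap.range f) h hπ f.rangeRestrict
  have hβ' : ∀ x, π (β x) = f.rangeRestrict x := fun x => LinearMap.congr_fun hβ x
  -- The maps `π ∘ β` and `π` are both onto `range f`, so `β` is onto modulo `ker π`, which lies in
  -- the radical.
  have hβs : Function.Surjective β := h.surjective_of_sub_mem_rad fun y => by
    obtain ⟨x, hx⟩ := (LinearMap.surjective_rangeRestrict f) (π y)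
    exact ⟨x, hk (by rw [LinearMap.mem_ker, map_sub, hβ', hx, sub_self])⟩
  -- Projectivity splits `β`. The complement `ker β`, with the projection `r`, is the summand that
  -- `f` maps to zero.
  obtain ⟨s, hs⟩ := ProjSum.exists_comp_eq h hβs LinearMap.id
  have hs' : ∀ x, β (s x) = x := fun x => LinearMap.congr_fun hs x
  obtain ⟨l, ρ, hl, hρ, hkρ⟩ := h.exists_cover (LinearMap.ker β)
  let r : ProjSum Γ n →ₗ[Γᵐᵒᵖ] LinearMap.ker β := (LinearMap.id - s ∘ₗ β).codRestrict (LinearMap.ker β) fun x => by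
    rw [LinearMap.mem_ker, LinearMap.sub_apply, map_sub, LinearMap.id_apply, LinearMap.comp_apply, hs', sub_self]
  have hr : ∀ x, (r x : ProjSum Γ n) = x - s (β x) := fun x => rfl
  have hr' : ∀ x : LinearMap.ker β, r x = x := fun x => Subtype.ext (by
    rw [hr, LinearMap.mem_ker.1 x.2, map_zero, sub_zero])
  obtain ⟨r', hr''⟩ := ProjSum.exists_comp_eq (M' := LinearMap.ker β) h hρ r
  have hr3 : ∀ x, ρ (r' x) = r x := fun x => LinearMap.congr_fun hr'' x
  -- The cover `ρ` of the summand `ker β` has the section `σ`, which is onto modulo `ker ρ` and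
  -- hence onto. So `σ` is an isomorphism, and `ker β` has the form `ProjSum Γ l`.
  let σ : LinearMap.ker β →ₗ[Γᵐᵒᵖ] ProjSum Γ l := r' ∘ₗ (LinearMap.ker β).subtype
  have hρσ : ∀ x, ρ (σ x) = x := fun x => (hr3 _).trans (hr' x)
  have hσs : Function.Surjective σ := h.surjective_of_sub_mem_rad fun y => ⟨ρ y, hkρ (by
    rw [LinearMap.mem_ker, map_sub, hρσ, sub_self])⟩
  have hσi : Function.Injective σ := fun x y hxy => by rw [← hρσ x, hxy, hρσ]
  let b : ProjSum Γ n →ₗ[Γᵐᵒᵖ] (ProjSum Γ n' × ProjSum Γ l) := β.prod (σ ∘ₗ r)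
  have hb : ∀ x, b x = (β x, σ (r x)) := fun x => rfl
  have hbb : Function.Bijective b := by
    constructor
    · rw [injective_iff_map_eq_zero]
      intro x hx
      rw [hb, Prod.mk_eq_zero] at hx
      have h1 : r x = 0 := hσi (by rw [hx.2, map_zero])
      have h2 := hr x
      rw [h1, hx.1, map_zero, sub_zero] at h2
      exact h2.symm
    · rintro ⟨y, z⟩
      obtain ⟨c, rfl⟩ := hσs z
      have h1 : β (s y + c) = y := by rw [map_add, hs', LinearMap.mem_ker.1 c.2, add_zero]
      refine ⟨s y + c, ?_⟩
      rw [hb, h1]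
      have h2 : r (s y + c) = c := Subtype.ext (by rw [hr, h1, add_sub_cancel_left])
      rw [h2]
  refine ⟨n', l, (LinearMap.range f).subtype ∘ₗ π, LinearEquiv.ofBijective b hbb, hn', hl, ?_, ?_, fun x => ?_⟩
  · rwa [LinearMap.ker_comp_of_ker_eq_bot _ (Submodule.ker_subtype _)]
  · rw [LinearMap.range_comp, LinearMap.range_eq_top.2 hπ, Submodule.map_top, Submodule.range_subtype]
  · exact (congrArg Subtype.val (hβ' x)).symm

/-- The ranks of the summands of `ProjSum Γ n` are invariants. -/
theorem size_eq_of_linearEquiv (h : IsBasicMatrixAlgebra Γ)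
    (hm : IsStepSequence (Γ : Set (Matrix (Fin t) (Fin t) k)) m)
    (hn : IsStepSequence (Γ : Set (Matrix (Fin t) (Fin t) k)) n)
    (a : ProjSum Γ n ≃ₗ[Γᵐᵒᵖ] ProjSum Γ m) : n = m := by
  -- Blown-up matrices are block triangular, so their diagonal blocks multiply separately. The
  -- diagonal blocks of mutually inverse matrices are mutually inverse, hence square.
  have key : ∀ {n m : Fin t → ℕ} {A : Matrix (Idx m) (Idx n) k} {B : Matrix (Idx n) (Idx m) k},
      A ∈ blowUp (Γ : Set (Matrix (Fin t) (Fin t) k)) (Γ : Set _) m n →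
      B ∈ blowUp (Γ : Set (Matrix (Fin t) (Fin t) k)) (Γ : Set _) n m → A * B = 1 →
      ∀ i, blk A i i * blk B i i = 1 := by
    intro n m A B hA hB hAB i
    have hz : ∀ {n m : Fin t → ℕ} {A : Matrix (Idx m) (Idx n) k},
        A ∈ blowUp (Γ : Set (Matrix (Fin t) (Fin t) k)) (Γ : Set _) m n → ∀ i j, j < i →
        ∀ p q, A (toLex ⟨i, p⟩) (toLex ⟨j, q⟩) = 0 := by
      intro n m A hA i j hij p q
      obtain ⟨C, hC, hAC⟩ := apply_of_mem_blowUp hA i j p q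
      rw [hAC i j p q ((stripSetoid _).refl _) ((stripSetoid _).refl _) rfl rfl]
      exact (h C hC).1 i j hij
    ext p q
    have h1 : (A * B) (toLex ⟨i, p⟩) (toLex ⟨i, q⟩) =
        (1 : Matrix (Idx m) (Idx m) k) (toLex ⟨i, p⟩) (toLex ⟨i, q⟩) := by rw [hAB]
    rw [Matrix.mul_apply, ← (toLex : (Σ i : Fin t, Fin (n i)) ≃ Idx n).sum_comp, Fintype.sum_sigma,
      Finset.sum_eq_single i] at h1
    · rw [Matrix.mul_apply, Matrix.one_apply]
      refine h1.trans ?_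
      rw [Matrix.one_apply]
      refine if_congr ?_ rfl rfl
      rw [toLex_inj]
      simp
    · intro j _ hj
      refine Finset.sum_eq_zero fun z _ => ?_
      rcases lt_or_gt_of_ne hj with hj | hj
      · rw [hz hA i j hj, zero_mul]
      · rw [hz hB j i hj, mul_zero]
    · simp
  obtain ⟨A, hA, hA'⟩ := ProjSum.exists_homMap_eq h hm hn a.toLinearMap
  obtain ⟨B, hB, hB'⟩ := ProjSum.exists_homMap_eq h hn hm a.symm.toLinearMap
  have hAB := mul_mem_blowUp_self hn hA hB
  have hBA := mul_mem_blowUp_self hm hB hA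
  have h1 : A * B = 1 := by
    refine ProjSum.homMap_injective h hm hm hAB (h.one_mem_blowUp hm) ?_
    rw [ProjSum.homMap_mul hn hA hB, ProjSum.homMap_one h hm, hA', hB']
    exact LinearMap.ext fun x => a.apply_symm_apply x
  have h2 : B * A = 1 := by
    refine ProjSum.homMap_injective h hn hn hBA (h.one_mem_blowUp hn) ?_
    rw [ProjSum.homMap_mul hm hB hA, ProjSum.homMap_one h hn, hA', hB']
    exact LinearMap.ext fun x => a.symm_apply_apply x
  ext i
  have h3 := Matrix.square_of_invertible (blk A i i) (blk B i i) (key hA hB h1 i) (key hB hA h2 i)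
  simpa using h3.symm

end IsBasicMatrixAlgebra

/-! ### Block-direct sums as direct sums of homomorphisms. -/

section BlockSum

variable {k : Type u} [Field k] {T : ℕ} {m₁ m₂ n₁ n₂ : Fin T → ℕ}

/-- The block-direct sum `[M_ij ⊕ N_ij]` of rectangular block matrices. -/
def blockSum (M : Matrix (Idx m₁) (Idx n₁) k) (N : Matrix (Idx m₂) (Idx n₂) k) :
    Matrix (Idx (m₁ + m₂)) (Idx (n₁ + n₂)) k :=
  fun a b => Matrix.fromBlocks (blk M (ofLex a).1 (ofLex b).1) 0 0 (blk N (ofLex a).1 (ofLex b).1)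
    (finSumFinEquiv.symm (ofLex a).2) (finSumFinEquiv.symm (ofLex b).2)

theorem blkEntry_blockSum (M : Matrix (Idx m₁) (Idx n₁) k) (N : Matrix (Idx m₂) (Idx n₂) k) (i j : Fin T) :
    (∀ x y, x < m₁ i → y < n₁ j → blkEntry (blockSum M N) i x j y = blkEntry M i x j y) ∧
    (∀ x y, blkEntry (blockSum M N) i (m₁ i + x) j (n₁ j + y) = blkEntry N i x j y) ∧
    (∀ x y, x < m₁ i → blkEntry (blockSum M N) i x j (n₁ j + y) = 0) ∧
    (∀ x y, y < n₁ j → blkEntry (blockSum M N) i (m₁ i + x) j y = 0) := by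
  have hl : ∀ {a b : ℕ} (x : ℕ) (hx : x < a) (hx' : x < a + b),
      finSumFinEquiv.symm (⟨x, hx'⟩ : Fin (a + b)) = Sum.inl ⟨x, hx⟩ := fun x hx hx' =>
    finSumFinEquiv_symm_apply_castAdd ⟨x, hx⟩
  have hr : ∀ {a b : ℕ} (x : ℕ) (hx : x < b) (hx' : a + x < a + b),
      finSumFinEquiv.symm (⟨a + x, hx'⟩ : Fin (a + b)) = Sum.inr ⟨x, hx⟩ := fun x hx hx' =>
    finSumFinEquiv_symm_apply_natAdd ⟨x, hx⟩
  have hL : ∀ {x y : ℕ} (hx : x < m₁ i + m₂ i) (hy : y < n₁ j + n₂ j), blkEntry (blockSum M N) i x j y =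
      Matrix.fromBlocks (blk M i j) 0 0 (blk N i j) (finSumFinEquiv.symm ⟨x, hx⟩)
        (finSumFinEquiv.symm ⟨y, hy⟩) := fun hx hy => dif_pos ⟨hx, hy⟩
  have hn : ∀ {x y : ℕ}, ¬ (x < m₁ i + m₂ i ∧ y < n₁ j + n₂ j) → blkEntry (blockSum M N) i x j y = 0 :=
    fun h => dif_neg h
  refine ⟨fun x y hx hy => ?_, fun x y => ?_, fun x y hx => ?_, fun x y hy => ?_⟩
  · rw [hL (by omega) (by omega), hl x hx, hl y hy, blkEntry_of_lt _ hx hy]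
    rfl
  · by_cases h : x < m₂ i ∧ y < n₂ j
    · rw [hL (by omega) (by omega), hr x h.1, hr y h.2, blkEntry_of_lt _ h.1 h.2]
      rfl
    · rw [hn (by omega), blkEntry_of_not _ h]
  · by_cases h : y < n₂ j
    · rw [hL (by omega) (by omega), hl x hx, hr y h]
      rfl
    · rw [hn (by omega)]
  · by_cases h : x < m₂ i
    · rw [hL (by omega) (by omega), hr x h, hl y hy]
      rfl
    · rw [hn (by omega)]

theorem cell_blockSum {𝓓 : Set (Matrix (Fin T) (Fin T) k)} (hm : IsStepSequence 𝓓 m₁) (hn : IsStepSequence 𝓓 n₁)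
    (M : Matrix (Idx m₁) (Idx n₁) k) (N : Matrix (Idx m₂) (Idx n₂) k) (I J : Quotient (stripSetoid 𝓓)) :
    (∀ x y, x < m₁ I.out → y < n₁ J.out → cell 𝓓 (blockSum M N) I x J y = cell 𝓓 M I x J y) ∧
    (∀ x y, cell 𝓓 (blockSum M N) I (m₁ I.out + x) J (n₁ J.out + y) = cell 𝓓 N I x J y) ∧
    (∀ x y, x < m₁ I.out → cell 𝓓 (blockSum M N) I x J (n₁ J.out + y) = 0) ∧
    (∀ x y, y < n₁ J.out → cell 𝓓 (blockSum M N) I (m₁ I.out + x) J y = 0) := by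
  classical
  have hI : ∀ {i}, Quotient.mk (stripSetoid 𝓓) i = I → m₁ I.out = m₁ i := by
    rintro i rfl
    exact hm _ _ (Quotient.mk_out i)
  have hJ : ∀ {j}, Quotient.mk (stripSetoid 𝓓) j = J → n₁ J.out = n₁ j := by
    rintro j rfl
    exact hn _ _ (Quotient.mk_out j)
  refine ⟨fun x y hx hy => ?_, fun x y => ?_, fun x y hx => ?_, fun x y hy => ?_⟩
  all_goals
    ext i j
    by_cases hij : Quotient.mk (stripSetoid 𝓓) i = I ∧ Quotient.mk (stripSetoid 𝓓) j = J
  · rw [cell, cell, if_pos hij, if_pos hij]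
    exact (blkEntry_blockSum M N i j).1 x y (hI hij.1 ▸ hx) (hJ hij.2 ▸ hy)
  · rw [cell, cell, if_neg hij, if_neg hij]
  · rw [cell, cell, if_pos hij, if_pos hij, hI hij.1, hJ hij.2]
    exact (blkEntry_blockSum M N i j).2.1 x y
  · rw [cell, cell, if_neg hij, if_neg hij]
  · rw [cell, if_pos hij, hJ hij.2]
    exact (blkEntry_blockSum M N i j).2.2.1 x y (hI hij.1 ▸ hx)
  · rw [cell, if_neg hij]
    rfl
  · rw [cell, if_pos hij, hI hij.1]
    exact (blkEntry_blockSum M N i j).2.2.2 x y (hJ hij.2 ▸ hy)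
  · rw [cell, if_neg hij]
    rfl

theorem blockSum_mem_blowUp {𝓓 𝓐 : Set (Matrix (Fin T) (Fin T) k)} (h0 : 0 ∈ 𝓐) (hm : IsStepSequence 𝓓 m₁)
    (hn : IsStepSequence 𝓓 n₁) {M : Matrix (Idx m₁) (Idx n₁) k} {N : Matrix (Idx m₂) (Idx n₂) k}
    (hM : M ∈ blowUp 𝓓 𝓐 m₁ n₁) (hN : N ∈ blowUp 𝓓 𝓐 m₂ n₂) :
    blockSum M N ∈ blowUp 𝓓 𝓐 (m₁ + m₂) (n₁ + n₂) := by
  intro I x J y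
  obtain ⟨h1, h2, h3, h4⟩ := cell_blockSum hm hn M N I J
  by_cases hx : x < m₁ I.out
  · by_cases hy : y < n₁ J.out
    · rw [h1 x y hx hy]
      exact hM I x J y
    · obtain ⟨y, rfl⟩ := Nat.exists_eq_add_of_le (not_lt.1 hy)
      rwa [h3 x y hx]
  · obtain ⟨x, rfl⟩ := Nat.exists_eq_add_of_le (not_lt.1 hx)
    by_cases hy : y < n₁ J.out
    · rwa [h4 x y hy]
    · obtain ⟨y, rfl⟩ := Nat.exists_eq_add_of_le (not_lt.1 hy)
      rw [h2 x y]
      exact hN I x J y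

theorem part_blockDirectSum {t : ℕ} {m n : Fin (t + t) → ℕ} (M : Matrix (Idx m) (Idx m) k)
    (N : Matrix (Idx n) (Idx n) k) (b b' : Bool) :
    part b b' (blockDirectSum M N) = blockSum (part b b' M) (part b b' N) := rfl

theorem blockSum_zero : blockSum (0 : Matrix (Idx m₁) (Idx n₁) k) (0 : Matrix (Idx m₂) (Idx n₂) k) = 0 := by
  ext a b
  change Matrix.fromBlocks 0 0 0 0 _ _ = _
  rw [Matrix.fromBlocks_zero]
  rfl

end BlockSum

namespace ProjSum

variable {k : Type u} [Field k] {t : ℕ} {Γ : Subalgebra k (Matrix (Fin t) (Fin t) k)} {m₁ m₂ n₁ n₂ : Fin t → ℕ}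

/-- `ProjSum Γ (n₁ + n₂)` is the direct sum of `ProjSum Γ n₁` and `ProjSum Γ n₂`. -/
noncomputable def sumEquiv (Γ : Subalgebra k (Matrix (Fin t) (Fin t) k)) (n₁ n₂ : Fin t → ℕ) :
    ProjSum Γ (n₁ + n₂) ≃ₗ[Γᵐᵒᵖ] (ProjSum Γ n₁ × ProjSum Γ n₂) where
  toFun y := (fun I p => y I (Fin.castAdd (n₂ I.out) p), fun I p => y I (Fin.natAdd (n₁ I.out) p))
  invFun y := fun I => Fin.append (y.1 I) (y.2 I)
  map_add' x y := rfl
  map_smul' c x := rfl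
  left_inv y := by
    funext I p
    refine Fin.addCases (fun q => ?_) (fun q => ?_) p
    · exact Fin.append_left _ _ q
    · exact Fin.append_right _ _ q
  right_inv y := by
    refine Prod.ext (funext fun I => funext fun p => ?_) (funext fun I => funext fun p => ?_)
    · exact Fin.append_left _ _ p
    · exact Fin.append_right _ _ p

theorem val_sumEquiv_fst (y : ProjSum Γ (n₁ + n₂))
    (I : Quotient (stripSetoid (Γ : Set (Matrix (Fin t) (Fin t) k)))) (p : Fin (n₁ I.out)) :
    (sumEquiv Γ n₁ n₂ y).1.val I p = y.val I (Fin.castAdd (n₂ I.out) p) := rfl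

theorem val_sumEquiv_snd (y : ProjSum Γ (n₁ + n₂))
    (I : Quotient (stripSetoid (Γ : Set (Matrix (Fin t) (Fin t) k)))) (p : Fin (n₂ I.out)) :
    (sumEquiv Γ n₁ n₂ y).2.val I p = y.val I (Fin.natAdd (n₁ I.out) p) := rfl

theorem sumEquiv_homMap (hm : IsStepSequence (Γ : Set (Matrix (Fin t) (Fin t) k)) m₁)
    (hn : IsStepSequence (Γ : Set (Matrix (Fin t) (Fin t) k)) n₁) {M : Matrix (Idx m₁) (Idx n₁) k}
    {N : Matrix (Idx m₂) (Idx n₂) k}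
    (hM : M ∈ blowUp (Γ : Set (Matrix (Fin t) (Fin t) k)) (Γ : Set _) m₁ n₁)
    (hN : N ∈ blowUp (Γ : Set (Matrix (Fin t) (Fin t) k)) (Γ : Set _) m₂ n₂)
    (hMN : blockSum M N ∈ blowUp (Γ : Set (Matrix (Fin t) (Fin t) k)) (Γ : Set _) (m₁ + m₂) (n₁ + n₂))
    (y : ProjSum Γ (n₁ + n₂)) : sumEquiv Γ m₁ m₂ (homMap hMN y) =
      (homMap hM (sumEquiv Γ n₁ n₂ y).1, homMap hN (sumEquiv Γ n₁ n₂ y).2) := by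
  classical
  have hsum : ∀ (I : Quotient (stripSetoid (Γ : Set (Matrix (Fin t) (Fin t) k)))) (x : Fin ((m₁ + m₂) I.out)),
      (homMap hMN y).val I x = ∑ J, ((∑ q : Fin (n₁ J.out), cell (Γ : Set _) (blockSum M N) I x J q *
        (sumEquiv Γ n₁ n₂ y).1.val J q) + ∑ q : Fin (n₂ J.out), cell (Γ : Set _) (blockSum M N) I x J
        (n₁ J.out + q) * (sumEquiv Γ n₁ n₂ y).2.val J q) := by
    intro I x
    rw [val_homMap]
    refine Finset.sum_congr rfl fun J _ => ?_
    exact Fin.sum_univ_add (fun q : Fin (n₁ J.out + n₂ J.out) =>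
      cell (Γ : Set _) (blockSum M N) I x J q * y.val J q)
  refine Prod.ext (ext fun I p => ?_) (ext fun I p => ?_)
  · rw [val_sumEquiv_fst, hsum]
    refine Eq.trans ?_ (val_homMap hM (sumEquiv Γ n₁ n₂ y).1 I p).symm
    refine Finset.sum_congr rfl fun J _ => ?_
    obtain ⟨h1, h2, h3, h4⟩ := cell_blockSum hm hn M N I J
    rw [Finset.sum_eq_zero (s := (Finset.univ : Finset (Fin (n₂ J.out)))), add_zero]
    · refine Finset.sum_congr rfl fun q _ => ?_
      rw [Fin.val_castAdd, h1 p q p.2 q.2]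
    · intro q _
      rw [Fin.val_castAdd, h3 p q p.2, zero_mul]
  · rw [val_sumEquiv_snd, hsum]
    refine Eq.trans ?_ (val_homMap hN (sumEquiv Γ n₁ n₂ y).2 I p).symm
    refine Finset.sum_congr rfl fun J _ => ?_
    obtain ⟨h1, h2, h3, h4⟩ := cell_blockSum hm hn M N I J
    rw [Finset.sum_eq_zero (s := (Finset.univ : Finset (Fin (n₁ J.out)))), zero_add]
    · refine Finset.sum_congr rfl fun q _ => ?_
      rw [Fin.val_natAdd, h2 p q]
    · intro q _
      rw [Fin.val_natAdd, h4 p q q.2, zero_mul]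

theorem sumEquiv_mem_rad (h : IsBasicMatrixAlgebra Γ) {y : ProjSum Γ (n₁ + n₂)} :
    y ∈ rad h (n₁ + n₂) ↔
      (sumEquiv Γ n₁ n₂ y).1 ∈ rad h n₁ ∧ (sumEquiv Γ n₁ n₂ y).2 ∈ rad h n₂ := by
  constructor
  · exact fun hy => ⟨fun I p i => hy I _ i, fun I p i => hy I _ i⟩
  · rintro ⟨h1, h2⟩ I p i
    refine Fin.addCases (fun q => ?_) (fun q => ?_) p
    · exact h1 I q i
    · exact h2 I q i

end ProjSum

open MulOpposite

/-! ### Isomorphism of homomorphisms and cokernels. -/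

section ArrowEquiv

variable {R : Type*} [Ring R] {P Q P' Q' P'' Q'' : Type*} [AddCommGroup P] [AddCommGroup Q] [AddCommGroup P']
  [AddCommGroup Q'] [AddCommGroup P''] [AddCommGroup Q''] [Module R P] [Module R Q] [Module R P'] [Module R Q']
  [Module R P''] [Module R Q'']

/-- Isomorphism of linear maps. -/
def ArrowEquiv (f : P →ₗ[R] Q) (f' : P' →ₗ[R] Q') : Prop :=
  ∃ (a : Q ≃ₗ[R] Q') (b : P ≃ₗ[R] P'), ∀ x, a (f x) = f' (b x)

theorem ArrowEquiv.symm {f : P →ₗ[R] Q} {f' : P' →ₗ[R] Q'} (h : ArrowEquiv f f') : ArrowEquiv f' f := by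
  obtain ⟨a, b, h⟩ := h
  refine ⟨a.symm, b.symm, fun x => ?_⟩
  rw [LinearEquiv.symm_apply_eq, h, LinearEquiv.apply_symm_apply]

theorem ArrowEquiv.trans {f : P →ₗ[R] Q} {f' : P' →ₗ[R] Q'} {f'' : P'' →ₗ[R] Q''} (h : ArrowEquiv f f')
    (h' : ArrowEquiv f' f'') : ArrowEquiv f f'' := by
  obtain ⟨a, b, h⟩ := h
  obtain ⟨a', b', h'⟩ := h'
  refine ⟨a.trans a', b.trans b', fun x => ?_⟩
  rw [LinearEquiv.trans_apply, LinearEquiv.trans_apply, h, h']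

theorem ArrowEquiv.nonempty_coker {f : P →ₗ[R] Q} {f' : P' →ₗ[R] Q'} (h : ArrowEquiv f f') :
    Nonempty ((Q ⧸ LinearMap.range f) ≃ₗ[R] (Q' ⧸ LinearMap.range f')) := by
  obtain ⟨a, b, h⟩ := h
  refine ⟨Submodule.Quotient.equiv _ _ a ?_⟩
  ext y
  constructor
  · rintro ⟨_, ⟨x, rfl⟩, rfl⟩
    exact ⟨b x, (h x).symm⟩
  · rintro ⟨x, rfl⟩
    refine ⟨f (b.symm x), ⟨_, rfl⟩, ?_⟩
    change a (f (b.symm x)) = _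
    rw [h, LinearEquiv.apply_symm_apply]

theorem ArrowEquiv.prodMap {P₁ Q₁ P₁' Q₁' : Type*} [AddCommGroup P₁] [AddCommGroup Q₁] [AddCommGroup P₁']
    [AddCommGroup Q₁'] [Module R P₁] [Module R Q₁] [Module R P₁'] [Module R Q₁'] {f : P →ₗ[R] Q} {f' : P' →ₗ[R] Q'}
    {g : P₁ →ₗ[R] Q₁} {g' : P₁' →ₗ[R] Q₁'} (h : ArrowEquiv f f') (h' : ArrowEquiv g g') :
    ArrowEquiv (f.prodMap g) (f'.prodMap g') := by
  obtain ⟨a, b, h⟩ := h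
  obtain ⟨a', b', h'⟩ := h'
  exact ⟨a.prodCongr a', b.prodCongr b', fun x => Prod.ext (h x.1) (h' x.2)⟩

/-- The cokernel of a direct sum. -/
theorem nonempty_coker_prodMap (f : P →ₗ[R] Q) (f' : P' →ₗ[R] Q') :
    Nonempty (((Q × Q') ⧸ LinearMap.range (f.prodMap f')) ≃ₗ[R]
      ((Q ⧸ LinearMap.range f) × (Q' ⧸ LinearMap.range f'))) := by
  refine ⟨(Submodule.quotEquivOfEq _ _ ?_).trans (LinearMap.quotKerEquivOfSurjective
    ((LinearMap.range f).mkQ.prodMap (LinearMap.range f').mkQ)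
    ((Submodule.mkQ_surjective _).prodMap (Submodule.mkQ_surjective _)))⟩
  rw [LinearMap.ker_prodMap, LinearMap.range_prodMap, Submodule.ker_mkQ, Submodule.ker_mkQ]

end ArrowEquiv

/-! ### Matrices of the problem as homomorphisms with radical image. -/

section ProblemMatrix

variable {k : Type u} [Field k] {t : ℕ} {Γ : Subalgebra k (Matrix (Fin t) (Fin t) k)} {X Y : BlockMatrix k (t + t)}

/-- The sizes of the horizontal strips of `X.upperRight`. -/
abbrev BlockMatrix.rows (X : BlockMatrix k (t + t)) : Fin t → ℕ := fun i => X.size (side false i)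

/-- The sizes of the vertical strips of `X.upperRight`. -/
abbrev BlockMatrix.cols (X : BlockMatrix k (t + t)) : Fin t → ℕ := fun i => X.size (side true i)

theorem BlockMatrix.size_eq_zero_iff : X.size = 0 ↔ X.rows = 0 ∧ X.cols = 0 := by
  constructor
  · intro h
    exact ⟨funext fun i => congrFun h _, funext fun i => congrFun h _⟩
  · rintro ⟨h1, h2⟩
    ext a
    obtain ⟨b, i, rfl⟩ := exists_side a
    cases b
    · exact congrFun h1 i
    · exact congrFun h2 i

namespace IsProblemMatrix

theorem rows (hX : IsProblemMatrix (doubleAlgebra Γ) (zeroRad Γ) X) :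
    IsStepSequence (Γ : Set (Matrix (Fin t) (Fin t) k)) X.rows :=
  isStepSequence_doubleAlgebra.1 hX.1 false

theorem cols (hX : IsProblemMatrix (doubleAlgebra Γ) (zeroRad Γ) X) :
    IsStepSequence (Γ : Set (Matrix (Fin t) (Fin t) k)) X.cols :=
  isStepSequence_doubleAlgebra.1 hX.1 true

theorem part_mem (hX : IsProblemMatrix (doubleAlgebra Γ) (zeroRad Γ) X) :
    part false true X.mat ∈ blowUp (Γ : Set (Matrix (Fin t) (Fin t) k)) (Γ : Set _) X.rows X.cols :=
  blowUp_mono radSet_subset (mem_blowUp_zeroRad.1 hX.2).1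

theorem part_eq_zero (hX : IsProblemMatrix (doubleAlgebra Γ) (zeroRad Γ) X) {b b' : Bool}
    (hb : ¬ (b = false ∧ b' = true)) : part b b' X.mat = 0 :=
  (mem_blowUp_zeroRad.1 hX.2).2 b b' hb

/-- The homomorphism of projective modules determined by `X`. -/
noncomputable def hom (hX : IsProblemMatrix (doubleAlgebra Γ) (zeroRad Γ) X) :
    ProjSum Γ X.cols →ₗ[Γᵐᵒᵖ] ProjSum Γ X.rows := ProjSum.homMap hX.part_mem

theorem range_hom_le (h : IsBasicMatrixAlgebra Γ) (hX : IsProblemMatrix (doubleAlgebra Γ) (zeroRad Γ) X) :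
    LinearMap.range hX.hom ≤ ProjSum.rad h X.rows :=
  (ProjSum.range_homMap_le_rad_iff h hX.rows hX.cols hX.part_mem).2 (mem_blowUp_zeroRad.1 hX.2).1

theorem range_hom (hX : IsProblemMatrix (doubleAlgebra Γ) (zeroRad Γ) X) :
    LinearMap.range hX.hom = presentationImage Γ X := by
  classical
  ext y
  constructor
  · rintro ⟨x, rfl⟩
    refine ⟨x, fun I p => ?_⟩
    refine (ProjSum.val_homMap hX.part_mem x I p).trans ?_
    rfl
  · rintro ⟨x, hx⟩
    refine ⟨x, ProjSum.ext fun I p => ?_⟩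
    refine (ProjSum.val_homMap hX.part_mem x I p).trans ?_
    exact (hx I p).symm

end IsProblemMatrix

/-- The block-diagonal matrix `A ⊕ B`. -/
noncomputable def diagParts {m n : Fin (t + t) → ℕ}
    (A : Matrix (Idx fun i : Fin t => m (side false i)) (Idx fun i : Fin t => n (side false i)) k)
    (B : Matrix (Idx fun i : Fin t => m (side true i)) (Idx fun i : Fin t => n (side true i)) k) :
    Matrix (Idx m) (Idx n) k :=
  ofParts fun b b' => match b, b' with
    | false, false => A
    | true, true => B
    | _, _ => 0

/-- The matrix `[0 N; 0 0]`. -/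
noncomputable def upperPart {m n : Fin (t + t) → ℕ}
    (N : Matrix (Idx fun i : Fin t => m (side false i)) (Idx fun i : Fin t => n (side true i)) k) :
    Matrix (Idx m) (Idx n) k :=
  ofParts fun b b' => match b, b' with
    | false, true => N
    | _, _ => 0

namespace IsBasicMatrixAlgebra

theorem exists_linearEquiv_homMap (h : IsBasicMatrixAlgebra Γ) {m n : Fin t → ℕ}
    (hm : IsStepSequence (Γ : Set (Matrix (Fin t) (Fin t) k)) m)
    (hn : IsStepSequence (Γ : Set (Matrix (Fin t) (Fin t) k)) n)
    {A : Matrix (Idx m) (Idx n) k} {B : Matrix (Idx n) (Idx m) k}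
    (hA : A ∈ blowUp (Γ : Set (Matrix (Fin t) (Fin t) k)) (Γ : Set _) m n)
    (hB : B ∈ blowUp (Γ : Set (Matrix (Fin t) (Fin t) k)) (Γ : Set _) n m) (hAB : A * B = 1) (hBA : B * A = 1) :
    ∃ a : ProjSum Γ n ≃ₗ[Γᵐᵒᵖ] ProjSum Γ m, a.toLinearMap = ProjSum.homMap hA := by
  have key : ∀ {m n : Fin t → ℕ} (_ : IsStepSequence (Γ : Set (Matrix (Fin t) (Fin t) k)) m)
      (_ : IsStepSequence (Γ : Set (Matrix (Fin t) (Fin t) k)) n)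
      {A : Matrix (Idx m) (Idx n) k} {B : Matrix (Idx n) (Idx m) k}
      (hA : A ∈ blowUp (Γ : Set (Matrix (Fin t) (Fin t) k)) (Γ : Set _) m n)
      (hB : B ∈ blowUp (Γ : Set (Matrix (Fin t) (Fin t) k)) (Γ : Set _) n m) (_ : A * B = 1),
      ProjSum.homMap hA ∘ₗ ProjSum.homMap hB = LinearMap.id := by
    intro m n hm hn A B hA hB hAB
    have h1 : A * B ∈ blowUp (Γ : Set (Matrix (Fin t) (Fin t) k)) (Γ : Set _) m m := hAB ▸ h.one_mem_blowUp hm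
    rw [← ProjSum.homMap_mul hn hA hB h1, ← ProjSum.homMap_one h hm (h.one_mem_blowUp hm)]
    congr 1
  exact ⟨LinearEquiv.ofLinearMap _ _ (key hm hn hA hB hAB) (key hn hm hB hA hBA), rfl⟩

theorem matrix_inv_mem_blowUp (h : IsBasicMatrixAlgebra Γ) {s : Fin (t + t) → ℕ}
    (hs : IsStepSequence (doubleAlgebra Γ) s) {S : Matrix (Idx s) (Idx s) k}
    (hS : S ∈ blowUp (doubleAlgebra Γ) (doubleAlgebra Γ) s s) (hu : IsUnit S) :
    S⁻¹ ∈ blowUp (doubleAlgebra Γ) (doubleAlgebra Γ) s s :=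
  Subalgebra.matrix_inv_mem (Lam := h.doubleSubalgebra.blowUpSubalgebra hs) hS hu

/-- Matrices of the problem are equivalent if and only if they determine isomorphic homomorphisms. -/
theorem lamSimilar_iff_arrowEquiv (h : IsBasicMatrixAlgebra Γ)
    (hX : IsProblemMatrix (doubleAlgebra Γ) (zeroRad Γ) X) (hY : IsProblemMatrix (doubleAlgebra Γ) (zeroRad Γ) Y) :
    (∃ N, LamSimilar (blowUp (doubleAlgebra Γ) (doubleAlgebra Γ) X.size X.size) X.mat N ∧
      BlockMatrix.mk X.size N = Y) ↔ ArrowEquiv hX.hom hY.hom := by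
  constructor
  · rintro ⟨N, hN, rfl⟩
    obtain ⟨S, hS, hu, hMS⟩ := lamSimilar_iff.1 hN
    have hS' := h.matrix_inv_mem_blowUp hX.1 hS hu
    have hd := (Matrix.isUnit_iff_isUnit_det _).1 hu
    rw [mem_blowUp_double] at hS hS'
    have hone : ∀ {S T : Matrix (Idx X.size) (Idx X.size) k}, (∀ b b', b ≠ b' → part b b' S = 0) → S * T = 1 →
        ∀ b, part b b S * part b b T = 1 := by
      intro S T hS hST b
      rw [← part_one_self b, ← hST, part_mul, Finset.sum_eq_single b]
      · intro c _ hc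
        rw [hS b c hc.symm, Matrix.zero_mul]
      · simp
    have h1 := hone hS.2 (Matrix.mul_nonsing_inv S hd)
    have h2 := hone hS'.2 (Matrix.nonsing_inv_mul S hd)
    obtain ⟨a, ha⟩ := h.exists_linearEquiv_homMap hX.rows hX.rows (hS.1 false) (hS'.1 false) (h1 false) (h2 false)
    obtain ⟨b, hb⟩ := h.exists_linearEquiv_homMap hX.cols hX.cols (hS.1 true) (hS'.1 true) (h1 true) (h2 true)
    refine ArrowEquiv.symm ⟨a, b, fun x => ?_⟩
    -- The upper right part of `M S = S N`; the off-diagonal parts of `S` vanish.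
    have h3 : part false true X.mat * part true true S = part false false S * part false true N := by
      have h4 := congrArg (part false true) hMS
      rw [part_mul, part_mul, Fintype.sum_bool, Fintype.sum_bool, hS.2 _ _ (by simp : false ≠ true),
        Matrix.mul_zero, add_zero, Matrix.zero_mul, zero_add] at h4
      exact h4
    have h5 := mul_mem_blowUp_self hX.cols hX.part_mem (hS.1 true)
    have h6 := mul_mem_blowUp_self hX.rows (hS.1 false) hY.part_mem
    have h7 : ProjSum.homMap h5 = ProjSum.homMap h6 := by
      congr 1
    rw [ProjSum.homMap_mul hX.cols hX.part_mem (hS.1 true), ProjSum.homMap_mul hX.rows (hS.1 false) hY.part_mem,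
      ← ha, ← hb] at h7
    exact (LinearMap.congr_fun h7 x).symm
  · rintro ⟨a, b, hab⟩
    -- Isomorphic homomorphisms have source and target of the same ranks, so both matrices have the
    -- same strips.
    have h1 := h.size_eq_of_linearEquiv hY.rows hX.rows a
    have h2 := h.size_eq_of_linearEquiv hY.cols hX.cols b
    have h3 : X.size = Y.size := by
      ext c
      obtain ⟨b, i, rfl⟩ := exists_side c
      cases b
      · exact congrFun h1 i
      · exact congrFun h2 i
    obtain ⟨s, M⟩ := X
    obtain ⟨s', N⟩ := Y
    obtain rfl : s = s' := h3
    refine ⟨N, ?_, rfl⟩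
    -- The matrices `A` and `B` represent `a⁻¹` and `b⁻¹`, as the relation `M S = S N` with `S = A ⊕
    -- B` reads `hX.hom ∘ b⁻¹ = a⁻¹ ∘ hY.hom`. The matrices `C` and `D` of `a` and `b` provide the
    -- inverse of `S`.
    obtain ⟨A, hA, hA'⟩ := ProjSum.exists_homMap_eq h hX.rows hX.rows a.symm.toLinearMap
    obtain ⟨B, hB, hB'⟩ := ProjSum.exists_homMap_eq h hX.cols hX.cols b.symm.toLinearMap
    obtain ⟨C, hC, hC'⟩ := ProjSum.exists_homMap_eq h hX.rows hX.rows a.toLinearMap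
    obtain ⟨D, hD, hD'⟩ := ProjSum.exists_homMap_eq h hX.cols hX.cols b.toLinearMap
    have hAC : A * C = 1 := by
      refine ProjSum.homMap_injective h hX.rows hX.rows (mul_mem_blowUp_self hX.rows hA hC)
        (h.one_mem_blowUp hX.rows) ?_
      rw [ProjSum.homMap_mul hX.rows hA hC, ProjSum.homMap_one h hX.rows, hA', hC']
      exact LinearMap.ext fun x => a.symm_apply_apply x
    have hBD : B * D = 1 := by
      refine ProjSum.homMap_injective h hX.cols hX.cols (mul_mem_blowUp_self hX.cols hB hD)
        (h.one_mem_blowUp hX.cols) ?_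
      rw [ProjSum.homMap_mul hX.cols hB hD, ProjSum.homMap_one h hX.cols, hB', hD']
      exact LinearMap.ext fun x => b.symm_apply_apply x
    have hMN : part false true M * B = A * part false true N := by
      have h5 := mul_mem_blowUp_self hX.cols hX.part_mem hB
      have h6 := mul_mem_blowUp_self hX.rows hA hY.part_mem
      refine ProjSum.homMap_injective h hX.rows hX.cols h5 h6 ?_
      rw [ProjSum.homMap_mul hX.cols hX.part_mem hB, ProjSum.homMap_mul hX.rows hA hY.part_mem, hA', hB']
      refine LinearMap.ext fun x => ?_
      change hX.hom (b.symm x) = a.symm (hY.hom x)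
      rw [LinearEquiv.eq_symm_apply, hab, LinearEquiv.apply_symm_apply]
    have hp : ∀ (A : Matrix (Idx fun i : Fin t => s (side false i)) (Idx fun i : Fin t => s (side false i)) k)
        (B : Matrix (Idx fun i : Fin t => s (side true i)) (Idx fun i : Fin t => s (side true i)) k),
        part false false (diagParts A B) = A ∧ part true true (diagParts A B) = B ∧
        ∀ b b', b ≠ b' → part b b' (diagParts A B) = 0 := by
      refine fun A B => ⟨part_ofParts _ _ _, part_ofParts _ _ _, fun b b' hb => ?_⟩
      rw [diagParts, part_ofParts]
      cases b <;> cases b' <;> simp at hb ⊢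
    obtain ⟨p1, p2, p3⟩ := hp A B
    obtain ⟨q1, q2, q3⟩ := hp C D
    rw [lamSimilar_iff]
    refine ⟨diagParts A B, mem_blowUp_double.2 ⟨?_, p3⟩, ?_, part_ext ?_⟩
    · rintro (_ | _)
      · rwa [p1]
      · rwa [p2]
    · have h8 : diagParts A B * diagParts C D = 1 := by
        refine part_ext ?_
        rintro (_ | _) (_ | _) <;> rw [part_mul, Fintype.sum_bool]
        · rw [p1, q1, p3 _ _ (by simp : false ≠ true), Matrix.zero_mul, zero_add, hAC, part_one_self]
        · rw [p3 _ _ (by simp : false ≠ true), q3 _ _ (by simp : false ≠ true), Matrix.zero_mul, zero_add,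
            Matrix.mul_zero, part_one_of_ne (by simp)]
        · rw [p3 _ _ (by simp : true ≠ false), q3 _ _ (by simp : true ≠ false), Matrix.zero_mul, add_zero,
            Matrix.mul_zero, part_one_of_ne (by simp)]
        · rw [p2, q2, p3 _ _ (by simp : true ≠ false), Matrix.zero_mul, add_zero, hBD, part_one_self]
      exact IsUnit.of_mul_eq_one _ h8
    · have hM : ∀ b b', ¬ (b = false ∧ b' = true) → part b b' M = 0 := fun b b' hb => hX.part_eq_zero hb
      have hN : ∀ b b', ¬ (b = false ∧ b' = true) → part b b' N = 0 := fun b b' hb => hY.part_eq_zero hb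
      rintro (_ | _) (_ | _) <;> rw [part_mul, part_mul, Fintype.sum_bool, Fintype.sum_bool]
      · simp [hM, hN, p3]
      · rw [p1, p2, hM false false (by simp), hN true true (by simp), hMN]
        simp
      · simp [hM, hN, p3]
      · simp [hM, hN, p3]

/-- Every radical homomorphism is determined by a matrix of the problem. -/
theorem exists_isProblemMatrix (h : IsBasicMatrixAlgebra Γ) {m n : Fin t → ℕ}
    (hm : IsStepSequence (Γ : Set (Matrix (Fin t) (Fin t) k)) m)
    (hn : IsStepSequence (Γ : Set (Matrix (Fin t) (Fin t) k)) n) {f : ProjSum Γ n →ₗ[Γᵐᵒᵖ] ProjSum Γ m}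
    (hf : LinearMap.range f ≤ ProjSum.rad h m) :
    ∃ (X : BlockMatrix k (t + t)) (hX : IsProblemMatrix (doubleAlgebra Γ) (zeroRad Γ) X),
      X.rows = m ∧ X.cols = n ∧ ArrowEquiv hX.hom f := by
  obtain ⟨s, rfl, rfl⟩ : ∃ s : Fin (t + t) → ℕ, (fun i => s (side false i)) = m ∧ (fun i => s (side true i)) = n :=
    ⟨Fin.append m n, funext fun i => Fin.append_left m n i, funext fun i => Fin.append_right m n i⟩
  obtain ⟨N, hN, rfl⟩ := ProjSum.exists_homMap_eq h hm hn f
  have hp : part false true (upperPart N : Matrix (Idx s) (Idx s) k) = N := part_ofParts _ _ _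
  have hX : IsProblemMatrix (doubleAlgebra Γ) (zeroRad Γ) ⟨s, upperPart N⟩ := by
    refine ⟨isStepSequence_doubleAlgebra.2 ?_, mem_blowUp_zeroRad.2 ⟨?_, fun b b' hb => ?_⟩⟩
    · rintro (_ | _)
      exacts [hm, hn]
    · rw [hp]
      exact (ProjSum.range_homMap_le_rad_iff h hm hn hN).1 hf
    · rw [upperPart, part_ofParts]
      cases b <;> cases b' <;> simp at hb ⊢
  refine ⟨⟨s, upperPart N⟩, hX, rfl, rfl, LinearEquiv.refl _ _, LinearEquiv.refl _ _, fun x => ?_⟩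
  have h1 : hX.hom = ProjSum.homMap hN := by
    rw [IsProblemMatrix.hom]
    congr 1
  rw [h1]
  rfl

end IsBasicMatrixAlgebra

theorem isProblemMatrix_blockDirectSum {X₁ X₂ : BlockMatrix k (t + t)}
    (h₁ : IsProblemMatrix (doubleAlgebra Γ) (zeroRad Γ) X₁) (h₂ : IsProblemMatrix (doubleAlgebra Γ) (zeroRad Γ) X₂) :
    IsProblemMatrix (doubleAlgebra Γ) (zeroRad Γ) ⟨X₁.size + X₂.size, blockDirectSum X₁.mat X₂.mat⟩ := by
  refine ⟨fun i j hij => ?_, mem_blowUp_zeroRad.2 ⟨?_, fun b b' hb => ?_⟩⟩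
  · exact congrArg₂ (· + ·) (h₁.1 i j hij) (h₂.1 i j hij)
  · exact blockSum_mem_blowUp (zero_mem_radSet Γ) h₁.rows h₁.cols (mem_blowUp_zeroRad.1 h₁.2).1
      (mem_blowUp_zeroRad.1 h₂.2).1
  · change part b b' (blockDirectSum X₁.mat X₂.mat) = 0
    rw [part_blockDirectSum, h₁.part_eq_zero hb, h₂.part_eq_zero hb, blockSum_zero]

theorem arrowEquiv_blockDirectSum {X₁ X₂ : BlockMatrix k (t + t)}
    (h₁ : IsProblemMatrix (doubleAlgebra Γ) (zeroRad Γ) X₁) (h₂ : IsProblemMatrix (doubleAlgebra Γ) (zeroRad Γ) X₂) :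
    ArrowEquiv (isProblemMatrix_blockDirectSum h₁ h₂).hom (h₁.hom.prodMap h₂.hom) :=
  ⟨ProjSum.sumEquiv Γ _ _, ProjSum.sumEquiv Γ _ _, fun x =>
    ProjSum.sumEquiv_homMap h₁.rows h₁.cols h₁.part_mem h₂.part_mem _ x⟩

end ProblemMatrix

open MulOpposite

/-! ### Indecomposable matrices and indecomposable cokernels. -/

section Correspondence

variable {k : Type u} [Field k] {t : ℕ} {Γ : Subalgebra k (Matrix (Fin t) (Fin t) k)} {X Y : BlockMatrix k (t + t)}

namespace ProjSum

variable {m n : Fin t → ℕ}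

/-- Elements of the radical are sums of multiples by elements of `h.radIdeal`, and homomorphisms
commute with these multiplications. -/
theorem map_mem_rad (h : IsBasicMatrixAlgebra Γ) (g : ProjSum Γ n →ₗ[Γᵐᵒᵖ] ProjSum Γ m) {y : ProjSum Γ n}
    (hy : y ∈ rad h n) : g y ∈ rad h m := by
  refine Submodule.smul_induction_on (p := fun y => g y ∈ rad h m) (h.rad_le hy) (fun c hc x _ => ?_)
    fun x y hx hy => ?_
  · rw [map_smul]
    intro I p i
    rw [val_smul, h.mul_apply_self (val_mem _ I p) (unop c).2, hc i, mul_zero]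
  · rw [map_add]
    exact Submodule.add_mem _ hx hy

theorem eq_zero_of_rad_eq_top (h : IsBasicMatrixAlgebra Γ)
    (hn : IsStepSequence (Γ : Set (Matrix (Fin t) (Fin t) k)) n) (hr : rad h n = ⊤) : n = 0 := by
  classical
  ext i
  by_contra hi
  let I : Quotient (stripSetoid (Γ : Set (Matrix (Fin t) (Fin t) k))) := Quotient.mk _ i
  have hI : 0 < n I.out := by
    rw [hn _ _ (Quotient.mk_out (s := stripSetoid (Γ : Set (Matrix (Fin t) (Fin t) k))) i)]
    exact Nat.pos_of_ne_zero hi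
  have h1 : gen h I ⟨0, hI⟩ ∈ rad h n := hr ▸ Submodule.mem_top
  have h2 := h1 I ⟨0, hI⟩ i
  rw [val_gen, if_pos ⟨rfl, rfl⟩, classIdempotent, Matrix.diagonal_apply_eq, if_pos rfl] at h2
  exact one_ne_zero h2

theorem subsingleton_of_eq_zero (hn : n = 0) : Subsingleton (ProjSum Γ n) := by
  subst hn
  exact ⟨fun x y => ext fun I p => p.elim0⟩

end ProjSum

theorem IsProblemMatrix.mat_eq_zero (hX : IsProblemMatrix (doubleAlgebra Γ) (zeroRad Γ) X) (h : X.rows = 0) :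
    X.mat = 0 := by
  refine part_ext fun b b' => ?_
  by_cases hb : b = false ∧ b' = true
  · obtain ⟨rfl, rfl⟩ := hb
    ext x y
    have h1 := (ofLex x).2.2
    have h2 : X.size (side false (ofLex x).1) = 0 := congrFun h (ofLex x).1
    exact absurd (h1.trans_eq h2) (Nat.not_lt_zero _)
  · rw [hX.part_eq_zero hb]
    rfl

namespace IsBasicMatrixAlgebra

/-- If the cokernel is zero, the image is the whole module, yet it lies in the radical. The
generators are not in the radical, so there are none. -/
theorem subsingleton_coker_iff (h : IsBasicMatrixAlgebra Γ)
    (hX : IsProblemMatrix (doubleAlgebra Γ) (zeroRad Γ) X) :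
    Subsingleton (ProjSum Γ X.rows ⧸ LinearMap.range hX.hom) ↔ X.rows = 0 := by
  constructor
  · intro hs
    have h1 : LinearMap.range hX.hom = ⊤ := Submodule.Quotient.subsingleton_iff.1 hs
    exact ProjSum.eq_zero_of_rad_eq_top h hX.rows (top_le_iff.1 (h1 ▸ hX.range_hom_le h))
  · intro h0
    have := ProjSum.subsingleton_of_eq_zero (Γ := Γ) h0
    infer_instance

theorem size_eq_zero (h : IsBasicMatrixAlgebra Γ) (hX : IsProblemMatrix (doubleAlgebra Γ) (zeroRad Γ) X)
    (hk : LinearMap.ker hX.hom ≤ ProjSum.rad h X.cols) (h0 : X.rows = 0) : X.size = 0 := by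
  refine BlockMatrix.size_eq_zero_iff.2 ⟨h0, ProjSum.eq_zero_of_rad_eq_top h hX.cols (top_le_iff.1 ?_)⟩
  have := ProjSum.subsingleton_of_eq_zero (Γ := Γ) h0
  exact fun x _ => hk (LinearMap.mem_ker.2 (Subsingleton.elim _ _))

theorem ker_le_rad_of_arrowEquiv (h : IsBasicMatrixAlgebra Γ) {m n m' n' : Fin t → ℕ}
    {f : ProjSum Γ n →ₗ[Γᵐᵒᵖ] ProjSum Γ m} {f' : ProjSum Γ n' →ₗ[Γᵐᵒᵖ] ProjSum Γ m'} (hf : ArrowEquiv f f')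
    (hk : LinearMap.ker f ≤ ProjSum.rad h n) : LinearMap.ker f' ≤ ProjSum.rad h n' := by
  obtain ⟨a, b, hab⟩ := hf.symm
  intro x hx
  have h1 : b x ∈ LinearMap.ker f := by rw [LinearMap.mem_ker, ← hab, LinearMap.mem_ker.1 hx, map_zero]
  rw [← b.symm_apply_apply x]
  exact ProjSum.map_mem_rad h b.symm.toLinearMap (hk h1)

theorem ker_blockDirectSum_le_rad (h : IsBasicMatrixAlgebra Γ) {X₁ X₂ : BlockMatrix k (t + t)}
    (h₁ : IsProblemMatrix (doubleAlgebra Γ) (zeroRad Γ) X₁) (h₂ : IsProblemMatrix (doubleAlgebra Γ) (zeroRad Γ) X₂) :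
    LinearMap.ker (isProblemMatrix_blockDirectSum h₁ h₂).hom ≤ ProjSum.rad h (X₁.cols + X₂.cols) ↔
      LinearMap.ker h₁.hom ≤ ProjSum.rad h X₁.cols ∧ LinearMap.ker h₂.hom ≤ ProjSum.rad h X₂.cols := by
  have key : ∀ x : ProjSum Γ (X₁.cols + X₂.cols), (isProblemMatrix_blockDirectSum h₁ h₂).hom x = 0 ↔
      h₁.hom (ProjSum.sumEquiv Γ _ _ x).1 = 0 ∧ h₂.hom (ProjSum.sumEquiv Γ _ _ x).2 = 0 := by
    intro x
    rw [← Prod.mk_eq_zero, ← LinearEquiv.map_eq_zero_iff (ProjSum.sumEquiv Γ X₁.rows X₂.rows)]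
    exact Eq.congr_left
      (ProjSum.sumEquiv_homMap h₁.rows h₁.cols h₁.part_mem h₂.part_mem (isProblemMatrix_blockDirectSum h₁ h₂).part_mem x)
  constructor
  · intro hk
    constructor
    · intro y hy
      have h3 := (ProjSum.sumEquiv_mem_rad h).1 (hk ((key ((ProjSum.sumEquiv Γ X₁.cols X₂.cols).symm (y, 0))).2 (by
        rw [LinearEquiv.apply_symm_apply]
        exact ⟨hy, map_zero _⟩)))
      rw [LinearEquiv.apply_symm_apply] at h3
      exact h3.1
    · intro y hy
      have h3 := (ProjSum.sumEquiv_mem_rad h).1 (hk ((key ((ProjSum.sumEquiv Γ X₁.cols X₂.cols).symm (0, y))).2 (by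
        rw [LinearEquiv.apply_symm_apply]
        exact ⟨map_zero _, hy⟩)))
      rw [LinearEquiv.apply_symm_apply] at h3
      exact h3.2
  · rintro ⟨hk₁, hk₂⟩ x hx
    have h3 := (key x).1 hx
    exact (ProjSum.sumEquiv_mem_rad h).2 ⟨hk₁ h3.1, hk₂ h3.2⟩

/-- Indecomposability in terms of homomorphisms. -/
theorem isIndecomposableMatrix_iff (h : IsBasicMatrixAlgebra Γ)
    (hX : IsProblemMatrix (doubleAlgebra Γ) (zeroRad Γ) X) :
    IsIndecomposableMatrix (doubleAlgebra Γ) (zeroRad Γ) X ↔ X.size ≠ 0 ∧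
      ∀ (X₁ X₂ : BlockMatrix k (t + t)) (h₁ : IsProblemMatrix (doubleAlgebra Γ) (zeroRad Γ) X₁)
        (h₂ : IsProblemMatrix (doubleAlgebra Γ) (zeroRad Γ) X₂),
        ArrowEquiv hX.hom (h₁.hom.prodMap h₂.hom) → X₁.size = 0 ∨ X₂.size = 0 := by
  refine and_congr_right fun _ => ⟨fun hi X₁ X₂ h₁ h₂ hf => ?_, fun hi N X₁ X₂ h₁ h₂ hN he => ?_⟩
  · obtain ⟨N, hN, he⟩ := (h.lamSimilar_iff_arrowEquiv hX (isProblemMatrix_blockDirectSum h₁ h₂)).2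
      (hf.trans (arrowEquiv_blockDirectSum h₁ h₂).symm)
    exact hi N X₁ X₂ h₁ h₂ hN he
  · exact hi X₁ X₂ h₁ h₂ (((h.lamSimilar_iff_arrowEquiv hX (isProblemMatrix_blockDirectSum h₁ h₂)).1
      ⟨N, hN, he⟩).trans (arrowEquiv_blockDirectSum h₁ h₂))

/-- Up to the exceptional zero matrices, indecomposable matrices determine minimal presentations. -/
theorem ker_le_rad_of_isIndecomposableMatrix (h : IsBasicMatrixAlgebra Γ)
    (hX : IsProblemMatrix (doubleAlgebra Γ) (zeroRad Γ) X)
    (hi : IsIndecomposableMatrix (doubleAlgebra Γ) (zeroRad Γ) X) (h0 : X.rows ≠ 0) :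
    LinearMap.ker hX.hom ≤ ProjSum.rad h X.cols := by
  -- The homomorphism is the sum of one with kernel in the radical and of a map from `ProjSum Γ l`
  -- to zero. The first summand has nonzero target, so indecomposability leaves only `l = 0`.
  obtain ⟨n', l, f', b, hn', hl, hk, hr, hb⟩ := h.exists_splitting hX.hom
  obtain ⟨X₁, h₁, hr₁, -, he₁⟩ := h.exists_isProblemMatrix hX.rows hn' (f := f') (hr ▸ hX.range_hom_le h)
  obtain ⟨X₂, h₂, -, hc₂, he₂⟩ := h.exists_isProblemMatrix (m := 0) (fun _ _ _ => rfl) hl (f := 0) (by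
    rintro _ ⟨x, rfl⟩
    exact Submodule.zero_mem _)
  have := ProjSum.subsingleton_of_eq_zero (Γ := Γ) (n := 0) rfl
  let a : ProjSum Γ X.rows ≃ₗ[Γᵐᵒᵖ] (ProjSum Γ X.rows × ProjSum Γ 0) :=
    LinearEquiv.ofLinearMap (LinearMap.inl _ _ _) (LinearMap.fst _ _ _)
      (LinearMap.ext fun x => Prod.ext rfl (Subsingleton.elim _ _)) (LinearMap.ext fun x => rfl)
  have hab : ArrowEquiv hX.hom (f'.prodMap (0 : ProjSum Γ l →ₗ[Γᵐᵒᵖ] ProjSum Γ 0)) :=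
    ⟨a, b, fun x => Prod.ext (hb x) (Subsingleton.elim _ _)⟩
  rcases ((h.isIndecomposableMatrix_iff hX).1 hi).2 X₁ X₂ h₁ h₂ (hab.trans (he₁.symm.prodMap he₂.symm))
    with h3 | h3
  · exact absurd (hr₁.symm.trans (BlockMatrix.size_eq_zero_iff.1 h3).1) h0
  · have := ProjSum.subsingleton_of_eq_zero (Γ := Γ) (hc₂.symm.trans (BlockMatrix.size_eq_zero_iff.1 h3).2)
    intro x hx
    have h4 : (b x).1 ∈ LinearMap.ker f' := by
      rw [LinearMap.mem_ker, ← hb]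
      exact hx
    have h5 : x = (b.symm.toLinearMap ∘ₗ LinearMap.inl _ _ _) (b x).1 := by
      change x = b.symm ((b x).1, 0)
      rw [LinearEquiv.eq_symm_apply]
      exact Prod.ext rfl (Subsingleton.elim _ _)
    rw [h5]
    exact ProjSum.map_mem_rad h _ (hk h4)

theorem exists_minimal (h : IsBasicMatrixAlgebra Γ) (V : Type*) [AddCommGroup V] [Module Γᵐᵒᵖ V]
    [Module.Finite Γᵐᵒᵖ V] : ∃ (X : BlockMatrix k (t + t)) (hX : IsProblemMatrix (doubleAlgebra Γ) (zeroRad Γ) X),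
      LinearMap.ker hX.hom ≤ ProjSum.rad h X.cols ∧
      Nonempty ((ProjSum Γ X.rows ⧸ LinearMap.range hX.hom) ≃ₗ[Γᵐᵒᵖ] V) := by
  obtain ⟨m, n, f, hm, hn, hr, hk, ⟨θ⟩⟩ := h.exists_presentation V
  obtain ⟨X, hX, -, -, he⟩ := h.exists_isProblemMatrix hm hn hr
  obtain ⟨θ'⟩ := he.nonempty_coker
  exact ⟨X, hX, h.ker_le_rad_of_arrowEquiv he.symm hk, ⟨θ'.trans θ⟩⟩

/-- A direct decomposition of the cokernel of a minimal presentation comes from a decomposition of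
the presentation. -/
theorem subsingleton_or_of_linearEquiv (h : IsBasicMatrixAlgebra Γ)
    (hX : IsProblemMatrix (doubleAlgebra Γ) (zeroRad Γ) X)
    (hi : IsIndecomposableMatrix (doubleAlgebra Γ) (zeroRad Γ) X)
    (hk : LinearMap.ker hX.hom ≤ ProjSum.rad h X.cols) {V W : Type*} [AddCommGroup V] [Module Γᵐᵒᵖ V]
    [AddCommGroup W] [Module Γᵐᵒᵖ W]
    (θ : (ProjSum Γ X.rows ⧸ LinearMap.range hX.hom) ≃ₗ[Γᵐᵒᵖ] (V × W)) : Subsingleton V ∨ Subsingleton W := by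
  have := h.finite_projSum (n := X.rows)
  have : Module.Finite Γᵐᵒᵖ (V × W) := Module.Finite.equiv θ
  have : Module.Finite Γᵐᵒᵖ V := Module.Finite.of_surjective (LinearMap.fst Γᵐᵒᵖ V W) Prod.fst_surjective
  have : Module.Finite Γᵐᵒᵖ W := Module.Finite.of_surjective (LinearMap.snd Γᵐᵒᵖ V W) Prod.snd_surjective
  obtain ⟨X₁, h₁, hk₁, ⟨θ₁⟩⟩ := h.exists_minimal V
  obtain ⟨X₂, h₂, hk₂, ⟨θ₂⟩⟩ := h.exists_minimal W
  obtain ⟨θ₃⟩ := (arrowEquiv_blockDirectSum h₁ h₂).nonempty_coker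
  obtain ⟨θ₄⟩ := nonempty_coker_prodMap h₁.hom h₂.hom
  -- The sum of minimal presentations of `V` and `W` is a minimal presentation of `V × W`, and by
  -- uniqueness it is isomorphic to the given one.
  have he : ArrowEquiv hX.hom (isProblemMatrix_blockDirectSum h₁ h₂).hom :=
    h.exists_linearEquiv_of_presentation (hX.range_hom_le h) ((isProblemMatrix_blockDirectSum h₁ h₂).range_hom_le h)
      hk ((h.ker_blockDirectSum_le_rad h₁ h₂).2 ⟨hk₁, hk₂⟩)
      (θ.trans ((θ₃.trans θ₄).trans (θ₁.prodCongr θ₂)).symm)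
  rcases ((h.isIndecomposableMatrix_iff hX).1 hi).2 X₁ X₂ h₁ h₂ (he.trans (arrowEquiv_blockDirectSum h₁ h₂))
    with h3 | h3
  · have := (h.subsingleton_coker_iff h₁).2 (BlockMatrix.size_eq_zero_iff.1 h3).1
    exact Or.inl θ₁.symm.toEquiv.subsingleton
  · have := (h.subsingleton_coker_iff h₂).2 (BlockMatrix.size_eq_zero_iff.1 h3).1
    exact Or.inr θ₂.symm.toEquiv.subsingleton

/-- Minimal presentations of indecomposable modules are indecomposable. -/
theorem isIndecomposableMatrix_of_coker (h : IsBasicMatrixAlgebra Γ)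
    (hX : IsProblemMatrix (doubleAlgebra Γ) (zeroRad Γ) X) (hk : LinearMap.ker hX.hom ≤ ProjSum.rad h X.cols)
    (h0 : X.rows ≠ 0)
    (hV : ∀ (V W : Type u) [AddCommGroup V] [Module Γᵐᵒᵖ V] [AddCommGroup W] [Module Γᵐᵒᵖ W],
      ((ProjSum Γ X.rows ⧸ LinearMap.range hX.hom) ≃ₗ[Γᵐᵒᵖ] (V × W)) → Subsingleton V ∨ Subsingleton W) :
    IsIndecomposableMatrix (doubleAlgebra Γ) (zeroRad Γ) X := by
  refine (h.isIndecomposableMatrix_iff hX).2 ⟨fun hs => h0 (BlockMatrix.size_eq_zero_iff.1 hs).1,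
    fun X₁ X₂ h₁ h₂ he => ?_⟩
  obtain ⟨hk₁, hk₂⟩ := (h.ker_blockDirectSum_le_rad h₁ h₂).1
    (h.ker_le_rad_of_arrowEquiv (he.trans (arrowEquiv_blockDirectSum h₁ h₂).symm) hk)
  obtain ⟨θ₁⟩ := he.nonempty_coker
  obtain ⟨θ₂⟩ := nonempty_coker_prodMap h₁.hom h₂.hom
  rcases hV _ _ (θ₁.trans θ₂) with hs | hs
  · exact Or.inl (h.size_eq_zero h₁ hk₁ ((h.subsingleton_coker_iff h₁).1 hs))
  · exact Or.inr (h.size_eq_zero h₂ hk₂ ((h.subsingleton_coker_iff h₂).1 hs))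

/-- The radical is a two-sided ideal, so `0 ∖ rad Γ` is stable under multiplication by `Γ ⊕ Γ` on
both sides, and this stability passes to blow-ups. -/
theorem isProblemMatrix_of_lamSimilar (h : IsBasicMatrixAlgebra Γ)
    (hX : IsProblemMatrix (doubleAlgebra Γ) (zeroRad Γ) X) {N : Matrix (Idx X.size) (Idx X.size) k}
    (hN : LamSimilar (blowUp (doubleAlgebra Γ) (doubleAlgebra Γ) X.size X.size) X.mat N) :
    IsProblemMatrix (doubleAlgebra Γ) (zeroRad Γ) ⟨X.size, N⟩ := by
  obtain ⟨S, hS, hu, rfl⟩ := hN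
  let 𝓒 : AddSubmonoid (Matrix (Fin (t + t)) (Fin (t + t)) k) :=
    { carrier := zeroRad Γ
      zero_mem' := ⟨0, Submodule.zero_mem _, by
        rw [ZeroMemClass.coe_zero, Matrix.fromBlocks_zero]
        rfl⟩
      add_mem' := by
        rintro _ _ ⟨R, hR, rfl⟩ ⟨R', hR', rfl⟩
        refine ⟨R + R', Submodule.add_mem _ hR hR', ?_⟩
        rw [Subalgebra.coe_add]
        have h1 := Matrix.fromBlocks_add (0 : Matrix (Fin t) (Fin t) k) (R : Matrix (Fin t) (Fin t) k)
          (0 : Matrix (Fin t) (Fin t) k) (0 : Matrix (Fin t) (Fin t) k) 0 (R' : Matrix (Fin t) (Fin t) k) 0 0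
        simp only [add_zero] at h1
        rw [← h1]
        rfl }
  refine ⟨hX.1, mul_mem_blowUp 𝓒 (𝓐 := zeroRad Γ) (𝓑 := doubleAlgebra Γ) ?_ hX.1
    (mul_mem_blowUp 𝓒 (𝓐 := doubleAlgebra Γ) (𝓑 := zeroRad Γ) ?_ hX.1 (h.matrix_inv_mem_blowUp hX.1 hS hu) hX.2) hS⟩
  · rintro _ ⟨R, hR, rfl⟩ _ ⟨A, hA, B, hB, rfl⟩
    refine ⟨R * ⟨B, hB⟩, Ideal.mul_mem_right _ _ hR, ?_⟩
    rw [Matrix.submatrix_mul_equiv, Matrix.fromBlocks_multiply]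
    simp
  · rintro _ ⟨A, hA, B, hB, rfl⟩ _ ⟨R, hR, rfl⟩
    refine ⟨⟨A, hA⟩ * R, Ideal.mul_mem_left _ _ hR, ?_⟩
    rw [Matrix.submatrix_mul_equiv, Matrix.fromBlocks_multiply]
    simp

end IsBasicMatrixAlgebra

theorem isFiniteDimensional_iff {V : ModuleCat.{u} Γᵐᵒᵖ} : IsFiniteDimensional V ↔ Module.Finite Γᵐᵒᵖ V := by
  let _ : Module k V := Module.compHom V (algebraMap k Γᵐᵒᵖ)
  have : IsScalarTower k Γᵐᵒᵖ V := ⟨fun c a v => by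
    rw [Algebra.smul_def, mul_smul]
    rfl⟩
  have : Module.Finite k Γᵐᵒᵖ := Module.Finite.equiv (MulOpposite.opLinearEquiv k : Γ ≃ₗ[k] Γᵐᵒᵖ)
  exact ⟨fun (h : Module.Finite k V) => Module.Finite.of_restrictScalars_finite k Γᵐᵒᵖ V, fun h => Module.Finite.trans Γᵐᵒᵖ V⟩

theorem indecomposable_iff {R : Type*} [Ring R] {V : ModuleCat.{u} R} : CategoryTheory.Indecomposable V ↔
    ¬ Subsingleton V ∧ ∀ (W W' : Type u) [AddCommGroup W] [Module R W] [AddCommGroup W'] [Module R W'],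
      (V ≃ₗ[R] (W × W')) → Subsingleton W ∨ Subsingleton W' := by
  refine and_congr (not_congr ModuleCat.isZero_iff_subsingleton) ⟨fun hi W W' _ _ _ _ e => ?_, fun hi W W' e => ?_⟩
  · have h1 := hi (ModuleCat.of R W) (ModuleCat.of R W')
      (e.toModuleIso ≪≫ (ModuleCat.biprodIsoProd (ModuleCat.of R W) (ModuleCat.of R W')).symm)
    rwa [ModuleCat.isZero_iff_subsingleton, ModuleCat.isZero_iff_subsingleton] at h1
  · rw [ModuleCat.isZero_iff_subsingleton, ModuleCat.isZero_iff_subsingleton]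
    exact hi W W' (e ≪≫ ModuleCat.biprodIsoProd W W').toLinearEquiv

end Correspondence

/-! ### The bijection. -/

theorem theorem2p4 {k : Type u} [Field k] [IsAlgClosed k] [LinearOrder k] (t : ℕ)
    (Γ : Subalgebra k (Matrix (Fin t) (Fin t) k)) (hΓ : IsBasicMatrixAlgebra Γ) :
    Set.BijOn (fun X : BlockMatrix k (t + t) => isoclass (presentedModule Γ X))
      (indecomposableCanonicalMatrices Γ) (indecomposableIsoclasses Γ) := by
  have hcoker : ∀ {X : BlockMatrix k (t + t)} (hX : IsProblemMatrix (doubleAlgebra Γ) (zeroRad Γ) X),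
      Nonempty ((ProjSum Γ X.rows ⧸ LinearMap.range hX.hom) ≃ₗ[Γᵐᵒᵖ] presentedModule Γ X) :=
    fun hX => ⟨Submodule.quotEquivOfEq _ _ hX.range_hom⟩
  have hmin : ∀ {X : BlockMatrix k (t + t)} (hX : IsProblemMatrix (doubleAlgebra Γ) (zeroRad Γ) X),
      X ∈ indecomposableCanonicalMatrices Γ →
      X.rows ≠ 0 ∧ LinearMap.ker hX.hom ≤ ProjSum.rad hΓ X.cols := by
    rintro X hX ⟨_, hi, hne⟩
    -- Without rows in its upper right part the matrix is zero, and it is one of the excluded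
    -- matrices.
    have h0 : X.rows ≠ 0 := fun h0 => hne ⟨hX.mat_eq_zero h0, fun i => congrFun h0 i⟩
    exact ⟨h0, hΓ.ker_le_rad_of_isIndecomposableMatrix hX hi h0⟩
  have hred : ∀ {X : BlockMatrix k (t + t)} (_ : IsProblemMatrix (doubleAlgebra Γ) (zeroRad Γ) X),
      ∃ (P : StripPartition (Idx X.size)) (r : Setoid (Fin P.count)),
        IsReducedAlgebra P r (blowUp (doubleAlgebra Γ) (doubleAlgebra Γ) X.size X.size) :=
    fun hX => hΓ.doubleSubalgebra.exists_isReducedAlgebra_blowUp hX.1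
  refine ⟨fun X hX => ?_, fun X hX Y hY hXY => ?_, ?_⟩
  · obtain ⟨θ⟩ := hcoker hX.1.1
    obtain ⟨h0, hk⟩ := hmin hX.1.1 hX
    refine ⟨presentedModule Γ X, rfl, isFiniteDimensional_iff.2 ?_, indecomposable_iff.2 ⟨fun hs => ?_, ?_⟩⟩
    · have := hΓ.finite_projSum (n := X.rows)
      exact Module.Finite.equiv θ
    · exact h0 ((hΓ.subsingleton_coker_iff hX.1.1).1 θ.toEquiv.subsingleton)
    · intro W W' _ _ _ _ e
      exact hΓ.subsingleton_or_of_linearEquiv hX.1.1 hX.2.1 hk (θ.trans e)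
  · obtain ⟨e⟩ := Quotient.exact hXY
    obtain ⟨θ⟩ := hcoker hX.1.1
    obtain ⟨θ'⟩ := hcoker hY.1.1
    have he : ArrowEquiv hX.1.1.hom hY.1.1.hom :=
      hΓ.exists_linearEquiv_of_presentation (hX.1.1.range_hom_le hΓ) (hY.1.1.range_hom_le hΓ)
        (hmin hX.1.1 hX).2 (hmin hY.1.1 hY).2 ((θ.trans e.toLinearEquiv).trans θ'.symm)
    -- Both presentations are minimal with isomorphic cokernels, so `Y` has the size of `X` and is
    -- equivalent to it; the canonical matrix of an equivalence class is unique.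
    obtain ⟨N, hN, rfl⟩ := (hΓ.lamSimilar_iff_arrowEquiv hX.1.1 hY.1.1).2 he
    obtain ⟨P, r, hr⟩ := hred hX.1.1
    have h1 := IsLamCanonical.eq_of_lamSimilar hr hX.1.2 hY.1.2 hN
    cases X
    cases h1
    rfl
  · rintro _ ⟨V, rfl, hfd, hV⟩
    have := isFiniteDimensional_iff.1 hfd
    obtain ⟨hV0, hV⟩ := indecomposable_iff.1 hV
    obtain ⟨X, hX, hk, ⟨θ⟩⟩ := hΓ.exists_minimal V
    obtain ⟨P, r, hr⟩ := hred hX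
    -- Passing to the canonical form changes the homomorphism only up to isomorphism, so minimality
    -- and the cokernel are preserved.
    obtain ⟨N, hN, hXN⟩ := hr.exists_isLamCanonicalForm X.mat
    have hY := hΓ.isProblemMatrix_of_lamSimilar hX hXN
    have he := (hΓ.lamSimilar_iff_arrowEquiv hX hY).1 ⟨N, hXN, rfl⟩
    obtain ⟨θ'⟩ := he.nonempty_coker
    obtain ⟨θ''⟩ := hcoker hY
    have h0 : X.rows ≠ 0 := fun h0 => hV0 (by
      have := (hΓ.subsingleton_coker_iff hX).2 h0
      exact θ.symm.toEquiv.subsingleton)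
    refine ⟨⟨X.size, N⟩, ⟨⟨hY, X.mat, hN⟩, hΓ.isIndecomposableMatrix_of_coker hY
      (hΓ.ker_le_rad_of_arrowEquiv he hk) h0 fun W W' _ _ _ _ e => hV W W' (θ.symm.trans (θ'.trans e)),
      fun hne => h0 (funext hne.2)⟩, Quotient.sound ⟨?_⟩⟩
    exact (((θ''.symm.trans θ'.symm).trans θ).toModuleIso)
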